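/- **Theorem.** Let $k$ be a commutative ring (for instance a field of characteristic $0$), let $\mathcal P$ be a non-symmetric differential graded $\{\mathfrak c,\mathfrak o\}$-coloured operad over $k$ (homological grading), and let $\eta:(\mathsf{hsc}_1)_\infty\to\mathcal P$ be a morphism of non-symmetric dg operads. Here $(\mathsf{hsc}_1)_\infty=\Omega(\mathsf{hsc}_1^{¡})$ is the quasi-free operad with one generator $e_{I;x}$ for each *admissible* profile $(I;x)$, i.e. $(\mathfrak c^n;\mathfrak c)$ and $(\mathfrak c^n;\mathfrak o)$ with $n\ge 1$, and $(\mathfrak c^p,\mathfrak o;\mathfrak o)$ with $p\ge 0$, other than $(\mathfrak c;\mathfrak c)$ and $(\mathfrak o;\mathfrak o)$; in the closed suspension $\Lambda_{\mathfrak c}(\mathsf{hsc}_1)_\infty$ all generators have degree $-1$ and $d\,e_{I;x}=-\sum e_{(A,t,C);x}\circ e_{B;t}$, over all $I=(A,B,C)$ and colours $t$ for which both profiles are generating. The closed suspension is $\Lambda_{\mathfrak c}\mathcal P(I;x)=s^{\delta_{x,\mathfrak c}-|I_{\mathfrak c}|}\mathcal P(I;x)$, normalised so that a $\mathcal P$-algebra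 structure on $(V_{\mathfrak c},V_{\mathfrak o})$ is a $\Lambda_{\mathfrak c}\mathcal P$-algebra structure on $(sV_{\mathfrak c},V_{\mathfrak o})$. Put $$D_{\mathfrak c}=\prod_{n\ge1}\Lambda_{\mathfrak c}\mathcal P(\mathfrak c^{n};\mathfrak c),\qquad D_{\mathfrak o}=\prod_{m\ge1}\Lambda_{\mathfrak c}\mathcal P(\mathfrak c^{m};\mathfrak o)\times\prod_{p\ge0}\Lambda_{\mathfrak c}\mathcal P(\mathfrak c^{p},\mathfrak o;\mathfrak o),$$ let $\eta_{\mathfrak c}\in D_{\mathfrak c}$ and $\eta_{\mathfrak o}\in D_{\mathfrak o}$ be the degree $-1$ elements whose components are the images of the generators (and $0$ on the two identity profiles). For $a$ in $D_{\mathfrak c}$ or $D_{\mathfrak o}$ and $y_1,\dots,y_q\in D_{\mathfrak c}$ let $a\{y_1,\dots,y_q\}$ be the Gerstenhaber–Voronov brace, the sum of all insertions of $y_1,\dots,y_q$, in this order, into distinct closed inputs of $a$; for $a,b\in D_{\mathfrak o}$ let $a\cdot b$ be the insertion of $b$ into the open input, if any, of $a$. Equip $D_{\mathfrak c}$ and $D_{\mathfrak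 o}$ with $$\delta\psi=d\psi+\eta_{\mathfrak c}\{\psi\}-(-1)^{|\psi|}\psi\{\eta_{\mathfrak c}\},\qquad d_H\psi=d\psi+\eta_{\mathfrak o}\cdot\psi-(-1)^{|\psi|}\psi\{\eta_{\mathfrak c}\}-(-1)^{|\psi|}\psi\cdot\eta_{\mathfrak o},$$ where $d$ is the differential of $\Lambda_{\mathfrak c}\mathcal P$. Let $\Lambda_{\mathfrak c}\mathrm{rBr}$ be the coloured symmetric dg operad over $\mathbb Z$ of relative braces: $\Lambda_{\mathfrak c}\mathrm{rBr}(I;\mathfrak c)$ is free on planar rooted trees with round vertices and $\Lambda_{\mathfrak c}\mathrm{rBr}(I;\mathfrak o)$ is free on nonempty words of planar rooted trees with square roots and all other vertices round; vertices are either labelled bijectively by the inputs $I$ (closed inputs label round vertices, open inputs label square ones; degree $0$) or neutral (at least $2$ children if round, at least $1$ if square; degree $-1$), and each tree or word comes with an orientation, an ordering of its neutral vertices up to sign. The composition $W\circ_vX$ is the sum, over nondecreasing maps from the children of $v$ to the angles of $X$, of the words obtained by substituting $X$ for $v$, oriented by (neutral vertices of $W$) $\wedge$ (those of $X$). The differential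 is the sum over the vertices of their blow-ups, where, for a vertex with subtrees in the order $A,B,C$: * round labelled $v$: $-$(a new neutral round vertex with subtrees $A$, $v(B)$, $C$; $A,C$ not both empty) $+$ ($v$ with subtrees $A$, a new neutral vertex over $B$, $C$; $|B|\ge2$); * round neutral $v$: $-$(neutral, with subtrees $A$, a neutral vertex over $B$, $C$; $|B|\ge2$, $A,C$ not both empty); * square labelled $v$: $+$($v$ with subtrees $A$, a neutral round vertex over $B$, $C$; $|B|\ge2$) $+$ (word $v(A)\,\blacksquare(B)$, $B\neq\emptyset$) $-$ (word $\blacksquare(A)\,v(B)$, $A\ne\emptyset$); * square neutral $v$: $-$($\blacksquare$ with subtrees $A$, a neutral round vertex over $B$, $C$; $|B|\ge2$) $-$ (word $\blacksquare(A)\blacksquare(B)$, $A,B\ne\emptyset$); here $\blacksquare$ is a neutral square vertex, a new neutral vertex produced by a labelled one is put first in the orientation, and a neutral vertex is replaced in the orientation by $v^1\wedge v^2$ ($v^1$ the lower or left one). Then $\delta^2=0$, $d_H^2=0$, and $\Lambda_{\mathfrak c}\mathrm{rBr}$ acts on the pair of complexes $(D_{\mathfrak c},\delta)$, $(D_{\mathfrak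 o},d_H)$ (equivalently $\mathrm{rBr}$ acts on $(s^{-1}D_{\mathfrak c},D_{\mathfrak o})$): there is a map from $\Lambda_{\mathfrak c}\mathrm{rBr}$ to the endomorphism operad of the pair, compatible with units, compositions, permutations, degrees and differentials, under which the generating corollas act, for $a,y_j$ homogeneous, by * $M_{1,q}$ (closed labelled root): $(a,y_1,\dots,y_q)\mapsto a\{y_1,\dots,y_q\}$ on $D_{\mathfrak c}$, $q\ge 0$; * $\delta_n$ (neutral round root): $(y_1,\dots,y_n)\mapsto\eta_{\mathfrak c}\{y_1,\dots,y_n\}$, $n\ge2$ (together with the relations of the closed part of $\Lambda_{\mathfrak c}\mathrm{rBr}$, these two families are the $B_\infty$ structure on $s^{-1}D_{\mathfrak c}$); * $\mu$ (word of two open labelled roots): $(a,b)\mapsto a\cdot b$ on $D_{\mathfrak o}$; * $\Gamma_{1,q}$ (open labelled root): $(a,y_1,\dots,y_q)\mapsto a\{y_1,\dots,y_q\}$ for $a\in D_{\mathfrak o}$, $q\ge 0$; * $G_n$ (neutral square root): $(y_1,\dots,y_n)\mapsto\eta_{\mathfrak o}\{y_1,\dots,y_n\}\in D_{\mathfrak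 o}$, $n\ge1$. -/

import Mathlib

/-! # Two-coloured operads, `(hsc₁)_∞`, deformation complexes and relative braces -/

/-- The two colours: closed and open. -/
inductive Color
  | cl
  | op
  deriving DecidableEq

namespace SwissCheese

open Color

/-- The Koszul sign `(-1)^n` as an integer. -/
def sgn (n : ℤ) : ℤ := if Even n then 1 else -1

/-! ## Non-symmetric dg operads with two colours -/

/-- The data of a non-symmetric differential graded two-coloured operad over `k`
(homological grading, `d` of degree `-1`): graded modules `obj I x d`, units, partial compositions
`∘_{|a|+1}` and differential.  Source and target profiles are tied together by equations, so that
no transports are needed: `comp a c : (a, t, c; s) × (J; t) → (a, J, c; s)`. -/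
structure OpData.{u, v} (k : Type u) [CommRing k] where
  obj : List Color → Color → ℤ → Type v
  [acg : ∀ I x d, AddCommGroup (obj I x d)]
  [mod : ∀ I x d, Module k (obj I x d)]
  one : ∀ (c : Color) {I : List Color} {m : ℤ}, I = [c] → m = 0 → obj I c m
  comp : ∀ (a c : List Color) {I J K : List Color} {t s : Color} {m n l : ℤ},
    I = a ++ t :: c → K = a ++ J ++ c → l = m + n →
      (obj I s m →ₗ[k] obj J t n →ₗ[k] obj K s l)
  d : ∀ {I : List Color} {x : Color} {m n : ℤ}, n = m - 1 → (obj I x m →ₗ[k] obj I x n)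

attribute [instance] OpData.acg OpData.mod

/-- The axioms of a non-symmetric dg operad: sequential and parallel associativity with the Koszul
sign, units, and a square-zero differential that is a derivation for the partial compositions. -/
structure IsNSOperad.{u, v} {k : Type u} [CommRing k] (O : OpData.{u, v} k) : Prop where
  assoc_seq : ∀ (a b c e : List Color) {I J K L M N : List Color} {s t u : Color}
    {m n l mn nl mnl : ℤ} (hI : I = a ++ t :: c) (hJ : J = b ++ u :: e) (hK : K = a ++ J ++ c)
    (hL : L = b ++ M ++ e) (hK' : K = (a ++ b) ++ u :: (e ++ c)) (hN : N = (a ++ b) ++ M ++ (e ++ c))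
    (hN' : N = a ++ L ++ c) (h₁ : mn = m + n) (h₂ : nl = n + l) (h₃ : mnl = mn + l)
    (h₄ : mnl = m + nl) (p : O.obj I s m) (q : O.obj J t n) (r : O.obj M u l),
    O.comp (a ++ b) (e ++ c) hK' hN h₃ (O.comp a c hI hK h₁ p q) r =
      O.comp a c hI hN' h₄ p (O.comp b e hJ hL h₂ q r)
  assoc_par : ∀ (a b c : List Color) {I J M K L N : List Color} {s t u : Color}
    {m n l mn ml mnl : ℤ} (hI : I = a ++ t :: (b ++ u :: c)) (hI' : I = (a ++ t :: b) ++ u :: c)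
    (hK : K = a ++ J ++ (b ++ u :: c)) (hK' : K = (a ++ J ++ b) ++ u :: c)
    (hL : L = (a ++ t :: b) ++ M ++ c) (hL' : L = a ++ t :: (b ++ M ++ c))
    (hN : N = (a ++ J ++ b) ++ M ++ c) (hN' : N = a ++ J ++ (b ++ M ++ c))
    (h₁ : mn = m + n) (h₂ : ml = m + l) (h₃ : mnl = mn + l) (h₄ : mnl = ml + n)
    (p : O.obj I s m) (q : O.obj J t n) (r : O.obj M u l),
    O.comp (a ++ J ++ b) c hK' hN h₃ (O.comp a (b ++ u :: c) hI hK h₁ p q) r =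
      sgn (n * l) • O.comp a (b ++ M ++ c) hL' hN' h₄ (O.comp (a ++ t :: b) c hI' hL h₂ p r) q
  one_comp : ∀ {I J : List Color} {s : Color} {z m : ℤ} (h1 : I = [s]) (hz : z = 0)
    (hI : I = [] ++ s :: []) (hJ : J = [] ++ J ++ []) (hm : m = z + m) (p : O.obj J s m),
    O.comp [] [] hI hJ hm (O.one s h1 hz) p = p
  comp_one : ∀ (a c : List Color) {I J : List Color} {s t : Color} {m z : ℤ} (h1 : J = [t])
    (hz : z = 0) (hI : I = a ++ t :: c) (hI' : I = a ++ J ++ c) (hm : m = m + z) (p : O.obj I s m),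
    O.comp a c hI hI' hm p (O.one t h1 hz) = p
  d_d : ∀ {I : List Color} {x : Color} {m n l : ℤ} (h : n = m - 1) (h' : l = n - 1)
    (p : O.obj I x m), O.d h' (O.d h p) = 0
  d_comp : ∀ (a c : List Color) {I J K : List Color} {s t : Color} {m n l m' n' l' : ℤ}
    (hI : I = a ++ t :: c) (hK : K = a ++ J ++ c) (hl : l = m + n) (hm' : m' = m - 1)
    (hn' : n' = n - 1) (hl' : l' = l - 1) (h₁ : l' = m' + n) (h₂ : l' = m + n')
    (p : O.obj I s m) (q : O.obj J t n),
    O.d hl' (O.comp a c hI hK hl p q) =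
      O.comp a c hI hK h₁ (O.d hm' p) q + sgn m • O.comp a c hI hK h₂ p (O.d hn' q)

/-- Morphisms of non-symmetric dg operads. -/
structure OpHom.{u, v, w} {k : Type u} [CommRing k] (A : OpData.{u, v} k) (B : OpData.{u, w} k) where
  map : ∀ {I : List Color} {x : Color} {d : ℤ}, A.obj I x d →ₗ[k] B.obj I x d
  map_one : ∀ (c : Color) {I : List Color} {m : ℤ} (hI : I = [c]) (hm : m = 0),
    map (A.one c hI hm) = B.one c hI hm
  map_comp : ∀ (a c : List Color) {I J K : List Color} {t s : Color} {m n l : ℤ}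
    (hI : I = a ++ t :: c) (hK : K = a ++ J ++ c) (hl : l = m + n)
    (p : A.obj I s m) (q : A.obj J t n),
    map (A.comp a c hI hK hl p q) = B.comp a c hI hK hl (map p) (map q)
  map_d : ∀ {I : List Color} {x : Color} {m n : ℤ} (h : n = m - 1) (p : A.obj I x m),
    map (A.d h p) = B.d h (map p)

/-! ## Suspension with respect to the closed colour -/

/-- Number of closed entries. -/
def nc (I : List Color) : ℤ := (I.count cl : ℤ)

/-- `1` on the closed colour, `0` on the open one. -/
def wt : Color → ℤ
  | cl => 1
  | op => 0

/-- `Λ_cl P (I; x) = s^(wt x - nc I) P (I; x)`, so an element of degree `d` in `Λ_cl P` is an element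
of degree `d + shift I x` in `P`. -/
def shift (I : List Color) (x : Color) : ℤ := nc I - wt x

/-- The Koszul sign of a partial composition in `Λ_cl P`.  With `p̄ = s^(wt x) p (s⁻¹)^{⊗ closed}`,
`p̄ ∘ q̄ = lamSign • (p ∘ q)‾`, where `a`, `c` are the inputs before and after the one used, and
`q̄` has profile `(J; t)` and degree `n`. -/
def lamSign (a c J : List Color) (t : Color) (n : ℤ) : ℤ :=
  sgn (nc c * n + nc a * (n + shift J t))

lemma shift_comp (a c J : List Color) (t s : Color) :
    shift (a ++ J ++ c) s = shift (a ++ t :: c) s + shift J t := by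
  cases t <;> cases s <;> simp [shift, nc, wt] <;> ring

/-- The closed suspension `Λ_cl P`: a `P`-structure on `(V_cl, V_op)` is a `Λ_cl P`-structure on
`(s V_cl, V_op)`. -/
def lam.{u, v} {k : Type u} [CommRing k] (P : OpData.{u, v} k) : OpData.{u, v} k where
  obj I x d := P.obj I x (d + shift I x)
  acg _ _ _ := P.acg _ _ _
  mod _ _ _ := P.mod _ _ _
  one c I m hI hm := P.one c hI (by subst hI hm; cases c <;> simp [shift, nc, wt])
  comp a c {I J K t s m n l} hI hK hl := lamSign a c J t n • P.comp a c hI hK (by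
    subst hI hK hl; rw [shift_comp a c J t s]; ring)
  d {I x m n} h := sgn (wt x) • P.d (by subst h; ring)

/-! ## The operad `(hsc₁)_∞`

`hsc₁` has one-dimensional components exactly on the admissible profiles `(cl^n; cl)`, `(cl^n; op)`
with `n ≥ 1` and `(cl^p, op; op)` with `p ≥ 0`; so has its Koszul dual cooperad, and
`(hsc₁)_∞ = Ω(hsc₁^¡)` is quasi-free with one generator for each admissible profile other than
the two identities `(x; x)`. -/

/-- Admissible profiles. -/
def IsAdm (I : List Color) (x : Color) : Prop :=
  (I ≠ [] ∧ I = List.replicate I.length cl) ∨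
    (x = op ∧ I = List.replicate (I.length - 1) cl ++ [op])

instance (I : List Color) (x : Color) : Decidable (IsAdm I x) := by
  unfold IsAdm; infer_instance

/-- Profiles of the generators of `(hsc₁)_∞`. -/
def IsGen (I : List Color) (x : Color) : Prop := IsAdm I x ∧ I ≠ [x]

instance (I : List Color) (x : Color) : Decidable (IsGen I x) := by
  unfold IsGen; infer_instance

/-- Degree of the generator of profile `(I; x)`: it has degree `-1` in the closed suspension, that
is `n - 2` for `(cl^n; cl)`, `n - 1` for `(cl^n; op)` and `p - 1` for `(cl^p, op; op)`. -/
def genDeg (I : List Color) (x : Color) : ℤ := -1 + shift I x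

/-- Planar forests with coloured leaves and coloured inner vertices, as lists of planar trees:
`leaf c r` is the leaf `c` followed by the forest `r`, and `node x ch r` is the tree with root
vertex of output colour `x` and children `ch`, followed by the forest `r`. -/
inductive HForest
  | nil
  | leaf (c : Color) (r : HForest)
  | node (x : Color) (ch r : HForest)
  deriving DecidableEq

namespace HForest

def app : HForest → HForest → HForest
  | nil, G => G
  | leaf c r, G => leaf c (r.app G)
  | node x ch r, G => node x ch (r.app G)

/-- Colours of the leaves, from left to right. -/
def leaves : HForest → List Color
  | nil => []
  | leaf c r => c :: r.leaves
  | node _ ch r => ch.leaves ++ r.leaves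

/-- Output colours of the trees of the forest. -/
def roots : HForest → List Color
  | nil => []
  | leaf c r => c :: r.roots
  | node x _ r => x :: r.roots

/-- Total degree. -/
def deg : HForest → ℤ
  | nil => 0
  | leaf _ r => r.deg
  | node x ch r => genDeg ch.roots x + ch.deg + r.deg

/-- Every vertex is a generator. -/
def OK : HForest → Prop
  | nil => True
  | leaf _ r => r.OK
  | node x ch r => IsGen ch.roots x ∧ ch.OK ∧ r.OK

/-- The forest of bare leaves. -/
def bare : List Color → HForest
  | [] => nil
  | c :: cs => leaf c (bare cs)

/-- Replace the leaf number `i` (counted from `0`) by the forest `G`. -/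
def graft : HForest → ℕ → HForest → HForest
  | nil, _, _ => nil
  | leaf _ r, 0, G => G.app r
  | leaf c r, i + 1, G => leaf c (r.graft i G)
  | node x ch r, i, G =>
      if i < ch.leaves.length then node x (ch.graft i G) r
      else node x ch (r.graft (i - ch.leaves.length) G)

/-- Total degree of the vertices that come after the leaf number `i` in prefix order. -/
def degAfter : HForest → ℕ → ℤ
  | nil, _ => 0
  | leaf _ r, 0 => r.deg
  | leaf _ r, i + 1 => r.degAfter i
  | node _ ch r, i =>
      if i < ch.leaves.length then ch.degAfter i + r.deg
      else r.degAfter (i - ch.leaves.length)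

/-- All ways to cut a forest in two. -/
def splits : HForest → List (HForest × HForest)
  | nil => [(nil, nil)]
  | leaf c r => (nil, leaf c r) :: r.splits.map (fun p => (leaf c p.1, p.2))
  | node x ch r => (nil, node x ch r) :: r.splits.map (fun p => (node x ch p.1, p.2))

/-- All ways to cut a forest in three. -/
def splits3 (F : HForest) : List (HForest × HForest × HForest) :=
  F.splits.flatMap fun p => p.2.splits.map fun q => (p.1, q.1, q.2)

/-- Replacement of the vertex of output `x` with children `ch` by its boundary, the signed sum of all
composites of two generators: in the closed suspension `d (I; x) = - ∑ (a, t, c; x) ∘ (B; t)` over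
all `I = a ++ B ++ c`.  The last sign moves the new vertex into prefix order. -/
def blow (x : Color) (ch : HForest) : List (ℤ × HForest) :=
  ch.splits3.flatMap fun s => [cl, op].flatMap fun t =>
    if IsGen s.2.1.roots t ∧ IsGen (s.1.roots ++ t :: s.2.2.roots) x then
      [(- sgn (wt x) * lamSign s.1.roots s.2.2.roots s.2.1.roots t (-1) *
          sgn (genDeg s.2.1.roots t * s.1.deg),
        s.1.app (node t s.2.1 s.2.2))]
    else []

/-- The derivation of the free operad that extends the boundary of the generators; vertices are
in prefix order. -/
def bd : HForest → List (ℤ × HForest)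
  | nil => []
  | leaf c r => r.bd.map fun p => (p.1, leaf c p.2)
  | node x ch r =>
      ((blow x ch).map fun p => (p.1, node x p.2 r)) ++
      (ch.bd.map fun p => (sgn (genDeg ch.roots x) * p.1, node x p.2 r)) ++
      (r.bd.map fun p => (sgn (genDeg ch.roots x + ch.deg) * p.1, node x ch p.2))

/-- `F` is a tree of profile `(I; x)` and degree `d` in the free operad. -/
def Valid (I : List Color) (x : Color) (d : ℤ) (F : HForest) : Prop :=
  F.roots = [x] ∧ F.leaves = I ∧ F.deg = d ∧ F.OK

end HForest

open Classical in
/-- The basis element of a tree (zero if the tree does not have the profile asked for). -/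
noncomputable def hbas.{u} (k : Type u) [CommRing k] (I : List Color) (x : Color) (d : ℤ)
    (F : HForest) : {F : HForest // F.Valid I x d} →₀ k :=
  if h : F.Valid I x d then Finsupp.single ⟨F, h⟩ 1 else 0

/-- The dg operad `(hsc₁)_∞ = Ω(hsc₁^¡)`: free on the generators, composition by grafting. A tree
stands for the composite of its vertices in prefix order, whence the Koszul signs. -/
noncomputable def hscInf.{u} (k : Type u) [CommRing k] : OpData.{u, u} k where
  obj I x d := {F : HForest // F.Valid I x d} →₀ k
  one c I m _ _ := hbas k I c m (.leaf c .nil)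
  comp a _ {_ _ K _ s _ n l} _ _ _ :=
    Finsupp.linearCombination k fun F => Finsupp.linearCombination k fun G =>
      sgn (n * F.1.degAfter a.length) • hbas k K s l (F.1.graft a.length G.1)
  d {I x _ n} _ := Finsupp.linearCombination k fun F =>
    (F.1.bd.map fun p => p.1 • hbas k I x n p.2).sum

/-- The generator of `(hsc₁)_∞` of profile `(I; x)`; it is zero by convention for the two identity
profiles and for the profiles that are not admissible. -/
noncomputable def hgen.{u} (k : Type u) [CommRing k] (I : List Color) (x : Color) :
    (hscInf k).obj I x (-1 + shift I x) :=
  hbas k I x (-1 + shift I x) (.node x (.bare I) .nil)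

/-! ## Deformation complexes -/

section Def

universe u v

variable {k : Type u} [CommRing k]

/-- Admissible input profiles for the output colour `x`. -/
abbrev Adm (x : Color) := {I : List Color // IsAdm I x}

/-- For `L = Λ_cl P`: `Fam L cl d` and `Fam L op d` are the degree `d` parts of
`D_c = ∏_{n ≥ 1} L(cl^n; cl)` and `D_o = ∏_{m ≥ 1} L(cl^m; op) × ∏_{p ≥ 0} L(cl^p, op; op)`. -/
abbrev Fam (L : OpData.{u, v} k) (x : Color) (d : ℤ) := ∀ I : Adm x, L.obj I.1 x d

/-- Families whose components also depend on a bound `b`, see `ins`. -/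
abbrev MFam (L : OpData.{u, v} k) (x : Color) (d : ℤ) := ∀ I : Adm x, ℕ → L.obj I.1 x d

lemma take_block (K : List Color) (i j : ℕ) :
    K = K.take i ++ (K.drop i).take j ++ K.drop (i + j) := by
  rw [List.append_assoc, ← List.drop_drop, List.take_append_drop, List.take_append_drop]

/-- Insert one more closed element `y` in all possible ways, to the right of all earlier insertions.
The component `(K, b)` of the result is the sum over the nonempty closed blocks `K[i, i + l)` with
`i + l ≤ b` that `y` may occupy; the earlier insertions occupy blocks inside `K[0, i)`. -/
noncomputable def ins {L : OpData.{u, v} k} {x : Color} {m n l : ℤ} (h : l = m + n)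
    (F : MFam L x m) (y : Fam L cl n) : MFam L x l := fun K b =>
  ∑ i ∈ Finset.range (K.1.length + 1), ∑ j ∈ Finset.range (K.1.length + 1),
    if hc : i + j ≤ b ∧ IsAdm ((K.1.drop i).take j) cl ∧
        IsAdm (K.1.take i ++ cl :: K.1.drop (i + j)) x then
      L.comp (K.1.take i) (K.1.drop (i + j)) rfl
        (take_block K.1 i j) h
        (F ⟨_, hc.2.2⟩ i) (y ⟨_, hc.2.1⟩)
    else 0

/-- The degree of `x{y_1, …, y_q}`, the `y`'s being listed from the last one to the first. -/
def braceDeg (L : OpData.{u, v} k) (d : ℤ) : List (Σ e : ℤ, Fam L cl e) → ℤ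
  | [] => d
  | y :: ys => braceDeg L d ys + y.1

/-- Iterated insertion, the `y`'s being listed from the last one to the first. -/
noncomputable def braceAux {L : OpData.{u, v} k} {x : Color} {d : ℤ} (a : Fam L x d) :
    (ys : List (Σ e : ℤ, Fam L cl e)) → MFam L x (braceDeg L d ys)
  | [] => fun K _ => a K
  | y :: ys => ins rfl (braceAux a ys) y.2

/-- The Gerstenhaber–Voronov brace `a{y_1, …, y_q}`, for `a` in `D_c` or `D_o` and `y_j` in `D_c`:
the sum of all the insertions of `y_1, …, y_q`, in this order, into closed inputs of `a`. -/
noncomputable def brace {L : OpData.{u, v} k} {x : Color} {d : ℤ} (a : Fam L x d)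
    (ys : List (Σ e : ℤ, Fam L cl e)) : Fam L x (braceDeg L d ys.reverse) :=
  fun K => braceAux a ys.reverse K K.1.length

/-- The brace `a{y}` with one argument, as a bilinear map. -/
noncomputable def pre (L : OpData.{u, v} k) (x : Color) {m n l : ℤ} (h : l = m + n) :
    Fam L x m →ₗ[k] Fam L cl n →ₗ[k] Fam L x l :=
  LinearMap.mk₂ k (fun a y K => ins h (fun K _ => a K) y K K.1.length)
    (by
      intro a a' y; funext K
      simp only [ins, Pi.add_apply, ← Finset.sum_add_distrib]
      refine Finset.sum_congr rfl fun i _ => Finset.sum_congr rfl fun j _ => ?_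
      split_ifs <;> simp)
    (by
      intro r a y; funext K
      simp only [ins, Pi.smul_apply, Finset.smul_sum]
      refine Finset.sum_congr rfl fun i _ => Finset.sum_congr rfl fun j _ => ?_
      split_ifs <;> simp)
    (by
      intro a y y'; funext K
      simp only [ins, Pi.add_apply, ← Finset.sum_add_distrib]
      refine Finset.sum_congr rfl fun i _ => Finset.sum_congr rfl fun j _ => ?_
      split_ifs <;> simp)
    (by
      intro r a y; funext K
      simp only [ins, Pi.smul_apply, Finset.smul_sum]
      refine Finset.sum_congr rfl fun i _ => Finset.sum_congr rfl fun j _ => ?_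
      split_ifs <;> simp)

/-- The product of `D_o`: graft the second factor into the open input (if any) of the first. -/
noncomputable def openMul (L : OpData.{u, v} k) {m n l : ℤ} (h : l = m + n) :
    Fam L op m →ₗ[k] Fam L op n →ₗ[k] Fam L op l :=
  LinearMap.mk₂ k (fun a b K => ∑ i ∈ Finset.range (K.1.length + 1),
      if hc : IsAdm (K.1.take i ++ [op]) op ∧ IsAdm (K.1.drop i) op then
        L.comp (K.1.take i) [] rfl (by simp) h (a ⟨_, hc.1⟩) (b ⟨_, hc.2⟩)
      else 0)
    (by
      intro a a' y; funext K
      simp only [Pi.add_apply, ← Finset.sum_add_distrib]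
      refine Finset.sum_congr rfl fun i _ => ?_
      split_ifs <;> simp)
    (by
      intro r a y; funext K
      simp only [Pi.smul_apply, Finset.smul_sum]
      refine Finset.sum_congr rfl fun i _ => ?_
      split_ifs <;> simp)
    (by
      intro a y y'; funext K
      simp only [Pi.add_apply, ← Finset.sum_add_distrib]
      refine Finset.sum_congr rfl fun i _ => ?_
      split_ifs <;> simp)
    (by
      intro r a y; funext K
      simp only [Pi.smul_apply, Finset.smul_sum]
      refine Finset.sum_congr rfl fun i _ => ?_
      split_ifs <;> simp)

/-- The internal differential of `Λ_cl P` on families. -/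
noncomputable def dInt (L : OpData.{u, v} k) (x : Color) {m n : ℤ} (h : n = m - 1) :
    Fam L x m →ₗ[k] Fam L x n :=
  LinearMap.pi fun K => (L.d h).comp (LinearMap.proj K)

/-- The data of a pair of differential graded `k`-modules `(V_cl, V_op)`.  That the differential
squares to zero is part of `OpAlgebra` below. -/
structure DGPair (k : Type u) [CommRing k] where
  V : Color → ℤ → Type v
  [acg : ∀ c m, AddCommGroup (V c m)]
  [mod : ∀ c m, Module k (V c m)]
  d : ∀ (c : Color) {m n : ℤ}, n = m - 1 → (V c m →ₗ[k] V c n)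

attribute [instance] DGPair.acg DGPair.mod

/-- The twisting element `(η_cl, η_op)` of degree `-1` given by a morphism `η : (hsc₁)_∞ → P`: its
components are the images of the generators. -/
noncomputable def twist {P : OpData.{u, v} k} (η : OpHom (hscInf k) P) (x : Color) :
    Fam (lam P) x (-1) := fun K => η.map (hgen k K.1 x)

/-- The deformation complex of `η : (hsc₁)_∞ → P`, as the pair `(D_c, D_o)` with differentials
`δ ψ = d_P ψ + η_cl{ψ} - (-1)^|ψ| ψ{η_cl}` on `D_c` and
`d_H ψ = d_P ψ + η_op · ψ - (-1)^|ψ| ψ{η_cl} - (-1)^|ψ| ψ · η_op` on `D_o`. -/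
noncomputable def defPair {P : OpData.{u, v} k} (η : OpHom (hscInf k) P) : DGPair.{u, v} k where
  V c m := Fam (lam P) c m
  d c {m n} h := match c with
    | cl => dInt (lam P) cl h
        + pre (lam P) cl (by omega : n = -1 + m) (twist η cl)
        - sgn m • (pre (lam P) cl (by omega : n = m + -1)).flip (twist η cl)
    | op => dInt (lam P) op h
        + openMul (lam P) (by omega : n = -1 + m) (twist η op)
        - sgn m • (pre (lam P) op (by omega : n = m + -1)).flip (twist η cl)
        - sgn m • (openMul (lam P) (by omega : n = m + -1)).flip (twist η op)

end Def

/-! ## Symmetric operads and their algebras -/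

section Algebra

universe u v w

/-- The data of a (symmetric) dg two-coloured operad over `k`: on top of `OpData`, the right actions
`O(s_1, …, s_n; x) → O(s_σ(1), …, s_σ(n); x)` of permutations. -/
structure SymOpData (k : Type u) [CommRing k] extends OpData.{u, v} k where
  perm : ∀ {I I' : List Color} {x : Color} {d : ℤ} (σ : Equiv.Perm (Fin I.length)),
    I' = List.ofFn (fun j => I.get (σ j)) → (obj I x d →ₗ[k] obj I' x d)

namespace DGPair

variable {k : Type u} [CommRing k] (A : DGPair.{u, v} k)

/-- The total module. -/
abbrev Tot := DirectSum (Color × ℤ) (fun i => A.V i.1 i.2)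

/-- The inclusion of a homogeneous component. -/
noncomputable def ι (c : Color) (m : ℤ) : A.V c m →ₗ[k] A.Tot :=
  DirectSum.lof k (Color × ℤ) (fun i => A.V i.1 i.2) (c, m)

/-- The differential on the total module. -/
noncomputable def dTot : A.Tot →ₗ[k] A.Tot :=
  DirectSum.toModule k (Color × ℤ) A.Tot fun i => (A.ι i.1 (i.2 - 1)).comp (A.d i.1 rfl)

/-- The Koszul operator: multiplication by `(-1)^(n |a|)`. -/
noncomputable def kos (n : ℤ) : A.Tot →ₗ[k] A.Tot :=
  DirectSum.toModule k (Color × ℤ) A.Tot fun i => sgn (n * i.2) • A.ι i.1 i.2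

end DGPair

/-- The Koszul sign of the permutation `σ` on inputs of degrees `g`. -/
def koszulSign {n : ℕ} (σ : Equiv.Perm (Fin n)) (g : Fin n → ℤ) : ℤ :=
  ∏ i, ∏ j, if i < j ∧ σ j < σ i then sgn (g i * g j) else 1

/-- Evaluate a map with `n` inputs on a list of `n` elements. -/
def feed {k : Type u} [CommRing k] {M : Type v} [AddCommGroup M] [Module k M] {n : ℕ}
    (f : MultilinearMap k (fun _ : Fin n => M) M) (l : List M) : M :=
  f fun j => l.getD j 0

/-- Algebra structures of a dg operad `O` over `ℤ` on a pair `A` of dg `k`-modules, that is, morphisms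
of dg operads from `O` to the endomorphism operad of `A`.  A degree `e` map
`A_(s_1) ⊗ … ⊗ A_(s_n) → A_x` is encoded as a multilinear map on the total module which vanishes on
homogeneous inputs with a wrong colour (`act_color`) and is homogeneous (`act_deg`).  A list `l` of
`n` elements is fed in by `feed`. -/
structure OpAlgebra (O : SymOpData.{0, w} ℤ) {k : Type u} [CommRing k] (A : DGPair.{u, v} k) where
  d_d : ∀ a, A.dTot (A.dTot a) = 0
  act : ∀ {I : List Color} {x : Color} {e : ℤ},
    O.obj I x e →ₗ[ℤ] MultilinearMap k (fun _ : Fin I.length => A.Tot) A.Tot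
  act_color : ∀ {I : List Color} {x : Color} {e : ℤ} (p : O.obj I x e)
    (f : Fin I.length → A.Tot) (j : Fin I.length) (c : Color) (m : ℤ) (a : A.V c m),
    c ≠ I.get j → f j = A.ι c m a → act p f = 0
  act_deg : ∀ {I : List Color} {x : Color} {e : ℤ} (p : O.obj I x e) (g : Fin I.length → ℤ)
    (a : ∀ j, A.V (I.get j) (g j)),
    act p (fun j => A.ι (I.get j) (g j) (a j)) ∈ LinearMap.range (A.ι x (e + ∑ j, g j))
  act_one : ∀ (c : Color) {I : List Color} {z : ℤ} (hI : I = [c]) (hz : z = 0) (m : ℤ)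
    (a : A.V c m), feed (act (O.one c hI hz)) [A.ι c m a] = A.ι c m a
  act_comp : ∀ (a c : List Color) {I J K : List Color} {t s : Color} {m n l : ℤ}
    (hI : I = a ++ t :: c) (hK : K = a ++ J ++ c) (hl : l = m + n) (p : O.obj I s m)
    (q : O.obj J t n) (u v w : List A.Tot),
    u.length = a.length → v.length = J.length → w.length = c.length →
    feed (act (O.comp a c hI hK hl p q)) (u ++ v ++ w) =
      feed (act p) (u.map (A.kos n) ++ feed (act q) v :: w)
  act_perm : ∀ {I I' : List Color} {x : Color} {e : ℤ} (σ : Equiv.Perm (Fin I.length))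
    (hI : I' = List.ofFn (fun j => I.get (σ j))) (p : O.obj I x e) (g : Fin I.length → ℤ)
    (b : ∀ j, A.V (I.get (σ j)) (g j)) (f : Fin I.length → A.Tot),
    (∀ j, f j = A.ι _ (g j) (b j)) →
    feed (act (O.perm σ hI p)) (List.ofFn f) =
      koszulSign σ g • feed (act p) (List.ofFn fun i => f (σ.symm i))
  act_d : ∀ {I : List Color} {x : Color} {e e' : ℤ} (h : e' = e - 1) (p : O.obj I x e)
    (l : List A.Tot), l.length = I.length →
    feed (act (O.d h p)) l = A.dTot (feed (act p) l) - sgn e • ∑ j ∈ Finset.range I.length,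
      feed (act p) ((l.take j).map (A.kos 1) ++ A.dTot (l.getD j 0) :: l.drop (j + 1))

end Algebra

/-! ## The operad of relative braces -/

/-- Vertices: labelled ones (closed or open), with their label, and neutral ones, with a name.  The
names of the neutral vertices record the orientation `e_0 ∧ e_1 ∧ …` in `det`. -/
inductive Vtx
  | lab (i : ℕ)
  | neu (e : ℕ)
  deriving DecidableEq

/-- Planar forests (words of planar rooted trees): `cons v ch r` is the tree with root `v` and subtrees
`ch`, followed by the forest `r`.  In a word with open output the roots are the square-shaped vertices,
all the other vertices are round-shaped. -/
inductive Forest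
  | nil
  | cons (v : Vtx) (ch r : Forest)
  deriving DecidableEq

namespace Forest

open Vtx

def app : Forest → Forest → Forest
  | nil, G => G
  | cons v ch r, G => cons v ch (r.app G)

/-- Number of trees. -/
def len : Forest → ℕ
  | nil => 0
  | cons _ _ r => r.len + 1

/-- The labels, in the canonical order of the vertices. -/
def labels : Forest → List ℕ
  | nil => []
  | cons (lab i) ch r => i :: (ch.labels ++ r.labels)
  | cons (neu _) ch r => ch.labels ++ r.labels

/-- The names of the neutral vertices, in the canonical order of the vertices. -/
def names : Forest → List ℕ
  | nil => []
  | cons (lab _) ch r => ch.names ++ r.names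
  | cons (neu e) ch r => e :: (ch.names ++ r.names)

/-- Apply `f` to all the labels and `g` to all the names. -/
def rename (f g : ℕ → ℕ) : Forest → Forest
  | nil => nil
  | cons (lab i) ch r => cons (lab (f i)) (ch.rename f g) (r.rename f g)
  | cons (neu e) ch r => cons (neu (g e)) (ch.rename f g) (r.rename f g)

/-- Name the neutral vertices `s, s + 1, …` in the canonical order. -/
def renum : ℕ → Forest → Forest
  | _, nil => nil
  | s, cons (lab i) ch r => cons (lab i) (ch.renum s) (r.renum (s + ch.names.length))
  | s, cons (neu _) ch r =>
      cons (neu s) (ch.renum (s + 1)) (r.renum (s + 1 + ch.names.length))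

/-- All ways to cut a forest in two. -/
def splits : Forest → List (Forest × Forest)
  | nil => [(nil, nil)]
  | cons v ch r => (nil, cons v ch r) :: r.splits.map (fun p => (cons v ch p.1, p.2))

/-- All ways to cut a forest in three. -/
def splits3 (F : Forest) : List (Forest × Forest × Forest) :=
  F.splits.flatMap fun p => p.2.splits.map fun q => (p.1, q.1, q.2)

/-- All ways to attach the trees of the second forest, in order, to an angle of a vertex with subtrees
the first forest, or to angles of these subtrees. -/
def plug : Forest → Forest → List Forest
  | nil, S => [S]
  | cons v ch r, S => S.splits3.flatMap fun s => (ch.plug s.2.1).flatMap fun ch' =>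
      (r.plug s.2.2).map fun r' => s.1.app (cons v ch' r')

/-- All ways to attach the trees of the second forest, in order, to angles of the trees of the first. -/
def plugWord : Forest → Forest → List Forest
  | nil, nil => [nil]
  | nil, cons _ _ _ => []
  | cons v ch r, S => S.splits.flatMap fun s => (ch.plug s.1).flatMap fun ch' =>
      (r.plugWord s.2).map fun r' => cons v ch' r'

/-- All ways to substitute the word `X` for the vertex labelled `i`: the subtrees of this vertex are
attached to the angles of `X` by a nondecreasing map. -/
def subst : Forest → ℕ → Forest → List Forest
  | nil, _, _ => []
  | cons v ch r, i, X =>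
      if v = lab i then (X.plugWord ch).map fun X' => X'.app r
      else ((ch.subst i X).map fun ch' => cons v ch' r) ++
        ((r.subst i X).map fun r' => cons v ch r')

/-- Blow-ups of a round-shaped vertex with subtrees `ch`, with their coefficients.  The new neutral
vertices are named `0`, or `0` and `1`; old names are at least `2`. -/
def blowRound : Vtx → Forest → List (ℤ × Forest)
  | lab i, ch =>
      (ch.splits3.flatMap fun s => if 1 ≤ s.1.len + s.2.2.len then
        [(-1, cons (neu 0) (s.1.app (cons (lab i) s.2.1 s.2.2)) nil)] else []) ++
      (ch.splits3.flatMap fun s => if 2 ≤ s.2.1.len then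
        [(1, cons (lab i) (s.1.app (cons (neu 0) s.2.1 s.2.2)) nil)] else [])
  | neu e, ch =>
      ch.splits3.flatMap fun s => if 2 ≤ s.2.1.len ∧ 1 ≤ s.1.len + s.2.2.len then
        [(-sgn e, cons (neu 0) (s.1.app (cons (neu 1) s.2.1 s.2.2)) nil)] else []

/-- Blow-ups of a square-shaped vertex with subtrees `ch`, with their coefficients. -/
def blowSquare : Vtx → Forest → List (ℤ × Forest)
  | lab i, ch =>
      (ch.splits3.flatMap fun s => if 2 ≤ s.2.1.len then
        [(1, cons (lab i) (s.1.app (cons (neu 0) s.2.1 s.2.2)) nil)] else []) ++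
      (ch.splits.flatMap fun s => if 1 ≤ s.2.len then
        [(1, cons (lab i) s.1 (cons (neu 0) s.2 nil))] else []) ++
      (ch.splits.flatMap fun s => if 1 ≤ s.1.len then
        [(-1, cons (neu 0) s.1 (cons (lab i) s.2 nil))] else [])
  | neu e, ch =>
      (ch.splits3.flatMap fun s => if 2 ≤ s.2.1.len then
        [(-sgn e, cons (neu 0) (s.1.app (cons (neu 1) s.2.1 s.2.2)) nil)] else []) ++
      (ch.splits.flatMap fun s => if 1 ≤ s.1.len ∧ 1 ≤ s.2.len then
        [(-sgn e, cons (neu 0) s.1 (cons (neu 1) s.2 nil))] else [])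

/-- Sum of the blow-ups of all the vertices, all of them round-shaped. -/
def bdRound : Forest → List (ℤ × Forest)
  | nil => []
  | cons v ch r =>
      ((blowRound v ch).map fun p => (p.1, p.2.app r)) ++
      (ch.bdRound.map fun p => (p.1, cons v p.2 r)) ++
      (r.bdRound.map fun p => (p.1, cons v ch p.2))

/-- Sum of the blow-ups of all the vertices, the roots being square-shaped. -/
def bdSquare : Forest → List (ℤ × Forest)
  | nil => []
  | cons v ch r =>
      ((blowSquare v ch).map fun p => (p.1, p.2.app r)) ++
      (ch.bdRound.map fun p => (p.1, cons v p.2 r)) ++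
      (r.bdSquare.map fun p => (p.1, cons v ch p.2))

/-- Labels of round-shaped vertices are closed inputs, and neutral round-shaped vertices have at least
two inputs. -/
def RoundOK (I : List Color) : Forest → Prop
  | nil => True
  | cons (lab i) ch r => I[i]? = some cl ∧ ch.RoundOK I ∧ r.RoundOK I
  | cons (neu _) ch r => 2 ≤ ch.len ∧ ch.RoundOK I ∧ r.RoundOK I

/-- Labels of the roots are open inputs, and neutral roots have at least one input. -/
def SquareOK (I : List Color) : Forest → Prop
  | nil => True
  | cons (lab i) ch r => I[i]? = some op ∧ ch.RoundOK I ∧ r.SquareOK I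
  | cons (neu _) ch r => 1 ≤ ch.len ∧ ch.RoundOK I ∧ r.SquareOK I

/-- The shape of elements of `𝒯(I; x)`: round trees for `x = cl`, nonempty words for `x = op`. -/
def Shape (I : List Color) : Color → Forest → Prop
  | cl, F => F.len = 1 ∧ F.RoundOK I
  | op, F => 1 ≤ F.len ∧ F.SquareOK I

/-- `F` is an element of `𝒯(I; x)` of degree `e`, with its canonical orientation.  Inputs are
numbered from `0`. -/
def Valid (I : List Color) (x : Color) (e : ℤ) (F : Forest) : Prop :=
  F.labels.Perm (List.range I.length) ∧ F.renum 0 = F ∧ e = -(F.names.length : ℤ) ∧ F.Shape I x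

end Forest

/-- The sign of the permutation that sorts a list without repetitions. -/
def sortSign : List ℕ → ℤ
  | [] => 1
  | a :: l => (-1) ^ (l.countP (· < a)) * sortSign l

/-- The degree `e` part of `Λ_cl rBr(I; x)`. -/
abbrev RB (I : List Color) (x : Color) (e : ℤ) := {F : Forest // F.Valid I x e} →₀ ℤ

open Classical in
/-- The basis element of a word with canonical orientation (zero if it is not in `𝒯(I; x)`). -/
noncomputable def rbas (I : List Color) (x : Color) (e : ℤ) (F : Forest) : RB I x e :=
  if h : F.Valid I x e then Finsupp.single ⟨F, h⟩ 1 else 0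

/-- The element `F ⊗ e_0 ∧ e_1 ∧ …` given by a word with arbitrarily named neutral vertices. -/
noncomputable def rori (I : List Color) (x : Color) (e : ℤ) (F : Forest) : RB I x e :=
  sortSign F.names • rbas I x e (F.renum 0)

open Forest in
/-- The terms of the composition of the word `F` with the word `X` with `m` inputs at the input `i`,
with orientation `ε_F ∧ ε_X`. -/
def rcompTerms (i m : ℕ) (F X : Forest) : List Forest :=
  (F.rename (fun j => if j ≤ i then j else j + m - 1) id).subst i
    (X.rename (fun j => j + i) (fun e => e + F.names.length))

/-- The terms of the differential of the word `F`. -/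
def rbdTerms (x : Color) (F : Forest) : List (ℤ × Forest) :=
  match x with
  | cl => (F.rename id (fun e => e + 2)).bdRound
  | op => (F.rename id (fun e => e + 2)).bdSquare

/-- The two-coloured dg operad `Λ_cl rBr` of relative braces, over `ℤ`. -/
noncomputable def relBrace : SymOpData.{0, 0} ℤ where
  obj I x e := RB I x e
  one c I m _ _ := rbas I c m (.cons (.lab 0) .nil .nil)
  comp a _ {_ J K _ s _ _ l} _ _ _ :=
    Finsupp.linearCombination ℤ fun F => Finsupp.linearCombination ℤ fun X =>
      ((rcompTerms a.length J.length F.1 X.1).map (rori K s l)).sum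
  d {I x _ n} _ := Finsupp.linearCombination ℤ fun F =>
    ((rbdTerms x F.1).map fun p => p.1 • rori I x n p.2).sum
  perm {I I' x d} σ _ := Finsupp.linearCombination ℤ fun F =>
    rori I' x d (F.1.rename
      (fun i => if h : i < I.length then ((σ.symm ⟨i, h⟩ : Fin I.length) : ℕ) else i) id)

/-- The forest of one-vertex trees labelled `i, i + 1, …, i + n - 1`. -/
def dots (i : ℕ) : ℕ → Forest
  | 0 => .nil
  | n + 1 => .cons (.lab i) .nil (dots (i + 1) n)

/-- The corolla `δ_n`, a neutral round-shaped vertex with `n ≥ 2` closed inputs. -/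
noncomputable def genDelta (n : ℕ) : relBrace.obj (List.replicate n cl) cl (-1) :=
  rbas _ _ _ (.cons (.neu 0) (dots 0 n) .nil)

/-- The corolla `M_{1,n}`, a closed vertex with `n` closed inputs. -/
noncomputable def genM (n : ℕ) : relBrace.obj (cl :: List.replicate n cl) cl 0 :=
  rbas _ _ _ (.cons (.lab 0) (dots 1 n) .nil)

/-- The corolla `G_n`, a neutral square-shaped vertex with `n ≥ 1` closed inputs. -/
noncomputable def genG (n : ℕ) : relBrace.obj (List.replicate n cl) op (-1) :=
  rbas _ _ _ (.cons (.neu 0) (dots 0 n) .nil)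

/-- The corolla `Γ_{1,n}`, an open vertex with `n` closed inputs. -/
noncomputable def genGamma (n : ℕ) : relBrace.obj (op :: List.replicate n cl) op 0 :=
  rbas _ _ _ (.cons (.lab 0) (dots 1 n) .nil)

/-- The product `μ`, the word of two one-vertex open trees. -/
noncomputable def genMu : relBrace.obj [op, op] op 0 :=
  rbas _ _ _ (.cons (.lab 0) .nil (.cons (.lab 1) .nil .nil))

end SwissCheese

/-! The theorem rests on three facts about insertion in an operad. The brace relation expands
`a{Y}{Z}` over all ways to place the `Z`, in order, between or inside the `Y`
(`PlainOp.brace_brace`). The differential is a derivation of braces (`Deriv.fam_brace`). The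
twisting element satisfies the Maurer–Cartan equations `d η_c = -η_c{η_c}` and `d η_o = -η_o{η_c} -
η_o · η_o`, which are the boundary formulas of the generators of `(hsc₁)_∞` carried over by `η`
(`dInt_twist_cl`, `dInt_twist_op`). The product is also a brace, the insertion of one open element.
It is associative and distributes over closed braces because an admissible profile has at most one
open input, at the very end (`mul_assoc`, `cbrace_mul`).

A word of trees acts by evaluation: a vertex with its subtrees becomes a brace, a neutral vertex the
twisting element, and a word the product of its trees. Substitution of a word for a vertex, summed
over the ways to attach the subtrees, is then an iterated brace relation (`lsum_plug`,
`lsum_plugWord`, `lsum_subst_ev`). The twisted differential of a brace produces, besides the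
differentials of the entries, one term for each blow-up of the root (`dcl_cbrace`, `dop_cbrace`).
For a neutral root the Maurer–Cartan equation cancels all terms but the blow-ups of a neutral vertex
(`dcl_cbrace_neutral`, `dop_cbrace_neutral`). Summation over the vertices gives the differential of
the operad of relative braces (`tw_ev`).

None of these computations involves a sign, because they take place in the Grassmann envelope of
`Λ_cl P`: elements are multiplied by monomials in anticommuting letters of the same parity, so that
everything is even (`envelope`, `envD`). A homogeneous element with a word of letters is a `Keyed`
family, and `Keyed.toM` puts it into the envelope. Different copies of the twisting element carry
different letters, so exchanging two of them changes the sign (`Keyed.toM_swap`). This replaces the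
oddness of `η`. The square of the differential is treated in the same way, by two copies of it with
different letters (`tw_tw_toM`).

To return from the envelope, each vertex of a word gets letters of its own and the coefficient of
the product of all letters is extracted. The sign of rearranging the blocks of letters depends on
degrees only (`wordSign_flatMap_perm`), so the result does not depend on the choice of the letters
(`Args.ev_eq_act`). All signs in the definition of an algebra then become signs of reordered
letters: orientations in `Args.act_renum`, permutations in `inc_act_rename`, compositions in
`lsum_rcompTerms`, differentials in `extract_dlab`. The sign that a blow-up of a neutral vertex
carries is the comparison of two naming conventions (`wordSign_map_bump`). -/

namespace SwissCheese

open Color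

/-! ## Sums over the ways to cut a list -/

section Splits

variable {α β A B : Type*} [AddCommMonoid A] [AddCommMonoid B]

/-- The sum of `f p q` over all `p ++ q = K`. -/
def splitSum : List α → (List α → List α → A) → A
  | [], f => f [] []
  | x :: K, f => f [] (x :: K) + splitSum K (fun p q => f (x :: p) q)

lemma splitSum_congr {K : List α} {f g : List α → List α → A}
    (h : ∀ p q, p ++ q = K → f p q = g p q) : splitSum K f = splitSum K g := by
  induction K generalizing f g with
  | nil => exact h [] [] rfl
  | cons x K ih =>
    simp only [splitSum]
    rw [h [] (x :: K) rfl, ih (fun p q hpq => h (x :: p) q (by simp [hpq]))]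

lemma splitSum_congr' {K : List α} {f g : List α → List α → A}
    (h : ∀ p q, f p q = g p q) : splitSum K f = splitSum K g :=
  splitSum_congr fun p q _ => h p q

lemma splitSum_add (K : List α) (f g : List α → List α → A) :
    splitSum K (fun p q => f p q + g p q) = splitSum K f + splitSum K g := by
  induction K generalizing f g with
  | nil => rfl
  | cons x K ih => simp only [splitSum, ih]; exact add_add_add_comm _ _ _ _

lemma splitSum_zero (K : List α) : splitSum K (fun _ _ => (0 : A)) = 0 := by
  induction K with
  | nil => rfl
  | cons x K ih => simp only [splitSum, ih, add_zero]

lemma splitSum_eq_zero {K : List α} {f : List α → List α → A}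
    (h : ∀ p q, p ++ q = K → f p q = 0) : splitSum K f = 0 :=
  (splitSum_congr h).trans (splitSum_zero K)

lemma map_splitSum {F : Type*} [FunLike F A B] [AddMonoidHomClass F A B] (g : F) (K : List α)
    (f : List α → List α → A) : g (splitSum K f) = splitSum K (fun p q => g (f p q)) := by
  induction K generalizing f with
  | nil => rfl
  | cons x K ih => simp only [splitSum, map_add, ih]

lemma splitSum_apply {ι : Type*} {C : ι → Type*} [∀ i, AddCommMonoid (C i)] (K : List α)
    (f : List α → List α → ∀ i, C i) (i : ι) :
    splitSum K f i = splitSum K (fun p q => f p q i) := by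
  induction K generalizing f with
  | nil => rfl
  | cons x K ih => simp only [splitSum, Pi.add_apply, ih]

/-- Both sides run over the ways to cut `K` in three. This coassociativity of cutting, together with
the exchange of independent cuts in `splitSum_comm`, does the reindexing in the brace relation. -/
lemma splitSum_assoc (K : List α) (f : List α → List α → List α → A) :
    splitSum K (fun p r => splitSum r fun q s => f p q s) =
      splitSum K (fun r s => splitSum r fun p q => f p q s) := by
  induction K generalizing f with
  | nil => rfl
  | cons x K ih =>
    simp only [splitSum, splitSum_add, ih (fun p q s => f (x :: p) q s)]
    exact add_assoc _ _ _

lemma splitSum_comm (K : List α) (Z : List β) (f : List α → List α → List β → List β → A) :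
    splitSum K (fun p q => splitSum Z fun r s => f p q r s) =
      splitSum Z (fun r s => splitSum K fun p q => f p q r s) := by
  induction K generalizing f with
  | nil => rfl
  | cons x K ih => simp only [splitSum, splitSum_add, ih (fun p q r s => f (x :: p) q r s)]

/-- Cutting a list in four, the first and the second cut being refined. -/
lemma splitSum_refine_both (K : List α) (f : List α → List α → List α → List α → List α → A) :
    splitSum K (fun p r => splitSum r fun b s => splitSum p fun p₁ p₂ => f p p₁ p₂ b s) =
      splitSum K (fun p₁ q => splitSum q fun p₂ r => splitSum r fun b s =>
        f (p₁ ++ p₂) p₁ p₂ b s) := by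
  rw [splitSum_congr' fun p r => splitSum_comm r p _,
    splitSum_assoc K fun p₁ p₂ r => splitSum r fun b s => f (p₁ ++ p₂) p₁ p₂ b s]
  refine splitSum_congr' fun p r => splitSum_congr fun p₁ p₂ hp => ?_
  rw [hp]

/-- Cutting a list in four, from the left or from the right. -/
lemma splitSum_refine_right (K : List α) (f : List α → List α → List α → List α → List α → A) :
    splitSum K (fun p r => splitSum r fun b s => splitSum s fun s₁ s₂ => f p b s s₁ s₂) =
      splitSum K (fun q s₂ => splitSum q fun p r => splitSum r fun b s₁ =>
        f p b (s₁ ++ s₂) s₁ s₂) := by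
  rw [← splitSum_assoc K fun p r s₂ => splitSum r fun b s₁ => f p b (s₁ ++ s₂) s₁ s₂]
  refine splitSum_congr' fun p r => ?_
  rw [← splitSum_assoc r fun b s₁ s₂ => f p b (s₁ ++ s₂) s₁ s₂]
  refine splitSum_congr' fun b s => splitSum_congr fun s₁ s₂ hs => ?_
  rw [hs]

/-- Cutting a list in five, from the left or from the right. -/
lemma splitSum_five (K : List α)
    (f : List α → List α → List α → List α → List α → List α → A) :
    splitSum K (fun p r => splitSum r fun b s => splitSum s fun s₁ q => splitSum q fun c t =>
      f p b s s₁ c t) =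
    splitSum K (fun p r => splitSum r fun c t => splitSum p fun p₁ q => splitSum q fun b s₁ =>
      f p₁ b (s₁ ++ c ++ t) s₁ c t) := by
  rw [splitSum_refine_right K fun p b s s₁ q => splitSum q fun c t => f p b s s₁ c t]
  refine splitSum_congr' fun p r => ?_
  rw [splitSum_comm r p]
  refine splitSum_congr' fun p₁ q => ?_
  rw [splitSum_comm r q]
  refine splitSum_congr' fun b s₁ => splitSum_congr fun c t hr => ?_
  rw [← hr, List.append_assoc]

/-- A cut falls either before or after the marked entry `t`. In `insAll_split` this entry is the
input that receives the next item. -/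
lemma splitSum_append_cons (p : List α) (t : α) (J : List α) (f : List α → List α → A) :
    splitSum (p ++ t :: J) f =
      splitSum p (fun p₁ p₂ => f p₁ (p₂ ++ t :: J)) +
        splitSum J (fun J₁ J₂ => f (p ++ t :: J₁) J₂) := by
  induction p generalizing f with
  | nil => simp [splitSum]
  | cons x p ih => simp only [List.cons_append, splitSum, ih]; exact (add_assoc _ _ _).symm

lemma splitSum_map (g : α → β) (K : List α) (f : List β → List β → A) :
    splitSum (K.map g) f = splitSum K (fun p q => f (p.map g) (q.map g)) := by
  induction K generalizing f with
  | nil => rfl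
  | cons x K ih => simp only [List.map_cons, splitSum, List.map_nil, ih]

lemma sum_range_take_drop (K : List α) (f : List α → List α → A) :
    ∑ i ∈ Finset.range (K.length + 1), f (K.take i) (K.drop i) = splitSum K f := by
  induction K generalizing f with
  | nil => simp [splitSum]
  | cons x K ih =>
    rw [List.length_cons, Finset.sum_range_succ', splitSum, ← ih, add_comm]
    simp

end Splits

/-! ## Braces in an ungraded operad -/

/-- An ungraded non-symmetric two-coloured operad, with a unit for the open colour only. -/
structure PlainOp.{u, v} (k : Type u) [CommRing k] where
  obj : List Color → Color → Type v
  [acg : ∀ I x, AddCommGroup (obj I x)]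
  [mod : ∀ I x, Module k (obj I x)]
  comp : ∀ (a c : List Color) {I J K : List Color} {t s : Color},
    I = a ++ t :: c → K = a ++ J ++ c → (obj I s →ₗ[k] obj J t →ₗ[k] obj K s)
  assoc_seq : ∀ (a b c e : List Color) {I J K L M N : List Color} {s t u : Color}
    (hI : I = a ++ t :: c) (hJ : J = b ++ u :: e) (hK : K = a ++ J ++ c)
    (hL : L = b ++ M ++ e) (hK' : K = (a ++ b) ++ u :: (e ++ c)) (hN : N = (a ++ b) ++ M ++ (e ++ c))
    (hN' : N = a ++ L ++ c) (p : obj I s) (q : obj J t) (r : obj M u),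
    comp (a ++ b) (e ++ c) hK' hN (comp a c hI hK p q) r =
      comp a c hI hN' p (comp b e hJ hL q r)
  assoc_par : ∀ (a b c : List Color) {I J M K L N : List Color} {s t u : Color}
    (hI : I = a ++ t :: (b ++ u :: c)) (hI' : I = (a ++ t :: b) ++ u :: c)
    (hK : K = a ++ J ++ (b ++ u :: c)) (hK' : K = (a ++ J ++ b) ++ u :: c)
    (hL : L = (a ++ t :: b) ++ M ++ c) (hL' : L = a ++ t :: (b ++ M ++ c))
    (hN : N = (a ++ J ++ b) ++ M ++ c) (hN' : N = a ++ J ++ (b ++ M ++ c))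
    (p : obj I s) (q : obj J t) (r : obj M u),
    comp (a ++ J ++ b) c hK' hN (comp a (b ++ u :: c) hI hK p q) r =
      comp a (b ++ M ++ c) hL' hN' (comp (a ++ t :: b) c hI' hL p r) q

attribute [instance] PlainOp.acg PlainOp.mod

namespace PlainOp

universe u v

variable {k : Type u} [CommRing k] (O : PlainOp.{u, v} k)

/-- Families of operations of all profiles with output `x`. -/
abbrev M (x : Color) := ∀ I : List Color, O.obj I x

/-- Families together with their output colour. -/
abbrev Item := Σ c : Color, O.M c

variable {O}

open Classical in
/-- Partial composition at the input `t` of the component `(a, t, c)` with the component `J`. -/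
noncomputable def cmp (a : List Color) (t : Color) (c J : List Color) {s : Color} :
    O.M s →ₗ[k] O.M t →ₗ[k] O.M s :=
  LinearMap.mk₂ k
    (fun p q K => if h : K = a ++ J ++ c then O.comp a c rfl h (p (a ++ t :: c)) (q J) else 0)
    (by intro p p' q; funext K; by_cases h : K = a ++ J ++ c <;> simp [h, -List.append_assoc])
    (by intro r p q; funext K; by_cases h : K = a ++ J ++ c <;> simp [h, -List.append_assoc])
    (by intro p q q'; funext K; by_cases h : K = a ++ J ++ c <;> simp [h, -List.append_assoc])
    (by intro r p q; funext K; by_cases h : K = a ++ J ++ c <;> simp [h, -List.append_assoc])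

open Classical in
lemma cmp_apply (a : List Color) (t : Color) (c J : List Color) {s : Color} (p : O.M s) (q : O.M t)
    (K : List Color) : cmp a t c J p q K =
      if h : K = a ++ J ++ c then O.comp a c rfl h (p (a ++ t :: c)) (q J) else 0 := rfl

lemma comp_congr (a c : List Color) {I I' J K : List Color} {t s : Color} (hI : I = a ++ t :: c)
    (hI' : I' = a ++ t :: c) (hK : K = a ++ J ++ c) (p : O.M s) (q : O.obj J t) :
    O.comp a c hI hK (p I) q = O.comp a c hI' hK (p I') q := by
  subst hI hI'; rfl

/-- Families are indexed by all profiles and a partial composite is supported on a single one. The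
associativity axioms thereby become equations between families, with no transport along equalities
of profiles. -/
lemma cmp_seq (a b c e N : List Color) (t u : Color) {s : Color} (p : O.M s) (q : O.M t)
    (r : O.M u) :
    cmp (a ++ b) u (e ++ c) N (cmp a t c (b ++ u :: e) p q) r =
      cmp a t c (b ++ N ++ e) p (cmp b u e N q r) := by
  funext K
  have h1 : a ++ b ++ u :: (e ++ c) = a ++ (b ++ u :: e) ++ c := by simp
  simp only [cmp_apply]
  by_cases h : K = a ++ b ++ N ++ (e ++ c)
  · have h' : K = a ++ (b ++ N ++ e) ++ c := by simp [h]
    rw [dif_pos h, dif_pos h', dif_pos h1]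
    simp only [dite_true]
    exact O.assoc_seq a b c e rfl rfl _ rfl _ _ _ _ _ _
  · rw [dif_neg h, dif_neg (by simpa using h)]

lemma cmp_par (a b c J N : List Color) (t u : Color) {s : Color} (p : O.M s) (q : O.M t)
    (r : O.M u) :
    cmp (a ++ J ++ b) u c N (cmp a t (b ++ u :: c) J p q) r =
      cmp a t (b ++ N ++ c) J (cmp (a ++ t :: b) u c N p r) q := by
  funext K
  have h1 : a ++ J ++ b ++ u :: c = a ++ J ++ (b ++ u :: c) := by simp
  have h2 : a ++ t :: (b ++ N ++ c) = a ++ t :: b ++ N ++ c := by simp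
  simp only [cmp_apply]
  by_cases h : K = a ++ J ++ b ++ N ++ c
  · have h' : K = a ++ J ++ (b ++ N ++ c) := by simp [h]
    rw [dif_pos h, dif_pos h', dif_pos h1, dif_pos h2]
    rw [comp_congr (a ++ t :: b) c rfl (I' := a ++ t :: (b ++ u :: c)) (by simp)]
    exact O.assoc_par a b c rfl _ _ _ _ _ _ _ _ _ _
  · rw [dif_neg h, dif_neg (by simpa using h)]

/-- `insAll Z φ u v K` inserts the families `Z`, in this order, into the middle part of the profile
`u ++ J ++ v` of `φ J` in all ways that give the profile `u ++ K ++ v`. -/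
noncomputable def insAll {x : Color} : List O.Item → (List Color → O.M x) →
    List Color → List Color → List Color → O.M x
  | [], φ, _, _, K => φ K
  | z :: Z, φ, u, v, K => splitSum K fun p r => splitSum r fun B s =>
      cmp (u ++ p) z.1 (s ++ v) B
        (insAll Z (fun J => φ (p ++ z.1 :: J)) (u ++ p ++ [z.1]) v s) z.2

variable {x : Color}

lemma insAll_add (Z : List O.Item) (φ ψ : List Color → O.M x) (u v K : List Color) :
    insAll Z (fun J => φ J + ψ J) u v K = insAll Z φ u v K + insAll Z ψ u v K := by
  induction Z generalizing φ ψ u K with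
  | nil => rfl
  | cons z Z ih => simp only [insAll, ih, map_add, LinearMap.add_apply, splitSum_add]

lemma insAll_splitSum {α : Type*} (Z : List O.Item) (W : List α)
    (φ : List α → List α → List Color → O.M x) (u v K : List Color) :
    insAll Z (fun J => splitSum W fun p q => φ p q J) u v K =
      splitSum W fun p q => insAll Z (φ p q) u v K := by
  induction W generalizing φ with
  | nil => rfl
  | cons w W ih => simp only [splitSum, insAll_add, ih (fun p q => φ (w :: p) q)]

lemma cmp_splitSum {α : Type*} (W : List α) (a : List Color) (t : Color) (c J : List Color)
    (f : List α → List α → O.M x) (y : O.M t) :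
    cmp a t c J (splitSum W f) y = splitSum W fun p q => cmp a t c J (f p q) y := by
  induction W generalizing f with
  | nil => rfl
  | cons w W ih => simp only [splitSum, map_add, LinearMap.add_apply, ih]

/-- Insertion into a profile that is cut in two. -/
lemma insAll_split (Z : List O.Item) (H : List Color → List Color → O.M x) (u v K : List Color) :
    insAll Z (fun J => splitSum J H) u v K =
      splitSum Z fun Z₁ Z₂ => splitSum K fun K₁ K₂ =>
        insAll Z₁ (fun J₁ => insAll Z₂ (fun J₂ => H J₁ J₂) (u ++ J₁) v K₂) u (K₂ ++ v) K₁ := by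
  induction Z generalizing H u K with
  | nil => rfl
  | cons z Z ih =>
    simp only [splitSum, insAll, splitSum_append_cons, insAll_add, map_add, LinearMap.add_apply,
      splitSum_add]
    congr 1
    -- The cut lies to the left of the first item, so no item goes into the left part.
    · simp only [insAll_splitSum, cmp_splitSum]
      refine (splitSum_refine_both K fun p p₁ p₂ B s => cmp (u ++ p) z.1 (s ++ v) B
        (insAll Z (fun J => H p₁ (p₂ ++ z.1 :: J)) (u ++ p ++ [z.1]) v s) z.2).trans ?_
      simp only [List.append_assoc]
    -- The cut lies to the right of the first item; the later items are distributed by induction.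
    · simp only [ih, cmp_splitSum]
      rw [splitSum_congr' fun p r => splitSum_congr' fun B s => rfl,
        splitSum_congr' fun p r => splitSum_comm r Z _, splitSum_comm K Z]
      refine splitSum_congr' fun Z₁ Z₂ => ?_
      refine (splitSum_refine_right K fun p B s s₁ s₂ => cmp (u ++ p) z.1 (s ++ v) B
        (insAll Z₁ (fun J₁ => insAll Z₂ (fun J₂ => H (p ++ z.1 :: J₁) J₂)
          (u ++ p ++ [z.1] ++ J₁) v s₂) (u ++ p ++ [z.1]) (s₂ ++ v) s₁) z.2).trans ?_
      simp only [List.append_assoc, List.cons_append, List.nil_append]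

/-- Insertions to the right of an earlier one commute with it. -/
lemma insAll_cmp_left (Z : List O.Item) (φ : List Color → O.M x) {t : Color} (y : O.M t)
    (u p v B K : List Color) :
    insAll Z (fun J => cmp u t (p ++ J ++ v) B (φ J) y) (u ++ B ++ p) v K =
      cmp u t (p ++ K ++ v) B (insAll Z φ (u ++ t :: p) v K) y := by
  induction Z generalizing φ p K with
  | nil => rfl
  | cons z Z ih =>
    simp only [insAll, cmp_splitSum]
    refine splitSum_congr fun q r hK => splitSum_congr fun C s hr => ?_
    subst hr hK
    have := ih (fun J => φ (q ++ z.1 :: J)) (p ++ q ++ [z.1]) s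
    simp only [List.append_assoc, List.cons_append, List.nil_append] at this ⊢
    rw [this]
    have := cmp_par (O := O) u (p ++ q) (s ++ v) B C t z.1
      (insAll Z (fun J => φ (q ++ z.1 :: J)) (u ++ t :: (p ++ (q ++ [z.1]))) v s) y z.2
    simp only [List.append_assoc] at this ⊢
    rw [this]

/-- Insertions into an inserted element. -/
lemma insAll_cmp_right (Z : List O.Item) {t : Color} (X : O.M x) (ψ : List Color → O.M t)
    (u w b e K : List Color) :
    insAll Z (fun J => cmp u t w (b ++ J ++ e) X (ψ J)) (u ++ b) (e ++ w) K =
      cmp u t w (b ++ K ++ e) X (insAll Z ψ b e K) := by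
  induction Z generalizing ψ b K with
  | nil => rfl
  | cons z Z ih =>
    simp only [insAll, map_splitSum]
    refine splitSum_congr fun q r hK => splitSum_congr fun C s hr => ?_
    subst hr hK
    have := ih (fun J => ψ (q ++ z.1 :: J)) (b ++ q ++ [z.1]) s
    simp only [List.append_assoc, List.cons_append, List.nil_append] at this ⊢
    rw [this]
    have := cmp_seq (O := O) u (b ++ q) w (s ++ e) C t z.1 X
      (insAll Z (fun J => ψ (q ++ z.1 :: J)) (b ++ (q ++ [z.1])) e s) z.2
    simp only [List.append_assoc] at this ⊢
    rw [this]

/-- Insertion of a list in terms of the insertions of two parts and one element between them. -/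
lemma insAll_append_cons (Z L : List O.Item) (y : O.Item) (φ : List Color → O.M x)
    (u v K : List Color) :
    insAll (Z ++ y :: L) φ u v K = splitSum K fun p r => splitSum r fun B s =>
      insAll Z (fun J => cmp (u ++ J) y.1 (s ++ v) B
        (insAll L (fun J' => φ (J ++ y.1 :: J')) (u ++ J ++ [y.1]) v s) y.2) u (B ++ s ++ v) p := by
  induction Z generalizing φ u K with
  | nil => rfl
  | cons z Z ih =>
    simp only [List.cons_append, insAll, ih, cmp_splitSum]
    refine (splitSum_five K fun p B s s₁ C t => cmp (u ++ p) z.1 (s ++ v) B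
      (insAll Z (fun J => cmp (u ++ p ++ [z.1] ++ J) y.1 (t ++ v) C
        (insAll L (fun J' => φ (p ++ z.1 :: (J ++ y.1 :: J'))) (u ++ p ++ [z.1] ++ J ++ [y.1]) v t)
        y.2) (u ++ p ++ [z.1]) (C ++ t ++ v) s₁) z.2).trans ?_
    simp only [List.append_assoc, List.cons_append, List.nil_append]

/-- The brace `a{y₁, …, y_q}`. -/
noncomputable def brace (a : O.M x) (Y : List O.Item) : O.M x :=
  fun K => insAll Y (fun _ => a) [] [] K K

/-- The insertions read off `φ J` only at the profile `u ++ J ++ v`. This lets `brace_brace` replace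
the constant family `brace a Y` by its description profile by profile. -/
lemma insAll_congr (Z : List O.Item) (φ ψ : List Color → O.M x) (u v K : List Color)
    (h : ∀ J K', K' = u ++ J ++ v → φ J K' = ψ J K') (K' : List Color) (hK' : K' = u ++ K ++ v) :
    insAll Z φ u v K K' = insAll Z ψ u v K K' := by
  induction Z generalizing φ ψ u K K' with
  | nil => exact h K K' hK'
  | cons z Z ih =>
    simp only [insAll, splitSum_apply]
    refine splitSum_congr fun q r hK => splitSum_congr fun C s hr => ?_
    simp only [cmp_apply]
    rw [ih (fun J => φ (q ++ z.1 :: J)) (fun J => ψ (q ++ z.1 :: J)) (u ++ q ++ [z.1]) s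
      (fun J K' hK' => h (q ++ z.1 :: J) K' (by simpa using hK')) _ (by simp)]

lemma cmp_congr (a : List Color) (t : Color) (c J : List Color) (X : O.M x) (y y' : O.M t)
    (h : y J = y' J) : cmp a t c J X y = cmp a t c J X y' := by
  funext K; simp only [cmp_apply, h]

/-- The sum of `Φ` over all the ways to insert the items `Z`, in order, between or into the
items `Y`. -/
noncomputable def plugSum {A : Type*} [AddCommMonoid A] :
    List O.Item → List O.Item → (List O.Item → A) → A
  | [], Z, Φ => Φ Z
  | y :: Y, Z, Φ => splitSum Z fun Z₀ Z' => splitSum Z' fun Z₁ Z₂ =>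
      plugSum Y Z₂ fun L => Φ (Z₀ ++ ⟨y.1, brace y.2 Z₁⟩ :: L)

lemma plugSum_map {A B F : Type*} [AddCommMonoid A] [AddCommMonoid B] [FunLike F A B]
    [AddMonoidHomClass F A B] (g : F) (Y Z : List O.Item) (Φ : List O.Item → A) :
    g (plugSum Y Z Φ) = plugSum Y Z fun L => g (Φ L) := by
  induction Y generalizing Z Φ with
  | nil => rfl
  | cons y Y ih => simp only [plugSum, map_splitSum, ih]

lemma cmp_plugSum (Y Z : List O.Item) (a : List Color) (t : Color) (c J : List Color)
    (f : List O.Item → O.M x) (y : O.M t) :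
    cmp a t c J (plugSum Y Z f) y = plugSum Y Z fun L => cmp a t c J (f L) y :=
  plugSum_map ((cmp (O := O) a t c J).flip y) Y Z f


lemma plugSum_add {A : Type*} [AddCommMonoid A] (Y Z : List O.Item) (Φ Ψ : List O.Item → A) :
    plugSum Y Z (fun L => Φ L + Ψ L) = plugSum Y Z Φ + plugSum Y Z Ψ := by
  induction Y generalizing Z Φ Ψ with
  | nil => rfl
  | cons y Y ih => simp only [plugSum, ih, splitSum_add]

lemma plugSum_splitSum {α A : Type*} [AddCommMonoid A] (Y Z : List O.Item) (K : List α)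
    (f : List O.Item → List α → List α → A) :
    plugSum Y Z (fun L => splitSum K (f L)) = splitSum K fun p q => plugSum Y Z fun L => f L p q := by
  induction K generalizing f with
  | nil => rfl
  | cons w K ih => simp only [splitSum, plugSum_add, ih (fun L p q => f L (w :: p) q)]

lemma insAll_plugSum (Y Z W : List O.Item) (f : List O.Item → List Color → O.M x)
    (u v K : List Color) :
    insAll W (fun J => plugSum Y Z fun L => f L J) u v K =
      plugSum Y Z fun L => insAll W (f L) u v K := by
  induction Y generalizing Z f with
  | nil => rfl
  | cons y Y ih => simp only [plugSum, insAll_splitSum, ih]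

/-- Composition of two multiple insertions. -/
lemma insAll_insAll (Y Z : List O.Item) (φ : List Color → O.M x) (u v K : List Color) :
    insAll Z (fun J => insAll Y φ u v J) u v K =
      plugSum Y Z fun L => insAll L φ u v K := by
  induction Y generalizing Z φ u K with
  | nil => rfl
  | cons y Y ih =>
    simp only [insAll, plugSum]
    -- The profile after the insertion of `y` is cut at the start of the block of `y`, and `Z₀` goes
    -- to the left of it. The cut at the end of the block is treated in `h`: there `Z₁` enters `y`
    -- and `Z₂` stays to its right.
    rw [insAll_split]
    refine splitSum_congr' fun Z₀ Z' => ?_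
    have h : ∀ p r, insAll Z' (fun r => splitSum r fun B s => cmp (u ++ p) y.1 (s ++ v) B
        (insAll Y (fun J => φ (p ++ y.1 :: J)) (u ++ p ++ [y.1]) v s) y.2) (u ++ p) v r =
        splitSum Z' fun Z₁ Z₂ => splitSum r fun B s => cmp (u ++ p) y.1 (s ++ v) B
          (plugSum Y Z₂ fun L => insAll L (fun J => φ (p ++ y.1 :: J)) (u ++ p ++ [y.1]) v s)
          (brace y.2 Z₁) := by
      intro p r
      rw [insAll_split]
      refine splitSum_congr' fun Z₁ Z₂ => splitSum_congr' fun B s => ?_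
      have h₁ : ∀ J₁, insAll Z₂ (fun J₂ => cmp (u ++ p) y.1 (J₂ ++ v) J₁
          (insAll Y (fun J => φ (p ++ y.1 :: J)) (u ++ p ++ [y.1]) v J₂) y.2) (u ++ p ++ J₁) v s =
          cmp (u ++ p) y.1 (s ++ v) J₁ (plugSum Y Z₂ fun L =>
            insAll L (fun J => φ (p ++ y.1 :: J)) (u ++ p ++ [y.1]) v s) y.2 := by
        intro J₁
        have := insAll_cmp_left Z₂ (fun J₂ => insAll Y (fun J => φ (p ++ y.1 :: J))
          (u ++ p ++ [y.1]) v J₂) y.2 (u ++ p) [] v J₁ s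
        simp only [List.append_nil, List.nil_append] at this
        rw [this, ← ih]
      simp only [h₁]
      have := insAll_cmp_right Z₁ (plugSum Y Z₂ fun L =>
            insAll L (fun J => φ (p ++ y.1 :: J)) (u ++ p ++ [y.1]) v s) (fun _ => y.2)
            (u ++ p) (s ++ v) [] [] B
      simp only [List.append_nil, List.nil_append] at this
      rw [this]
      -- Only the component `B` of the inserted family is composed, and at this component the
      -- insertions of `Z₁` into `y` are the brace by definition.
      exact cmp_congr _ _ _ _ _ _ _ rfl
    simp only [h, insAll_splitSum, insAll_append_cons, cmp_plugSum, insAll_plugSum,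
      plugSum_splitSum]
    rw [splitSum_congr' fun p r => splitSum_congr' fun Z₁ Z₂ => rfl, splitSum_comm K Z']
    refine splitSum_congr' fun Z₁ Z₂ => splitSum_congr' fun p r => splitSum_congr fun B s hr => ?_
    simp only [← hr]

/-- The brace relation. -/
lemma brace_brace (a : O.M x) (Y Z : List O.Item) :
    brace (brace a Y) Z = plugSum Y Z fun L => brace a L := by
  funext K
  have h : plugSum Y Z (fun L => brace a L) K = plugSum Y Z fun L => brace a L K :=
    plugSum_map (Pi.evalAddMonoidHom _ K) Y Z _
  rw [h]
  have := congrFun (insAll_insAll Y Z (fun _ => a) [] [] K) K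
  have h2 : plugSum Y Z (fun L => insAll L (fun _ => a) [] [] K) K =
      plugSum Y Z fun L => insAll L (fun _ => a) [] [] K K :=
    plugSum_map (Pi.evalAddMonoidHom _ K) Y Z _
  rw [h2] at this
  simp only [brace]
  rw [← this]
  exact insAll_congr Z (fun _ => brace a Y) (fun J => insAll Y (fun _ => a) [] [] J) [] [] K
    (fun J K' h => by simp [h, brace]) _ (by simp)

end PlainOp
end SwissCheese

namespace SwissCheese

open Color

/-! ## Admissible profiles -/

lemma isAdm_cl_iff (I : List Color) : IsAdm I cl ↔ I ≠ [] ∧ ∀ c ∈ I, c = cl := by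
  simp [IsAdm, List.eq_replicate_iff]

lemma isAdm_op_iff (I : List Color) : IsAdm I op ↔
    (I ≠ [] ∧ ∀ c ∈ I, c = cl) ∨ ∃ J, (∀ c ∈ J, c = cl) ∧ I = J ++ [op] := by
  simp only [IsAdm, List.eq_replicate_iff, true_and]
  refine or_congr Iff.rfl ⟨fun h => ⟨_, ?_, h⟩, ?_⟩
  · intro c hc; exact List.eq_of_mem_replicate hc
  · rintro ⟨J, hJ, rfl⟩
    have : J = List.replicate J.length cl := List.eq_replicate_iff.2 ⟨rfl, hJ⟩
    simpa using this

/-- A closed input is replaced by a nonempty closed word, and the open input, which comes last, by a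
word whose only open entry, if any, is its last one. Admissibility survives in both cases, which
makes `Supp` stable under braces. -/
lemma isAdm_comp {a B c : List Color} {t s : Color} (h : IsAdm (a ++ t :: c) s) (hB : IsAdm B t) :
    IsAdm (a ++ B ++ c) s := by
  have key : ∀ {a B c : List Color} {t : Color}, (∀ x ∈ a ++ t :: c, x = cl) → IsAdm B t →
      a ++ B ++ c ≠ [] ∧ ∀ x ∈ a ++ B ++ c, x = cl := by
    intro a B c t h hB
    obtain rfl : t = cl := h t (by simp)
    rw [isAdm_cl_iff] at hB
    refine ⟨by simp [hB.1], fun x hx => ?_⟩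
    simp only [List.mem_append] at hx
    rcases hx with (hx | hx) | hx
    · exact h x (by simp [hx])
    · exact hB.2 x hx
    · exact h x (by simp [hx])
  cases s with
  | cl => rw [isAdm_cl_iff] at h ⊢; exact key h.2 hB
  | op =>
    rw [isAdm_op_iff] at h ⊢
    rcases h with h | ⟨J, hJ, h⟩
    · exact Or.inl (key h.2 hB)
    · rcases List.eq_nil_or_concat c with rfl | ⟨c, e, rfl⟩
      · obtain ⟨rfl, h2⟩ := List.append_inj' h rfl
        obtain rfl : t = op := by simpa using h2
        rw [isAdm_op_iff] at hB
        rcases hB with hB | ⟨J', hJ', rfl⟩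
        · left
          refine ⟨by simp [hB.1], fun x hx => ?_⟩
          simp only [List.append_nil, List.mem_append] at hx
          exact hx.elim (hJ x) (hB.2 x)
        · right
          refine ⟨a ++ J', fun x hx => ?_, by simp⟩
          exact (List.mem_append.1 hx).elim (hJ x) (hJ' x)
      · rw [List.concat_eq_append, ← List.cons_append, ← List.append_assoc] at h
        obtain ⟨h1, h2⟩ := List.append_inj' h rfl
        obtain rfl : e = op := by simpa using h2
        subst h1
        exact Or.inr ⟨a ++ B ++ c, (key hJ hB).2, by simp⟩

lemma not_isAdm_cl_of_mem {I : List Color} (h : op ∈ I) : ¬ IsAdm I cl := by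
  rw [isAdm_cl_iff]; intro h'; exact absurd (h'.2 _ h) (by decide)

/-- In an admissible profile nothing follows an open entry. Sums over cuts that involve an open
insertion reduce to their last term for this reason. -/
lemma not_isAdm_op_of_sublist {I : List Color} {c : Color} (h : [op, c].Sublist I) :
    ¬ IsAdm I op := by
  rw [isAdm_op_iff]
  rintro (⟨-, h'⟩ | ⟨J, hJ, rfl⟩)
  · exact absurd (h' op (h.subset (by simp))) (by decide)
  · obtain ⟨l₁, l₂, h1, h2, h3⟩ := List.sublist_append_iff.1 h
    cases l₁ with
    | nil => rw [List.nil_append] at h1; subst h1; have := h3.length_le; simp at this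
    | cons y l₁ =>
      obtain rfl : op = y := by simpa using (List.cons.inj h1).1
      exact absurd (hJ op (h2.subset (by simp))) (by decide)

lemma splitSum_eq_first {α A : Type*} [AddCommMonoid A] {K : List α} {f : List α → List α → A}
    (h : ∀ p q, p ≠ [] → f p q = 0) : splitSum K f = f [] K := by
  cases K with
  | nil => rfl
  | cons x K =>
    rw [splitSum, splitSum_eq_zero, add_zero]
    intro p q _; exact h _ _ (by simp)

lemma splitSum_eq_last {α A : Type*} [AddCommMonoid A] {K : List α} {f : List α → List α → A}
    (h : ∀ p q, q ≠ [] → f p q = 0) : splitSum K f = f K [] := by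
  induction K generalizing f with
  | nil => rfl
  | cons x K ih =>
    rw [splitSum, ih fun p q hq => h _ _ hq, h _ _ (by simp), zero_add]

/-! ### Linearity and support of braces. -/

namespace PlainOp

universe u v

variable {k : Type u} [CommRing k] {O : PlainOp.{u, v} k} {x : Color}

lemma splitSum_linearMap_apply {α N N' : Type*} [AddCommGroup N] [Module k N] [AddCommGroup N']
    [Module k N'] (K : List α) (f : List α → List α → (N →ₗ[k] N')) (n : N) :
    splitSum K f n = splitSum K fun p q => f p q n := by
  induction K generalizing f with
  | nil => rfl
  | cons x K ih => simp only [splitSum, LinearMap.add_apply, ih]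

/-- Linearity is recorded as the existence of a linear map. Additivity and compatibility with
negation and with sums are then read off from `map_add`, `map_neg` and the like, and no multilinear
map has to be built. -/
lemma insAll_linear_left {N : Type*} [AddCommGroup N] [Module k N] (Z : List O.Item)
    (ψ : List Color → (N →ₗ[k] O.M x)) (u v K : List Color) :
    ∃ l : N →ₗ[k] O.M x, ∀ n, insAll Z (fun J => ψ J n) u v K = l n := by
  induction Z generalizing ψ u K with
  | nil => exact ⟨ψ K, fun n => rfl⟩
  | cons z Z ih =>
    choose l hl using fun p s => ih (fun J => ψ (p ++ z.1 :: J)) (u ++ p ++ [z.1]) s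
    refine ⟨splitSum K fun p r => splitSum r fun B s =>
      ((cmp (u ++ p) z.1 (s ++ v) B).flip z.2).comp (l p s), fun n => ?_⟩
    simp only [insAll, hl, splitSum_linearMap_apply]
    rfl

lemma insAll_linear_item (Z Z' : List O.Item) (c : Color)
    (φ : List Color → O.M x) (u v K : List Color) :
    ∃ l : O.M c →ₗ[k] O.M x, ∀ y, insAll (Z ++ ⟨c, y⟩ :: Z') φ u v K = l y := by
  induction Z generalizing φ u K with
  | nil =>
    refine ⟨splitSum K fun p r => splitSum r fun B s => cmp (u ++ p) c (s ++ v) B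
        (insAll Z' (fun J => φ (p ++ c :: J)) (u ++ p ++ [c]) v s), fun y => ?_⟩
    simp only [List.nil_append, insAll, splitSum_linearMap_apply]
  | cons z Z ih =>
    choose l hl using fun p s => ih (fun J => φ (p ++ z.1 :: J)) (u ++ p ++ [z.1]) s
    refine ⟨splitSum K fun p r => splitSum r fun B s =>
      ((cmp (u ++ p) z.1 (s ++ v) B).flip z.2).comp (l p s), fun n => ?_⟩
    simp only [List.cons_append, insAll, hl, splitSum_linearMap_apply]
    rfl

lemma brace_linear_left (Z : List O.Item) :
    ∃ l : O.M x →ₗ[k] O.M x, ∀ a, brace a Z = l a := by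
  choose l hl using fun K => insAll_linear_left Z (fun _ => (LinearMap.id : O.M x →ₗ[k] O.M x))
    [] [] K
  refine ⟨LinearMap.pi fun K => (LinearMap.proj K).comp (l K), fun a => ?_⟩
  funext K
  exact congrFun (hl K a) K

lemma brace_linear_item (a : O.M x) (Z Z' : List O.Item) (c : Color) :
    ∃ l : O.M c →ₗ[k] O.M x, ∀ y, brace a (Z ++ ⟨c, y⟩ :: Z') = l y := by
  choose l hl using fun K => insAll_linear_item Z Z' c (fun _ => a) [] [] K
  refine ⟨LinearMap.pi fun K => (LinearMap.proj K).comp (l K), fun a => ?_⟩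
  funext K
  exact congrFun (hl K a) K

@[simp] lemma brace_nil (a : O.M x) : brace a [] = a := rfl

/-- Insertion of the last element. -/
lemma insAll_snoc (Y : List O.Item) (y : O.Item) (φ : List Color → O.M x) (u v K : List Color) :
    insAll (Y ++ [y]) φ u v K = splitSum K fun p r => splitSum r fun B s =>
      cmp (u ++ p) y.1 (s ++ v) B (insAll Y (fun J => φ (J ++ y.1 :: s)) u (y.1 :: s ++ v) p)
        y.2 := by
  rw [insAll_append_cons]
  refine splitSum_congr' fun p r => splitSum_congr' fun B s => ?_
  induction Y generalizing φ u p with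
  | nil => rfl
  | cons z Z ih =>
    simp only [insAll, cmp_splitSum] at ih ⊢
    refine splitSum_congr fun q r hK => splitSum_congr fun C s' hr => ?_
    subst hr hK
    have := ih (fun J => φ (q ++ z.1 :: J)) (u ++ q ++ [z.1]) s'
    simp only [List.append_assoc, List.cons_append, List.nil_append] at this ⊢
    rw [this]
    -- In `insAll` the first item is composed last; parallel associativity moves the composition
    -- with the last item `y` outside.
    have := cmp_par (O := O) (u ++ q) s' (s ++ v) C B z.1 y.1
      (insAll Z (fun J => φ (q ++ z.1 :: (J ++ y.1 :: s))) (u ++ (q ++ [z.1]))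
        (y.1 :: (s ++ v)) s') z.2 y.2
    simp only [List.append_assoc] at this ⊢
    rw [this]

/-- Every insertion starts from a component of `φ` whose profile contains the output colours of the
items as a subword. If these components vanish, so does each term. -/
lemma insAll_eq_zero (Z : List O.Item) (φ : List Color → O.M x) (u v K : List Color)
    (h : ∀ J K', K' = u ++ J ++ v → (Z.map Sigma.fst).Sublist J → φ J K' = 0)
    (K' : List Color) (hK' : K' = u ++ K ++ v) : insAll Z φ u v K K' = 0 := by
  induction Z generalizing φ u K K' with
  | nil => exact h K K' hK' (by simp)
  | cons z Z ih =>
    simp only [insAll, splitSum_apply]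
    refine splitSum_eq_zero fun q r hK => splitSum_eq_zero fun C s hr => ?_
    rw [cmp_apply, ih]
    · simp
    · intro J K' hJ hs
      refine h _ _ (by simpa using hJ) ?_
      simp only [List.map_cons]
      exact ((hs.cons_cons z.1)).trans (List.sublist_append_right _ _)
    · simp

lemma brace_eq_zero (a : O.M x) (Z : List O.Item)
    (h : ∀ I, (Z.map Sigma.fst).Sublist I → a I = 0) : brace a Z = 0 := by
  funext K
  exact insAll_eq_zero Z _ [] [] K (fun J K' hJ hs => h _ (by rw [hJ]; simpa using hs)) K (by simp)

/-- The family is concentrated on the admissible profiles. -/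
def Supp (a : O.M x) : Prop := ∀ I, ¬ IsAdm I x → a I = 0

/-- By `isAdm_comp`, a composite of inadmissible profile has a factor of inadmissible profile, and
that factor is zero. -/
lemma insAll_supp (Z : List O.Item) (hZ : ∀ z ∈ Z, Supp z.2) (φ : List Color → O.M x)
    (u v K : List Color) (h : ∀ J K', K' = u ++ J ++ v → ¬ IsAdm K' x → φ J K' = 0)
    (K' : List Color) (hK' : K' = u ++ K ++ v) (hadm : ¬ IsAdm K' x) :
    insAll Z φ u v K K' = 0 := by
  induction Z generalizing φ u K K' with
  | nil => exact h K K' hK' hadm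
  | cons z Z ih =>
    simp only [insAll, splitSum_apply]
    refine splitSum_eq_zero fun q r hK => splitSum_eq_zero fun C s hr => ?_
    rw [cmp_apply]
    split_ifs with hc
    · by_cases h1 : IsAdm C z.1
      · rw [ih (fun z' hz' => hZ z' (by simp [hz'])) _ (u ++ q ++ [z.1]) s
          (fun J K' hJ => h _ K' (by simpa using hJ)) _ (by simp)
          (fun h2 => hadm (hc ▸ isAdm_comp h2 h1))]
        simp
      · rw [hZ z (by simp) C h1]; simp
    · rfl

lemma Supp.brace {a : O.M x} (ha : Supp a) {Z : List O.Item} (hZ : ∀ z ∈ Z, Supp z.2) :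
    Supp (brace a Z) := fun K hK =>
  insAll_supp Z hZ _ [] [] K (fun _ K' _ h => ha K' h) K (by simp) hK

lemma brace_cl_eq_zero {a : O.M cl} (ha : Supp a) {Z : List O.Item} (b : O.M op)
    (hZ : ⟨op, b⟩ ∈ Z) : PlainOp.brace a Z = 0 :=
  brace_eq_zero a Z fun I hI => ha I <| not_isAdm_cl_of_mem <|
    hI.subset (List.mem_map.2 ⟨_, hZ, rfl⟩)

lemma brace_op_eq_zero {a : O.M op} (ha : Supp a) (Z : List O.Item) (b : O.M op) (z : O.Item)
    (Z' : List O.Item) : PlainOp.brace a (Z ++ ⟨op, b⟩ :: z :: Z') = 0 :=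
  brace_eq_zero a _ fun I hI => ha I <| not_isAdm_op_of_sublist (c := z.1) <| by
    refine List.Sublist.trans ?_ hI
    simp only [List.map_append, List.map_cons]
    exact ((List.nil_sublist _).cons_cons _).cons_cons _ |>.trans (List.sublist_append_right _ _)

end PlainOp
end SwissCheese

namespace SwissCheese

open Color

/-! ### Cuts in three parts and Leibniz sums. -/

section Splits

variable {α A : Type*} [AddCommMonoid A]

/-- The sum of `f p q r` over all `p ++ q ++ r = K`. -/
def splitSum₃ (K : List α) (f : List α → List α → List α → A) : A :=
  splitSum K fun p r => splitSum r fun q s => f p q s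

lemma splitSum_if (K : List α) (P : List α → List α → Prop) [∀ p q, Decidable (P p q)]
    (f : List α → List α → A) :
    splitSum K f = splitSum K (fun p q => if P p q then f p q else 0) +
      splitSum K (fun p q => if P p q then 0 else f p q) := by
  rw [← splitSum_add]
  refine splitSum_congr' fun p q => ?_
  split_ifs <;> simp

lemma splitSum₃_congr {K : List α} {f g : List α → List α → List α → A}
    (h : ∀ p q r, p ++ q ++ r = K → f p q r = g p q r) : splitSum₃ K f = splitSum₃ K g :=
  splitSum_congr fun p r hr => splitSum_congr fun q s hs => h p q s (by simp [hs, hr])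

lemma splitSum₃_add (K : List α) (f g : List α → List α → List α → A) :
    splitSum₃ K (fun p q r => f p q r + g p q r) = splitSum₃ K f + splitSum₃ K g := by
  simp only [splitSum₃, splitSum_add]

lemma splitSum₃_eq_zero {K : List α} {f : List α → List α → List α → A}
    (h : ∀ p q r, p ++ q ++ r = K → f p q r = 0) : splitSum₃ K f = 0 :=
  splitSum_eq_zero fun p r hr => splitSum_eq_zero fun q s hs => h p q s (by simp [hs, hr])

lemma splitSum_neg {A : Type*} [AddCommGroup A] (K : List α) (f : List α → List α → A) :
    splitSum K (fun p q => - f p q) = - splitSum K f :=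
  (map_splitSum (-AddMonoidHom.id A) K f).symm

lemma splitSum₃_neg {A : Type*} [AddCommGroup A] (K : List α) (f : List α → List α → List α → A) :
    splitSum₃ K (fun p q r => - f p q r) = - splitSum₃ K f := by
  simp only [splitSum₃, splitSum_neg]

/-- Removal of the term with empty outer parts. -/
lemma splitSum₃_outer (K : List α) (f : List α → List α → List α → A) :
    splitSum₃ K f = f [] K [] +
      splitSum₃ K (fun p q r => if 1 ≤ p.length + r.length then f p q r else 0) := by
  have h : splitSum₃ K f = splitSum₃ K (fun p q r => if 1 ≤ p.length + r.length then 0 else f p q r)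
      + splitSum₃ K (fun p q r => if 1 ≤ p.length + r.length then f p q r else 0) := by
    rw [← splitSum₃_add]
    refine splitSum₃_congr fun p q r _ => ?_
    split_ifs <;> simp
  rw [h]
  congr 1
  rw [splitSum₃, splitSum_eq_first, splitSum_eq_last]
  · simp
  · intro p q hq; have := List.length_pos_iff.2 hq; rw [if_pos (by simp; omega)]
  · intro p q hp; have := List.length_pos_iff.2 hp
    exact splitSum_eq_zero fun _ _ _ => if_pos (by omega)

/-- Apply `D` to the elements of the list, one after the other, and sum up the values of `Φ`. -/
def leib (D : α → α) : List α → (List α → A) → A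
  | [], _ => 0
  | y :: Y, Φ => Φ (D y :: Y) + leib D Y fun L => Φ (y :: L)

lemma leib_add (D : α → α) (Y : List α) (Φ Ψ : List α → A) :
    leib D Y (fun L => Φ L + Ψ L) = leib D Y Φ + leib D Y Ψ := by
  induction Y generalizing Φ Ψ with
  | nil => simp [leib]
  | cons y Y ih => simp only [leib, ih]; exact add_add_add_comm _ _ _ _

lemma map_leib {B F : Type*} [AddCommMonoid B] [FunLike F A B] [AddMonoidHomClass F A B] (g : F)
    (D : α → α) (Y : List α) (Φ : List α → A) :
    g (leib D Y Φ) = leib D Y fun L => g (Φ L) := by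
  induction Y generalizing Φ with
  | nil => simp [leib]
  | cons y Y ih => simp only [leib, map_add, ih]

lemma leib_splitSum {β : Type*} (D : α → α) (Y : List α) (K : List β)
    (f : List α → List β → List β → A) :
    leib D Y (fun L => splitSum K (f L)) = splitSum K fun p q => leib D Y fun L => f L p q := by
  induction K generalizing f with
  | nil => rfl
  | cons w K ih => simp only [splitSum, leib_add, ih (fun L p q => f L (w :: p) q)]

lemma leib_map {β : Type*} (D : α → α) (D' : β → β) (g : β → α) (h : ∀ y, D (g y) = g (D' y))
    (Y : List β) (Φ : List α → A) : leib D (Y.map g) Φ = leib D' Y fun L => Φ (L.map g) := by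
  induction Y generalizing Φ with
  | nil => rfl
  | cons y Y ih => simp only [List.map_cons, leib, ih, h]

/-- Separation of the terms whose middle part has at most one element. -/
lemma splitSum₃_mid (K : List α) (D : α → α) (f : List α → List α → List α → A)
    (Φ : List α → A) (h : ∀ p y r, f p [y] r = Φ (p ++ D y :: r)) :
    splitSum₃ K f = splitSum K (fun p r => f p [] r) + leib D K Φ +
      splitSum₃ K (fun p q r => if 2 ≤ q.length then f p q r else 0) := by
  induction K generalizing f Φ with
  | nil => simp [splitSum₃, splitSum, leib]
  | cons x K ih =>
    have ih' := ih (fun p q r => f (x :: p) q r) (fun L => Φ (x :: L)) (fun p y r => h _ _ _)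
    simp only [splitSum₃] at ih'
    simp only [splitSum₃, splitSum, leib, ih']
    -- With empty left part, the middle is `[]`, `[x]` or longer. A second unfolding shows that the
    -- longer ones have length at least two.
    cases K with
    | nil => simp [splitSum, leib, h, add_right_comm]
    | cons y K =>
      simp only [splitSum, List.length_nil, List.length_cons, h, List.nil_append]
      simp only [show ¬ (2 ≤ 0) by omega, show ¬ (2 ≤ 0 + 1) by omega, if_false, zero_add,
        if_true, show ∀ n, 2 ≤ n + 1 + 1 by omega]
      abel

end Splits

/-! ### Braces with closed arguments and the open product. -/

namespace PlainOp

universe u v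

variable {k : Type u} [CommRing k] {O : PlainOp.{u, v} k} {x : Color}

/-- Closed families as items. -/
abbrev cls (Y : List (O.M cl)) : List O.Item := Y.map fun y => ⟨cl, y⟩

/-- Braces with closed arguments. -/
noncomputable abbrev cbrace (a : O.M x) (Y : List (O.M cl)) : O.M x := brace a (cls Y)

@[simp] lemma cbrace_nil (a : O.M x) : cbrace a [] = a := rfl

/-- Insertion into the open input. -/
noncomputable abbrev mul (a : O.M x) (b : O.M op) : O.M x := brace a [⟨op, b⟩]

/-- The version of `plugSum` for closed families. -/
noncomputable def cplug {A : Type*} [AddCommMonoid A] :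
    List (O.M cl) → List (O.M cl) → (List (O.M cl) → A) → A
  | [], Z, Φ => Φ Z
  | y :: Y, Z, Φ => splitSum₃ Z fun Z₀ Z₁ Z₂ =>
      cplug Y Z₂ fun L => Φ (Z₀ ++ cbrace y Z₁ :: L)

lemma plugSum_cls {A : Type*} [AddCommMonoid A] (Y Z : List (O.M cl)) (Φ : List O.Item → A) :
    plugSum (cls Y) (cls Z) Φ = cplug Y Z fun L => Φ (cls L) := by
  induction Y generalizing Z Φ with
  | nil => rfl
  | cons y Y ih =>
    simp only [cls, List.map_cons, plugSum, cplug, splitSum_map, splitSum₃] at ih ⊢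
    refine splitSum_congr' fun _ _ => splitSum_congr' fun _ _ => ?_
    rw [ih]
    simp

lemma cbrace_cbrace (a : O.M x) (Y Z : List (O.M cl)) :
    cbrace (cbrace a Y) Z = cplug Y Z fun L => cbrace a L := by
  rw [cbrace, cbrace, brace_brace, plugSum_cls]

lemma plugSum_nil {A : Type*} [AddCommMonoid A] (Y : List O.Item) (Φ : List O.Item → A) :
    plugSum Y [] Φ = Φ Y := by
  induction Y generalizing Φ with
  | nil => rfl
  | cons y Y ih => simp [plugSum, splitSum, ih]

lemma cplug_nil {A : Type*} [AddCommMonoid A] (Y : List (O.M cl)) (Φ : List (O.M cl) → A) :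
    cplug Y [] Φ = Φ Y := by
  induction Y generalizing Φ with
  | nil => rfl
  | cons y Y ih => simp only [cplug, splitSum₃, splitSum, ih, cbrace_nil, List.nil_append]

/-- A single element either enters one of the `y`, which gives the Leibniz sum, or takes a place
between them. -/
lemma cplug_singleton {A : Type*} [AddCommMonoid A] (Y : List (O.M cl)) (z : O.M cl)
    (Φ : List (O.M cl) → A) :
    cplug Y [z] Φ = leib (fun y => cbrace y [z]) Y Φ + splitSum Y fun A C => Φ (A ++ z :: C) := by
  induction Y generalizing Φ with
  | nil => simp [cplug, leib, splitSum]
  | cons y Y ih =>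
    simp only [cplug, splitSum₃, splitSum, cplug_nil, ih, leib, List.nil_append,
      cbrace_nil, List.cons_append]
    abel

lemma cbrace_cbrace_singleton (a : O.M x) (z : O.M cl) (Y : List (O.M cl)) :
    cbrace (cbrace a [z]) Y = splitSum₃ Y fun A B C => cbrace a (A ++ cbrace z B :: C) := by
  rw [cbrace_cbrace]; rfl

lemma cbrace_singleton_cbrace (a : O.M x) (z : O.M cl) (Y : List (O.M cl)) :
    cbrace (cbrace a Y) [z] = leib (fun y => cbrace y [z]) Y (fun L => cbrace a L) +
      splitSum Y fun A C => cbrace a (A ++ z :: C) := by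
  rw [cbrace_cbrace, cplug_singleton]

lemma brace_zero_item (a : O.M x) (Z Z' : List O.Item) (c : Color) :
    brace a (Z ++ ⟨c, 0⟩ :: Z') = 0 := by
  obtain ⟨l, hl⟩ := brace_linear_item a Z Z' c
  rw [hl, map_zero]

/-- An open element that is inserted after closed ones. -/
lemma brace_append_op {a : O.M op} (ha : Supp a) {Y : List (O.M cl)} (hY : ∀ y ∈ Y, Supp y)
    (b : O.M op) : brace a (cls Y ++ [⟨op, b⟩]) = mul (cbrace a Y) b := by
  rw [mul, cbrace, brace_brace]
  have key : ∀ (Y : List (O.M cl)) (Φ : List O.Item → O.M op), (∀ y ∈ Y, Supp y) →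
      (∀ A z C, Φ (A ++ ⟨op, b⟩ :: z :: C) = 0) → (∀ A C, Φ (A ++ ⟨cl, 0⟩ :: C) = 0) →
      plugSum (cls Y) [⟨op, b⟩] Φ = Φ (cls Y ++ [⟨op, b⟩]) := by
    intro Y
    induction Y with
    | nil => intros; rfl
    | cons y Y ih =>
      intro Φ hY h1 h2
      -- An open element cannot enter a closed operation, and it cannot stand before another
      -- argument because the open input comes last. Only the position after all of `Y` survives.
      have h3 : brace y [⟨op, b⟩] = 0 := brace_cl_eq_zero (hY y (by simp)) b (by simp)
      have h4 := ih (fun L => Φ (⟨cl, y⟩ :: L)) (fun y hy => hY y (by simp [hy]))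
        (fun A z C => h1 (⟨cl, y⟩ :: A) z C) (fun A C => h2 (⟨cl, y⟩ :: A) C)
      have h5 := h2 [] (cls Y)
      have h6 := h1 [] ⟨cl, y⟩ (cls Y)
      simp only [cls, List.nil_append] at h4 h5 h6
      simp [plugSum, splitSum, plugSum_nil, h3, h4, h5, h6]
  exact (key Y _ hY (fun A z C => brace_op_eq_zero ha A b z C)
    (fun A C => brace_zero_item a A C cl)).symm

/-- The brace relation places each argument before `b` in `a`, inside `b`, or after `b`. The last
possibility gives zero since the open input of `a` is its last one, so only the cuts of `Y` in two
remain. -/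
lemma cbrace_mul {a : O.M op} (ha : Supp a) (b : O.M op) {Y : List (O.M cl)}
    (hY : ∀ y ∈ Y, Supp y) :
    cbrace (mul a b) Y = splitSum Y fun A B => mul (cbrace a A) (cbrace b B) := by
  rw [cbrace, mul, brace_brace]
  simp only [plugSum]
  rw [cls, splitSum_map]
  refine splitSum_congr fun A B hAB => ?_
  rw [splitSum_eq_last, ← brace_append_op ha fun y hy => hY y (by simp [← hAB, hy])]
  intro p q hq
  obtain ⟨z, C, rfl⟩ := List.exists_cons_of_ne_nil hq
  exact brace_op_eq_zero ha _ _ _ _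

/-- The brace relation has two further terms, with `b` and `c` side by side in `a`. They vanish
because nothing may follow an open input of `a`. -/
lemma mul_assoc {a : O.M op} (ha : Supp a) (b c : O.M op) :
    mul (mul a b) c = mul a (mul b c) := by
  have h1 := brace_op_eq_zero ha [] b ⟨op, c⟩ []
  have h2 := brace_op_eq_zero ha [] c ⟨op, b⟩ []
  simp only [List.nil_append] at h1 h2
  simp [mul, brace_brace, plugSum, splitSum, h1, h2]

lemma cls_append (Y Z : List (O.M cl)) : cls (Y ++ Z) = cls Y ++ cls Z := List.map_append

lemma cbrace_linear_item (a : O.M x) (Z Z' : List (O.M cl)) :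
    ∃ l : O.M cl →ₗ[k] O.M x, ∀ y, cbrace a (Z ++ y :: Z') = l y := by
  obtain ⟨l, hl⟩ := brace_linear_item a (cls Z) (cls Z') cl
  exact ⟨l, fun y => by rw [← hl, cbrace, cls_append]; rfl⟩

lemma mul_linear_right (a : O.M x) : ∃ l : O.M op →ₗ[k] O.M x, ∀ b, mul a b = l b :=
  brace_linear_item a [] [] op

/-- Functions of a list of families that are linear in each entry. -/
def MLin {c : Color} {A : Type*} [AddCommGroup A] [Module k A] (Φ : List (O.M c) → A) : Prop :=
  ∀ Z Z', ∃ l : O.M c →ₗ[k] A, ∀ y, Φ (Z ++ y :: Z') = l y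

lemma cbrace_mlin (a : O.M x) : MLin (k := k) fun Y => cbrace a Y := cbrace_linear_item a

namespace MLin

variable {c : Color} {A : Type*} [AddCommGroup A] [Module k A] {Φ : List (O.M c) → A}

lemma add (h : MLin Φ) (Z Z' : List (O.M c)) (y y' : O.M c) :
    Φ (Z ++ (y + y') :: Z') = Φ (Z ++ y :: Z') + Φ (Z ++ y' :: Z') := by
  obtain ⟨l, hl⟩ := h Z Z'
  simp only [hl, map_add]

lemma sub (h : MLin Φ) (Z Z' : List (O.M c)) (y y' : O.M c) :
    Φ (Z ++ (y - y') :: Z') = Φ (Z ++ y :: Z') - Φ (Z ++ y' :: Z') := by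
  obtain ⟨l, hl⟩ := h Z Z'
  simp only [hl, map_sub]

lemma cons (h : MLin Φ) (y : O.M c) : MLin fun L => Φ (y :: L) := fun Z Z' => h (y :: Z) Z'

lemma append (h : MLin Φ) (Y Y' : List (O.M c)) : MLin fun L => Φ (Y ++ L ++ Y') :=
  fun Z Z' => by
    obtain ⟨l, hl⟩ := h (Y ++ Z) (Z' ++ Y')
    exact ⟨l, fun y => by rw [← hl]; simp⟩

lemma comp {d : Color} (h : MLin Φ) {f : List (O.M d) → O.M c} (hf : MLin f)
    (Y Y' : List (O.M c)) : MLin fun L => Φ (Y ++ f L :: Y') := fun Z Z' => by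
  obtain ⟨l, hl⟩ := h Y Y'
  obtain ⟨m, hm⟩ := hf Z Z'
  exact ⟨l.comp m, fun y => by simp [hl, hm]⟩

lemma leib_add (h : MLin Φ) (D D' : O.M c → O.M c) (Y : List (O.M c)) :
    leib (fun y => D y + D' y) Y Φ = leib D Y Φ + leib D' Y Φ := by
  induction Y generalizing Φ with
  | nil => simp [leib]
  | cons y Y ih =>
    simp only [leib, ih (h.cons y)]
    rw [show Φ ((D y + D' y) :: Y) = _ from h.add [] Y _ _]
    exact add_add_add_comm _ _ _ _

lemma leib_sub (h : MLin Φ) (D D' : O.M c → O.M c) (Y : List (O.M c)) :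
    leib (fun y => D y - D' y) Y Φ = leib D Y Φ - leib D' Y Φ := by
  induction Y generalizing Φ with
  | nil => simp [leib]
  | cons y Y ih =>
    simp only [leib, ih (h.cons y)]
    rw [show Φ ((D y - D' y) :: Y) = _ from h.sub [] Y _ _]
    exact sub_add_sub_comm _ _ _ _

end MLin

end PlainOp
end SwissCheese

namespace SwissCheese

open Color

namespace PlainOp

universe u v

variable {k : Type u} [CommRing k] {O : PlainOp.{u, v} k} {x : Color}

/-! ## Derivations and twisted differentials -/

/-- A derivation of the partial compositions. -/
structure Deriv (O : PlainOp.{u, v} k) where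
  map : ∀ {I : List Color} {x : Color}, O.obj I x →ₗ[k] O.obj I x
  leibniz : ∀ (a c : List Color) {I J K : List Color} {t s : Color} (hI : I = a ++ t :: c)
    (hK : K = a ++ J ++ c) (p : O.obj I s) (q : O.obj J t),
    map (O.comp a c hI hK p q) = O.comp a c hI hK (map p) q + O.comp a c hI hK p (map q)

namespace Deriv

variable (D : Deriv O)

/-- The derivation on families. -/
def fam : O.M x →ₗ[k] O.M x := LinearMap.pi fun I => D.map.comp (LinearMap.proj I)

lemma fam_apply (a : O.M x) (I : List Color) : D.fam a I = D.map (a I) := rfl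

lemma fam_cmp (a : List Color) (t : Color) (c J : List Color) (p : O.M x) (q : O.M t) :
    D.fam (cmp a t c J p q) = cmp a t c J (D.fam p) q + cmp a t c J p (D.fam q) := by
  funext K
  simp only [fam_apply, cmp_apply, Pi.add_apply]
  split_ifs
  · exact D.leibniz _ _ _ _ _ _
  · simp

/-- The derivation on items. -/
def item (z : O.Item) : O.Item := ⟨z.1, D.fam z.2⟩

lemma fam_insAll (Z : List O.Item) (φ : List Color → O.M x) (u v K : List Color) :
    D.fam (insAll Z φ u v K) = insAll Z (fun J => D.fam (φ J)) u v K +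
      leib D.item Z fun L => insAll L φ u v K := by
  induction Z generalizing φ u K with
  | nil => simp [insAll, leib]
  | cons z Z ih =>
    simp only [insAll, leib, map_splitSum, fam_cmp, ih, map_add, LinearMap.add_apply, item,
      splitSum_add]
    have h : ∀ (p s B : List Color), cmp (u ++ p) z.1 (s ++ v) B (leib D.item Z fun L =>
        insAll L (fun J => φ (p ++ z.1 :: J)) (u ++ p ++ [z.1]) v s) z.2 =
        leib D.item Z fun L => cmp (u ++ p) z.1 (s ++ v) B
          (insAll L (fun J => φ (p ++ z.1 :: J)) (u ++ p ++ [z.1]) v s) z.2 := fun p s B =>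
      map_leib ((cmp (O := O) (u ++ p) z.1 (s ++ v) B).flip z.2) _ _ _
    simp only [h, leib_splitSum]
    abel

lemma fam_brace (a : O.M x) (Z : List O.Item) :
    D.fam (brace a Z) = brace (D.fam a) Z + leib D.item Z fun L => brace a L := by
  funext K
  have h1 : D.fam (brace a Z) K = D.fam (insAll Z (fun _ => a) [] [] K) K := rfl
  have h2 := map_leib (Pi.evalAddMonoidHom (fun I => O.obj I x) K) D.item Z fun L => brace a L
  have h3 := map_leib (Pi.evalAddMonoidHom (fun I => O.obj I x) K) D.item Z
    fun L => insAll L (fun _ => a) [] [] K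
  simp only [Pi.evalAddMonoidHom_apply] at h2 h3
  rw [h1, fam_insAll, Pi.add_apply, Pi.add_apply, h2, h3]
  rfl

lemma fam_cbrace (a : O.M x) (Y : List (O.M cl)) :
    D.fam (cbrace a Y) = cbrace (D.fam a) Y + leib D.fam Y fun L => cbrace a L := by
  rw [cbrace, fam_brace, cls, leib_map D.item D.fam (fun y => ⟨cl, y⟩) (fun y => rfl)]

lemma fam_mul (a b : O.M op) : D.fam (mul a b) = mul (D.fam a) b + mul a (D.fam b) := by
  rw [mul, fam_brace]
  simp [leib, item]

/-- The closed differential twisted by `e`. -/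
noncomputable def dcl (e : O.M cl) (a : O.M cl) : O.M cl :=
  D.fam a + cbrace e [a] - cbrace a [e]

/-- The open differential twisted by `e` and `f`. -/
noncomputable def dop (e : O.M cl) (f : O.M op) (a : O.M op) : O.M op :=
  D.fam a + mul f a - cbrace a [e] - mul a f

end Deriv

lemma cbrace_add (a b : O.M x) (Y : List (O.M cl)) : cbrace (a + b) Y = cbrace a Y + cbrace b Y := by
  obtain ⟨l, hl⟩ := brace_linear_left (k := k) (x := x) (cls Y)
  simp only [cbrace, hl, map_add]

lemma cbrace_sub (a b : O.M x) (Y : List (O.M cl)) : cbrace (a - b) Y = cbrace a Y - cbrace b Y := by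
  obtain ⟨l, hl⟩ := brace_linear_left (k := k) (x := x) (cls Y)
  simp only [cbrace, hl, map_sub]

lemma cbrace_neg (a : O.M x) (Y : List (O.M cl)) : cbrace (-a) Y = - cbrace a Y := by
  obtain ⟨l, hl⟩ := brace_linear_left (k := k) (x := x) (cls Y)
  simp only [cbrace, hl, map_neg]

lemma mul_add_left (a b c : O.M op) : mul (a + b) c = mul a c + mul b c := by
  obtain ⟨l, hl⟩ := brace_linear_left (k := k) (x := op) [(⟨op, c⟩ : O.Item)]
  simp only [mul, hl, map_add]

lemma mul_sub_left (a b c : O.M op) : mul (a - b) c = mul a c - mul b c := by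
  obtain ⟨l, hl⟩ := brace_linear_left (k := k) (x := op) [(⟨op, c⟩ : O.Item)]
  simp only [mul, hl, map_sub]

lemma mul_add_right (a b c : O.M op) : mul a (b + c) = mul a b + mul a c := by
  obtain ⟨l, hl⟩ := mul_linear_right a
  simp only [hl, map_add]

lemma mul_sub_right (a b c : O.M op) : mul a (b - c) = mul a b - mul a c := by
  obtain ⟨l, hl⟩ := mul_linear_right a
  simp only [hl, map_sub]

/-- The part of the boundary that `e` inserted among the arguments produces. -/
lemma cbrace_insert (e : O.M cl) (a : O.M x) (Y : List (O.M cl)) :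
    cbrace (cbrace a [e]) Y - cbrace (cbrace a Y) [e] =
      leib (fun y => cbrace e [y]) Y (fun L => cbrace a L) -
        leib (fun y => cbrace y [e]) Y (fun L => cbrace a L) +
        splitSum₃ Y fun A B C => if 2 ≤ B.length then cbrace a (A ++ cbrace e B :: C) else 0 := by
  -- Among the terms `a{A, e{B}, C}` of the first composite, those with `B` empty cancel the terms
  -- of the second one in which `e` stands between the arguments. Those with one element in `B` form
  -- the Leibniz sum of `e{y}`.
  rw [cbrace_cbrace_singleton, cbrace_singleton_cbrace,
    splitSum₃_mid Y (fun y => cbrace e [y]) _ (fun L => cbrace a L) fun p y r => rfl]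
  simp only [cbrace_nil]
  abel

/-- Boundary of a brace with a closed root. -/
lemma dcl_cbrace (D : Deriv O) (e a : O.M cl) (Y : List (O.M cl)) :
    D.dcl e (cbrace a Y) = cbrace (D.dcl e a) Y + leib (D.dcl e) Y (fun L => cbrace a L) -
      (splitSum₃ Y fun A B C => if 1 ≤ A.length + C.length then
        cbrace e (A ++ cbrace a B :: C) else 0) +
      splitSum₃ Y fun A B C => if 2 ≤ B.length then cbrace a (A ++ cbrace e B :: C) else 0 := by
  have h1 := cbrace_insert e a Y
  have h2 := cbrace_cbrace_singleton e a Y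
  -- The term with `A` and `C` empty is `e{a{Y}}`, which belongs to the twisted differential of
  -- `a{Y}`. The others are the blow-ups with a new root below `a`.
  rw [splitSum₃_outer] at h2
  have h3 : leib (D.dcl e) Y (fun L => cbrace a L) = leib D.fam Y (fun L => cbrace a L) +
      leib (fun y => cbrace e [y]) Y (fun L => cbrace a L) -
        leib (fun y => cbrace y [e]) Y (fun L => cbrace a L) := by
    rw [← (cbrace_mlin a).leib_add, ← (cbrace_mlin a).leib_sub]
    rfl
  rw [h3]
  simp only [Deriv.dcl, D.fam_cbrace, cbrace_sub, cbrace_add]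
  rw [h2, sub_eq_iff_eq_add.1 h1]
  simp only [List.nil_append]
  abel

/-- Boundary of a brace with an open root. -/
lemma dop_cbrace (D : Deriv O) (e : O.M cl) {f a : O.M op} (hf : Supp f) (ha : Supp a)
    {Y : List (O.M cl)} (hY : ∀ y ∈ Y, Supp y) :
    D.dop e f (cbrace a Y) = cbrace (D.dop e f a) Y + leib (D.dcl e) Y (fun L => cbrace a L) +
      (splitSum₃ Y fun A B C => if 2 ≤ B.length then cbrace a (A ++ cbrace e B :: C) else 0) +
      (splitSum Y fun A B => if 1 ≤ B.length then mul (cbrace a A) (cbrace f B) else 0) -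
      splitSum Y fun A B => if 1 ≤ A.length then mul (cbrace f A) (cbrace a B) else 0 := by
  have h1 := cbrace_insert e a Y
  have h2 : cbrace (mul f a) Y = mul f (cbrace a Y) +
      splitSum Y fun A B => if 1 ≤ A.length then mul (cbrace f A) (cbrace a B) else 0 := by
    -- The term with `A` empty is `f · a{Y}`, part of the twisted differential on the left-hand
    -- side; the others are the words with a new neutral root on the left.
    rw [cbrace_mul hf a hY, splitSum_if Y (fun A _ => 1 ≤ A.length), add_comm,
      splitSum_eq_first]
    · simp
    · intro p q hp; exact if_pos (List.length_pos_iff.2 hp)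
  have h4 : cbrace (mul a f) Y = mul (cbrace a Y) f +
      splitSum Y fun A B => if 1 ≤ B.length then mul (cbrace a A) (cbrace f B) else 0 := by
    rw [cbrace_mul ha f hY, splitSum_if Y (fun _ B => 1 ≤ B.length), add_comm,
      splitSum_eq_last]
    · simp
    · intro p q hp; exact if_pos (List.length_pos_iff.2 hp)
  have h3 : leib (D.dcl e) Y (fun L => cbrace a L) = leib D.fam Y (fun L => cbrace a L) +
      leib (fun y => cbrace e [y]) Y (fun L => cbrace a L) -
        leib (fun y => cbrace y [e]) Y (fun L => cbrace a L) := by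
    rw [← (cbrace_mlin a).leib_add, ← (cbrace_mlin a).leib_sub]
    rfl
  rw [h3]
  simp only [Deriv.dop, D.fam_cbrace, cbrace_sub, cbrace_add]
  rw [h2, h4, sub_eq_iff_eq_add.1 h1]
  abel

/-- Boundary of a product. -/
lemma dop_mul (D : Deriv O) (e : O.M cl) {f a b : O.M op} (hf : Supp f) (ha : Supp a)
    (he : Supp e) : D.dop e f (mul a b) = mul (D.dop e f a) b + mul a (D.dop e f b) := by
  have h1 : cbrace (mul a b) [e] = mul a (cbrace b [e]) + mul (cbrace a [e]) b := by
    rw [cbrace_mul ha b (by simpa using he)]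
    simp [splitSum]
  simp only [Deriv.dop, D.fam_mul, mul_add_left, mul_sub_left, mul_add_right, mul_sub_right, h1]
  rw [mul_assoc hf, mul_assoc ha, mul_assoc ha]
  abel

/-- Boundary of a brace whose closed root `g` is a copy of the twisting element `e`. -/
lemma dcl_cbrace_neutral (D : Deriv O) (e g : O.M cl) {Y : List (O.M cl)} (h2 : 2 ≤ Y.length)
    (hg : D.fam g = - cbrace e [g])
    (has : ∀ A B C, A ++ B ++ C = Y →
      cbrace g (A ++ cbrace e B :: C) = - cbrace e (A ++ cbrace g B :: C)) :
    D.dcl e (cbrace g Y) = leib (D.dcl e) Y (fun L => cbrace g L) -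
      splitSum₃ Y fun A B C => if 2 ≤ B.length ∧ 1 ≤ A.length + C.length then
        cbrace e (A ++ cbrace g B :: C) else 0 := by
  -- Here `D g` cancels `e{g}`. The remaining `-g{e}` is turned into terms with root `e` by the
  -- exchange `has`.
  have h3 : cbrace (D.dcl e g) Y = splitSum₃ Y fun A B C => cbrace e (A ++ cbrace g B :: C) := by
    rw [Deriv.dcl, hg, neg_add_cancel, zero_sub, cbrace_neg, cbrace_cbrace_singleton,
      ← splitSum₃_neg]
    exact splitSum₃_congr fun A B C h => by rw [has A B C h, neg_neg]
  -- Inclusion–exclusion: the term `e{A, g{B}, C}` has the coefficient `(1 - [A or C nonempty]) (1 -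
  -- [|B| ≥ 2])`. This is zero, because `B = Y` has at least two elements when `A` and `C` are
  -- empty.
  have h7 : (splitSum₃ Y fun A B C => cbrace e (A ++ cbrace g B :: C)) -
      (splitSum₃ Y fun A B C => if 1 ≤ A.length + C.length then
        cbrace e (A ++ cbrace g B :: C) else 0) +
      (splitSum₃ Y fun A B C => if 2 ≤ B.length then cbrace g (A ++ cbrace e B :: C) else 0) +
      (splitSum₃ Y fun A B C => if 2 ≤ B.length ∧ 1 ≤ A.length + C.length then
        cbrace e (A ++ cbrace g B :: C) else 0) = 0 := by
    simp only [sub_eq_add_neg, ← splitSum₃_neg, ← splitSum₃_add]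
    refine splitSum₃_eq_zero fun A B C h => ?_
    rw [has A B C h]
    have hl : A.length + B.length + C.length = Y.length := by simp [← h]; omega
    by_cases p : 2 ≤ B.length <;> by_cases q : 1 ≤ A.length + C.length <;>
      simp only [p, q, if_true, if_false, and_true, and_false] <;> first | omega | abel
  rw [dcl_cbrace, h3, ← sub_eq_zero]
  refine Eq.trans ?_ h7
  abel

/-- Boundary of a brace whose open root `g` is a copy of the twisting element `f`. -/
lemma dop_cbrace_neutral (D : Deriv O) (e g' : O.M cl) {f g : O.M op} (hf : Supp f) (hg : Supp g)
    {Y : List (O.M cl)} (hY : ∀ y ∈ Y, Supp y) (h1 : 1 ≤ Y.length)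
    (hd : D.fam g = - cbrace f [g'] - mul f g)
    (has : ∀ A B C, A ++ B ++ C = Y →
      cbrace g (A ++ cbrace e B :: C) = - cbrace f (A ++ cbrace g' B :: C))
    (has' : ∀ A B, A ++ B = Y → mul (cbrace g A) (cbrace f B) = - mul (cbrace f A) (cbrace g B)) :
    D.dop e f (cbrace g Y) = leib (D.dcl e) Y (fun L => cbrace g L) -
      (splitSum₃ Y fun A B C => if 2 ≤ B.length then
        cbrace f (A ++ cbrace g' B :: C) else 0) -
      splitSum Y fun A B => if 1 ≤ A.length ∧ 1 ≤ B.length then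
        mul (cbrace f A) (cbrace g B) else 0 := by
  -- After the exchange of the two copies, the terms from `f{g'}` and `g{e}` cancel. Only `-g · f`
  -- contributes, and its sign disappears by `has'`.
  have h3 : cbrace (D.dop e f g) Y = splitSum Y fun A B => mul (cbrace f A) (cbrace g B) := by
    have h4 : cbrace (cbrace g [e]) Y = - cbrace (cbrace f [g']) Y := by
      rw [cbrace_cbrace_singleton, cbrace_cbrace_singleton, ← splitSum₃_neg]
      exact splitSum₃_congr has
    have h5 : cbrace (mul g f) Y = - splitSum Y fun A B => mul (cbrace f A) (cbrace g B) := by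
      rw [cbrace_mul hg f hY, ← splitSum_neg]
      exact splitSum_congr has'
    rw [Deriv.dop, hd, sub_add_cancel, cbrace_sub, cbrace_sub, cbrace_neg, h4, h5]
    abel
  have h6 : (splitSum₃ Y fun A B C => if 2 ≤ B.length then cbrace g (A ++ cbrace e B :: C) else 0) =
      - splitSum₃ Y fun A B C => if 2 ≤ B.length then cbrace f (A ++ cbrace g' B :: C) else 0 := by
    rw [← splitSum₃_neg]
    refine splitSum₃_congr fun A B C h => ?_
    split_ifs
    · exact has A B C h
    · simp
  -- The coefficient of `f{A} · g{B}` is `(1 - [A nonempty]) (1 - [B nonempty])`, which is zero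
  -- since `Y` is nonempty.
  have h7 : (splitSum Y fun A B => mul (cbrace f A) (cbrace g B)) +
      (splitSum Y fun A B => if 1 ≤ B.length then mul (cbrace g A) (cbrace f B) else 0) -
      (splitSum Y fun A B => if 1 ≤ A.length then mul (cbrace f A) (cbrace g B) else 0) +
      (splitSum Y fun A B => if 1 ≤ A.length ∧ 1 ≤ B.length then
        mul (cbrace f A) (cbrace g B) else 0) = 0 := by
    simp only [sub_eq_add_neg, ← splitSum_neg, ← splitSum_add]
    refine splitSum_eq_zero fun A B h => ?_
    rw [has' A B h]
    have hl : A.length + B.length = Y.length := by simp [← h]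
    by_cases p : 1 ≤ A.length <;> by_cases q : 1 ≤ B.length <;>
      simp only [p, q, if_true, if_false, and_true, and_false] <;> first | omega | abel
  rw [dop_cbrace D e hf hg hY, h3, h6, ← sub_eq_zero]
  refine Eq.trans ?_ h7
  abel

end PlainOp
end SwissCheese

namespace SwissCheese

open Color

/-! ### Sums over lists. -/

section ListSum

variable {α β A : Type*} [AddCommMonoid A]

/-- The sum of the values of `f` on a list. -/
def lsum (xs : List α) (f : α → A) : A := (xs.map f).sum

@[simp] lemma lsum_nil (f : α → A) : lsum [] f = 0 := rfl

@[simp] lemma lsum_cons (x : α) (xs : List α) (f : α → A) : lsum (x :: xs) f = f x + lsum xs f := by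
  simp [lsum]

lemma lsum_append (xs ys : List α) (f : α → A) : lsum (xs ++ ys) f = lsum xs f + lsum ys f := by
  simp [lsum]

lemma lsum_map (g : α → β) (xs : List α) (f : β → A) :
    lsum (xs.map g) f = lsum xs fun x => f (g x) := by
  simp [lsum, Function.comp_def]

lemma lsum_flatMap (g : α → List β) (xs : List α) (f : β → A) :
    lsum (xs.flatMap g) f = lsum xs fun x => lsum (g x) f := by
  induction xs with
  | nil => rfl
  | cons x xs ih => simp only [List.flatMap_cons, lsum_append, ih, lsum_cons]

lemma lsum_congr {xs : List α} {f g : α → A} (h : ∀ x ∈ xs, f x = g x) : lsum xs f = lsum xs g := by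
  induction xs with
  | nil => rfl
  | cons x xs ih =>
    rw [lsum_cons, lsum_cons, h x (by simp), ih fun y hy => h y (by simp [hy])]

lemma lsum_zero (xs : List α) : lsum xs (fun _ => (0 : A)) = 0 := by
  induction xs with
  | nil => rfl
  | cons x xs ih => rw [lsum_cons, ih, add_zero]

lemma lsum_add (xs : List α) (f g : α → A) :
    lsum xs (fun x => f x + g x) = lsum xs f + lsum xs g := by
  induction xs with
  | nil => simp
  | cons x xs ih => simp only [lsum_cons, ih]; exact add_add_add_comm _ _ _ _

lemma lsum_comm (xs : List α) (ys : List β) (f : α → β → A) :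
    lsum xs (fun x => lsum ys (f x)) = lsum ys fun y => lsum xs fun x => f x y := by
  induction xs with
  | nil => simp [lsum_zero]
  | cons x xs ih => simp only [lsum_cons, ih, lsum_add]

lemma map_lsum {B F : Type*} [AddCommMonoid B] [FunLike F A B] [AddMonoidHomClass F A B] (g : F)
    (xs : List α) (f : α → A) : g (lsum xs f) = lsum xs fun x => g (f x) := by
  induction xs with
  | nil => simp
  | cons x xs ih => simp only [lsum_cons, map_add, ih]

lemma lsum_ite (p : Prop) [Decidable p] (x : α) (f : α → A) :
    lsum (if p then [x] else []) f = if p then f x else 0 := by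
  split_ifs <;> simp

end ListSum

/-! ### Cuts, roots and labels of forests. -/

namespace Forest

open Vtx

lemma len_app (F G : Forest) : (F.app G).len = F.len + G.len := by
  induction F with
  | nil => simp [app, len]
  | cons v ch r _ ih => simp only [app, len, ih]; omega

lemma names_app (F G : Forest) : (F.app G).names = F.names ++ G.names := by
  induction F with
  | nil => rfl
  | cons v ch r _ ih => cases v <;> simp [app, names, ih]

/-- The map `t` evaluates a forest tree by tree, so cutting the forest means cutting the list of its
values. It will be `evR`. -/
lemma lsum_splits {α A : Type*} [AddCommMonoid A] (t : Forest → List α) (h : t nil = [])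
    (g : Vtx → Forest → α) (h' : ∀ v ch r, t (cons v ch r) = g v ch :: t r) (F : Forest)
    (f : List α → List α → A) :
    lsum F.splits (fun p => f (t p.1) (t p.2)) = splitSum (t F) f := by
  induction F generalizing f with
  | nil => simp [splits, h, splitSum]
  | cons v ch r _ ih =>
    simp only [splits, lsum_cons, lsum_map, h, h', splitSum]
    rw [ih fun p q => f (g v ch :: p) q]

lemma lsum_splits₃ {α A : Type*} [AddCommMonoid A] (t : Forest → List α) (h : t nil = [])
    (g : Vtx → Forest → α) (h' : ∀ v ch r, t (cons v ch r) = g v ch :: t r) (F : Forest)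
    (f : List α → List α → List α → A) :
    lsum F.splits3 (fun p => f (t p.1) (t p.2.1) (t p.2.2)) = splitSum₃ (t F) f := by
  simp only [splits3, lsum_flatMap, lsum_map, splitSum₃]
  rw [← lsum_splits t h g h']
  exact lsum_congr fun p _ => lsum_splits t h g h' p.2 fun q s => f (t p.1) q s

lemma lsum_splits_eq_last {A : Type*} [AddCommMonoid A] (F : Forest) (f : Forest × Forest → A)
    (h : ∀ p v ch r, f (p, cons v ch r) = 0) : lsum F.splits f = f (F, nil) := by
  induction F generalizing f with
  | nil => simp [splits]
  | cons v ch r _ ih =>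
    rw [splits, lsum_cons, h, lsum_map, ih (fun p => f (cons v ch p.1, p.2)) 
      (fun p => h (cons v ch p)), zero_add]

/-- Labels of the roots. -/
def rootLabels : Forest → List ℕ
  | nil => []
  | cons (lab i) _ r => i :: r.rootLabels
  | cons (neu _) _ r => r.rootLabels

/-- Labels of the vertices other than the roots. -/
def innerLabels : Forest → List ℕ
  | nil => []
  | cons _ ch r => ch.labels ++ r.innerLabels

lemma mem_labels_iff (F : Forest) (i : ℕ) :
    i ∈ F.labels ↔ i ∈ F.rootLabels ∨ i ∈ F.innerLabels := by
  induction F with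
  | nil => simp [labels, rootLabels, innerLabels]
  | cons v ch r _ ih => cases v <;> simp [labels, rootLabels, innerLabels, ih] <;> tauto

lemma subst_eq_nil (F : Forest) (i : ℕ) (X : Forest) (h : i ∉ F.labels) : F.subst i X = [] := by
  induction F with
  | nil => rfl
  | cons v ch r ih₁ ih₂ =>
    cases v with
    | lab j =>
      simp only [labels, List.mem_cons, List.mem_append, not_or] at h
      rw [subst, if_neg (by simpa using Ne.symm h.1), ih₁ h.2.1, ih₂ h.2.2]; rfl
    | neu e =>
      simp only [labels, List.mem_append, not_or] at h
      rw [subst, if_neg (by simp), ih₁ h.1, ih₂ h.2]; rfl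

end Forest

namespace PlainOp

universe u v

variable {k : Type u} [CommRing k] {O : PlainOp.{u, v} k} {x : Color}

open Vtx Forest

/-! ## Evaluation of forests -/

/-- Values of the vertices, for both shapes. -/
abbrev Env (O : PlainOp.{u, v} k) := ∀ c : Color, Vtx → O.M c

/-- Values of the trees of a forest of round-shaped vertices. -/
noncomputable def evR (ρ : Env O) : Forest → List (O.M cl)
  | .nil => []
  | .cons v ch r => cbrace (ρ cl v) (evR ρ ch) :: evR ρ r

/-- Values of the trees of a word with square-shaped roots. -/
noncomputable def evL (ρ : Env O) : Forest → List (O.M op)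
  | .nil => []
  | .cons v ch r => cbrace (ρ op v) (evR ρ ch) :: evL ρ r

/-- The product of a list of open families (zero for the empty list). -/
noncomputable def oprod : List (O.M op) → O.M op
  | [] => 0
  | [a] => a
  | a :: b :: L => mul a (oprod (b :: L))

/-- The entry of a list of length one (zero for the other lists). -/
def only : List (O.M cl) → O.M cl
  | [a] => a
  | _ => 0

/-- Value of a word of either type. -/
noncomputable def ev (ρ : Env O) : ∀ c : Color, Forest → O.M c
  | cl, F => only (evR ρ F)
  | op, F => oprod (evL ρ F)

/-- Change of the value of one vertex for one shape. -/
def Env.set (ρ : Env O) (c : Color) (v : Vtx) (y : O.M c) : Env O :=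
  Function.update ρ c (Function.update (ρ c) v y)

lemma Env.set_self (ρ : Env O) (c : Color) (v : Vtx) (y : O.M c) : ρ.set c v y c v = y := by
  simp [Env.set]

lemma Env.set_ne (ρ : Env O) (c : Color) (v : Vtx) (y : O.M c) (d : Color) (w : Vtx) (h : w ≠ v) :
    ρ.set c v y d w = ρ d w := by
  by_cases hd : d = c
  · subst hd; simp [Env.set, h]
  · simp [Env.set, hd]

lemma evR_app (ρ : Env O) (F G : Forest) : evR ρ (F.app G) = evR ρ F ++ evR ρ G := by
  induction F with
  | nil => rfl
  | cons v ch r _ ih => simp only [app, evR, ih, List.cons_append]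

lemma evL_app (ρ : Env O) (F G : Forest) : evL ρ (F.app G) = evL ρ F ++ evL ρ G := by
  induction F with
  | nil => rfl
  | cons v ch r _ ih => simp only [app, evL, ih, List.cons_append]

lemma evR_length (ρ : Env O) (F : Forest) : (evR ρ F).length = F.len := by
  induction F with
  | nil => rfl
  | cons v ch r _ ih => simp [evR, len, ih]

lemma evR_congr {ρ ρ' : Env O} (F : Forest) (h : ∀ i ∈ F.labels, ρ cl (lab i) = ρ' cl (lab i))
    (h' : ∀ e ∈ F.names, ρ cl (neu e) = ρ' cl (neu e)) : evR ρ F = evR ρ' F := by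
  induction F with
  | nil => rfl
  | cons v ch r ih₁ ih₂ =>
    cases v with
    | lab i =>
      simp only [labels, names, List.mem_cons, List.mem_append] at h h'
      rw [evR, evR, ih₁ (fun i hi => h i (by simp [hi])) (fun i hi => h' i (by simp [hi])),
        ih₂ (fun i hi => h i (by simp [hi])) (fun i hi => h' i (by simp [hi])), h i (by simp)]
    | neu e =>
      simp only [labels, names, List.mem_cons, List.mem_append] at h h'
      rw [evR, evR, ih₁ (fun i hi => h i (by simp [hi])) (fun i hi => h' i (by simp [hi])),
        ih₂ (fun i hi => h i (by simp [hi])) (fun i hi => h' i (by simp [hi])), h' e (by simp)]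

lemma evL_congr {ρ ρ' : Env O} (F : Forest)
    (h : ∀ i ∈ F.rootLabels, ρ op (lab i) = ρ' op (lab i))
    (h₂ : ∀ i ∈ F.innerLabels, ρ cl (lab i) = ρ' cl (lab i))
    (h' : ∀ c, ∀ e ∈ F.names, ρ c (neu e) = ρ' c (neu e)) : evL ρ F = evL ρ' F := by
  induction F with
  | nil => rfl
  | cons v ch r _ ih =>
    cases v with
    | lab i =>
      simp only [rootLabels, innerLabels, names, List.mem_cons, List.mem_append] at h h₂ h'
      rw [evL, evL, evR_congr ch (fun i hi => h₂ i (by simp [hi])) (fun i hi => h' cl i (by simp [hi])),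
        ih (fun i hi => h i (by simp [hi])) (fun i hi => h₂ i (by simp [hi]))
        (fun c i hi => h' c i (by simp [hi])), h i (by simp)]
    | neu e =>
      simp only [rootLabels, innerLabels, names, List.mem_cons, List.mem_append] at h h₂ h'
      rw [evL, evL, evR_congr ch (fun i hi => h₂ i (by simp [hi])) (fun i hi => h' cl i (by simp [hi])),
        ih (fun i hi => h i (by simp [hi])) (fun i hi => h₂ i (by simp [hi]))
        (fun c i hi => h' c i (by simp [hi])), h' op e (by simp)]

lemma evR_set_of_not_mem (ρ : Env O) (c : Color) (i : ℕ) (y : O.M c) (F : Forest)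
    (h : i ∉ F.labels) : evR (ρ.set c (lab i) y) F = evR ρ F :=
  evR_congr F (fun j hj => ρ.set_ne _ _ _ _ _ (by rintro ⟨⟩; exact h hj))
    fun e _ => ρ.set_ne _ _ _ _ _ (by simp)

lemma evL_set_of_not_mem (ρ : Env O) (c : Color) (i : ℕ) (y : O.M c) (F : Forest)
    (h : i ∉ F.labels) : evL (ρ.set c (lab i) y) F = evL ρ F := by
  rw [mem_labels_iff, not_or] at h
  exact evL_congr F (fun j hj => ρ.set_ne _ _ _ _ _ (by rintro ⟨⟩; exact h.1 hj))
    (fun j hj => ρ.set_ne _ _ _ _ _ (by rintro ⟨⟩; exact h.2 hj))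
    fun c e _ => ρ.set_ne _ _ _ _ _ (by simp)

lemma only_mlin : MLin (only : List (O.M cl) → O.M cl) := by
  intro Z Z'
  rcases Z with _ | ⟨z, Z⟩
  · rcases Z' with _ | ⟨z, Z'⟩
    · exact ⟨LinearMap.id, fun y => rfl⟩
    · exact ⟨0, fun y => rfl⟩
  · exact ⟨0, fun y => by cases Z <;> rfl⟩

lemma oprod_cons (a : O.M op) {L : List (O.M op)} (h : L ≠ []) :
    oprod (a :: L) = mul a (oprod L) := by
  cases L with
  | nil => exact absurd rfl h
  | cons b L => rfl

lemma oprod_mlin : MLin (oprod : List (O.M op) → O.M op) := by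
  intro Z Z'
  induction Z with
  | nil =>
    rcases Z' with _ | ⟨z, Z'⟩
    · exact ⟨LinearMap.id, fun y => rfl⟩
    · exact brace_linear_left _
  | cons z Z ih =>
    obtain ⟨l, hl⟩ := ih
    obtain ⟨m, hm⟩ := mul_linear_right z
    refine ⟨m.comp l, fun y => ?_⟩
    rw [List.cons_append, oprod_cons _ (by simp), hl, hm]
    rfl

/-- Functions of a list of open families that depend on the products of neighbours only. -/
def IsMul {A : Type*} (Ψ : List (O.M op) → A) : Prop :=
  ∀ L a b L', Supp a → Ψ (L ++ mul a b :: L') = Ψ (L ++ a :: b :: L')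

lemma oprod_isMul : IsMul (oprod : List (O.M op) → O.M op) := by
  intro L a b L' ha
  induction L with
  | nil =>
    rcases L' with _ | ⟨z, L'⟩
    · rfl
    · exact mul_assoc ha b _
  | cons z L ih =>
    rw [List.cons_append, oprod_cons _ (by simp), ih, List.cons_append, oprod_cons _ (by simp)]

lemma IsMul.append {A : Type*} {Ψ : List (O.M op) → A} (h : IsMul Ψ) (Y Y' : List (O.M op)) :
    IsMul fun L => Ψ (Y ++ L ++ Y') := fun L a b L' ha => by
  simpa using h (Y ++ L) a b (L' ++ Y') ha

variable {A : Type*} [AddCommGroup A] [Module k A]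

lemma MLin.splitSum {c : Color} {Φ : List (O.M c) → A} (h : MLin Φ) {α : Type*} (Z Z' : List (O.M c))
    (K : List α) (f : List α → List α → O.M c) :
    Φ (Z ++ SwissCheese.splitSum K f :: Z') =
      SwissCheese.splitSum K fun p q => Φ (Z ++ f p q :: Z') := by
  obtain ⟨l, hl⟩ := h Z Z'
  simp only [hl, map_splitSum]

lemma cplug_map {A B F : Type*} [AddCommMonoid A] [AddCommMonoid B] [FunLike F A B]
    [AddMonoidHomClass F A B] (g : F) (Y Z : List (O.M cl)) (Φ : List (O.M cl) → A) :
    g (cplug Y Z Φ) = cplug Y Z fun L => g (Φ L) := by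
  induction Y generalizing Z Φ with
  | nil => rfl
  | cons y Y ih => simp only [cplug, splitSum₃, map_splitSum, ih]

lemma lsum_splits_evR (ρ : Env O) {A : Type*} [AddCommMonoid A] (F : Forest)
    (f : List (O.M cl) → List (O.M cl) → A) :
    lsum F.splits (fun p => f (evR ρ p.1) (evR ρ p.2)) = splitSum (evR ρ F) f :=
  lsum_splits (evR ρ) rfl _ (fun _ _ _ => rfl) F f

lemma lsum_splits₃_evR (ρ : Env O) {A : Type*} [AddCommMonoid A] (F : Forest)
    (f : List (O.M cl) → List (O.M cl) → List (O.M cl) → A) :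
    lsum F.splits3 (fun p => f (evR ρ p.1) (evR ρ p.2.1) (evR ρ p.2.2)) = splitSum₃ (evR ρ F) f :=
  lsum_splits₃ (evR ρ) rfl _ (fun _ _ _ => rfl) F f

/-- Evaluation of the plugged forests. -/
lemma lsum_plug (ρ : Env O) (F S : Forest) {Φ : List (O.M cl) → A} (h : MLin Φ) :
    lsum (F.plug S) (fun T => Φ (evR ρ T)) = cplug (evR ρ F) (evR ρ S) Φ := by
  induction F generalizing S Φ with
  | nil => simp [plug, evR, cplug]
  | cons v ch r ih₁ ih₂ =>
    simp only [plug, lsum_flatMap, lsum_map, evR, cplug, evR_app]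
    rw [← lsum_splits₃_evR]
    refine lsum_congr fun s _ => ?_
    rw [lsum_comm]
    -- The trees `s.2.1` attached above `v` contribute a sum over `cplug` by induction, and by
    -- `cbrace_cbrace` this is the brace of the value of the whole tree with these arguments.
    have h1 : ∀ L, lsum (ch.plug s.2.1) (fun ch' => Φ (evR ρ s.1 ++ cbrace (ρ cl v) (evR ρ ch') :: L))
        = Φ (evR ρ s.1 ++ cbrace (cbrace (ρ cl v) (evR ρ ch)) (evR ρ s.2.1) :: L) := by
      intro L
      rw [ih₁ s.2.1 (h.comp (cbrace_mlin (ρ cl v)) (evR ρ s.1) L), cbrace_cbrace]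
      obtain ⟨l, hl⟩ := h (evR ρ s.1) L
      simp only [hl, cplug_map]
    simp only [h1]
    have := ih₂ s.2.2 (h.append (evR ρ s.1 ++ [cbrace (cbrace (ρ cl v) (evR ρ ch)) (evR ρ s.2.1)]) [])
    simpa only [List.append_assoc, List.cons_append, List.nil_append, List.append_nil] using this

lemma lsum_plug_brace (ρ : Env O) {d : Color} (a : O.M d) (F S : Forest) {Φ : List (O.M d) → A}
    (h : MLin Φ) (L L' : List (O.M d)) :
    lsum (F.plug S) (fun T => Φ (L ++ cbrace a (evR ρ T) :: L')) =
      Φ (L ++ cbrace (cbrace a (evR ρ F)) (evR ρ S) :: L') := by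
  rw [lsum_plug ρ F S (h.comp (cbrace_mlin a) L L'), cbrace_cbrace]
  obtain ⟨l, hl⟩ := h L L'
  simp only [hl, cplug_map]

/-- The empty word has no angle, so all subtrees must be attached to the only tree. -/
lemma lsum_plugWord_single {A : Type*} [AddCommMonoid A] (v : Vtx) (ch S : Forest)
    (f : Forest → A) :
    lsum ((Forest.cons v ch .nil).plugWord S) f = lsum (ch.plug S) fun c => f (.cons v c .nil) := by
  simp only [plugWord, lsum_flatMap, lsum_map]
  rw [lsum_splits_eq_last]
  · simp [plugWord]
  · intro p v ch r; simp [plugWord, lsum_zero]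

lemma evR_supp {ρ : Env O} (hρ : ∀ c v, Supp (ρ c v)) (F : Forest) : ∀ y ∈ evR ρ F, Supp y := by
  induction F with
  | nil => simp [evR]
  | cons v ch r ih₁ ih₂ =>
    intro y hy
    rcases List.mem_cons.1 hy with rfl | hy
    · refine (hρ cl v).brace fun z hz => ?_
      obtain ⟨y, hy, rfl⟩ := List.mem_map.1 hz
      exact ih₁ y hy
    · exact ih₂ y hy

lemma Supp.cbrace {a : O.M x} (ha : Supp a) {Y : List (O.M cl)} (hY : ∀ y ∈ Y, Supp y) :
    Supp (cbrace a Y) := ha.brace fun z hz => by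
  obtain ⟨y, hy, rfl⟩ := List.mem_map.1 hz
  exact hY y hy

lemma evL_supp {ρ : Env O} (hρ : ∀ c v, Supp (ρ c v)) (F : Forest) : ∀ y ∈ evL ρ F, Supp y := by
  induction F with
  | nil => simp [evL]
  | cons v ch r _ ih =>
    intro y hy
    rcases List.mem_cons.1 hy with rfl | hy
    · exact (hρ op v).cbrace (evR_supp hρ ch)
    · exact ih y hy

lemma evL_ne_nil (ρ : Env O) {F : Forest} (h : F ≠ .nil) : evL ρ F ≠ [] := by
  cases F with
  | nil => exact absurd rfl h
  | cons v ch r => simp [evL]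

/-- Evaluation of the plugged words. -/
lemma lsum_plugWord (ρ : Env O) (hρ : ∀ c v, Supp (ρ c v)) (X S : Forest) (hX : X ≠ .nil)
    {Ψ : List (O.M op) → A} (h : MLin Ψ) (h' : IsMul Ψ) (L L' : List (O.M op)) :
    lsum (X.plugWord S) (fun T => Ψ (L ++ evL ρ T ++ L')) =
      Ψ (L ++ cbrace (oprod (evL ρ X)) (evR ρ S) :: L') := by
  induction X generalizing L S with
  | nil => exact absurd rfl hX
  | cons v ch r _ ih =>
    by_cases hr : r = .nil
    · subst hr
      rw [lsum_plugWord_single]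
      simpa [evL, oprod] using lsum_plug_brace ρ (ρ op v) ch S h L L'
    · have ih' := fun S L => ih S hr L
      simp only [plugWord, lsum_flatMap, lsum_map, evL]
      -- A brace of a product is a sum over the cuts of its arguments; these cuts distribute `S`
      -- between the first tree of the word and the rest.
      rw [oprod_cons _ (evL_ne_nil ρ hr), cbrace_mul ((hρ op v).cbrace (evR_supp hρ ch)) _
        (evR_supp hρ S), h.splitSum, ← lsum_splits_evR]
      refine lsum_congr fun s _ => ?_
      have h1 : ∀ ch', lsum (r.plugWord s.2) (fun r' =>
          Ψ (L ++ cbrace (ρ op v) (evR ρ ch') :: evL ρ r' ++ L')) = Ψ (L ++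
            cbrace (ρ op v) (evR ρ ch') :: (cbrace (oprod (evL ρ r)) (evR ρ s.2) :: L')) := by
        intro ch'
        have := ih' s.2 (L ++ [cbrace (ρ op v) (evR ρ ch')])
        simpa only [List.append_assoc, List.cons_append, List.nil_append] using this
      simp only [h1]
      rw [lsum_plug_brace ρ (ρ op v) ch s.1 h L, h']
      exact ((hρ op v).cbrace (evR_supp hρ ch)).cbrace (evR_supp hρ s.1)

lemma nodup_labels_cons {v : Vtx} {ch r : Forest} (h : (Forest.cons v ch r).labels.Nodup) :
    ch.labels.Nodup ∧ r.labels.Nodup ∧ (∀ i ∈ ch.labels, i ∉ r.labels) ∧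
      (∀ i ∈ ch.labels, v ≠ lab i) ∧ ∀ i ∈ r.labels, v ≠ lab i := by
  cases v with
  | lab j =>
    simp only [labels, List.nodup_cons, List.nodup_append', List.mem_append, not_or] at h
    refine ⟨h.2.1, h.2.2.1, fun i hi hi' => h.2.2.2 hi hi', ?_, ?_⟩
    · rintro i hi ⟨⟩; exact h.1.1 hi
    · rintro i hi ⟨⟩; exact h.1.2 hi
  | neu e =>
    simp only [labels, List.nodup_append'] at h
    exact ⟨h.1, h.2.1, fun i hi hi' => h.2.2 hi hi', by simp, by simp⟩

lemma mem_labels_cons {v : Vtx} {ch r : Forest} {i : ℕ} :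
    i ∈ (Forest.cons v ch r).labels ↔ v = lab i ∨ i ∈ ch.labels ∨ i ∈ r.labels := by
  cases v <;> simp [labels, eq_comm]

/-- Substitution of a tree into a forest of round-shaped vertices. -/
lemma lsum_subst_evR (ρ : Env O) (F : Forest) (i : ℕ) (w : Vtx) (X : Forest)
    (hF : F.labels.Nodup) (hi : i ∈ F.labels) {Φ : List (O.M cl) → A} (h : MLin Φ) :
    lsum (F.subst i (.cons w X .nil)) (fun T => Φ (evR ρ T)) =
      Φ (evR (ρ.set cl (lab i) (cbrace (ρ cl w) (evR ρ X))) F) := by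
  induction F generalizing Φ with
  | nil => simp [labels] at hi
  | cons v ch r ih₁ ih₂ =>
    obtain ⟨h1, h2, h3, h4, h5⟩ := nodup_labels_cons hF
    rw [mem_labels_cons] at hi
    by_cases hv : v = lab i
    · subst hv
      rw [subst, if_pos rfl, lsum_map, lsum_plugWord_single, evR, evR_set_of_not_mem _ _ _ _ ch
        (fun hc => h4 i hc rfl), evR_set_of_not_mem _ _ _ _ r (fun hc => h5 i hc rfl),
        Env.set_self]
      exact lsum_plug_brace ρ (ρ cl w) X ch h [] (evR ρ r)
    · rw [subst, if_neg hv, lsum_append, lsum_map, lsum_map, evR, Env.set_ne _ _ _ _ _ _ hv]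
      by_cases hc : i ∈ ch.labels
      · rw [subst_eq_nil r i _ (h3 i hc), lsum_nil, add_zero, evR_set_of_not_mem _ _ _ _ r (h3 i hc)]
        exact ih₁ h1 hc (h.comp (cbrace_mlin (ρ cl v)) [] (evR ρ r))
      · rw [subst_eq_nil ch i _ hc, lsum_nil, zero_add, evR_set_of_not_mem _ _ _ _ ch hc]
        exact ih₂ h2 (by tauto) (h.cons _)

/-- Substitution of a tree for a round-shaped vertex of a word. -/
lemma lsum_subst_evL_inner (ρ : Env O) (F : Forest) (i : ℕ) (w : Vtx) (X : Forest)
    (hF : F.labels.Nodup) (hi : i ∈ F.innerLabels) (hi' : i ∉ F.rootLabels)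
    {Ψ : List (O.M op) → A} (h : MLin Ψ) :
    lsum (F.subst i (.cons w X .nil)) (fun T => Ψ (evL ρ T)) =
      Ψ (evL (ρ.set cl (lab i) (cbrace (ρ cl w) (evR ρ X))) F) := by
  induction F generalizing Ψ with
  | nil => simp [innerLabels] at hi
  | cons v ch r _ ih =>
    obtain ⟨h1, h2, h3, h4, h5⟩ := nodup_labels_cons hF
    have hv : v ≠ lab i := by rintro rfl; simp [rootLabels] at hi'
    have hr : i ∉ r.rootLabels := by
      cases v <;> simp only [rootLabels, List.mem_cons, not_or] at hi' <;> tauto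
    rw [subst, if_neg hv, lsum_append, lsum_map, lsum_map, evL, Env.set_ne _ _ _ _ _ _ hv]
    simp only [innerLabels, List.mem_append] at hi
    by_cases hc : i ∈ ch.labels
    · rw [subst_eq_nil r i _ (h3 i hc), lsum_nil, add_zero, evL_set_of_not_mem _ _ _ _ r (h3 i hc)]
      exact lsum_subst_evR ρ ch i w X h1 hc (h.comp (cbrace_mlin (ρ op v)) [] (evL ρ r))
    · rw [subst_eq_nil ch i _ hc, lsum_nil, zero_add, evR_set_of_not_mem _ _ _ _ ch hc]
      exact ih h2 (by tauto) hr (h.cons _)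

/-- Substitution of a word for a square-shaped vertex. -/
lemma lsum_subst_evL_root (ρ : Env O) (hρ : ∀ c v, Supp (ρ c v)) (F : Forest) (i : ℕ) (X : Forest)
    (hX : X ≠ .nil) (hF : F.labels.Nodup) (hi : i ∈ F.rootLabels) (hi' : i ∉ F.innerLabels)
    {Ψ : List (O.M op) → A} (h : MLin Ψ) (h' : IsMul Ψ) :
    lsum (F.subst i X) (fun T => Ψ (evL ρ T)) =
      Ψ (evL (ρ.set op (lab i) (oprod (evL ρ X))) F) := by
  induction F generalizing Ψ with
  | nil => simp [rootLabels] at hi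
  | cons v ch r _ ih =>
    obtain ⟨h1, h2, h3, h4, h5⟩ := nodup_labels_cons hF
    simp only [innerLabels, List.mem_append, not_or] at hi'
    by_cases hv : v = lab i
    · subst hv
      rw [subst, if_pos rfl, lsum_map, evL, evR_set_of_not_mem _ _ _ _ ch hi'.1,
        evL_set_of_not_mem _ _ _ _ r (fun hc => h5 i hc rfl), Env.set_self]
      simpa [evL_app] using lsum_plugWord ρ hρ X ch hX h h' [] (evL ρ r)
    · have hr : i ∈ r.rootLabels := by
        cases v with
        | lab j => 
          rcases List.mem_cons.1 hi with rfl | hi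
          · exact absurd rfl hv
          · exact hi
        | neu e => exact hi
      rw [subst, if_neg hv, lsum_append, lsum_map, lsum_map, evL, Env.set_ne _ _ _ _ _ _ hv,
        subst_eq_nil ch i _ hi'.1, lsum_nil, zero_add, evR_set_of_not_mem _ _ _ _ ch hi'.1]
      exact ih h2 hr hi'.2 (h.cons _) (by simpa using h'.append [cbrace (ρ op v) (evR ρ ch)] [])

end PlainOp
end SwissCheese

namespace SwissCheese

open Color

/-! ### Blow-ups with names adapted to the envelope. -/

namespace Forest

open Vtx

/-- Like `blowRound`, but the upper vertex in the blow-up of a neutral vertex keeps the name. -/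
def blowR : Vtx → Forest → List (ℤ × Forest)
  | lab i, ch =>
      (ch.splits3.flatMap fun s => if 1 ≤ s.1.len + s.2.2.len then
        [(-1, cons (neu 0) (s.1.app (cons (lab i) s.2.1 s.2.2)) nil)] else []) ++
      (ch.splits3.flatMap fun s => if 2 ≤ s.2.1.len then
        [(1, cons (lab i) (s.1.app (cons (neu 0) s.2.1 s.2.2)) nil)] else [])
  | neu e, ch =>
      ch.splits3.flatMap fun s => if 2 ≤ s.2.1.len ∧ 1 ≤ s.1.len + s.2.2.len then
        [(-1, cons (neu 0) (s.1.app (cons (neu e) s.2.1 s.2.2)) nil)] else []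

/-- Like `blowSquare`, but the second vertex in the blow-up of a neutral vertex keeps the name. -/
def blowS : Vtx → Forest → List (ℤ × Forest)
  | lab i, ch =>
      (ch.splits3.flatMap fun s => if 2 ≤ s.2.1.len then
        [(1, cons (lab i) (s.1.app (cons (neu 0) s.2.1 s.2.2)) nil)] else []) ++
      (ch.splits.flatMap fun s => if 1 ≤ s.2.len then
        [(1, cons (lab i) s.1 (cons (neu 0) s.2 nil))] else []) ++
      (ch.splits.flatMap fun s => if 1 ≤ s.1.len then
        [(-1, cons (neu 0) s.1 (cons (lab i) s.2 nil))] else [])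
  | neu e, ch =>
      (ch.splits3.flatMap fun s => if 2 ≤ s.2.1.len then
        [(-1, cons (neu 0) (s.1.app (cons (neu e) s.2.1 s.2.2)) nil)] else []) ++
      (ch.splits.flatMap fun s => if 1 ≤ s.1.len ∧ 1 ≤ s.2.len then
        [(-1, cons (neu 0) s.1 (cons (neu e) s.2 nil))] else [])

/-- The version of `bdRound` for `blowR`. -/
def bdR : Forest → List (ℤ × Forest)
  | nil => []
  | cons v ch r =>
      ((blowR v ch).map fun p => (p.1, p.2.app r)) ++
      (ch.bdR.map fun p => (p.1, cons v p.2 r)) ++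
      (r.bdR.map fun p => (p.1, cons v ch p.2))

/-- The version of `bdSquare` for `blowS`. -/
def bdS : Forest → List (ℤ × Forest)
  | nil => []
  | cons v ch r =>
      ((blowS v ch).map fun p => (p.1, p.2.app r)) ++
      (ch.bdR.map fun p => (p.1, cons v p.2 r)) ++
      (r.bdS.map fun p => (p.1, cons v ch p.2))

/-- Neutral vertices have at least two children and are not named `0`. -/
def StableR : Forest → Prop
  | nil => True
  | cons (lab _) ch r => ch.StableR ∧ r.StableR
  | cons (neu e) ch r => e ≠ 0 ∧ 2 ≤ ch.len ∧ ch.StableR ∧ r.StableR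

/-- The version of `StableR` for square-shaped roots. -/
def StableS : Forest → Prop
  | nil => True
  | cons (lab _) ch r => ch.StableR ∧ r.StableS
  | cons (neu e) ch r => e ≠ 0 ∧ 1 ≤ ch.len ∧ ch.StableR ∧ r.StableS

end Forest

/-! ### The twisted differential of an evaluated word. -/

namespace PlainOp

universe u v

variable {k : Type u} [CommRing k] {O : PlainOp.{u, v} k} {x : Color}

open Vtx Forest

/-- The twisted differential of either colour. -/
noncomputable def Deriv.tw (D : Deriv O) (e : O.M cl) (f : O.M op) : ∀ c, O.M c → O.M c
  | cl => D.dcl e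
  | op => D.dop e f

/-- The neutral vertices take values in copies of the twisting element, which is the value of
`neu 0`.  The arguments range over a set `S` that is stable under braces. -/
structure IsTwisted (D : Deriv O) (S : O.M cl → Prop) (ρ : Env O) : Prop where
  supp : ∀ c v, Supp (ρ c v)
  mem : ∀ v (Y : List (O.M cl)), (∀ y ∈ Y, S y) → S (cbrace (ρ cl v) Y)
  d_cl : ∀ e ≠ 0, D.fam (ρ cl (neu e)) = - cbrace (ρ cl (neu 0)) [ρ cl (neu e)]
  d_op : ∀ e ≠ 0, D.fam (ρ op (neu e)) =
    - cbrace (ρ op (neu 0)) [ρ cl (neu e)] - mul (ρ op (neu 0)) (ρ op (neu e))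
  swap : ∀ e ≠ 0, ∀ (c : Color) (Y₁ Y₂ Y₃ : List (O.M cl)), (∀ y ∈ Y₁, S y) → (∀ y ∈ Y₂, S y) →
    (∀ y ∈ Y₃, S y) → cbrace (ρ c (neu e)) (Y₁ ++ cbrace (ρ cl (neu 0)) Y₂ :: Y₃) =
      - cbrace (ρ c (neu 0)) (Y₁ ++ cbrace (ρ cl (neu e)) Y₂ :: Y₃)
  swap_mul : ∀ e ≠ 0, ∀ (Y₁ Y₂ : List (O.M cl)), (∀ y ∈ Y₁, S y) → (∀ y ∈ Y₂, S y) →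
    mul (cbrace (ρ op (neu e)) Y₁) (cbrace (ρ op (neu 0)) Y₂) =
      - mul (cbrace (ρ op (neu 0)) Y₁) (cbrace (ρ op (neu e)) Y₂)

namespace IsTwisted

variable {D : Deriv O} {S : O.M cl → Prop} {ρ : Env O}

lemma mem_evR (h : IsTwisted D S ρ) (F : Forest) : ∀ y ∈ evR ρ F, S y := by
  induction F with
  | nil => simp [evR]
  | cons v ch r ih₁ ih₂ =>
    intro y hy
    rcases List.mem_cons.1 hy with rfl | hy
    · exact h.mem v _ ih₁
    · exact ih₂ y hy

end IsTwisted

/-- Apply the twisted differential to the value of one label. -/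
noncomputable def Env.dlab (D : Deriv O) (ρ : Env O) (i : ℕ) : Env O := fun c =>
  Function.update (ρ c) (lab i) (D.tw (ρ cl (neu 0)) (ρ op (neu 0)) c (ρ c (lab i)))

lemma Env.dlab_self (D : Deriv O) (ρ : Env O) (i : ℕ) (c : Color) :
    ρ.dlab D i c (lab i) = D.tw (ρ cl (neu 0)) (ρ op (neu 0)) c (ρ c (lab i)) := by
  simp [Env.dlab]

lemma Env.dlab_ne (D : Deriv O) (ρ : Env O) (i : ℕ) (c : Color) (v : Vtx) (h : v ≠ lab i) :
    ρ.dlab D i c v = ρ c v := by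
  simp [Env.dlab, h]

lemma evR_dlab (D : Deriv O) (ρ : Env O) (i : ℕ) (F : Forest) (h : i ∉ F.labels) :
    evR (ρ.dlab D i) F = evR ρ F :=
  evR_congr F (fun j hj => ρ.dlab_ne _ _ _ _ (by rintro ⟨⟩; exact h hj))
    fun e _ => ρ.dlab_ne _ _ _ _ (by simp)

lemma evL_dlab (D : Deriv O) (ρ : Env O) (i : ℕ) (F : Forest) (h : i ∉ F.labels) :
    evL (ρ.dlab D i) F = evL ρ F := by
  rw [mem_labels_iff, not_or] at h
  exact evL_congr F (fun j hj => ρ.dlab_ne _ _ _ _ (by rintro ⟨⟩; exact h.1 hj))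
    (fun j hj => ρ.dlab_ne _ _ _ _ (by rintro ⟨⟩; exact h.2 hj))
    fun c e _ => ρ.dlab_ne _ _ _ _ (by simp)

section

variable {A : Type*} [AddCommGroup A]

/-- The numbers of trees in the condition of a blow-up are the lengths of the lists of their values.
A sum over blow-ups is therefore a conditional sum over cuts, the form that occurs in the boundary
formulas for braces. -/
lemma lsum_blow₃ (ρ : Env O) (ch : Forest) (P : ℕ → ℕ → ℕ → Prop) [∀ a b c, Decidable (P a b c)]
    (t : Forest × Forest × Forest → ℤ × Forest) (Φ : ℤ × Forest → A)
    (f : List (O.M cl) → List (O.M cl) → List (O.M cl) → A)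
    (h : ∀ s, Φ (t s) = f (evR ρ s.1) (evR ρ s.2.1) (evR ρ s.2.2)) :
    lsum (ch.splits3.flatMap fun s => if P s.1.len s.2.1.len s.2.2.len then [t s] else []) Φ =
      splitSum₃ (evR ρ ch) fun A B C => if P A.length B.length C.length then f A B C else 0 := by
  rw [lsum_flatMap, ← lsum_splits₃_evR]
  refine lsum_congr fun s _ => ?_
  rw [lsum_ite, h]
  simp only [evR_length]

lemma lsum_blow₂ (ρ : Env O) (ch : Forest) (P : ℕ → ℕ → Prop) [∀ a b, Decidable (P a b)]
    (t : Forest × Forest → ℤ × Forest) (Φ : ℤ × Forest → A)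
    (f : List (O.M cl) → List (O.M cl) → A)
    (h : ∀ s, Φ (t s) = f (evR ρ s.1) (evR ρ s.2)) :
    lsum (ch.splits.flatMap fun s => if P s.1.len s.2.len then [t s] else []) Φ =
      splitSum (evR ρ ch) fun A B => if P A.length B.length then f A B else 0 := by
  rw [lsum_flatMap, ← lsum_splits_evR]
  refine lsum_congr fun s _ => ?_
  rw [lsum_ite, h]
  simp only [evR_length]

lemma splitSum₃_ite_neg {α : Type*} (Y : List α) (P : List α → List α → List α → Prop)
    [∀ a b c, Decidable (P a b c)] (f : List α → List α → List α → A) :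
    splitSum₃ Y (fun a b c => if P a b c then - f a b c else 0) =
      - splitSum₃ Y fun a b c => if P a b c then f a b c else 0 := by
  rw [← splitSum₃_neg]
  refine splitSum₃_congr fun a b c _ => ?_
  split_ifs <;> simp

lemma splitSum_ite_neg {α : Type*} (Y : List α) (P : List α → List α → Prop)
    [∀ a b, Decidable (P a b)] (f : List α → List α → A) :
    splitSum Y (fun a b => if P a b then - f a b else 0) =
      - splitSum Y fun a b => if P a b then f a b else 0 := by
  rw [← splitSum_neg]
  refine splitSum_congr' fun a b => ?_
  split_ifs <;> simp

end

variable {A : Type*} [AddCommGroup A] [Module k A]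

lemma map_splitSum₃_ite {α N : Type*} [AddCommGroup N] [Module k N] (l : N →ₗ[k] A) (Y : List α)
    (P : List α → List α → List α → Prop) [∀ a b c, Decidable (P a b c)]
    (f : List α → List α → List α → N) :
    l (splitSum₃ Y (fun a b c => if P a b c then f a b c else 0)) =
      splitSum₃ Y fun a b c => if P a b c then l (f a b c) else 0 := by
  simp only [splitSum₃, map_splitSum, apply_ite l, map_zero]

lemma map_splitSum_ite {α N : Type*} [AddCommGroup N] [Module k N] (l : N →ₗ[k] A) (Y : List α)
    (P : List α → List α → Prop) [∀ a b, Decidable (P a b)] (f : List α → List α → N) :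
    l (splitSum Y (fun a b => if P a b then f a b else 0)) =
      splitSum Y fun a b => if P a b then l (f a b) else 0 := by
  simp only [map_splitSum, apply_ite l, map_zero]

/-- Boundary of a tree with round-shaped vertices, up to the boundaries of its children. -/
lemma tw_blowR {D : Deriv O} {S : O.M cl → Prop} {ρ : Env O} (h : IsTwisted D S ρ)
    (v : Vtx) (ch : Forest) (hs : (Forest.cons v ch .nil).StableR) (l : O.M cl →ₗ[k] A) (R : Forest)
    (Φ : List (O.M cl) → A) (hΦ : ∀ y, Φ (y :: evR ρ R) = l y) :
    l (D.dcl (ρ cl (neu 0)) (cbrace (ρ cl v) (evR ρ ch))) =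
      (match v with
        | lab i => l (cbrace (D.dcl (ρ cl (neu 0)) (ρ cl (lab i))) (evR ρ ch))
        | neu _ => 0) +
      leib (D.dcl (ρ cl (neu 0))) (evR ρ ch) (fun L => l (cbrace (ρ cl v) L)) +
      lsum (blowR v ch) (fun p => p.1 • Φ (evR ρ (p.2.app R))) := by
  cases v with
  | lab i =>
    rw [dcl_cbrace]
    simp only [map_add, map_sub, map_leib, map_splitSum₃_ite, blowR, lsum_append]
    rw [lsum_blow₃ ρ ch (fun a _ c => 1 ≤ a + c) _ _ (fun A B C =>
        - l (cbrace (ρ cl (neu 0)) (A ++ cbrace (ρ cl (lab i)) B :: C))),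
      lsum_blow₃ ρ ch (fun _ b _ => 2 ≤ b) _ _ (fun A B C =>
        l (cbrace (ρ cl (lab i)) (A ++ cbrace (ρ cl (neu 0)) B :: C))), splitSum₃_ite_neg]
    · abel
    · intro s; simp [evR_app, evR, app, hΦ]
    · intro s; simp [evR_app, evR, app, hΦ]
  | neu e =>
    obtain ⟨he, h2, -⟩ := hs
    rw [dcl_cbrace_neutral D _ _ (by rwa [evR_length]) (h.d_cl e he)]
    · simp only [map_sub, map_leib, map_splitSum₃_ite, blowR, zero_add]
      rw [lsum_blow₃ ρ ch (fun a b c => 2 ≤ b ∧ 1 ≤ a + c) _ _ (fun A B C =>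
        - l (cbrace (ρ cl (neu 0)) (A ++ cbrace (ρ cl (neu e)) B :: C))), splitSum₃_ite_neg]
      · abel
      · intro s; simp [evR_app, evR, app, hΦ]
    · intro A B C hABC
      have hm := h.mem_evR ch
      exact h.swap e he cl A B C (fun y hy => hm y (by simp [← hABC, hy]))
        (fun y hy => hm y (by simp [← hABC, hy])) (fun y hy => hm y (by simp [← hABC, hy]))

/-- Boundary of a forest of round-shaped vertices. -/
lemma leib_evR {D : Deriv O} {S : O.M cl → Prop} {ρ : Env O} (h : IsTwisted D S ρ)
    (F : Forest) (hs : F.StableR) (hF : F.labels.Nodup) {Φ : List (O.M cl) → A} (hΦ : MLin Φ) :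
    leib (D.dcl (ρ cl (neu 0))) (evR ρ F) Φ =
      lsum F.labels (fun i => Φ (evR (ρ.dlab D i) F)) +
        lsum (bdR F) (fun p => p.1 • Φ (evR ρ p.2)) := by
  induction F generalizing Φ with
  | nil => simp [evR, leib, labels, bdR]
  | cons v ch r ih₁ ih₂ =>
    obtain ⟨h1, h2, h3, h4, h5⟩ := nodup_labels_cons hF
    have hs1 : (Forest.cons v ch .nil).StableR := by
      cases v <;> simp only [StableR] at hs ⊢ <;> tauto
    have hs2 : ch.StableR := by cases v <;> simp only [StableR] at hs <;> tauto
    have hs3 : r.StableR := by cases v <;> simp only [StableR] at hs <;> tauto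
    obtain ⟨l, hl⟩ := hΦ [] (evR ρ r)
    simp only [List.nil_append] at hl
    have e1 : lsum ch.labels (fun i => Φ (evR (ρ.dlab D i) (.cons v ch r))) =
        lsum ch.labels fun i => l (cbrace (ρ cl v) (evR (ρ.dlab D i) ch)) := by
      refine lsum_congr fun i hi => ?_
      rw [evR, evR_dlab _ _ _ r (h3 i hi), Env.dlab_ne _ _ _ _ _ (h4 i hi), hl]
    have e2 : lsum r.labels (fun i => Φ (evR (ρ.dlab D i) (.cons v ch r))) =
        lsum r.labels fun i => Φ (cbrace (ρ cl v) (evR ρ ch) :: evR (ρ.dlab D i) r) := by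
      refine lsum_congr fun i hi => ?_
      rw [evR, evR_dlab _ _ _ ch (fun hc => h3 i hc hi), Env.dlab_ne _ _ _ _ _ (h5 i hi)]
    have hΦ' : MLin fun L => l (cbrace (ρ cl v) L) := by
      simpa only [List.nil_append, hl] using hΦ.comp (cbrace_mlin (ρ cl v)) [] (evR ρ r)
    -- The root of the first tree, its children and the remaining trees contribute separately, as in
    -- the three summands of `bdR`.
    rw [evR, leib, hl, tw_blowR h v ch hs1 l r Φ hl, ih₁ hs2 h1 hΦ', ih₂ hs3 h2 (hΦ.cons _)]
    simp only [bdR, lsum_append, lsum_map, evR]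
    cases v with
    | lab i =>
      have e3 : Φ (evR (ρ.dlab D i) (.cons (lab i) ch r)) =
          l (cbrace (D.dcl (ρ cl (neu 0)) (ρ cl (lab i))) (evR ρ ch)) := by
        rw [evR, evR_dlab _ _ _ r (fun hc => h5 i hc rfl), evR_dlab _ _ _ ch
          (fun hc => h4 i hc rfl), Env.dlab_self, hl]
        rfl
      simp only [labels, lsum_cons, lsum_append, hl, evR] at e1 e2 e3 ⊢
      rw [e1, e2, e3]
      abel
    | neu e =>
      simp only [labels, lsum_append, hl, evR] at e1 e2 ⊢
      rw [e1, e2]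
      abel

/-- Boundary of a tree with a square-shaped root, up to the boundaries of its children. -/
lemma tw_blowS {D : Deriv O} {S : O.M cl → Prop} {ρ : Env O} (h : IsTwisted D S ρ)
    (v : Vtx) (ch : Forest) (hs : (Forest.cons v ch .nil).StableS) (l : O.M op →ₗ[k] A) (R : Forest)
    (Ψ : List (O.M op) → A) (hΨ : ∀ y, Ψ (y :: evL ρ R) = l y) (hm : IsMul Ψ) :
    l (D.dop (ρ cl (neu 0)) (ρ op (neu 0)) (cbrace (ρ op v) (evR ρ ch))) =
      (match v with
        | lab i => l (cbrace (D.dop (ρ cl (neu 0)) (ρ op (neu 0)) (ρ op (lab i))) (evR ρ ch))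
        | neu _ => 0) +
      leib (D.dcl (ρ cl (neu 0))) (evR ρ ch) (fun L => l (cbrace (ρ op v) L)) +
      lsum (blowS v ch) (fun p => p.1 • Ψ (evL ρ (p.2.app R))) := by
  have hch := evR_supp h.supp ch
  -- A blow-up of a root into two roots gives two neighbours in the word. `IsMul` identifies them
  -- with their product, the form in which `dop_cbrace` yields them.
  have hm' : ∀ v w (s : Forest × Forest), Ψ (cbrace (ρ op v) (evR ρ s.1) ::
      cbrace (ρ op w) (evR ρ s.2) :: evL ρ R) =
      l (mul (cbrace (ρ op v) (evR ρ s.1)) (cbrace (ρ op w) (evR ρ s.2))) := by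
    intro v w s
    rw [← hΨ]
    exact (hm [] _ _ _ ((h.supp op v).cbrace (evR_supp h.supp s.1))).symm
  cases v with
  | lab i =>
    rw [dop_cbrace D _ (h.supp _ _) (h.supp _ _) hch]
    simp only [map_add, map_sub, map_leib, map_splitSum₃_ite, map_splitSum_ite, blowS, lsum_append]
    rw [lsum_blow₃ ρ ch (fun _ b _ => 2 ≤ b) _ _ (fun A B C =>
        l (cbrace (ρ op (lab i)) (A ++ cbrace (ρ cl (neu 0)) B :: C))),
      lsum_blow₂ ρ ch (fun _ b => 1 ≤ b) _ _ (fun A B =>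
        l (mul (cbrace (ρ op (lab i)) A) (cbrace (ρ op (neu 0)) B))),
      lsum_blow₂ ρ ch (fun a _ => 1 ≤ a) _ _ (fun A B =>
        - l (mul (cbrace (ρ op (neu 0)) A) (cbrace (ρ op (lab i)) B))), splitSum_ite_neg]
    · abel
    · intro s; simp [evL, app, hm']
    · intro s; simp [evL, app, hm']
    · intro s; simp [evR_app, evR, evL, app, hΨ]
  | neu e =>
    obtain ⟨he, h2, -⟩ := hs
    rw [dop_cbrace_neutral D (ρ cl (neu 0)) (ρ cl (neu e)) (h.supp _ _) (h.supp _ _) hch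
      (by rwa [evR_length]) (h.d_op e he)]
    · simp only [map_sub, map_leib, map_splitSum₃_ite, map_splitSum_ite, blowS, lsum_append, zero_add]
      rw [lsum_blow₃ ρ ch (fun _ b _ => 2 ≤ b) _ _ (fun A B C =>
          - l (cbrace (ρ op (neu 0)) (A ++ cbrace (ρ cl (neu e)) B :: C))),
        lsum_blow₂ ρ ch (fun a b => 1 ≤ a ∧ 1 ≤ b) _ _ (fun A B =>
          - l (mul (cbrace (ρ op (neu 0)) A) (cbrace (ρ op (neu e)) B))),
        splitSum_ite_neg, splitSum₃_ite_neg]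
      · abel
      · intro s; simp [evL, app, hm']
      · intro s; simp [evR_app, evR, evL, app, hΨ]
    · intro A B C hABC
      have hm := h.mem_evR ch
      exact h.swap e he op A B C (fun y hy => hm y (by simp [← hABC, hy]))
        (fun y hy => hm y (by simp [← hABC, hy])) (fun y hy => hm y (by simp [← hABC, hy]))
    · intro A B hAB
      have hm := h.mem_evR ch
      exact h.swap_mul e he A B (fun y hy => hm y (by simp [← hAB, hy]))
        (fun y hy => hm y (by simp [← hAB, hy]))

/-- Boundary of a word with square-shaped roots. -/
lemma leib_evL {D : Deriv O} {S : O.M cl → Prop} {ρ : Env O} (h : IsTwisted D S ρ)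
    (F : Forest) (hs : F.StableS) (hF : F.labels.Nodup) {Ψ : List (O.M op) → A} (hΨ : MLin Ψ)
    (hm : IsMul Ψ) :
    leib (D.dop (ρ cl (neu 0)) (ρ op (neu 0))) (evL ρ F) Ψ =
      lsum F.labels (fun i => Ψ (evL (ρ.dlab D i) F)) +
        lsum (bdS F) (fun p => p.1 • Ψ (evL ρ p.2)) := by
  induction F generalizing Ψ with
  | nil => simp [evL, leib, labels, bdS]
  | cons v ch r _ ih₂ =>
    obtain ⟨h1, h2, h3, h4, h5⟩ := nodup_labels_cons hF
    have hs1 : (Forest.cons v ch .nil).StableS := by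
      cases v <;> simp only [StableS] at hs ⊢ <;> tauto
    have hs2 : ch.StableR := by cases v <;> simp only [StableS] at hs <;> tauto
    have hs3 : r.StableS := by cases v <;> simp only [StableS] at hs <;> tauto
    obtain ⟨l, hl⟩ := hΨ [] (evL ρ r)
    simp only [List.nil_append] at hl
    have e1 : lsum ch.labels (fun i => Ψ (evL (ρ.dlab D i) (.cons v ch r))) =
        lsum ch.labels fun i => l (cbrace (ρ op v) (evR (ρ.dlab D i) ch)) := by
      refine lsum_congr fun i hi => ?_
      rw [evL, evL_dlab _ _ _ r (h3 i hi), Env.dlab_ne _ _ _ _ _ (h4 i hi), hl]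
    have e2 : lsum r.labels (fun i => Ψ (evL (ρ.dlab D i) (.cons v ch r))) =
        lsum r.labels fun i => Ψ (cbrace (ρ op v) (evR ρ ch) :: evL (ρ.dlab D i) r) := by
      refine lsum_congr fun i hi => ?_
      rw [evL, evR_dlab _ _ _ ch (fun hc => h3 i hc hi), Env.dlab_ne _ _ _ _ _ (h5 i hi)]
    have hΨ' : MLin fun L => l (cbrace (ρ op v) L) := by
      simpa only [List.nil_append, hl] using hΨ.comp (cbrace_mlin (ρ op v)) [] (evL ρ r)
    rw [evL, leib, hl, tw_blowS h v ch hs1 l r Ψ hl hm, leib_evR h ch hs2 h1 hΨ',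
      ih₂ hs3 h2 (hΨ.cons _) (by simpa using hm.append [cbrace (ρ op v) (evR ρ ch)] [])]
    simp only [bdS, lsum_append, lsum_map, evL]
    cases v with
    | lab i =>
      have e3 : Ψ (evL (ρ.dlab D i) (.cons (lab i) ch r)) =
          l (cbrace (D.dop (ρ cl (neu 0)) (ρ op (neu 0)) (ρ op (lab i))) (evR ρ ch)) := by
        rw [evL, evL_dlab _ _ _ r (fun hc => h5 i hc rfl), evR_dlab _ _ _ ch
          (fun hc => h4 i hc rfl), Env.dlab_self, hl]
        rfl
      simp only [labels, lsum_cons, lsum_append, hl, evL] at e1 e2 e3 ⊢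
      rw [e1, e2, e3]
      abel
    | neu e =>
      simp only [labels, lsum_append, hl, evL] at e1 e2 ⊢
      rw [e1, e2]
      abel

/-- Induction on the number of factors with the Leibniz rule `dop_mul`. The empty product is zero
and not a unit, so the first factor can be split off only from a nonempty rest. -/
lemma dop_oprod (D : Deriv O) {e : O.M cl} {f : O.M op} (he : Supp e) (hf : Supp f)
    {L : List (O.M op)} (hL : ∀ y ∈ L, Supp y) :
    D.dop e f (oprod L) = leib (D.dop e f) L oprod := by
  induction L with
  | nil =>
    have h1 : cbrace (0 : O.M op) [e] = 0 := by
      obtain ⟨l, hl⟩ := brace_linear_left (k := k) (x := op) (cls [e])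
      rw [cbrace, hl, map_zero]
    have h2 : mul (0 : O.M op) f = 0 := by
      obtain ⟨l, hl⟩ := brace_linear_left (k := k) (x := op) [(⟨op, f⟩ : O.Item)]
      rw [mul, hl, map_zero]
    have h3 : mul f (0 : O.M op) = 0 := brace_zero_item f [] [] op
    simp [Deriv.dop, oprod, leib, h1, h2, h3]
  | cons a L ih =>
    by_cases hL' : L = []
    · subst hL'; simp [oprod, leib]
    · rw [oprod_cons _ hL', dop_mul D e hf (hL a (by simp)) he, leib, oprod_cons _ hL',
        ih fun y hy => hL y (by simp [hy])]
      congr 1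
      obtain ⟨l, hl⟩ := mul_linear_right a
      -- Generalised over an initial part `L'`, into which the Leibniz sum moves one factor after
      -- the other.
      have h : ∀ (L' M : List (O.M op)), L' ++ M ≠ [] →
          leib (D.dop e f) M (fun R => l (oprod (L' ++ R))) =
            leib (D.dop e f) M fun R => oprod (a :: (L' ++ R)) := by
        intro L' M
        induction M generalizing L' with
        | nil => intros; rfl
        | cons b M ihM =>
          intro _
          simp only [leib]
          rw [oprod_cons _ (by simp), hl]
          congr 1
          simpa using ihM (L' ++ [b]) (by simp)
      rw [hl, map_leib]
      exact h [] L hL'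

end PlainOp
end SwissCheese

namespace SwissCheese

open Color

/-! ### Signs -/

lemma sgn_add (a b : ℤ) : sgn (a + b) = sgn a * sgn b := by
  unfold sgn
  by_cases ha : Even a <;> by_cases hb : Even b <;> simp [ha, hb, Int.even_add]

lemma sgn_mul_self (a : ℤ) : sgn a * sgn a = 1 := by
  unfold sgn
  split_ifs <;> simp

@[simp] lemma sgn_zero : sgn 0 = 1 := by simp [sgn]

/-- A sign depends on its exponent modulo two. Sign identities thus become identities in `ZMod 2`,
which are verified by computation. -/
lemma sgn_congr {a b : ℤ} (h : (a : ZMod 2) = b) : sgn a = sgn b := by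
  have : Even a ↔ Even b := by
    rw [← ZMod.intCast_eq_zero_iff_even, ← ZMod.intCast_eq_zero_iff_even, h]
  simp [sgn, this]

lemma nc_append (a b : List Color) : nc (a ++ b) = nc a + nc b := by simp [nc]

lemma nc_cons (c : Color) (a : List Color) : nc (c :: a) = wt c + nc a := by
  cases c <;> simp [nc, wt, add_comm]

lemma nc_nil : nc [] = 0 := by simp [nc]

universe u v

variable {k : Type u} [CommRing k]

lemma shift_deg {a c I J K : List Color} {t s : Color} {m n l : ℤ} (hI : I = a ++ t :: c)
    (hK : K = a ++ J ++ c) (hl : l = m + n) :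
    l + shift K s = (m + shift I s) + (n + shift J t) := by
  subst hI hK hl
  rw [shift_comp a c J t s]
  ring

/-- The closed suspension of an operad is an operad. -/
lemma IsNSOperad.lam {P : OpData.{u, v} k} (hP : IsNSOperad P) : IsNSOperad (lam P) where
  assoc_seq a b c e I J K L M N s t u m n l mn nl mnl hI hJ hK hL hK' hN hN' h₁ h₂ h₃ h₄ := by
    -- The axiom of the suspension, unfolded to a statement about `P` in the shifted degrees; the
    -- two agree by definition.
    have key : ∀ (p : P.obj I s (m + shift I s)) (q : P.obj J t (n + shift J t))
        (r : P.obj M u (l + shift M u)),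
        lamSign (a ++ b) (e ++ c) M u l • P.comp (a ++ b) (e ++ c) hK' hN (shift_deg hK' hN h₃)
          (lamSign a c J t n • P.comp a c hI hK (shift_deg hI hK h₁) p q) r =
        lamSign a c L t nl • P.comp a c hI hN' (shift_deg hI hN' h₄) p
          (lamSign b e M u l • P.comp b e hJ hL (shift_deg hJ hL h₂) q r) := by
      intro p q r
      simp only [LinearMap.smul_apply, map_zsmul, smul_smul, lamSign]
      rw [hP.assoc_seq a b c e hI hJ hK hL hK' hN hN' _ (shift_deg hJ hL h₂) _
        (shift_deg hI hN' h₄) p q r]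
      congr 1
      -- What is left is the cocycle identity for `lamSign`, checked modulo two after the counts of
      -- closed inputs are expanded.
      rw [← sgn_add, ← sgn_add]
      apply sgn_congr
      subst hI hJ hL h₁ h₂
      simp only [shift, nc_append, nc_cons]
      push_cast
      grind
    exact key
  assoc_par := by
    intro a b c I J M K L N s t u m n l mn ml mnl hI hI' hK hK' hL hL' hN hN' h₁ h₂ h₃ h₄
    have key : ∀ (p : P.obj I s (m + shift I s)) (q : P.obj J t (n + shift J t))
        (r : P.obj M u (l + shift M u)),
        lamSign (a ++ J ++ b) c M u l • P.comp (a ++ J ++ b) c hK' hN (shift_deg hK' hN h₃)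
          (lamSign a (b ++ u :: c) J t n •
            P.comp a (b ++ u :: c) hI hK (shift_deg hI hK h₁) p q) r =
        sgn (n * l) • lamSign a (b ++ M ++ c) J t n •
          P.comp a (b ++ M ++ c) hL' hN' (shift_deg hL' hN' h₄)
            (lamSign (a ++ t :: b) c M u l •
              P.comp (a ++ t :: b) c hI' hL (shift_deg hI' hL h₂) p r) q := by
      intro p q r
      simp only [LinearMap.smul_apply, map_zsmul, smul_smul, lamSign]
      rw [hP.assoc_par a b c hI hI' hK hK' hL hL' hN hN' _ (shift_deg hI' hL h₂) _
        (shift_deg hL' hN' h₄) p q r, smul_smul]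
      congr 1
      simp only [← sgn_add]
      apply sgn_congr
      simp only [shift, nc_append, nc_cons]
      push_cast
      grind
    exact key
  one_comp := by
    intro I J s z m h1 hz hI hJ hm
    have key : ∀ (p : P.obj J s (m + shift J s)) (hz' : z + shift I s = 0),
        lamSign [] [] J s m • P.comp [] [] hI hJ (shift_deg hI hJ hm) (P.one s h1 hz') p = p := by
      intro p hz'
      rw [hP.one_comp]
      simp [lamSign, nc_nil]
    exact fun p => key p _
  comp_one := by
    intro a c I J s t m z h1 hz hI hI' hm
    have key : ∀ (p : P.obj I s (m + shift I s)) (hz' : z + shift J t = 0),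
        lamSign a c J t z • P.comp a c hI hI' (shift_deg hI hI' hm) p (P.one t h1 hz') = p := by
      intro p hz'
      have h : lamSign a c J t z = 1 := by rw [lamSign, hz']; simp [hz]
      rw [h, one_smul]
      have key : ∀ {z' : ℤ} (hz' : z' = 0) (h2 : m + shift I s = m + shift I s + z'),
          P.comp a c hI hI' h2 p (P.one t h1 hz') = p :=
        fun hz' h2 => hP.comp_one a c h1 hz' hI hI' h2 p
      exact key _ _
    exact fun p => key p _
  d_d := by
    intro I x m n l h h'
    have key : ∀ (p : P.obj I x (m + shift I x)),
        sgn (wt x) • P.d (by subst h'; ring : l + shift I x = n + shift I x - 1)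
          (sgn (wt x) • P.d (by subst h; ring : n + shift I x = m + shift I x - 1) p) = 0 := by
      intro p
      rw [map_zsmul, hP.d_d]
      simp
    exact key
  d_comp := by
    intro a c I J K s t m n l m' n' l' hI hK hl hm' hn' hl' h₁ h₂
    have key : ∀ (p : P.obj I s (m + shift I s)) (q : P.obj J t (n + shift J t)),
        sgn (wt s) • P.d (by subst hl'; ring : l' + shift K s = l + shift K s - 1)
          (lamSign a c J t n • P.comp a c hI hK (shift_deg hI hK hl) p q) =
        lamSign a c J t n • P.comp a c hI hK (shift_deg hI hK h₁) (sgn (wt s) •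
          P.d (by subst hm'; ring : m' + shift I s = m + shift I s - 1) p) q +
        sgn m • lamSign a c J t n' • P.comp a c hI hK (shift_deg hI hK h₂) p (sgn (wt t) •
          P.d (by subst hn'; ring : n' + shift J t = n + shift J t - 1) q) := by
      intro p q
      simp only [map_zsmul, LinearMap.smul_apply, smul_smul, lamSign]
      rw [hP.d_comp a c hI hK _ (m' := m' + shift I s) (n' := n' + shift J t) (by omega) (by omega) _
        (shift_deg hI hK h₁) (shift_deg hI hK h₂), smul_add, smul_smul]
      congr 1
      · congr 1; ring
      · congr 1
        simp only [← sgn_add]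
        apply sgn_congr
        subst hI hn'
        simp only [shift, nc_append, nc_cons]
        push_cast
        grind
    exact key

end SwissCheese

namespace SwissCheese

open Color

/-! ### Signs of words in anticommuting letters -/

/-- The sign of the product of two anticommuting letters relative to the sorted product. -/
def letSign (i j : ℕ) : ℤ := if i = j then 0 else if j < i then -1 else 1

lemma letSign_swap (i j : ℕ) : letSign i j = - letSign j i := by
  unfold letSign
  rcases lt_trichotomy i j with h | h | h
  · simp [h.ne, h.ne', h.not_gt, h]
  · simp [h]
  · simp [h.ne, h.ne', h.not_gt, h]

/-- The sign of the product of two monomials in anticommuting letters. -/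
def biSign (S T : Multiset ℕ) : ℤ := (S.map fun i => (T.map fun j => letSign i j).prod).prod

@[simp] lemma biSign_zero_left (T : Multiset ℕ) : biSign 0 T = 1 := by simp [biSign]

@[simp] lemma biSign_zero_right (T : Multiset ℕ) : biSign T 0 = 1 := by simp [biSign]

lemma biSign_add_left (S S' T : Multiset ℕ) : biSign (S + S') T = biSign S T * biSign S' T := by
  simp [biSign]

lemma biSign_add_right (S T T' : Multiset ℕ) : biSign S (T + T') = biSign S T * biSign S T' := by
  simp [biSign, Multiset.prod_map_mul]

lemma sgn_natCast_succ (n : ℕ) : sgn (n + 1 : ℕ) = - sgn n := by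
  push_cast
  rw [sgn_add]
  simp [sgn]

lemma biSign_singleton_swap (i : ℕ) (T : Multiset ℕ) :
    biSign {i} T = sgn (T.card : ℤ) * biSign T {i} := by
  induction T using Multiset.induction_on with
  | empty => simp
  | cons j T ih =>
    rw [← Multiset.singleton_add, biSign_add_right, biSign_add_left, ih, Multiset.card_add,
      Multiset.card_singleton, add_comm 1, sgn_natCast_succ]
    simp only [biSign, Multiset.map_singleton, Multiset.prod_singleton]
    rw [letSign_swap i j]
    ring

/-- Each pair of letters contributes one factor `-1`. This graded commutativity cancels the Koszul
signs of the operad axioms in the envelope. -/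
lemma biSign_swap (S T : Multiset ℕ) :
    biSign S T = sgn ((S.card : ℤ) * T.card) * biSign T S := by
  induction S using Multiset.induction_on with
  | empty => simp
  | cons i S ih =>
    rw [← Multiset.singleton_add, biSign_add_left, biSign_add_right, ih, biSign_singleton_swap,
      Multiset.card_add, Multiset.card_singleton]
    push_cast
    rw [add_mul, one_mul, sgn_add]
    ring

/-- The sign of a word in anticommuting letters relative to the sorted word. -/
def wordSign : List ℕ → ℤ
  | [] => 1
  | i :: l => biSign {i} l * wordSign l

lemma wordSign_append (l l' : List ℕ) :
    wordSign (l ++ l') = biSign l l' * wordSign l * wordSign l' := by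
  induction l with
  | nil => simp [wordSign]
  | cons i l ih =>
    have h1 : ((l ++ l' : List ℕ) : Multiset ℕ) = (l : Multiset ℕ) + l' := rfl
    have h2 : ((i :: l : List ℕ) : Multiset ℕ) = {i} + (l : Multiset ℕ) := rfl
    rw [List.cons_append, wordSign, wordSign, ih, h1, h2, biSign_add_left, biSign_add_right]
    ring

lemma wordSign_swap (u l l' w : List ℕ) :
    wordSign (u ++ l ++ l' ++ w) = sgn ((l.length : ℤ) * l'.length) *
      wordSign (u ++ l' ++ l ++ w) := by
  have h1 : ∀ a b : List ℕ, ((a ++ b : List ℕ) : Multiset ℕ) = (a : Multiset ℕ) + b := fun _ _ => rfl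
  simp only [wordSign_append, h1, biSign_add_left]
  rw [biSign_swap l l']
  simp only [Multiset.coe_card]
  ring

/-- The letters between `i` and `j` are passed twice, so only the exchange of `i` with `j` counts.
If the two letters coincide, both sides are zero. -/
lemma wordSign_swap_letters (u v w : List ℕ) (i j : ℕ) :
    wordSign (u ++ i :: (v ++ j :: w)) = - wordSign (u ++ j :: (v ++ i :: w)) := by
  have h1 := wordSign_swap u [i] (v ++ [j]) w
  have h2 := wordSign_swap u v [j] (i :: w)
  have h3 : sgn ((v.length : ℤ) + 1) = - sgn (v.length) := by
    exact_mod_cast sgn_natCast_succ v.length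
  simp only [List.append_assoc, List.cons_append, List.nil_append, List.length_append,
    List.length_cons, List.length_nil] at h1 h2 ⊢
  rw [h1, h2]
  push_cast
  simp only [one_mul, mul_one, h3]
  linear_combination (- wordSign (u ++ j :: (v ++ i :: w))) * sgn_mul_self (v.length : ℤ)

/-! ### The Grassmann envelope -/

/-- A monomial in anticommuting letters and a degree of the same parity. -/
@[ext] structure Mono where
  let_ : Multiset ℕ
  deg : ℤ
  par : Even (deg + let_.card)

namespace Mono

noncomputable instance : DecidableEq Mono := Classical.decEq _

instance : Add Mono := ⟨fun p q => ⟨p.let_ + q.let_, p.deg + q.deg, by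
  have := p.par.add q.par
  rw [Multiset.card_add, Nat.cast_add, add_add_add_comm]
  exact this⟩⟩

@[simp] lemma add_let (p q : Mono) : (p + q).let_ = p.let_ + q.let_ := rfl

@[simp] lemma add_deg (p q : Mono) : (p + q).deg = p.deg + q.deg := rfl

lemma add_deg_eq (p q : Mono) : (p + q).deg = p.deg + q.deg := rfl

/-- Multiply by one letter and lower the degree. -/
def shiftBy (θ : ℕ) (p : Mono) : Mono := ⟨{θ} + p.let_, p.deg - 1, by
  have := p.par
  rw [Multiset.card_add, Multiset.card_singleton]
  push_cast
  convert this using 1; ring⟩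

lemma shiftBy_deg (θ : ℕ) (p : Mono) : (p.shiftBy θ).deg = p.deg - 1 := rfl

/-- The parity condition in `Mono` makes signs from moving letters equal to Koszul signs of degrees.
-/
lemma sgn_card (p : Mono) : sgn (p.let_.card : ℤ) = sgn p.deg := by
  apply sgn_congr
  have := (ZMod.intCast_eq_zero_iff_even (n := _)).2 p.par
  push_cast at this ⊢
  grind

lemma sgn_card_mul (p q : Mono) :
    sgn ((p.let_.card : ℤ) * q.let_.card) = sgn (p.deg * q.deg) := by
  apply sgn_congr
  have h1 := (ZMod.intCast_eq_zero_iff_even (n := _)).2 p.par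
  have h2 := (ZMod.intCast_eq_zero_iff_even (n := _)).2 q.par
  push_cast at h1 h2 ⊢
  grind

end Mono

universe u v

variable {k : Type u} [CommRing k]

section

variable (L : OpData.{u, v} k)

/-- Elements of an operad with coefficients in anticommuting letters, of even total parity. -/
abbrev GrObj (I : List Color) (x : Color) := DirectSum Mono fun p => L.obj I x p.deg

variable {L}

/-- The inclusion of a monomial. -/
noncomputable def grOf {I : List Color} {x : Color} (p : Mono) : L.obj I x p.deg →ₗ[k] GrObj L I x :=
  DirectSum.lof k Mono (fun p => L.obj I x p.deg) p

variable (L)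

/-- Composition with coefficients in anticommuting letters. -/
noncomputable def grComp (a c : List Color) {I J K : List Color} {t s : Color}
    (hI : I = a ++ t :: c) (hK : K = a ++ J ++ c) :
    GrObj L I s →ₗ[k] GrObj L J t →ₗ[k] GrObj L K s :=
  DirectSum.toModule k Mono _ fun p => LinearMap.flip <|
    DirectSum.toModule k Mono _ fun q => LinearMap.flip <|
      -- The only sign is that of multiplying the two monomials; letters are never moved past
      -- operations.
      biSign p.let_ q.let_ •
        (L.comp a c hI hK (rfl : (p + q).deg = p.deg + q.deg)).compr₂ (grOf (p + q))

variable {L}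

lemma grComp_of (a c : List Color) {I J K : List Color} {t s : Color}
    (hI : I = a ++ t :: c) (hK : K = a ++ J ++ c) (p q r : Mono) (hr : r = p + q)
    (hd : r.deg = p.deg + q.deg) (x : L.obj I s p.deg) (y : L.obj J t q.deg) :
    grComp L a c hI hK (grOf p x) (grOf q y) =
      biSign p.let_ q.let_ • grOf r (L.comp a c hI hK hd x y) := by
  subst hr
  simp only [grComp, grOf, DirectSum.toModule_lof, LinearMap.flip_apply]
  rfl

lemma GrObj.induction {I : List Color} {x : Color} {C : GrObj L I x → Prop} (a : GrObj L I x)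
    (h0 : C 0) (h1 : ∀ p y, C (grOf p y)) (h2 : ∀ a b, C a → C b → C (a + b)) : C a :=
  DirectSum.induction_on a h0 h1 h2

/-- The differential multiplied by the letter `θ`. -/
noncomputable def grD (θ : ℕ) {I : List Color} {x : Color} : GrObj L I x →ₗ[k] GrObj L I x :=
  DirectSum.toModule k Mono _ fun p =>
    biSign {θ} p.let_ • (grOf (p.shiftBy θ)).comp (L.d rfl)

lemma grD_of (θ : ℕ) {I : List Color} {x : Color} (p r : Mono) (hr : r = p.shiftBy θ)
    (hd : r.deg = p.deg - 1) (y : L.obj I x p.deg) :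
    grD θ (grOf p y) = biSign {θ} p.let_ • grOf r (L.d hd y) := by
  subst hr
  simp only [grD, grOf, DirectSum.toModule_lof]
  rfl

/-- The Grassmann envelope: an operad without signs. -/
noncomputable def envelope (hL : IsNSOperad L) : PlainOp.{u, v} k where
  obj := GrObj L
  comp a c := grComp L a c
  assoc_seq a b c e I J K L' M N s t u hI hJ hK hL' hK' hN hN' p q r := by
    induction p using GrObj.induction with
    | h0 => simp
    | h2 p p' h h' => simp only [map_add, LinearMap.add_apply, h, h']
    | h1 p x =>
    induction q using GrObj.induction with
    | h0 => simp
    | h2 p p' h h' => simp only [map_add, LinearMap.add_apply, h, h']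
    | h1 q y =>
    induction r using GrObj.induction with
    | h0 => simp
    | h2 p p' h h' => simp only [map_add, h, h']
    | h1 r z =>
    have hm : p + (q + r) = p + q + r := Mono.ext (add_assoc ..).symm (add_assoc ..).symm
    rw [grComp_of a c hI hK p q _ rfl rfl, grComp_of b e hJ hL' q r _ rfl rfl, map_zsmul, map_zsmul,
      LinearMap.smul_apply, grComp_of _ _ _ _ (p + q) r _ rfl rfl,
      grComp_of a c hI hN' p (q + r) (p + q + r) hm.symm (by simp [add_assoc]),
      hL.assoc_seq a b c e hI hJ hK hL' hK' hN hN' rfl rfl rfl (by simp [add_assoc]), smul_smul, smul_smul]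
    congr 1
    simp only [Mono.add_let, biSign_add_left, biSign_add_right]
    ring
  assoc_par a b c I J M K L' N s t u hI hI' hK hK' hL' hL'' hN hN' p q r := by
    induction p using GrObj.induction with
    | h0 => simp
    | h2 p p' h h' => simp only [map_add, LinearMap.add_apply, h, h']
    | h1 p x =>
    induction q using GrObj.induction with
    | h0 => simp
    | h2 p p' h h' => simp only [map_add, LinearMap.add_apply, h, h']
    | h1 q y =>
    induction r using GrObj.induction with
    | h0 => simp
    | h2 p p' h h' => simp only [map_add, LinearMap.add_apply, h, h']
    | h1 r z =>
    have hm : p + q + r = p + r + q := Mono.ext (add_right_comm ..) (add_right_comm ..)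
    rw [grComp_of _ _ hI hK p q _ rfl rfl, grComp_of _ _ hI' hL' p r _ rfl rfl, map_zsmul,
      map_zsmul, LinearMap.smul_apply, LinearMap.smul_apply,
      grComp_of _ _ _ _ (p + q) r _ rfl rfl,
      grComp_of _ _ hL'' hN' (p + r) q (p + q + r) hm (by simp [add_right_comm]),
      hL.assoc_par a b c hI hI' hK hK' hL' hL'' hN hN' rfl rfl rfl (by simp [add_right_comm]),
      map_zsmul, smul_smul, smul_smul, smul_smul]
    congr 1
    simp only [Mono.add_let, biSign_add_left]
    -- Exchanging the monomials of `q` and `r` costs the same Koszul sign as exchanging the two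
    -- operations, so the signs cancel.
    rw [biSign_swap q.let_ r.let_, Mono.sgn_card_mul]
    linear_combination (biSign p.let_ q.let_ * biSign p.let_ r.let_ * biSign r.let_ q.let_) *
      sgn_mul_self (q.deg * r.deg)

/-- The letter `θ` stands in front of the coefficient. Moving it past the letters of `p` produces
exactly the sign of the graded Leibniz rule, which therefore disappears. -/
lemma grD_comp (hL : IsNSOperad L) (θ : ℕ) (a c : List Color) {I J K : List Color} {t s : Color}
    (hI : I = a ++ t :: c) (hK : K = a ++ J ++ c) (p : GrObj L I s) (q : GrObj L J t) :
    grD θ (grComp L a c hI hK p q) = grComp L a c hI hK (grD θ p) q +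
      grComp L a c hI hK p (grD θ q) := by
  induction p using GrObj.induction with
  | h0 => simp
  | h2 p p' h h' => simp only [map_add, LinearMap.add_apply, h, h']; abel
  | h1 p x =>
    induction q using GrObj.induction with
    | h0 => simp
    | h2 p p' h h' => simp only [map_add, h, h']; abel
    | h1 q y =>
    have h1 : (p + q).shiftBy θ = p.shiftBy θ + q :=
      Mono.ext (add_assoc ..).symm (by simp [Mono.shiftBy]; ring)
    have h2 : (p + q).shiftBy θ = p + q.shiftBy θ :=
      Mono.ext (add_left_comm ..) (by simp [Mono.shiftBy]; ring)
    have d1 : ((p + q).shiftBy θ).deg = (p.shiftBy θ).deg + q.deg := by rw [h1]; rfl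
    have d2 : ((p + q).shiftBy θ).deg = p.deg + (q.shiftBy θ).deg := by rw [h2]; rfl
    rw [grComp_of _ _ hI hK p q _ rfl (Mono.add_deg_eq p q), map_zsmul, grD_of θ (p + q) _ rfl (Mono.shiftBy_deg θ _),
      grD_of θ p _ rfl (Mono.shiftBy_deg θ _), grD_of θ q _ rfl (Mono.shiftBy_deg θ _), map_zsmul, map_zsmul, LinearMap.smul_apply,
      grComp_of _ _ hI hK (p.shiftBy θ) q _ h1 d1, grComp_of _ _ hI hK p (q.shiftBy θ) _ h2 d2,
      hL.d_comp a c hI hK (Mono.add_deg_eq p q) (Mono.shiftBy_deg θ p) (Mono.shiftBy_deg θ q)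
        (Mono.shiftBy_deg θ (p + q)) d1 d2, map_add, map_zsmul]
    simp only [smul_add, smul_smul]
    congr 1
    · congr 1
      simp only [Mono.add_let, Mono.shiftBy, biSign_add_left, biSign_add_right]
      ring
    · congr 1
      simp only [Mono.add_let, Mono.shiftBy, biSign_add_right]
      rw [biSign_singleton_swap θ p.let_, Mono.sgn_card]
      linear_combination (biSign p.let_ q.let_ * biSign p.let_ {θ} * biSign {θ} q.let_) *
        sgn_mul_self p.deg

/-- The differential, multiplied by the letter `θ`, as a derivation. -/
noncomputable def envD (hL : IsNSOperad L) (θ : ℕ) : PlainOp.Deriv (envelope hL) where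
  map := grD θ
  leibniz a c _ _ _ _ _ hI hK p q := grD_comp hL θ a c hI hK p q

end

end SwissCheese

namespace SwissCheese

open Color

universe u v

variable {k : Type u} [CommRing k] {L : OpData.{u, v} k}

/-! ### Families with a word of letters as coefficient -/

/-- A homogeneous family together with a word of letters of the same parity. -/
structure Keyed (L : OpData.{u, v} k) (x : Color) where
  word : List ℕ
  deg : ℤ
  par : Even (deg + word.length)
  val : Fam L x deg

namespace Keyed

variable {x : Color}

/-- The monomial of a keyed family. -/
abbrev mono (A : Keyed L x) : Mono := ⟨A.word, A.deg, A.par⟩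

/-- The family without its word. -/
abbrev sig (A : Keyed L x) : Σ e : ℤ, Fam L x e := ⟨A.deg, A.val⟩

/-- A keyed family as a family of operations of the envelope. -/
noncomputable def toM (hL : IsNSOperad L) (A : Keyed L x) : (envelope hL).M x := fun I =>
  if h : IsAdm I x then wordSign A.word • grOf (L := L) A.mono (A.val ⟨I, h⟩) else 0

lemma toM_supp (hL : IsNSOperad L) (A : Keyed L x) : PlainOp.Supp (A.toM hL) := fun I h => by
  simp [toM, h]

/-- The monomial forgets the order of the word, and the factor `wordSign` in `toM` keeps track of
it. Families that differ only in the order of their letters thus differ by the sign that relates the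
words. -/
lemma toM_eq_of_word (hL : IsNSOperad L) (A B : Keyed L x) (ε : ℤ) (hd : A.deg = B.deg)
    (hv : HEq A.val B.val) (hp : A.word.Perm B.word) (hw : wordSign A.word = ε * wordSign B.word) :
    A.toM hL = ε • B.toM hL := by
  obtain ⟨w, d, p, a⟩ := A
  obtain ⟨w', d', p', a'⟩ := B
  obtain rfl : d = d' := hd
  obtain rfl : a = a' := eq_of_heq hv
  have hm : (⟨(w : Multiset ℕ), d, p⟩ : Mono) = ⟨(w' : Multiset ℕ), d, p'⟩ :=
    Mono.ext (Multiset.coe_eq_coe.2 hp) rfl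
  have key : ∀ (q : Mono) (hq : (⟨(w : Multiset ℕ), d, p⟩ : Mono) = q) (I : List Color)
      (y : L.obj I x d) (y' : L.obj I x q.deg), HEq y y' →
        grOf (L := L) ⟨(w : Multiset ℕ), d, p⟩ y = grOf (L := L) q y' := by
    rintro q rfl I y y' h
    rw [eq_of_heq h]
  funext I
  change (if h : IsAdm I x then wordSign w • grOf (L := L) ⟨(w : Multiset ℕ), d, p⟩ (a ⟨I, h⟩)
      else (0 : GrObj L I x)) = ε • if h : IsAdm I x then wordSign w' •
        grOf (L := L) ⟨(w' : Multiset ℕ), d, p'⟩ (a ⟨I, h⟩) else (0 : GrObj L I x)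
  by_cases h : IsAdm I x
  · rw [dif_pos h, dif_pos h, smul_smul, ← hw, key _ hm I _ _ HEq.rfl]
  · rw [dif_neg h, dif_neg h, smul_zero]

lemma toM_congr (hL : IsNSOperad L) (A B : Keyed L x) (hw : A.word = B.word) (hd : A.deg = B.deg)
    (hv : HEq A.val B.val) : A.toM hL = B.toM hL := by
  rw [toM_eq_of_word hL A B 1 hd hv (by rw [hw]) (by rw [hw, one_mul]), one_smul]

/-- Exchanging two copies of an odd element means exchanging their letters. The antisymmetry
hypotheses in the boundary formulas and in the square of the differential are supplied by this
lemma. -/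
lemma toM_swap (hL : IsNSOperad L) (A B : Keyed L x) (u v w : List ℕ) (i j : ℕ)
    (hA : A.word = u ++ i :: (v ++ j :: w)) (hB : B.word = u ++ j :: (v ++ i :: w))
    (hd : A.deg = B.deg) (hv : HEq A.val B.val) : A.toM hL = - B.toM hL := by
  rw [toM_eq_of_word hL A B (-1) hd hv, neg_one_smul]
  · rw [hA, hB]
    refine List.Perm.append_left _ ?_
    refine (List.perm_middle (l₁ := i :: v)).trans (.cons _ ?_)
    exact (List.perm_middle (a := i)).symm
  · rw [hA, hB, wordSign_swap_letters]; ring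

lemma grComp_word (a c : List Color) {I J K : List Color} {t s : Color}
    (hI : I = a ++ t :: c) (hK : K = a ++ J ++ c) (w w' : List ℕ) (m n l : ℤ)
    (hm : Even (m + (w : Multiset ℕ).card)) (hn : Even (n + (w' : Multiset ℕ).card))
    (hl : Even (l + ((w ++ w' : List ℕ) : Multiset ℕ).card)) (h : l = m + n)
    (X : L.obj I s m) (Y : L.obj J t n) :
    grComp L a c hI hK (wordSign w • grOf (L := L) ⟨w, m, hm⟩ X)
        (wordSign w' • grOf (L := L) ⟨w', n, hn⟩ Y) =
      wordSign (w ++ w') • grOf (L := L) ⟨(w ++ w' : List ℕ), l, hl⟩ (L.comp a c hI hK h X Y) := by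
  rw [map_zsmul, map_zsmul, LinearMap.smul_apply, grComp_of a c hI hK _ _ ⟨_, l, hl⟩
    (Mono.ext rfl h) h, smul_smul, smul_smul, wordSign_append]
  congr 1
  ring

/-- The word of `A{…}`, the arguments being listed from the last one to the first. -/
def braceWord (w : List ℕ) : List (Keyed L cl) → List ℕ
  | [] => w
  | y :: Y => braceWord w Y ++ y.word

lemma braceWord_eq (w : List ℕ) (Y : List (Keyed L cl)) :
    braceWord w Y = w ++ Y.reverse.flatMap Keyed.word := by
  induction Y with
  | nil => simp [braceWord]
  | cons y Y ih => simp [braceWord, ih]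

lemma brace_par (A : Keyed L x) (Y : List (Keyed L cl)) :
    Even (braceDeg L A.deg (Y.map sig) + ((braceWord A.word Y : List ℕ) : Multiset ℕ).card) := by
  induction Y with
  | nil => simpa [braceDeg, braceWord] using A.par
  | cons y Y ih =>
    have := ih.add y.par
    simp only [List.map_cons, braceDeg, braceWord, Multiset.coe_card, List.length_append,
      Nat.cast_add] at this ⊢
    rwa [add_add_add_comm]

lemma braceDeg_cons (d : ℤ) (y : Keyed L cl) (Y : List (Keyed L cl)) :
    braceDeg L d ((y :: Y).map sig) = braceDeg L d (Y.map sig) + y.deg := rfl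

/-- One term of `ins`. -/
noncomputable def insTerm {m n l : ℤ} (h : l = m + n) (F : MFam L x m) (y : Fam L cl n)
    (p B s K : List Color) (hK : K = p ++ B ++ s) (i : ℕ) (C : Prop) [Decidable C] : L.obj K x l :=
  if hc : C ∧ IsAdm B cl ∧ IsAdm (p ++ cl :: s) x then
    L.comp p s rfl hK h (F ⟨_, hc.2.2⟩ i) (y ⟨_, hc.2.1⟩) else 0

lemma insTerm_congr {m n l : ℤ} (h : l = m + n) (F : MFam L x m) (y : Fam L cl n)
    {p B s p' B' s' K : List Color} (hK : K = p ++ B ++ s) (hK' : K = p' ++ B' ++ s') (i : ℕ)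
    (C C' : Prop) [Decidable C] [Decidable C'] (hp : p = p') (hB : B = B') (hs : s = s')
    (hC : C ↔ C') : insTerm h F y p B s K hK i C = insTerm h F y p' B' s' K hK' i C' := by
  subst hp hB hs
  simp only [insTerm, hC]

lemma splitSum_length {α A : Type*} [AddCommMonoid A] (K : List α) (f : ℕ → A) :
    splitSum K (fun p _ => f p.length) = ∑ i ∈ Finset.range (K.length + 1), f i := by
  rw [← sum_range_take_drop K fun p _ => f p.length]
  refine Finset.sum_congr rfl fun i hi => ?_
  rw [List.length_take, min_eq_left (by simpa [Nat.lt_succ_iff] using hi)]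

/-- The double sum over start and length of a block is a sum over the cuts of `K` in three: blocks
that pass the bound `K.length` contribute zero, and the remaining pairs of indices are the cuts. The
tail `v` behind the bound is not touched. -/
lemma map_ins {m n l : ℤ} (h : l = m + n) (F : MFam L x m) (y : Fam L cl n)
    (K v K' : List Color) (hK' : K' = K ++ v) (hadm : IsAdm K' x) {A : Type*} [AddCommMonoid A]
    (Ψ : L.obj K' x l →+ A) (g : List Color → List Color → List Color → A)
    (hg : ∀ p B s (hK : K' = p ++ B ++ (s ++ v)), g p B s =
      Ψ (insTerm h F y p B (s ++ v) K' hK p.length True)) :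
    Ψ (ins h F y ⟨K', hadm⟩ K.length) = splitSum K fun p r => splitSum r fun B s => g p B s := by
  have hb : ∀ i j, K' = K'.take i ++ (K'.drop i).take j ++ K'.drop (i + j) := take_block K'
  have h0 : ∀ i j, K.length < i + j →
      insTerm h F y (K'.take i) ((K'.drop i).take j) (K'.drop (i + j)) K' (hb i j) i
        (i + j ≤ K.length) = 0 := fun i j hij => by
    rw [insTerm, dif_neg (fun hc => absurd hc.1 (not_le.2 hij))]
  have hlen : K.length ≤ K'.length := by rw [hK', List.length_append]; omega
  have e1 : ins h F y ⟨K', hadm⟩ K.length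
      = ∑ i ∈ Finset.range (K'.length + 1), ∑ j ∈ Finset.range (K'.length + 1),
          insTerm h F y (K'.take i) ((K'.drop i).take j) (K'.drop (i + j)) K' (hb i j) i
            (i + j ≤ K.length) := rfl
  have e2 : ins h F y ⟨K', hadm⟩ K.length =
      ∑ i ∈ Finset.range (K.length + 1), ∑ j ∈ Finset.range (K.length - i + 1),
          insTerm h F y (K'.take i) ((K'.drop i).take j) (K'.drop (i + j)) K' (hb i j) i
            (i + j ≤ K.length) := by
    rw [e1]
    symm
    rw [← Finset.sum_subset (Finset.range_subset_range.2 (Nat.succ_le_succ hlen))]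
    · refine Finset.sum_congr rfl fun i _ => ?_
      refine Finset.sum_subset (Finset.range_subset_range.2 (by omega)) fun j _ hj => h0 i j ?_
      simp only [Finset.mem_range] at hj
      omega
    · intro i _ hi
      refine Finset.sum_eq_zero fun j _ => h0 i j ?_
      simp only [Finset.mem_range] at hi
      omega
  rw [e2]
  simp only [map_sum]
  rw [← splitSum_length K fun i => ∑ j ∈ Finset.range (K.length - i + 1),
    Ψ (insTerm h F y (K'.take i) ((K'.drop i).take j) (K'.drop (i + j)) K' (hb i j) i
      (i + j ≤ K.length))]
  refine splitSum_congr fun p r hpr => ?_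
  have hr : K.length - p.length = r.length := by rw [← hpr, List.length_append]; omega
  rw [hr, ← splitSum_length r fun j => Ψ (
    insTerm h F y (K'.take p.length) ((K'.drop p.length).take j) (K'.drop (p.length + j)) K'
      (hb _ j) p.length (p.length + j ≤ K.length))]
  refine splitSum_congr fun B s hBs => ?_
  have hK : K' = p ++ B ++ (s ++ v) := by rw [hK', ← hpr, ← hBs]; simp
  rw [hg p B s hK]
  refine congrArg Ψ (insTerm_congr h F y _ _ _ _ _ ?_ ?_ ?_ ?_)
  · rw [hK]; simp
  · rw [hK]; simp
  · rw [hK, ← List.length_append, List.drop_left]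
  · have : K.length = p.length + B.length + s.length := by
      rw [← hpr, ← hBs, List.length_append, List.length_append]; omega
    simp [this]

/-- In `braceAux` the last argument is composed outermost, so the comparison with `insAll` goes
through `insAll_snoc`. The bound of `braceAux` is the length of the part `K` in which the arguments
in `Y` may still be inserted, and `v` is the part to its right. -/
lemma insAll_toM (hL : IsNSOperad L) (A : Keyed L x) (Y : List (Keyed L cl))
    (v K K' : List Color) (hK' : K' = K ++ v) :
    PlainOp.insAll (PlainOp.cls (Y.reverse.map (toM hL))) (fun _ => A.toM hL) [] v K K' =
      if h : IsAdm K' x then wordSign (braceWord A.word Y) • grOf (L := L) ⟨_, _, brace_par A Y⟩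
        (braceAux A.val (Y.map sig) ⟨K', h⟩ K.length) else (0 : GrObj L K' x) := by
  induction Y generalizing v K K' with
  | nil => rfl
  | cons y Y ih =>
    have e : PlainOp.cls ((y :: Y).reverse.map (toM hL)) =
        PlainOp.cls (Y.reverse.map (toM hL)) ++ [⟨cl, y.toM hL⟩] := by simp [PlainOp.cls]
    rw [e, PlainOp.insAll_snoc]
    simp only [splitSum_apply]
    have key : ∀ p B s, PlainOp.cmp (O := envelope hL) p cl (s ++ v) B
        (PlainOp.insAll (PlainOp.cls (Y.reverse.map (toM hL))) (fun _ => A.toM hL) []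
          (cl :: s ++ v) p) (y.toM hL) K' =
        if h : IsAdm K' x ∧ K' = p ++ B ++ (s ++ v) then
          wordSign (braceWord A.word (y :: Y)) • grOf (L := L) ⟨_, _, brace_par A (y :: Y)⟩
            (insTerm (braceDeg_cons A.deg y Y)
              (braceAux A.val (Y.map sig)) y.val p B (s ++ v) K' h.2 p.length True)
          else (0 : GrObj L K' x) := by
      intro p B s
      by_cases hK : K' = p ++ B ++ (s ++ v)
      swap
      · rw [PlainOp.cmp_apply, dif_neg hK, dif_neg (fun h => hK h.2)]
        rfl
      rw [PlainOp.cmp_apply, dif_pos hK, ih (cl :: s ++ v) p (p ++ cl :: (s ++ v)) rfl]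
      change grComp L p (s ++ v) rfl hK (dite _ _ _) (if h : IsAdm B cl then wordSign y.word •
        grOf (L := L) y.mono (y.val ⟨B, h⟩) else (0 : GrObj L B cl)) = _
      by_cases h1 : IsAdm (p ++ cl :: (s ++ v)) x
      swap
      · rw [dif_neg h1]
        split_ifs <;> simp [insTerm, h1]
      by_cases h2 : IsAdm B cl
      swap
      · rw [dif_neg h2]
        split_ifs <;> simp [insTerm, h2]
      have h3 : IsAdm K' x := by rw [hK]; exact isAdm_comp h1 h2
      rw [dif_pos h1, dif_pos h2, dif_pos ⟨h3, hK⟩, insTerm, dif_pos ⟨trivial, h2, h1⟩]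
      exact grComp_word _ _ _ _ _ _ _ _ _ _ _ _ _ _ _
    by_cases h : IsAdm K' x
    · rw [dif_pos h]
      symm
      refine map_ins (braceDeg_cons A.deg y Y) (braceAux A.val (Y.map sig))
        y.val K v K' hK' h (wordSign (braceWord A.word (y :: Y)) • grOf (L := L)
          ⟨_, _, brace_par A (y :: Y)⟩ : L.obj K' x _ →ₗ[k] GrObj L K' x).toAddMonoidHom _ ?_
      intro p B s hK
      exact (key p B s).trans (dif_pos ⟨h, hK⟩)
    · rw [dif_neg h]
      refine splitSum_eq_zero fun p r _ => splitSum_eq_zero fun B s _ => ?_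
      exact (key p B s).trans (dif_neg fun h' => h h'.1)

/-- The brace of keyed families. -/
noncomputable def brace (A : Keyed L x) (Y : List (Keyed L cl)) : Keyed L x where
  word := A.word ++ Y.flatMap word
  deg := braceDeg L A.deg (Y.map sig).reverse
  par := by
    have := brace_par A Y.reverse
    rwa [braceWord_eq, List.reverse_reverse, List.map_reverse] at this
  val := SwissCheese.brace A.val (Y.map sig)

lemma toM_brace (hL : IsNSOperad L) (A : Keyed L x) (Y : List (Keyed L cl)) :
    PlainOp.cbrace (A.toM hL) (Y.map (toM hL)) = (A.brace Y).toM hL := by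
  -- Degree and value of the brace are typed by a reversed list. The statement is generalised to any
  -- keyed family with the right word, degree and value, so that these equalities can be
  -- substituted.
  have h2 : ∀ (Z : List (Keyed L cl)) (B : Keyed L x) (K : List Color),
      B.word = braceWord A.word Z → B.deg = braceDeg L A.deg (Z.map sig) →
      HEq B.val (fun K => braceAux A.val (Z.map sig) K K.1.length : Fam L x _) →
      B.toM hL K = if h : IsAdm K x then wordSign (braceWord A.word Z) •
        grOf (L := L) ⟨_, _, brace_par A Z⟩ (braceAux A.val (Z.map sig) ⟨K, h⟩ K.length)
          else (0 : GrObj L K x) := by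
    rintro Z ⟨w, d, p, a⟩ K hw hd ha
    obtain rfl : w = _ := hw
    obtain rfl : d = _ := hd
    obtain rfl : a = _ := eq_of_heq ha
    rfl
  funext K
  have h1 := insAll_toM hL A Y.reverse [] K K (by simp)
  rw [List.reverse_reverse] at h1
  refine h1.trans (h2 Y.reverse _ K ?_ ?_ ?_).symm
  · simp [brace, braceWord_eq]
  · simp [brace, List.map_reverse]
  · rw [List.map_reverse]; rfl

/-- The brace with one argument. -/
noncomputable abbrev ins₁ (A : Keyed L x) (B : Keyed L cl) {l : ℤ} (h : l = A.deg + B.deg) :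
    Keyed L x where
  word := A.word ++ B.word
  deg := l
  par := by
    rw [h, List.length_append, Nat.cast_add, add_add_add_comm]
    exact A.par.add B.par
  val := pre L x h A.val B.val

lemma toM_ins₁ (hL : IsNSOperad L) (A : Keyed L x) (B : Keyed L cl) {l : ℤ}
    (h : l = A.deg + B.deg) :
    PlainOp.cbrace (A.toM hL) [B.toM hL] = (A.ins₁ B h).toM hL := by
  subst h
  exact (toM_brace hL A [B]).trans (toM_congr hL _ _ (by simp [brace]) rfl HEq.rfl)

/-- The product. -/
noncomputable abbrev mul (A B : Keyed L op) {l : ℤ} (h : l = A.deg + B.deg) : Keyed L op where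
  word := A.word ++ B.word
  deg := l
  par := by
    rw [h, List.length_append, Nat.cast_add, add_add_add_comm]
    exact A.par.add B.par
  val := openMul L h A.val B.val

/-- The open input comes last, so the block inserted there extends to the end of the profile. The
double sum over cuts in the one-argument brace collapses to the single sum of `openMul`. -/
lemma toM_mul (hL : IsNSOperad L) (A B : Keyed L op) {l : ℤ} (h : l = A.deg + B.deg) :
    PlainOp.mul (A.toM hL) (B.toM hL) = (A.mul B h).toM hL := by
  funext K
  have e1 : PlainOp.mul (A.toM hL) (B.toM hL) K = splitSum K fun p r =>
      PlainOp.cmp (O := envelope hL) p op [] r (A.toM hL) (B.toM hL) K := by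
    have : PlainOp.mul (A.toM hL) (B.toM hL) K = splitSum K (fun p r => splitSum r fun B' s =>
      PlainOp.cmp (O := envelope hL) p op (s ++ []) B' (A.toM hL) (B.toM hL)) K := rfl
    rw [this]
    simp only [splitSum_apply]
    refine splitSum_congr' fun p r => ?_
    refine splitSum_eq_last fun B' s hs => ?_
    have h0 : A.toM hL (p ++ op :: (s ++ [])) = 0 := by
      refine A.toM_supp hL _ ?_
      obtain ⟨c, s, rfl⟩ := List.exists_cons_of_ne_nil hs
      refine not_isAdm_op_of_sublist (c := c) (List.Sublist.trans ?_ (List.sublist_append_right _ _))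
      simp
    rw [PlainOp.cmp_apply, h0]
    simp
  rw [e1]
  have key : ∀ p r, PlainOp.cmp (O := envelope hL) p op [] r (A.toM hL) (B.toM hL) K =
      if hc : (IsAdm (p ++ [op]) op ∧ IsAdm r op) ∧ K = p ++ r ++ [] then
        wordSign (A.word ++ B.word) • grOf (L := L) (A.mul B h).mono
          (L.comp p [] rfl hc.2 h (A.val ⟨_, hc.1.1⟩) (B.val ⟨_, hc.1.2⟩))
      else (0 : GrObj L K op) := by
    intro p r
    by_cases hK : K = p ++ r ++ []
    swap
    · rw [PlainOp.cmp_apply, dif_neg hK, dif_neg (fun h => hK h.2)]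
      rfl
    rw [PlainOp.cmp_apply, dif_pos hK]
    change grComp L p [] rfl hK (if h : IsAdm (p ++ [op]) op then wordSign A.word •
        grOf (L := L) A.mono (A.val ⟨_, h⟩) else (0 : GrObj L _ op))
      (if h : IsAdm r op then wordSign B.word • grOf (L := L) B.mono (B.val ⟨r, h⟩)
        else (0 : GrObj L r op)) = _
    by_cases h1 : IsAdm (p ++ [op]) op
    swap
    · rw [dif_neg h1, map_zero, LinearMap.zero_apply, dif_neg fun h' => h1 h'.1.1]
    by_cases h2 : IsAdm r op
    swap
    · rw [dif_neg h2, map_zero, dif_neg fun h' => h2 h'.1.2]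
    rw [dif_pos h1, dif_pos h2, dif_pos ⟨⟨h1, h2⟩, hK⟩]
    exact grComp_word _ _ _ _ _ _ _ _ _ _ _ _ _ _ _
  simp only [key]
  by_cases hadm : IsAdm K op
  swap
  · rw [toM_supp hL _ K hadm]
    refine splitSum_eq_zero fun p r _ => ?_
    refine dif_neg ?_
    rintro ⟨⟨h1, h2⟩, rfl⟩
    exact hadm (isAdm_comp h1 h2)
  obtain ⟨Ψ, hΨ⟩ : ∃ Ψ : L.obj K op l →ₗ[k] GrObj L K op, ∀ y, Ψ y =
      wordSign (A.word ++ B.word) • grOf (L := L) (A.mul B h).mono y :=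
    ⟨wordSign (A.word ++ B.word) • grOf (L := L) (A.mul B h).mono, fun _ => rfl⟩
  have e2 : (A.mul B h).toM hL K = Ψ (openMul L h A.val B.val ⟨K, hadm⟩) :=
    (dif_pos hadm).trans (hΨ _).symm
  have e3 : openMul L h A.val B.val ⟨K, hadm⟩ = ∑ i ∈ Finset.range (K.length + 1),
      if hc : IsAdm (K.take i ++ [op]) op ∧ IsAdm (K.drop i) op then
        L.comp (K.take i) [] rfl (by simp) h (A.val ⟨_, hc.1⟩) (B.val ⟨_, hc.2⟩)
      else 0 := rfl
  rw [e2, e3, map_sum]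
  refine (sum_range_take_drop (A := GrObj L K op) K _).symm.trans ?_
  refine Finset.sum_congr rfl fun i _ => ?_
  by_cases hc : IsAdm (K.take i ++ [op]) op ∧ IsAdm (K.drop i) op
  · rw [dif_pos hc, dif_pos ⟨hc, by simp⟩, hΨ]
  · rw [dif_neg hc, dif_neg fun h' => hc h'.1, map_zero]

/-- The internal differential, multiplied by a letter. -/
noncomputable abbrev diff (θ : ℕ) (A : Keyed L x) {n : ℤ} (h : n = A.deg - 1) : Keyed L x where
  word := θ :: A.word
  deg := n
  par := by
    rw [h, List.length_cons]
    push_cast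
    convert A.par using 1
    ring
  val := dInt L x h A.val

lemma toM_diff (hL : IsNSOperad L) (θ : ℕ) (A : Keyed L x) {n : ℤ} (h : n = A.deg - 1) :
    (envD hL θ).fam (A.toM hL) = (A.diff θ h).toM hL := by
  funext K
  change grD θ (if h : IsAdm K x then wordSign A.word • grOf (L := L) A.mono (A.val ⟨K, h⟩)
    else (0 : GrObj L K x)) = if h' : IsAdm K x then wordSign (θ :: A.word) •
      grOf (L := L) (A.diff θ h).mono (L.d h (A.val ⟨K, h'⟩)) else (0 : GrObj L K x)
  by_cases hadm : IsAdm K x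
  · rw [dif_pos hadm, dif_pos hadm, map_zsmul, grD_of θ A.mono (A.diff θ h).mono
      (Mono.ext rfl h) h, smul_smul, wordSign, mul_comm]
  · rw [dif_neg hadm, dif_neg hadm, map_zero]

/-- The part of a family that belongs to a monomial. -/
noncomputable def part (hL : IsNSOperad L) (p : Mono) :
    (envelope hL).M x →ₗ[k] Fam L x p.deg :=
  LinearMap.pi fun I => (DirectSum.component k Mono (fun p => L.obj I.1 x p.deg) p).comp
    (LinearMap.proj (φ := fun I => GrObj L I x) I.1)

/-- Since an increasing word has sign `1`, a family with such a word is recovered from its image in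
the envelope. -/
lemma part_toM (hL : IsNSOperad L) (A : Keyed L x) :
    part hL A.mono (A.toM hL) = wordSign A.word • A.val := by
  funext I
  change DirectSum.component k Mono (fun p => L.obj I.1 x p.deg) A.mono (if h : IsAdm I.1 x then
    wordSign A.word • grOf (L := L) A.mono (A.val ⟨I.1, h⟩) else (0 : GrObj L I.1 x)) = _
  rw [dif_pos I.2, map_zsmul, grOf, DirectSum.component.lof_self]
  rfl

end Keyed

end SwissCheese

namespace SwissCheese

open Color

universe u v

/-! ### The Maurer–Cartan equation of the twisting element -/

namespace HForest

@[simp] lemma roots_bare (K : List Color) : (bare K).roots = K := by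
  induction K with
  | nil => rfl
  | cons c K ih => simp [bare, roots, ih]

@[simp] lemma leaves_bare (K : List Color) : (bare K).leaves = K := by
  induction K with
  | nil => rfl
  | cons c K ih => simp [bare, leaves, ih]

@[simp] lemma deg_bare (K : List Color) : (bare K).deg = 0 := by
  induction K with
  | nil => rfl
  | cons c K ih => simp [bare, deg, ih]

@[simp] lemma OK_bare (K : List Color) : (bare K).OK := by
  induction K with
  | nil => trivial
  | cons c K ih => simpa [bare, OK] using ih

@[simp] lemma bd_bare (K : List Color) : (bare K).bd = [] := by
  induction K with
  | nil => rfl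
  | cons c K ih => simp [bare, bd, ih]

@[simp] lemma degAfter_bare (K : List Color) (i : ℕ) : (bare K).degAfter i = 0 := by
  induction K generalizing i with
  | nil => rfl
  | cons c K ih => cases i <;> simp [bare, degAfter, ih]

lemma graft_bare (p s : List Color) (t : Color) (G : HForest) :
    (bare (p ++ t :: s)).graft p.length G = (bare p).app (G.app (bare s)) := by
  induction p with
  | nil => rfl
  | cons c p ih => simp [bare, graft, app, ih]

lemma lsum_splits_bare {A : Type*} [AddCommGroup A] (K : List Color) (f : HForest × HForest → A) :
    lsum (bare K).splits f = splitSum K fun p q => f (bare p, bare q) := by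
  induction K generalizing f with
  | nil => simp [bare, splits, splitSum]
  | cons c K ih => simp [bare, splits, splitSum, lsum_map, ih]

lemma valid_corolla {K : List Color} {x : Color} (h : IsGen K x) :
    (node x (bare K) nil).Valid K x (-1 + shift K x) := by
  refine ⟨rfl, ?_, ?_, ?_⟩
  · simp [leaves]
  · simp [deg, genDeg]
  · simpa [OK] using h

end HForest

open HForest

variable {k : Type u} [CommRing k]

lemma hgen_eq_zero {K : List Color} {x : Color} (h : ¬ IsGen K x) : hgen k K x = 0 := by
  refine dif_neg ?_
  rintro ⟨-, -, -, h', -⟩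
  exact h (by simpa using h')

lemma hscInf_comp_hbas (a c : List Color) {I J K : List Color} {t s : Color} {m n l : ℤ}
    (hI : I = a ++ t :: c) (hK : K = a ++ J ++ c) (hl : l = m + n) {F G : HForest}
    (hF : F.Valid I s m) (hG : G.Valid J t n) :
    (hscInf k).comp a c hI hK hl (hbas k I s m F) (hbas k J t n G) =
      sgn (n * F.degAfter a.length) • hbas k K s l (F.graft a.length G) := by
  rw [hbas, dif_pos hF, hbas, dif_pos hG]
  change Finsupp.linearCombination k (fun F : {F : HForest // F.Valid I s m} => Finsupp.linearCombination k
    fun G : {F : HForest // F.Valid J t n} => sgn (n * F.1.degAfter a.length) • hbas k K s l (F.1.graft a.length G.1))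
    (Finsupp.single ⟨F, hF⟩ 1) (Finsupp.single ⟨G, hG⟩ 1) = _
  simp

/-- The basis element of a tree as an element of `(hsc₁)_∞`. -/
noncomputable def hObj (k : Type u) [CommRing k] (K : List Color) (x : Color) (N : ℤ)
    (F : HForest) : (hscInf k).obj K x N := hbas k K x N F

lemma hgen_comp {p B s K : List Color} {t x : Color} (hK : K = p ++ B ++ s)
    (h1 : IsGen (p ++ t :: s) x) (h2 : IsGen B t) {N : ℤ}
    (hN : N = (-1 + shift (p ++ t :: s) x) + (-1 + shift B t)) :
    (hscInf k).comp p s rfl hK hN (hgen k (p ++ t :: s) x) (hgen k B t) =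
      hObj k K x N (node x ((bare p).app (node t (bare B) (bare s))) nil) := by
  rw [hgen, hgen, hscInf_comp_hbas p s rfl hK hN (valid_corolla h1) (valid_corolla h2)]
  simp [degAfter, graft, graft_bare, app, deg]
  rfl

/-- A generator is one vertex on bare leaves, so its boundary is the blow-up of this vertex alone.
Leaves have degree zero, hence moving the new vertex into prefix order costs no sign. -/
lemma hgen_d {K : List Color} {x : Color} {N : ℤ} (hN : N = -1 + shift K x - 1) (hg : IsGen K x) :
    (hscInf k).d hN (hgen k K x) = splitSum K fun p r => splitSum r fun B s =>
      lsum [cl, op] fun t => if IsGen B t ∧ IsGen (p ++ t :: s) x then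
        (- sgn (wt x) * lamSign p s B t (-1)) •
          hObj k K x N (node x ((bare p).app (node t (bare B) (bare s))) nil) else 0 := by
  rw [hgen, hbas, dif_pos (valid_corolla hg)]
  change Finsupp.linearCombination k (fun F : {F : HForest // F.Valid K x (-1 + shift K x)} =>
    lsum F.1.bd fun p => p.1 • hbas k K x N p.2) (Finsupp.single ⟨_, valid_corolla hg⟩ 1) = _
  rw [Finsupp.linearCombination_single, one_smul]
  simp only [bd, bd_bare, List.map_nil, List.append_nil, lsum_map, blow, lsum_flatMap, splits3,
    lsum_splits_bare, roots_bare, deg_bare, mul_zero, sgn_zero, mul_one]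
  refine splitSum_congr' fun p r => splitSum_congr' fun B s => lsum_congr fun t _ => ?_
  split_ifs
  · simp; rfl
  · rfl

variable {P : OpData.{u, v} k} (η : OpHom (hscInf k) P)

lemma twist_eq_zero {x : Color} (K : Adm x) (h : ¬ IsGen K.1 x) : twist η x K = 0 := by
  change η.map (hgen k K.1 x) = 0
  rw [hgen_eq_zero h, map_zero]

/-- A composite of two components of the twisting element. -/
noncomputable def twistComp {n : ℤ} (h : n = -1 + -1) (K : List Color) (x t : Color)
    (p B s : List Color) : (lam P).obj K x n :=
  if hc : K = p ++ B ++ s ∧ IsAdm B t ∧ IsAdm (p ++ t :: s) x then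
    (lam P).comp p s rfl hc.1 h (twist η x ⟨_, hc.2.2⟩) (twist η t ⟨_, hc.2.1⟩) else 0

/-- Since `η` commutes with differentials and compositions, the boundary of a generator is carried
over term by term. The factor `sgn (wt x)` of the suspended differential cancels the one in `blow`.
-/
lemma d_twist {x : Color} (K : Adm x) {n : ℤ} (h : n = -1 - 1) (h' : n = -1 + -1) :
    (lam P).d h (twist η x K) = - splitSum K.1 fun p r => splitSum r fun B s =>
      lsum [cl, op] fun t => twistComp η h' K.1 x t p B s := by
  obtain ⟨K, hK⟩ := K
  by_cases hg : IsGen K x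
  swap
  · rw [twist_eq_zero η _ hg, map_zero, eq_comm, neg_eq_zero]
    refine splitSum_eq_zero fun p r hp => splitSum_eq_zero fun B s hr => ?_
    refine (lsum_congr (g := fun _ => 0) fun t _ => ?_).trans (by simp)
    unfold twistComp
    split_ifs with hc
    · have hx : K = [x] := by
        by_contra hx
        exact hg ⟨hK, hx⟩
      obtain ⟨h1, h2, h3⟩ := hc
      have hB : B ≠ [] := by
        rintro rfl
        simp [IsAdm] at h2
      have h4 : B = [x] ∧ p = [] ∧ s = [] := by
        replace h1 : [x] = p ++ B ++ s := hx.symm.trans h1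
        rcases p with _ | ⟨a, p⟩
        · rcases B with _ | ⟨b, B⟩
          · exact absurd rfl hB
          · simp at h1
            obtain ⟨rfl, rfl, rfl⟩ := h1
            simp
        · simp at h1
          exact absurd h1.2.2.1 hB
      obtain ⟨rfl, rfl, rfl⟩ := h4
      by_cases ht : t = x
      · subst ht
        rw [twist_eq_zero η (x := t) ⟨[t], h2⟩ (fun h => h.2 rfl), map_zero]
      · exfalso
        cases t <;> cases x <;> simp_all [isAdm_cl_iff]
    · rfl
  have hn : n + shift K x = -1 + shift K x - 1 := by rw [h]; ring
  have e1 : ∀ y : P.obj K x (n + shift K x), y = η.map ((hscInf k).d hn (hgen k K x)) →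
      sgn (wt x) • y = - splitSum K fun p r => splitSum r fun B s =>
      lsum [cl, op] fun t => (twistComp η h' K x t p B s : P.obj K x (n + shift K x)) := by
    rintro y rfl
    rw [hgen_d hn hg]
    simp only [lsum_cons, lsum_nil, map_splitSum, map_add, ← splitSum_neg]
    have : ∀ z : P.obj K x (n + shift K x), sgn (wt x) • z =
        (sgn (wt x) • LinearMap.id : P.obj K x (n + shift K x) →ₗ[k] _) z := fun z => rfl
    simp only [this, map_splitSum]
    simp only [← this]
    refine splitSum_congr fun p r hp => splitSum_congr fun B s hr => ?_
    have hpBs : K = p ++ B ++ s := by rw [← hp, ← hr, List.append_assoc]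
    have key : ∀ t, sgn (wt x) • η.map (if IsGen B t ∧ IsGen (p ++ t :: s) x then
        (- sgn (wt x) * lamSign p s B t (-1)) •
          hObj k K x (n + shift K x) (node x ((bare p).app (node t (bare B) (bare s))) nil) else 0) =
        - (twistComp η h' K x t p B s : P.obj K x (n + shift K x)) := by
      intro t
      by_cases hc : IsGen B t ∧ IsGen (p ++ t :: s) x
      · have hN : n + shift K x = (-1 + shift (p ++ t :: s) x) + (-1 + shift B t) :=
          shift_deg rfl hpBs h'
        rw [if_pos hc, map_zsmul, smul_smul, ← hgen_comp hpBs hc.2 hc.1 hN, η.map_comp, twistComp,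
          dif_pos ⟨hpBs, hc.1.1, hc.2.1⟩]
        change _ = - (lamSign p s B t (-1) • P.comp p s rfl hpBs hN (η.map (hgen k (p ++ t :: s) x))
          (η.map (hgen k B t)))
        rw [← neg_smul]
        congr 1
        linear_combination (- lamSign p s B t (-1)) * sgn_mul_self (wt x)
      · have hz : twistComp η h' K x t p B s = 0 := by
          rw [twistComp]
          split_ifs with h4
          · rw [not_and_or] at hc
            rcases hc with hc | hc
            · rw [twist_eq_zero η (x := t) ⟨B, h4.2.1⟩ hc, map_zero]
            · rw [twist_eq_zero η (x := x) ⟨p ++ t :: s, h4.2.2⟩ hc, map_zero,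
                LinearMap.zero_apply]
          · rfl
        rw [if_neg hc, map_zero, smul_zero, hz]
        exact neg_zero.symm
    rw [smul_add, smul_add, key, key]
    simp
    abel
  exact e1 _ (η.map_d hn _).symm

/-- This identifies the terms of the boundary in which the inner generator has closed output. Those
with open output, where the inner block always ends the profile, are identified in `openMul_twist`.
-/
lemma pre_twist {x : Color} (K : Adm x) {n : ℤ} (h' : n = -1 + -1) :
    pre (lam P) x h' (twist η x) (twist η cl) K = splitSum K.1 fun p r => splitSum r fun B s =>
      twistComp η h' K.1 x cl p B s := by
  refine Keyed.map_ins h' (fun K _ => twist η x K) (twist η cl) K.1 [] K.1 (by simp) K.2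
    (AddMonoidHom.id _) _ ?_
  intro p B s hK
  have hK' : K.1 = p ++ B ++ s := by rw [hK, List.append_nil]
  rw [AddMonoidHom.id_apply, Keyed.insTerm_congr h' _ _ hK hK' _ True True rfl rfl
    (List.append_nil s) Iff.rfl, twistComp, Keyed.insTerm]
  by_cases hc : IsAdm B cl ∧ IsAdm (p ++ cl :: s) x
  · rw [dif_pos ⟨hK', hc⟩, dif_pos ⟨trivial, hc⟩]
  · rw [dif_neg fun h => hc h.2, dif_neg fun h => hc h.2]

lemma openMul_twist (K : Adm op) {n : ℤ} (h' : n = -1 + -1) :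
    openMul (lam P) h' (twist η op) (twist η op) K = splitSum K.1 fun p r => splitSum r fun B s =>
      twistComp η h' K.1 op op p B s := by
  have e : openMul (lam P) h' (twist η op) (twist η op) K = ∑ i ∈ Finset.range (K.1.length + 1),
      if hc : IsAdm (K.1.take i ++ [op]) op ∧ IsAdm (K.1.drop i) op then
        (lam P).comp (K.1.take i) [] rfl (by simp) h' (twist η op ⟨_, hc.1⟩) (twist η op ⟨_, hc.2⟩)
      else 0 := rfl
  have e2 : ∀ p r, (splitSum r fun B s => twistComp η h' K.1 op op p B s) =
      twistComp η h' K.1 op op p r [] := fun p r => by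
    refine splitSum_eq_last fun B s hs => ?_
    rw [twistComp, dif_neg]
    rintro ⟨-, -, h⟩
    obtain ⟨c, s, rfl⟩ := List.exists_cons_of_ne_nil hs
    refine not_isAdm_op_of_sublist (c := c) (List.Sublist.trans ?_ (List.sublist_append_right _ _)) h
    simp
  simp only [e2]
  rw [e, ← sum_range_take_drop]
  refine Finset.sum_congr rfl fun i _ => ?_
  rw [twistComp]
  by_cases hc : IsAdm (K.1.take i ++ [op]) op ∧ IsAdm (K.1.drop i) op
  · rw [dif_pos hc, dif_pos ⟨by simp, hc.2, hc.1⟩]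
  · rw [dif_neg hc, dif_neg fun h => hc ⟨h.2.2, h.2.1⟩]

/-- An admissible profile with closed output has no open input, so only composites through the
closed colour occur. This is the closed Maurer–Cartan equation. -/
lemma dInt_twist_cl {n : ℤ} (h : n = -1 - 1) (h' : n = -1 + -1) :
    dInt (lam P) cl h (twist η cl) = - pre (lam P) cl h' (twist η cl) (twist η cl) := by
  funext K
  rw [Pi.neg_apply, pre_twist]
  refine (d_twist η K h h').trans (congrArg _ (splitSum_congr' fun p r => splitSum_congr' fun B s => ?_))
  have : twistComp η h' K.1 cl op p B s = 0 := by
    rw [twistComp, dif_neg]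
    rintro ⟨-, -, h⟩
    exact not_isAdm_cl_of_mem (by simp) h
  simp [this]

/-- Composites through a closed input and through the open input give the two terms of the open
Maurer–Cartan equation. -/
lemma dInt_twist_op {n : ℤ} (h : n = -1 - 1) (h' : n = -1 + -1) :
    dInt (lam P) op h (twist η op) = - pre (lam P) op h' (twist η op) (twist η cl) -
      openMul (lam P) h' (twist η op) (twist η op) := by
  funext K
  rw [Pi.sub_apply, Pi.neg_apply, pre_twist, openMul_twist, ← neg_add', ← splitSum_add]
  refine (d_twist η K h h').trans (congrArg _ (splitSum_congr' fun p r => ?_))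
  rw [← splitSum_add]
  refine splitSum_congr' fun B s => ?_
  simp

end SwissCheese

namespace SwissCheese

open Color

universe u v

variable {k : Type u} [CommRing k]

/-! ### The twisted differential on the envelope -/

namespace PlainOp

variable {O : PlainOp.{u, v} k}

/-- The indices stand for two copies of the differential with different letters, and the
antisymmetry hypotheses express that exchanging the letters changes the sign. After expansion by the
Leibniz rule and the brace relation, each term cancels its mirror image, except those from `e₁{e₂}`,
which the Maurer–Cartan equation `h1` removes. -/
lemma Deriv.dcl_dcl_eq_zero (D₁ D₂ : Deriv O) (e₁ e₂ a : O.M cl)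
    (h0 : D₁.fam (D₂.fam a) = 0) (h1 : D₁.fam e₂ = - cbrace e₁ [e₂])
    (h2 : cbrace e₂ [D₁.fam a] = - cbrace e₁ [D₂.fam a])
    (h3 : cbrace (D₁.fam a) [e₂] = - cbrace (D₂.fam a) [e₁])
    (h4 : cbrace e₂ [a, e₁] = - cbrace e₁ [a, e₂])
    (h5 : cbrace e₂ [e₁, a] = - cbrace e₁ [e₂, a])
    (h6 : cbrace e₂ [cbrace a [e₁]] = - cbrace e₁ [cbrace a [e₂]])
    (h7 : cbrace a [cbrace e₁ [e₂]] = - cbrace a [cbrace e₂ [e₁]])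
    (h8 : cbrace a [e₂, e₁] = - cbrace a [e₁, e₂]) : D₁.dcl e₁ (D₂.dcl e₂ a) = 0 := by
  have hl : ∀ b c : O.M cl, cbrace e₁ [b + c] = cbrace e₁ [b] + cbrace e₁ [c] := fun b c =>
    (cbrace_mlin e₁).add [] [] b c
  have hs : ∀ b c : O.M cl, cbrace e₁ [b - c] = cbrace e₁ [b] - cbrace e₁ [c] := fun b c =>
    (cbrace_mlin e₁).sub [] [] b c
  have hn : ∀ b c : O.M cl, cbrace b [-c] = - cbrace b [c] := fun b c => by
    have := (cbrace_mlin b).sub [] [] 0 c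
    have h0 : cbrace b [0] = 0 := brace_zero_item b [] [] cl
    simpa [h0] using this
  have hbr : ∀ b c d : O.M cl, cbrace (cbrace b [c]) [d] =
      cbrace b [cbrace c [d]] + cbrace b [c, d] + cbrace b [d, c] := fun b c d => by
    rw [cbrace_cbrace_singleton]
    have hc : cbrace c [] = c := rfl
    simp only [splitSum₃, splitSum, List.nil_append, List.cons_append, hc]
    abel
  have hfam : ∀ b c : O.M cl, D₁.fam (cbrace b [c]) = cbrace (D₁.fam b) [c] +
      cbrace b [D₁.fam c] := fun b c => by
    rw [D₁.fam_cbrace]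
    simp [leib]
  simp only [Deriv.dcl, map_add, map_sub, hfam, h0, h1, cbrace_add, cbrace_sub, cbrace_neg, hl, hs,
    hn, hbr, h2, h3, h4, h5, h6, h7, h8]
  abel

/-- The cancellation is that of the closed case. In addition, the product is associative and the
insertion of `e₁` is a derivation of it, so the mixed terms also cancel in pairs. -/
lemma Deriv.dop_dop_eq_zero (D₁ D₂ : Deriv O) (e₁ e₂ : O.M cl) {f₁ f₂ a : O.M op}
    (hf₁ : Supp f₁) (hf₂ : Supp f₂) (ha : Supp a) (he₁ : Supp e₁)
    (h0 : D₁.fam (D₂.fam a) = 0) (h1 : D₁.fam e₂ = - cbrace e₁ [e₂])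
    (h1' : D₁.fam f₂ = - cbrace f₁ [e₂] - mul f₁ f₂)
    (h2 : mul f₂ (D₁.fam a) = - mul f₁ (D₂.fam a))
    (h3 : cbrace (D₁.fam a) [e₂] = - cbrace (D₂.fam a) [e₁])
    (h4 : mul (D₁.fam a) f₂ = - mul (D₂.fam a) f₁)
    (h5 : mul (cbrace f₁ [e₂]) a = - mul (cbrace f₂ [e₁]) a)
    (h6 : mul a (mul f₁ f₂) = - mul a (mul f₂ f₁))
    (h6' : mul f₁ (mul f₂ a) = - mul f₂ (mul f₁ a))
    (h7 : cbrace a [cbrace e₁ [e₂]] = - cbrace a [cbrace e₂ [e₁]])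
    (h8 : cbrace a [e₂, e₁] = - cbrace a [e₁, e₂])
    (h9 : mul f₁ (mul a f₂) = - mul f₂ (mul a f₁))
    (h10 : mul f₁ (cbrace a [e₂]) = - mul f₂ (cbrace a [e₁]))
    (h11 : mul a (cbrace f₁ [e₂]) = - mul a (cbrace f₂ [e₁]))
    (h12 : mul (cbrace a [e₁]) f₂ = - mul (cbrace a [e₂]) f₁) :
    D₁.dop e₁ f₁ (D₂.dop e₂ f₂ a) = 0 := by
  have hn : ∀ (b : O.M op) (c : O.M cl), cbrace b [-c] = - cbrace b [c] := fun b c => by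
    have := (cbrace_mlin b).sub [] [] 0 c
    have h0 : cbrace b [0] = 0 := brace_zero_item b [] [] cl
    simpa [h0] using this
  have hnl : ∀ b c : O.M op, mul (-b) c = - mul b c := fun b c => by
    obtain ⟨l, hl⟩ := brace_linear_left (k := k) (x := op) [(⟨op, c⟩ : O.Item)]
    simp only [mul, hl, map_neg]
  have hnr : ∀ b c : O.M op, mul b (-c) = - mul b c := fun b c => by
    obtain ⟨l, hl⟩ := mul_linear_right (k := k) b
    simp only [hl, map_neg]
  have hbr : ∀ (b : O.M op) (c d : O.M cl), cbrace (cbrace b [c]) [d] =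
      cbrace b [cbrace c [d]] + cbrace b [c, d] + cbrace b [d, c] := fun b c d => by
    rw [cbrace_cbrace_singleton]
    have hc : cbrace c [] = c := rfl
    simp only [splitSum₃, splitSum, List.nil_append, List.cons_append, hc]
    abel
  have hfam : ∀ (b : O.M op) (c : O.M cl), D₁.fam (cbrace b [c]) = cbrace (D₁.fam b) [c] +
      cbrace b [D₁.fam c] := fun b c => by
    rw [D₁.fam_cbrace]
    simp [leib]
  have hm : ∀ (b c : O.M op), Supp b → cbrace (mul b c) [e₁] =
      mul b (cbrace c [e₁]) + mul (cbrace b [e₁]) c := fun b c hb => by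
    rw [cbrace_mul hb c (by simpa using he₁)]
    rfl
  simp only [Deriv.dop, map_add, map_sub, hfam, D₁.fam_mul, h0, h1, h1', cbrace_add, cbrace_sub,
    mul_add_left, mul_sub_left, mul_add_right, mul_sub_right, hn, hnl, hnr, hbr, hm f₂ a hf₂,
    hm a f₂ ha, mul_assoc hf₁, mul_assoc hf₂, mul_assoc ha, h2, h3, h4, h5, h6, h6', h7, h8, h9, h10,
    h11, h12]
  abel

end PlainOp

namespace Keyed

variable {L : OpData.{u, v} k} {x : Color}

/-- The map `toM` for a fixed word and degree, as a linear map. -/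
noncomputable def lin (hL : IsNSOperad L) (w : List ℕ) (d : ℤ) (p : Even (d + w.length)) :
    Fam L x d →ₗ[k] (envelope hL).M x where
  toFun a := (⟨w, d, p, a⟩ : Keyed L x).toM hL
  map_add' a b := by
    funext I
    change (if h : IsAdm I x then wordSign w • grOf (L := L) ⟨(w : Multiset ℕ), d, p⟩ ((a + b) ⟨I, h⟩)
      else (0 : GrObj L I x)) = (if h : IsAdm I x then wordSign w • grOf (L := L)
      ⟨(w : Multiset ℕ), d, p⟩ (a ⟨I, h⟩) else (0 : GrObj L I x)) + (if h : IsAdm I x then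
      wordSign w • grOf (L := L) ⟨(w : Multiset ℕ), d, p⟩ (b ⟨I, h⟩) else (0 : GrObj L I x))
    by_cases h : IsAdm I x
    · rw [dif_pos h, dif_pos h, dif_pos h, Pi.add_apply, map_add, smul_add]
    · rw [dif_neg h, dif_neg h, dif_neg h, add_zero]
  map_smul' r a := by
    funext I
    change (if h : IsAdm I x then wordSign w • grOf (L := L) ⟨(w : Multiset ℕ), d, p⟩ ((r • a) ⟨I, h⟩)
      else (0 : GrObj L I x)) = r • (if h : IsAdm I x then wordSign w • grOf (L := L)
      ⟨(w : Multiset ℕ), d, p⟩ (a ⟨I, h⟩) else (0 : GrObj L I x))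
    by_cases h : IsAdm I x
    · rw [dif_pos h, dif_pos h, Pi.smul_apply, map_smul, smul_comm]
    · rw [dif_neg h, dif_neg h, smul_zero]

lemma toM_eq_lin (hL : IsNSOperad L) (A : Keyed L x) :
    A.toM hL = lin hL A.word A.deg A.par A.val := rfl

end Keyed

variable {P : OpData.{u, v} k}

/-- The twisting element with coefficient the letter `i`. -/
noncomputable def hat (η : OpHom (hscInf k) P) (x : Color) (i : ℕ) : Keyed (lam P) x :=
  ⟨[i], -1, by simp, twist η x⟩

section

variable (hL : IsNSOperad (lam P)) (η : OpHom (hscInf k) P)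

/-- The Maurer–Cartan equation is carried to the envelope by `Keyed.lin` for the word `[i, j]`. The
differential brings the letter `i`, and the copy to which it is applied has the letter `j`. -/
lemma fam_hat_cl (i j : ℕ) : (envD hL i).fam ((hat η cl j).toM hL) =
    - PlainOp.cbrace ((hat η cl i).toM hL) [(hat η cl j).toM hL] := by
  rw [Keyed.toM_diff hL i _ (rfl : (-2 : ℤ) = (hat η cl j).deg - 1),
    Keyed.toM_ins₁ hL _ _ (rfl : (-2 : ℤ) = (hat η cl i).deg + (hat η cl j).deg)]
  have h := dInt_twist_cl η (rfl : (-2 : ℤ) = -1 - 1) rfl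
  have h' := congrArg (Keyed.lin hL [i, j] (-2) ⟨0, rfl⟩) h
  rw [map_neg] at h'
  exact h'

lemma fam_hat_op (i j : ℕ) : (envD hL i).fam ((hat η op j).toM hL) =
    - PlainOp.cbrace ((hat η op i).toM hL) [(hat η cl j).toM hL] -
      PlainOp.mul ((hat η op i).toM hL) ((hat η op j).toM hL) := by
  rw [Keyed.toM_diff hL i _ (rfl : (-2 : ℤ) = (hat η op j).deg - 1),
    Keyed.toM_ins₁ hL _ _ (rfl : (-2 : ℤ) = (hat η op i).deg + (hat η cl j).deg),
    Keyed.toM_mul hL _ _ (rfl : (-2 : ℤ) = (hat η op i).deg + (hat η op j).deg)]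
  have h := dInt_twist_op η (rfl : (-2 : ℤ) = -1 - 1) rfl
  have h' := congrArg (Keyed.lin hL [i, j] (-2) ⟨0, rfl⟩) h
  rw [map_sub, map_neg] at h'
  exact h'

lemma par_cons {d n : ℤ} {w : List ℕ} (p : Even (d + w.length)) (h : n = d - 1) (i : ℕ) :
    Even (n + (i :: w).length) := by
  rw [h, List.length_cons]
  push_cast
  convert p using 1
  ring

/-- The letter `i` passes as many letters as `w` has, a number of the parity of `d`. This accounts
for the factors `(-1)^|ψ|` in the differentials of `defPair`. -/
lemma wordSign_concat {d : ℤ} {w : List ℕ} (p : Even (d + w.length)) (i : ℕ) :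
    wordSign (w ++ [i]) = sgn d * wordSign (i :: w) := by
  have h := wordSign_swap [] w [i] []
  simp only [List.nil_append, List.append_nil, List.length_singleton, Nat.cast_one, mul_one,
    List.singleton_append] at h
  rw [h]
  congr 1
  exact Mono.sgn_card ⟨(w : Multiset ℕ), d, p⟩

/-- The twisted differential on the envelope is the differential of the deformation complex. -/
lemma tw_toM (i : ℕ) (c : Color) (A : Keyed (lam P) c) {n : ℤ} (h : n = A.deg - 1) :
    (envD hL i).tw ((hat η cl i).toM hL) ((hat η op i).toM hL) c (A.toM hL) =
      (⟨i :: A.word, n, par_cons A.par h i, (defPair η).d c h A.val⟩ : Keyed (lam P) c).toM hL := by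
  have hp : (A.word ++ [i]).Perm (i :: A.word) := List.perm_append_singleton i A.word
  have hr : ∀ {x : Color} (v : Fam (lam P) x n) (q : Even (n + (A.word ++ [i]).length)),
      (⟨A.word ++ [i], n, q, v⟩ : Keyed (lam P) x).toM hL =
        sgn A.deg • Keyed.lin hL (i :: A.word) n (par_cons A.par h i) v := fun v q =>
    Keyed.toM_eq_of_word hL _ ⟨i :: A.word, n, par_cons A.par h i, v⟩ _ rfl HEq.rfl hp
      (wordSign_concat A.par i)
  cases c with
  | cl =>
    change (envD hL i).fam _ + PlainOp.cbrace _ [_] - PlainOp.cbrace _ [_] =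
      Keyed.lin hL (i :: A.word) n (par_cons A.par h i) (dInt (lam P) cl h A.val +
        pre (lam P) cl _ (twist η cl) A.val - sgn A.deg • pre (lam P) cl _ A.val (twist η cl))
    rw [map_sub, map_add, map_zsmul, Keyed.toM_diff hL i A h,
      Keyed.toM_ins₁ hL (hat η cl i) A (by change n = -1 + A.deg; omega),
      Keyed.toM_ins₁ hL A (hat η cl i) (by change n = A.deg + -1; omega), ← hr]
    rfl
  | op =>
    change (envD hL i).fam _ + PlainOp.mul _ _ - PlainOp.cbrace _ [_] - PlainOp.mul _ _ =
      Keyed.lin hL (i :: A.word) n (par_cons A.par h i) (dInt (lam P) op h A.val +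
        openMul (lam P) _ (twist η op) A.val - sgn A.deg • pre (lam P) op _ A.val (twist η cl) -
          sgn A.deg • openMul (lam P) _ A.val (twist η op))
    rw [map_sub, map_sub, map_add, map_zsmul, map_zsmul, Keyed.toM_diff hL i A h,
      Keyed.toM_mul hL (hat η op i) A (by change n = -1 + A.deg; omega),
      Keyed.toM_ins₁ hL A (hat η cl i) (by change n = A.deg + -1; omega),
      Keyed.toM_mul hL A (hat η op i) (by change n = A.deg + -1; omega), ← hr, ← hr]
    rfl

/-- The square of the differential of the deformation complex, on the envelope. -/
lemma tw_tw_toM (i j : ℕ) (c : Color) (A : Keyed (lam P) c) :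
    (envD hL i).tw ((hat η cl i).toM hL) ((hat η op i).toM hL) c
      ((envD hL j).tw ((hat η cl j).toM hL) ((hat η op j).toM hL) c (A.toM hL)) = 0 := by
  have hd : ∀ (x : Color) (A : Keyed (lam P) x) (i : ℕ), (envD hL i).fam (A.toM hL) =
    (A.diff i (rfl : A.deg - 1 = _)).toM hL := fun x A i => Keyed.toM_diff hL i A rfl
  have hb : ∀ (x : Color) (A : Keyed (lam P) x) (B : Keyed (lam P) cl),
      PlainOp.cbrace (A.toM hL) [B.toM hL] = (A.brace [B]).toM hL :=
    fun x A B => Keyed.toM_brace hL A [B]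
  have hb2 : ∀ (x : Color) (A : Keyed (lam P) x) (B C : Keyed (lam P) cl),
      PlainOp.cbrace (A.toM hL) [B.toM hL, C.toM hL] = (A.brace [B, C]).toM hL :=
    fun x A B C => Keyed.toM_brace hL A [B, C]
  have hm : ∀ (A B : Keyed (lam P) op),
      PlainOp.mul (A.toM hL) (B.toM hL) = (A.mul B rfl).toM hL := fun A B => Keyed.toM_mul hL A B rfl
  have h0 : (envD hL i).fam ((envD hL j).fam (A.toM hL)) = 0 := by
    rw [hd, hd]
    have : dInt (lam P) c (rfl : A.deg - 1 - 1 = _) (dInt (lam P) c (rfl : A.deg - 1 = _) A.val) =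
      0 := by
      funext K
      exact hL.d_d rfl rfl _
    change Keyed.lin hL _ _ _ _ = 0
    rw [this, map_zero]
  have h7 : PlainOp.cbrace (A.toM hL) [PlainOp.cbrace ((hat η cl i).toM hL) [(hat η cl j).toM hL]] =
      - PlainOp.cbrace (A.toM hL) [PlainOp.cbrace ((hat η cl j).toM hL) [(hat η cl i).toM hL]] := by
    rw [hb, hb, hb, hb]
    exact Keyed.toM_swap hL _ _ A.word [] [] i j (by simp [Keyed.brace, hat])
      (by simp [Keyed.brace, hat]) rfl HEq.rfl
  have h8 : PlainOp.cbrace (A.toM hL) [(hat η cl j).toM hL, (hat η cl i).toM hL] =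
      - PlainOp.cbrace (A.toM hL) [(hat η cl i).toM hL, (hat η cl j).toM hL] := by
    rw [hb2, hb2]
    exact Keyed.toM_swap hL _ _ A.word [] [] j i (by simp [Keyed.brace, hat])
      (by simp [Keyed.brace, hat]) rfl HEq.rfl
  have h3 : PlainOp.cbrace ((envD hL i).fam (A.toM hL)) [(hat η cl j).toM hL] =
      - PlainOp.cbrace ((envD hL j).fam (A.toM hL)) [(hat η cl i).toM hL] := by
    rw [hd, hd, hb, hb]
    exact Keyed.toM_swap hL _ _ [] A.word [] i j (by simp [Keyed.brace, hat])
      (by simp [Keyed.brace, hat]) rfl HEq.rfl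
  cases c with
  | cl =>
    refine PlainOp.Deriv.dcl_dcl_eq_zero _ _ _ _ _ h0 (fam_hat_cl hL η i j) ?_ h3 ?_ ?_ ?_ h7 h8
    · rw [hd, hd, hb, hb]
      exact Keyed.toM_swap hL _ _ [] [] A.word j i (by simp [Keyed.brace, hat])
        (by simp [Keyed.brace, hat]) rfl HEq.rfl
    · rw [hb2, hb2]
      exact Keyed.toM_swap hL _ _ [] A.word [] j i (by simp [Keyed.brace, hat])
        (by simp [Keyed.brace, hat]) rfl HEq.rfl
    · rw [hb2, hb2]
      exact Keyed.toM_swap hL _ _ [] [] A.word j i (by simp [Keyed.brace, hat])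
        (by simp [Keyed.brace, hat]) rfl HEq.rfl
    · rw [hb, hb, hb, hb]
      exact Keyed.toM_swap hL _ _ [] A.word [] j i (by simp [Keyed.brace, hat])
        (by simp [Keyed.brace, hat]) rfl HEq.rfl
  | op =>
    refine PlainOp.Deriv.dop_dop_eq_zero _ _ _ _ (Keyed.toM_supp hL _) (Keyed.toM_supp hL _)
      (Keyed.toM_supp hL _) (Keyed.toM_supp hL _) h0 (fam_hat_cl hL η i j) (fam_hat_op hL η i j)
      ?_ h3 ?_ ?_ ?_ ?_ h7 h8 ?_ ?_ ?_ ?_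
    · rw [hd, hd, hm, hm]
      exact Keyed.toM_swap hL _ _ [] [] A.word j i (by simp [hat])
        (by simp [hat]) rfl HEq.rfl
    · rw [hd, hd, hm, hm]
      exact Keyed.toM_swap hL _ _ [] A.word [] i j (by simp [hat])
        (by simp [hat]) rfl HEq.rfl
    · rw [hb, hb, hm, hm]
      exact Keyed.toM_swap hL _ _ [] [] A.word i j (by simp [Keyed.brace, hat])
        (by simp [Keyed.brace, hat]) rfl HEq.rfl
    · rw [hm, hm, hm, hm]
      exact Keyed.toM_swap hL _ _ A.word [] [] i j (by simp [hat])
        (by simp [hat]) rfl HEq.rfl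
    · rw [hm, hm, hm, hm]
      exact Keyed.toM_swap hL _ _ [] [] A.word i j (by simp [hat])
        (by simp [hat]) rfl HEq.rfl
    · rw [hm, hm, hm, hm]
      exact Keyed.toM_swap hL _ _ [] A.word [] i j (by simp [hat])
        (by simp [hat]) rfl HEq.rfl
    · rw [hb, hb, hm, hm]
      exact Keyed.toM_swap hL _ _ [] A.word [] i j (by simp [Keyed.brace, hat])
        (by simp [Keyed.brace, hat]) rfl HEq.rfl
    · rw [hb, hb, hm, hm]
      exact Keyed.toM_swap hL _ _ A.word [] [] i j (by simp [Keyed.brace, hat])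
        (by simp [Keyed.brace, hat]) rfl HEq.rfl
    · rw [hb, hb, hm, hm]
      exact Keyed.toM_swap hL _ _ A.word [] [] i j (by simp [Keyed.brace, hat])
        (by simp [Keyed.brace, hat]) rfl HEq.rfl

/-- The differential of the deformation complex squares to zero. -/
lemma defPair_d_d {P : OpData.{u, v} k} (hL : IsNSOperad (lam P)) (η : OpHom (hscInf k) P) (c : Color) {m n l : ℤ} (h : n = m - 1) (h' : l = n - 1) (a : Fam (lam P) c m) :
    (defPair η).d c h' ((defPair η).d c h a) = 0 := by
  have key : ∀ (w : List ℕ) (p : Even (m + w.length)), wordSign (0 :: 1 :: w) = 1 →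
      (defPair η).d c h' ((defPair η).d c h a) = 0 := by
    intro w p hw
    have h1 := tw_tw_toM hL η 0 1 c ⟨w, m, p, a⟩
    rw [tw_toM hL η 1 c _ h, tw_toM hL η 0 c _ h'] at h1
    have h2 := Keyed.part_toM hL (⟨0 :: 1 :: w, l, par_cons (par_cons p h 1) h' 0,
      (defPair η).d c h' ((defPair η).d c h a)⟩ : Keyed (lam P) c)
    rw [h1, map_zero] at h2
    simp only [hw] at h2
    exact (one_smul ℤ _).symm.trans h2.symm
  -- The word must have the parity of `m` and avoid the letters `0` and `1` of the two
  -- differentials. The choices `[]` and `[2]` keep the total word increasing, so its sign is `1`.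
  rcases Int.even_or_odd m with hm | hm
  · exact key [] (by simpa using hm) (by simp [wordSign, biSign, letSign])
  · exact key [2] (by simpa using hm.add_one) (by simp [wordSign, biSign, letSign])

end

end SwissCheese

namespace SwissCheese

open Color Vtx

universe u v

variable {k : Type u} [CommRing k]

/-! ### Evaluation of forests in keyed families -/

namespace Forest

/-- The vertices in the canonical order. -/
def verts : Forest → List Vtx
  | nil => []
  | cons v ch r => v :: (ch.verts ++ r.verts)

lemma verts_perm (F : Forest) : F.verts.Perm (F.names.map neu ++ F.labels.map lab) := by
  induction F with
  | nil => rfl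
  | cons v ch r ih₁ ih₂ =>
    have h := ih₁.append ih₂
    have h' : (ch.names.map neu ++ ch.labels.map lab ++ (r.names.map neu ++ r.labels.map lab)).Perm
        ((ch.names ++ r.names).map neu ++ (ch.labels ++ r.labels).map lab) := by
      simp only [List.map_append, List.append_assoc]
      refine List.Perm.append_left _ ?_
      rw [← List.append_assoc, ← List.append_assoc]
      exact List.Perm.append_right _ List.perm_append_comm
    cases v with
    | neu e => exact (h.trans h').cons _
    | lab i => exact ((h.trans h').cons _).trans List.perm_middle.symm

end Forest

/-- The neutral vertices named `0, …, r - 1` and the labels `0, …, n - 1`. -/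
def canonVerts (r n : ℕ) : List Vtx := (List.range r).map neu ++ (List.range n).map lab

/-- Exchanging two blocks of letters costs the Koszul sign of their parities, which `p` prescribes.
The total sign `ε` is therefore the same for all systems of letters `κ`. -/
lemma wordSign_flatMap_perm {β : Type*} {l l' : List β} (h : l.Perm l') (p : β → ℤ) :
    ∃ ε : ℤ, ε * ε = 1 ∧ ∀ κ : β → List ℕ, (∀ w, Even (p w + (κ w).length)) →
      wordSign (l.flatMap κ) = ε * wordSign (l'.flatMap κ) := by
  induction h with
  | nil => exact ⟨1, rfl, fun κ _ => by simp⟩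
  | cons x h ih =>
    obtain ⟨ε, h1, h2⟩ := ih
    refine ⟨ε, h1, fun κ hκ => ?_⟩
    have hp : ((List.flatMap κ _ : List ℕ) : Multiset ℕ) = (List.flatMap κ _ : List ℕ) :=
      Multiset.coe_eq_coe.2 (h.flatMap_right κ)
    rw [List.flatMap_cons, List.flatMap_cons, wordSign_append, wordSign_append, h2 κ hκ, hp]
    ring
  | swap x y l =>
    refine ⟨sgn (p x * p y), sgn_mul_self _, fun κ hκ => ?_⟩
    have := wordSign_swap [] (κ y) (κ x) (l.flatMap κ)
    simp only [List.nil_append] at this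
    rw [List.flatMap_cons, List.flatMap_cons, List.flatMap_cons, List.flatMap_cons,
      ← List.append_assoc, ← List.append_assoc, this]
    congr 1
    have := Mono.sgn_card_mul ⟨(κ y : Multiset ℕ), p y, hκ y⟩ ⟨(κ x : Multiset ℕ), p x, hκ x⟩
    rw [mul_comm (p x)]
    exact this
  | trans _ _ ih₁ ih₂ =>
    obtain ⟨ε, h1, h2⟩ := ih₁
    obtain ⟨ε', h1', h2'⟩ := ih₂
    refine ⟨ε * ε', by linear_combination (ε' * ε') * h1 + h1', fun κ hκ => ?_⟩
    rw [h2 κ hκ, h2' κ hκ, mul_assoc]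

lemma wordSign_eq_one {l : List ℕ} (h : l.Pairwise (· < ·)) : wordSign l = 1 := by
  induction h with
  | nil => rfl
  | @cons a l h _ ih =>
    rw [wordSign, ih, mul_one, biSign, Multiset.map_singleton, Multiset.prod_singleton]
    refine Multiset.prod_eq_one fun x hx => ?_
    obtain ⟨j, hj, rfl⟩ := Multiset.mem_map.1 hx
    have := h j (by simpa using hj)
    simp [letSign, this.ne, this.not_gt]

namespace Keyed

variable {L : OpData.{u, v} k} {x : Color}

lemma sig_eq_iff {A B : Keyed L x} : A.sig = B.sig ↔ A.deg = B.deg ∧ HEq A.val B.val := by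
  simp [sig]

/-- Words are only concatenated and never influence values, so degree and value of a composite
depend only on those of its entries. -/
lemma brace_sig {A B : Keyed L x} {Y Z : List (Keyed L cl)} (h : A.sig = B.sig)
    (h' : Y.map sig = Z.map sig) : (A.brace Y).sig = (B.brace Z).sig := by
  obtain ⟨w, d, p, a⟩ := A
  obtain ⟨w', d', p', a'⟩ := B
  obtain ⟨rfl, h⟩ := sig_eq_iff.1 h
  obtain rfl := eq_of_heq h
  simp only [sig, brace]
  rw [show (Y.map fun A => (⟨A.deg, A.val⟩ : Σ e : ℤ, Fam L cl e)) =
    Z.map fun A => (⟨A.deg, A.val⟩ : Σ e : ℤ, Fam L cl e) from h']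

lemma mul_sig {A B A' B' : Keyed L op} (h : A.sig = A'.sig) (h' : B.sig = B'.sig) :
    (A.mul B rfl).sig = (A'.mul B' rfl).sig := by
  obtain ⟨w, d, p, a⟩ := A
  obtain ⟨w', d', p', a'⟩ := A'
  obtain ⟨v, e, q, b⟩ := B
  obtain ⟨v', e', q', b'⟩ := B'
  obtain ⟨rfl, h⟩ := sig_eq_iff.1 h
  obtain rfl := eq_of_heq h
  obtain ⟨rfl, h'⟩ := sig_eq_iff.1 h'
  obtain rfl := eq_of_heq h'
  rfl

lemma braceDeg_eq (d : ℤ) (Y : List (Keyed L cl)) :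
    braceDeg L d (Y.map sig).reverse = d + (Y.map deg).sum := by
  rw [← List.map_reverse, ← List.sum_reverse, ← List.map_reverse]
  induction Y.reverse with
  | nil => simp [braceDeg]
  | cons y Z ih => rw [braceDeg_cons, ih, List.map_cons, List.sum_cons]; ring

variable (K : ∀ c : Color, Vtx → Keyed L c)

/-- Keyed values of the trees of a forest with round-shaped vertices. -/
noncomputable def evR : Forest → List (Keyed L cl)
  | .nil => []
  | .cons v ch r => (K cl v).brace (evR ch) :: evR r

/-- Keyed values of the trees of a word with square-shaped roots. -/
noncomputable def evL : Forest → List (Keyed L op)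
  | .nil => []
  | .cons v ch r => (K op v).brace (evR K ch) :: evL r

variable (L) in
/-- The zero family without letters. -/
def zero (x : Color) : Keyed L x := ⟨[], 0, by simp, 0⟩

/-- The product of a list of keyed open families. -/
noncomputable def oprod : List (Keyed L op) → Keyed L op
  | [] => zero L op
  | [a] => a
  | a :: b :: Y => a.mul (oprod (b :: Y)) rfl

/-- The entry of a list of length one. -/
def only : List (Keyed L cl) → Keyed L cl
  | [a] => a
  | _ => zero L cl

/-- Keyed value of a word of either type. -/
noncomputable def ev : ∀ c : Color, Forest → Keyed L c
  | cl, F => only (evR K F)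
  | op, F => oprod (evL K F)

variable (hL : IsNSOperad L)

lemma toM_zero (x : Color) : (zero L x).toM hL = 0 := by
  rw [toM_eq_lin]
  exact map_zero _

/-- The environment of the values of the vertices. -/
noncomputable abbrev env : PlainOp.Env (envelope hL) := fun c w => (K c w).toM hL

lemma toM_evR (F : Forest) : PlainOp.evR (env K hL) F = (evR K F).map (toM hL) := by
  induction F with
  | nil => rfl
  | cons v ch r ih₁ ih₂ => rw [PlainOp.evR, ih₁, ih₂, toM_brace, evR, List.map_cons]

lemma toM_evL (F : Forest) : PlainOp.evL (env K hL) F = (evL K F).map (toM hL) := by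
  induction F with
  | nil => rfl
  | cons v ch r ih₁ ih₂ => rw [PlainOp.evL, toM_evR, ih₂, toM_brace, evL, List.map_cons]

lemma toM_oprod (Y : List (Keyed L op)) : PlainOp.oprod (Y.map (toM hL)) = (oprod Y).toM hL := by
  induction Y with
  | nil => exact (toM_zero hL op).symm
  | cons a Y ih =>
    cases Y with
    | nil => rfl
    | cons b Y =>
      rw [oprod, ← toM_mul, ← ih]
      rfl

lemma toM_only (Y : List (Keyed L cl)) : PlainOp.only (Y.map (toM hL)) = (only Y).toM hL := by
  rcases Y with _ | ⟨a, _ | ⟨b, Y⟩⟩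
  · exact (toM_zero hL cl).symm
  · rfl
  · exact (toM_zero hL cl).symm

lemma toM_ev (c : Color) (F : Forest) : PlainOp.ev (env K hL) c F = (ev K c F).toM hL := by
  cases c
  · rw [PlainOp.ev, toM_evR, toM_only, ev]
  · rw [PlainOp.ev, toM_evL, toM_oprod, ev]

section

variable {K} {κ : Vtx → List ℕ} {g : Vtx → ℤ}

lemma evR_word (hw : ∀ c w, (K c w).word = κ w) (F : Forest) :
    (evR K F).flatMap word = F.verts.flatMap κ := by
  induction F with
  | nil => rfl
  | cons v ch r ih₁ ih₂ => simp [evR, Forest.verts, brace, ih₁, ih₂, hw]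

lemma evL_word (hw : ∀ c w, (K c w).word = κ w) (F : Forest) :
    (evL K F).flatMap word = F.verts.flatMap κ := by
  induction F with
  | nil => rfl
  | cons v ch r ih₁ ih₂ => simp [evL, Forest.verts, brace, evR_word hw, ih₂, hw]

lemma oprod_word (Y : List (Keyed L op)) : (oprod Y).word = Y.flatMap word := by
  induction Y with
  | nil => rfl
  | cons a Y ih =>
    cases Y with
    | nil => simp [oprod]
    | cons b Y => rw [oprod, List.flatMap_cons, ← ih]

lemma evR_deg (hd : ∀ c w, (K c w).deg = g w) (F : Forest) :
    ((evR K F).map deg).sum = (F.verts.map g).sum := by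
  induction F with
  | nil => rfl
  | cons v ch r ih₁ ih₂ => simp [evR, Forest.verts, brace, braceDeg_eq, ih₁, ih₂, hd, add_assoc]

lemma evL_deg (hd : ∀ c w, (K c w).deg = g w) (F : Forest) :
    ((evL K F).map deg).sum = (F.verts.map g).sum := by
  induction F with
  | nil => rfl
  | cons v ch r ih₁ ih₂ =>
    simp [evL, Forest.verts, brace, braceDeg_eq, evR_deg hd, ih₂, hd, add_assoc]

lemma oprod_deg (Y : List (Keyed L op)) : (oprod Y).deg = (Y.map deg).sum := by
  induction Y with
  | nil => rfl
  | cons a Y ih =>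
    cases Y with
    | nil => simp [oprod]
    | cons b Y => rw [oprod, List.map_cons, List.sum_cons, ← ih]

lemma evR_length (F : Forest) : (evR K F).length = F.len := by
  induction F with
  | nil => rfl
  | cons v ch r _ ih => simp [evR, Forest.len, ih]

/-- The hypothesis on the length excludes the case in which `only` returns the zero family with its
empty word. -/
lemma ev_word (hw : ∀ c w, (K c w).word = κ w) (c : Color) (F : Forest) (h : c = cl → F.len = 1) :
    (ev K c F).word = F.verts.flatMap κ := by
  cases c with
  | cl =>
    obtain ⟨a, ha⟩ := List.length_eq_one_iff.1 ((evR_length (K := K) F).trans (h rfl))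
    rw [← evR_word hw, ev, ha]
    simp [only]
  | op => rw [ev, oprod_word, evL_word hw]

lemma ev_deg (hd : ∀ c w, (K c w).deg = g w) (c : Color) (F : Forest) (h : c = cl → F.len = 1) :
    (ev K c F).deg = (F.verts.map g).sum := by
  cases c with
  | cl =>
    obtain ⟨a, ha⟩ := List.length_eq_one_iff.1 ((evR_length (K := K) F).trans (h rfl))
    rw [← evR_deg hd, ev, ha]
    simp [only]
  | op => rw [ev, oprod_deg, evL_deg hd]

variable {K' : ∀ c : Color, Vtx → Keyed L c}

lemma evR_sig (h : ∀ c w, (K c w).sig = (K' c w).sig) (F : Forest) :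
    (evR K F).map sig = (evR K' F).map sig := by
  induction F with
  | nil => rfl
  | cons v ch r ih₁ ih₂ =>
    rw [evR, evR, List.map_cons, List.map_cons, ih₂, brace_sig (h cl v) ih₁]

lemma evL_sig (h : ∀ c w, (K c w).sig = (K' c w).sig) (F : Forest) :
    (evL K F).map sig = (evL K' F).map sig := by
  induction F with
  | nil => rfl
  | cons v ch r ih₁ ih₂ =>
    rw [evL, evL, List.map_cons, List.map_cons, ih₂, brace_sig (h op v) (evR_sig h ch)]

lemma oprod_sig {Y Z : List (Keyed L op)} (h : Y.map sig = Z.map sig) :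
    (oprod Y).sig = (oprod Z).sig := by
  induction Y generalizing Z with
  | nil =>
    obtain rfl : Z = [] := by simpa using h.symm
    rfl
  | cons a Y ih =>
    rcases Z with _ | ⟨b, Z⟩
    · simp at h
    rw [List.map_cons, List.map_cons, List.cons.injEq] at h
    rcases Y with _ | ⟨a', Y⟩
    · obtain rfl : Z = [] := by simpa using h.2.symm
      exact h.1
    · rcases Z with _ | ⟨b', Z⟩
      · simp at h
      · exact mul_sig h.1 (ih h.2)

lemma ev_sig (h : ∀ c w, (K c w).sig = (K' c w).sig) (c : Color) (F : Forest) :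
    (ev K c F).sig = (ev K' c F).sig := by
  cases c with
  | cl =>
    have h1 := evR_sig h F
    rw [ev, ev]
    revert h1
    rcases evR K F with _ | ⟨a, _ | ⟨a', Y⟩⟩ <;> rcases evR K' F with _ | ⟨b, _ | ⟨b', Z⟩⟩ <;>
      simp [only]
  | op => exact oprod_sig (evL_sig h F)

end

/-- The same family with an ordered word. -/
lemma toM_eq_part (A : Keyed L x) (w : List ℕ) (d : ℤ) (p : Even (d + w.length))
    (hw : A.word.Perm w) (hd : A.deg = d) (h1 : wordSign w = 1) :
    A.toM hL = (⟨w, d, p, part hL ⟨(w : Multiset ℕ), d, p⟩ (A.toM hL)⟩ : Keyed L x).toM hL := by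
  obtain ⟨w', d, p', a⟩ := A
  obtain rfl : d = _ := hd
  have h2 := toM_eq_of_word hL ⟨w', d, p', a⟩ ⟨w, d, p, a⟩ (wordSign w') rfl HEq.rfl hw
    (by rw [h1, mul_one])
  have h3 := part_toM hL (⟨w, d, p, a⟩ : Keyed L x)
  have h4 : part hL ⟨(w : Multiset ℕ), d, p⟩ ((⟨w', d, p', a⟩ : Keyed L x).toM hL) =
      wordSign w' • a := by
    rw [h2, map_zsmul]
    refine (congrArg (wordSign w' • ·) h3).trans ?_
    simp only [h1]
    rw [one_smul]
  rw [h4, h2]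
  exact (map_zsmul (lin hL w d p) (wordSign w') a).symm

end Keyed

end SwissCheese

namespace SwissCheese

open Color Vtx

universe u v

variable {k : Type u} [CommRing k]

/-! ### The action on homogeneous families -/

/-- Homogeneous arguments: the degree of each label and its value for each colour. -/
structure Args (L : OpData.{u, v} k) where
  deg : ℕ → ℤ
  val : ∀ (c : Color) (i : ℕ), Fam L c (deg i)

namespace Args

/-- The degree of a vertex. -/
def vdeg {L : OpData.{u, v} k} (a : Args L) : Vtx → ℤ
  | lab i => a.deg i
  | neu _ => -1

/-- Words of letters for the vertices with the parity of their degrees. -/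
def IsKey {L : OpData.{u, v} k} (a : Args L) (κ : Vtx → List ℕ) : Prop :=
  ∀ w, Even (a.vdeg w + (κ w).length)

/-- The total degree of the vertices. -/
def tdeg {L : OpData.{u, v} k} (a : Args L) (r n : ℕ) : ℤ := -(r : ℤ) + ∑ i ∈ Finset.range n, a.deg i

section

variable {L : OpData.{u, v} k} (a : Args L)

lemma sum_vdeg (r n : ℕ) : ((canonVerts r n).map a.vdeg).sum = a.tdeg r n := by
  rw [canonVerts, List.map_append, List.sum_append, List.map_map, List.map_map, tdeg]
  congr 1
  · have : a.vdeg ∘ neu = fun _ => -1 := rfl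
    simp [this]

lemma even_flatMap {κ : Vtx → List ℕ} (hκ : a.IsKey κ) (l : List Vtx) :
    Even ((l.map a.vdeg).sum + (l.flatMap κ).length) := by
  induction l with
  | nil => simp
  | cons w l ih =>
    have := (hκ w).add ih
    rw [List.map_cons, List.sum_cons, List.flatMap_cons, List.length_append, Nat.cast_add,
      add_add_add_comm]
    exact this

lemma even_canon {κ : Vtx → List ℕ} (hκ : a.IsKey κ) (r n : ℕ) :
    Even (a.tdeg r n + ((canonVerts r n).flatMap κ).length) := by
  rw [← sum_vdeg]
  exact a.even_flatMap hκ _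

/-- The standard letters: the names of the neutral vertices, and the numbers from `r` on for the
labels of odd degree. -/
def std (r : ℕ) : Vtx → List ℕ
  | neu e => [e]
  | lab i => if Even (a.deg i) then [] else [r + i]

lemma isKey_std (r : ℕ) : a.IsKey (a.std r) := by
  intro w
  cases w with
  | neu e => simp [vdeg, std]
  | lab i =>
    by_cases h : Even (a.deg i)
    · simp [vdeg, std, h]
    · simp only [vdeg, std, h, if_false]
      exact (Int.not_even_iff_odd.1 h).add_one

lemma pairwise_canon_std (r n : ℕ) : ((canonVerts r n).flatMap (a.std r)).Pairwise (· < ·) := by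
  have h : ((canonVerts r n).flatMap (a.std r)).Sublist (List.range (r + n)) := by
    rw [canonVerts, List.flatMap_append, List.range_add]
    refine List.Sublist.append ?_ ?_
    · rw [List.flatMap_map]
      simp [std]
    · rw [List.flatMap_map]
      induction List.range n with
      | nil => simp
      | cons i l ih =>
        rw [List.flatMap_cons, List.map_cons]
        by_cases h : Even (a.deg i)
        · simpa [std, h] using ih.cons _
        · simpa [std, h] using ih
  exact List.Pairwise.sublist h List.pairwise_lt_range

lemma wordSign_canon_std (r n : ℕ) : wordSign ((canonVerts r n).flatMap (a.std r)) = 1 :=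
  wordSign_eq_one (a.pairwise_canon_std r n)

end

variable {P : OpData.{u, v} k} (η : OpHom (hscInf k) P) (a : Args (lam P))

/-- The value of a vertex, neutral vertices being copies of the twisting element. -/
noncomputable def vval (c : Color) : ∀ w, Fam (lam P) c (a.vdeg w)
  | lab i => a.val c i
  | neu _ => twist η c

/-- The value of a vertex with its letters. -/
noncomputable def keyed {κ : Vtx → List ℕ} (hκ : a.IsKey κ) (c : Color) (w : Vtx) :
    Keyed (lam P) c := ⟨κ w, a.vdeg w, hκ w, a.vval η c w⟩

variable (hL : IsNSOperad (lam P))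

/-- The environment of the values of the vertices. -/
noncomputable abbrev env {κ : Vtx → List ℕ} (hκ : a.IsKey κ) : PlainOp.Env (envelope hL) :=
  Keyed.env (a.keyed η hκ) hL

/-- The value of a word with output `x`. -/
noncomputable def act (r n : ℕ) (x : Color) (F : Forest) : Fam (lam P) x (a.tdeg r n) :=
  Keyed.part hL ⟨((canonVerts r n).flatMap (a.std r) : List ℕ), a.tdeg r n,
    a.even_canon (a.isKey_std r) r n⟩ (PlainOp.ev (a.env η hL (a.isKey_std r)) x F)

/-- The value of a word for arbitrary letters. -/
lemma ev_eq_act (r n : ℕ) (x : Color) (F : Forest) (hF : F.verts.Perm (canonVerts r n))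
    (hx : x = cl → F.len = 1) {κ : Vtx → List ℕ} (hκ : a.IsKey κ) :
    PlainOp.ev (a.env η hL hκ) x F = (⟨(canonVerts r n).flatMap κ, a.tdeg r n,
      a.even_canon hκ r n, a.act η hL r n x F⟩ : Keyed (lam P) x).toM hL := by
  -- The sign between the planar order of the vertices and the canonical one; it is common to all
  -- systems of letters.
  obtain ⟨ε, hε, h⟩ := wordSign_flatMap_perm hF a.vdeg
  have hdeg : ∀ {κ : Vtx → List ℕ} (hκ : a.IsKey κ),
      (Keyed.ev (a.keyed η hκ) x F).deg = a.tdeg r n := fun hκ => by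
    rw [Keyed.ev_deg (g := a.vdeg) (fun _ _ => rfl) x F hx, ← a.sum_vdeg]
    exact (hF.map _).sum_eq
  have hword : ∀ {κ : Vtx → List ℕ} (hκ : a.IsKey κ),
      (Keyed.ev (a.keyed η hκ) x F).word = F.verts.flatMap κ := fun hκ =>
    Keyed.ev_word (fun _ _ => rfl) x F hx
  have hstd := Keyed.toM_eq_part hL (Keyed.ev (a.keyed η (a.isKey_std r)) x F)
    ((canonVerts r n).flatMap (a.std r)) _ (a.even_canon (a.isKey_std r) r n)
    (by rw [hword]; exact hF.flatMap_right _) (hdeg _) (a.wordSign_canon_std r n)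
  rw [← Keyed.toM_ev] at hstd
  have hval : ∀ {κ : Vtx → List ℕ} (hκ : a.IsKey κ), ∃ y : Fam (lam P) x (a.tdeg r n),
      HEq (Keyed.ev (a.keyed η hκ) x F).val y := fun hκ => by
    rw [← hdeg hκ]
    exact ⟨_, HEq.rfl⟩
  obtain ⟨y, hy⟩ := hval (a.isKey_std r)
  have hsame : ∀ {κ : Vtx → List ℕ} (hκ : a.IsKey κ), PlainOp.ev (a.env η hL hκ) x F =
      ε • (⟨(canonVerts r n).flatMap κ, a.tdeg r n, a.even_canon hκ r n, y⟩ :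
        Keyed (lam P) x).toM hL := by
    intro κ hκ
    rw [Keyed.toM_ev]
    refine Keyed.toM_eq_of_word hL _ _ _ (hdeg hκ) ?_ ?_ ?_
    · have h2 := (Keyed.sig_eq_iff.1 (Keyed.ev_sig (K := a.keyed η hκ)
        (K' := a.keyed η (a.isKey_std r)) (fun _ _ => rfl) x F)).2
      exact h2.trans hy
    · rw [hword]; exact hF.flatMap_right _
    · rw [hword]; exact h κ hκ
  -- The canonical word of the standard letters is sorted, so reading off the coefficient yields `ε
  -- • y`: the sign is absorbed into `act`.
  have hact : a.act η hL r n x F = ε • y := by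
    rw [act, hsame, map_zsmul]
    refine (congrArg (ε • ·) (Keyed.part_toM hL _)).trans ?_
    rw [a.wordSign_canon_std, one_smul]
  rw [hsame hκ, hact]
  exact (map_zsmul (Keyed.lin hL _ _ (a.even_canon hκ r n)) ε y).symm

/-- The environment of an argument family is twisted. -/
lemma isTwisted {κ : Vtx → List ℕ} (hκ : a.IsKey κ) (hn : ∀ e, κ (neu e) = [e]) :
    PlainOp.IsTwisted (envD hL 0) (fun y => ∃ A : Keyed (lam P) cl, y = A.toM hL)
      (a.env η hL hκ) := by
  have hhat : ∀ c e, a.keyed η hκ c (neu e) = hat η c e := fun c e => by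
    have : ∀ (w : List ℕ) (h : w = [e]) (p : Even ((-1 : ℤ) + w.length)),
        (⟨w, -1, p, twist η c⟩ : Keyed (lam P) c) = hat η c e := by
      rintro w rfl p; rfl
    exact this _ (hn e) _
  have hlist : ∀ Y : List ((envelope hL).M cl), (∀ y ∈ Y, ∃ A : Keyed (lam P) cl, y = A.toM hL) →
      ∃ Z : List (Keyed (lam P) cl), Y = Z.map (Keyed.toM hL) := by
    intro Y hY
    induction Y with
    | nil => exact ⟨[], rfl⟩
    | cons y Y ih =>
      obtain ⟨Z, rfl⟩ := ih fun z hz => hY z (by simp [hz])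
      obtain ⟨A, rfl⟩ := hY y (by simp)
      exact ⟨A :: Z, rfl⟩
  have hne : ∀ c e, a.env η hL hκ c (neu e) = (hat η c e).toM hL := fun c e => by
    change (a.keyed η hκ c (neu e)).toM hL = _
    rw [hhat]
  have hsig : ∀ c e e', (hat η c e).sig = (hat η c e').sig := fun _ _ _ => rfl
  constructor
  · exact fun c v => Keyed.toM_supp hL _
  · intro v Y hY
    obtain ⟨Z, rfl⟩ := hlist Y hY
    exact ⟨_, Keyed.toM_brace hL _ _⟩
  · intro e _
    rw [hne, hne]
    exact fam_hat_cl hL η 0 e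
  · intro e _
    rw [hne, hne, hne]
    exact fam_hat_op hL η 0 e
  · intro e _ c Y₁ Y₂ Y₃ h₁ h₂ h₃
    obtain ⟨Z₁, rfl⟩ := hlist _ h₁
    obtain ⟨Z₂, rfl⟩ := hlist _ h₂
    obtain ⟨Z₃, rfl⟩ := hlist _ h₃
    rw [hne, hne, hne, hne, Keyed.toM_brace, Keyed.toM_brace, ← List.map_cons, ← List.map_cons,
      ← List.map_append, ← List.map_append, Keyed.toM_brace, Keyed.toM_brace]
    have hs : ((hat η c e).brace (Z₁ ++ (hat η cl 0).brace Z₂ :: Z₃)).sig =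
        ((hat η c 0).brace (Z₁ ++ (hat η cl e).brace Z₂ :: Z₃)).sig := by
      refine Keyed.brace_sig rfl ?_
      rw [List.map_append, List.map_append, List.map_cons, List.map_cons,
        Keyed.brace_sig (hsig cl 0 e) (rfl : Z₂.map Keyed.sig = _)]
    -- Both sides have the same values in the same places; they differ by the exchange of the
    -- letters `e` and `0`.
    exact Keyed.toM_swap hL _ _ [] (Z₁.flatMap Keyed.word)
      (Z₂.flatMap Keyed.word ++ Z₃.flatMap Keyed.word) e 0 (by simp [Keyed.brace, hat])
      (by simp [Keyed.brace, hat]) (Keyed.sig_eq_iff.1 hs).1 (Keyed.sig_eq_iff.1 hs).2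
  · intro e _ Y₁ Y₂ h₁ h₂
    obtain ⟨Z₁, rfl⟩ := hlist _ h₁
    obtain ⟨Z₂, rfl⟩ := hlist _ h₂
    rw [hne, hne, Keyed.toM_brace, Keyed.toM_brace, Keyed.toM_brace, Keyed.toM_brace,
      Keyed.toM_mul _ _ _ rfl, Keyed.toM_mul _ _ _ rfl]
    have hs : (((hat η op e).brace Z₁).mul ((hat η op 0).brace Z₂) rfl).sig =
        (((hat η op 0).brace Z₁).mul ((hat η op e).brace Z₂) rfl).sig :=
      Keyed.mul_sig (Keyed.brace_sig (hsig op e 0) rfl) (Keyed.brace_sig (hsig op 0 e) rfl)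
    exact Keyed.toM_swap hL _ _ [] (Z₁.flatMap Keyed.word) (Z₂.flatMap Keyed.word) e 0
      (by simp [Keyed.brace, hat]) (by simp [Keyed.brace, hat]) (Keyed.sig_eq_iff.1 hs).1
      (Keyed.sig_eq_iff.1 hs).2

end Args

end SwissCheese

namespace SwissCheese

open Color Vtx

universe u v

/-! ### Evaluation of words of a given shape -/

/-- Change the labels by `f` and the names by `g`. -/
def Vtx.rename (f g : ℕ → ℕ) : Vtx → Vtx
  | lab i => lab (f i)
  | neu e => neu (g e)

namespace Forest

lemma rename_cons (f g : ℕ → ℕ) (v : Vtx) (ch r : Forest) :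
    (cons v ch r).rename f g = cons (v.rename f g) (ch.rename f g) (r.rename f g) := by
  cases v <;> rfl

lemma RoundOK.label {I : List Color} {F : Forest} (h : F.RoundOK I) {i : ℕ} (hi : i ∈ F.labels) :
    I[i]? = some cl := by
  induction F with
  | nil => simp [labels] at hi
  | cons v ch r ih₁ ih₂ =>
    cases v with
    | lab j =>
      simp only [labels, List.mem_cons, List.mem_append] at hi
      rcases hi with rfl | hi | hi
      exacts [h.1, ih₁ h.2.1 hi, ih₂ h.2.2 hi]
    | neu e =>
      simp only [labels, List.mem_append] at hi
      rcases hi with hi | hi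
      exacts [ih₁ h.2.1 hi, ih₂ h.2.2 hi]

lemma SquareOK.rootLabel {I : List Color} {F : Forest} (h : F.SquareOK I) {i : ℕ}
    (hi : i ∈ F.rootLabels) : I[i]? = some op := by
  induction F with
  | nil => simp [rootLabels] at hi
  | cons v ch r _ ih =>
    cases v with
    | lab j =>
      simp only [rootLabels, List.mem_cons] at hi
      rcases hi with rfl | hi
      exacts [h.1, ih h.2.2 hi]
    | neu e => exact ih h.2.2 hi

lemma SquareOK.innerLabel {I : List Color} {F : Forest} (h : F.SquareOK I) {i : ℕ}
    (hi : i ∈ F.innerLabels) : I[i]? = some cl := by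
  induction F with
  | nil => simp [innerLabels] at hi
  | cons v ch r _ ih =>
    simp only [innerLabels, List.mem_append] at hi
    cases v with
    | lab j => exact hi.elim h.2.1.label (ih h.2.2)
    | neu e => exact hi.elim h.2.1.label (ih h.2.2)

/-- Sum of the blow-ups of all the vertices of a word. -/
def bd : Color → Forest → List (ℤ × Forest)
  | cl => bdR
  | op => bdS

/-- The neutral vertices have enough inputs and their names are not `0`. -/
def Stable : Color → Forest → Prop
  | cl => StableR
  | op => StableS

end Forest

namespace PlainOp

open Forest

variable {k : Type u} [CommRing k] {O : PlainOp.{u, v} k} {x : Color}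

lemma evR_rename (ρ : Env O) (f g : ℕ → ℕ) (F : Forest) :
    evR ρ (F.rename f g) = evR (fun c v => ρ c (v.rename f g)) F := by
  induction F with
  | nil => rfl
  | cons v ch r ih₁ ih₂ => rw [rename_cons, evR, evR, ih₁, ih₂]

lemma evL_rename (ρ : Env O) (f g : ℕ → ℕ) (F : Forest) :
    evL ρ (F.rename f g) = evL (fun c v => ρ c (v.rename f g)) F := by
  induction F with
  | nil => rfl
  | cons v ch r _ ih => rw [rename_cons, evL, evL, evR_rename, ih]

lemma ev_rename (ρ : Env O) (f g : ℕ → ℕ) (F : Forest) :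
    ev ρ x (F.rename f g) = ev (fun c v => ρ c (v.rename f g)) x F := by
  cases x
  · rw [ev, ev, evR_rename]
  · rw [ev, ev, evL_rename]

/-- In a word of the given shape, a label of colour `c` is evaluated at the colour `c` only. The
environment may take any value at the other colour. -/
lemma ev_congr {ρ ρ' : Env O} {I : List Color} {F : Forest} (hS : F.Shape I x)
    (h : ∀ i c, I[i]? = some c → ρ c (lab i) = ρ' c (lab i))
    (h' : ∀ c, ∀ e ∈ F.names, ρ c (neu e) = ρ' c (neu e)) : ev ρ x F = ev ρ' x F := by
  cases x
  · rw [ev, ev, evR_congr F (fun i hi => h i cl (hS.2.label hi)) (h' cl)]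
  · rw [ev, ev, evL_congr F (fun i hi => h i op (hS.2.rootLabel hi))
      (fun i hi => h i cl (hS.2.innerLabel hi)) h']

section

variable {A : Type*} [AddCommGroup A] [Module k A]

/-- The label occurs once, and every brace on the way from its vertex down to the root is linear in
the entry concerned. -/
lemma evR_linear (ρ : Env O) (F : Forest) (i : ℕ) (hF : F.labels.Nodup) (hi : i ∈ F.labels)
    {Φ : List (O.M cl) → A} (h : MLin Φ) :
    ∃ l : O.M cl →ₗ[k] A, ∀ y, Φ (evR (ρ.set cl (lab i) y) F) = l y := by
  induction F generalizing Φ with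
  | nil => simp [labels] at hi
  | cons v ch r ih₁ ih₂ =>
    obtain ⟨h1, h2, h3, h4, h5⟩ := nodup_labels_cons hF
    rw [mem_labels_cons] at hi
    by_cases hv : v = lab i
    · subst hv
      obtain ⟨l, hl⟩ := brace_linear_left (k := k) (x := cl) (cls (evR ρ ch))
      obtain ⟨m, hm⟩ := h [] (evR ρ r)
      refine ⟨m.comp l, fun y => ?_⟩
      rw [evR, evR_set_of_not_mem _ _ _ _ ch (fun hc => h4 i hc rfl),
        evR_set_of_not_mem _ _ _ _ r (fun hc => h5 i hc rfl), Env.set_self]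
      exact (hm _).trans (congrArg m (hl y))
    · by_cases hc : i ∈ ch.labels
      · obtain ⟨l, hl⟩ := ih₁ h1 hc (h.comp (cbrace_mlin (ρ cl v)) [] (evR ρ r))
        refine ⟨l, fun y => ?_⟩
        rw [evR, Env.set_ne _ _ _ _ _ _ hv, evR_set_of_not_mem _ _ _ _ r (h3 i hc), ← hl]
        rfl
      · obtain ⟨l, hl⟩ := ih₂ h2 (by tauto) (h.cons (cbrace (ρ cl v) (evR ρ ch)))
        refine ⟨l, fun y => ?_⟩
        rw [evR, Env.set_ne _ _ _ _ _ _ hv, evR_set_of_not_mem _ _ _ _ ch hc, ← hl]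

lemma evL_linear_inner (ρ : Env O) (F : Forest) (i : ℕ) (hF : F.labels.Nodup)
    (hi : i ∈ F.innerLabels) (hi' : i ∉ F.rootLabels) {Ψ : List (O.M op) → A} (h : MLin Ψ) :
    ∃ l : O.M cl →ₗ[k] A, ∀ y, Ψ (evL (ρ.set cl (lab i) y) F) = l y := by
  induction F generalizing Ψ with
  | nil => simp [innerLabels] at hi
  | cons v ch r _ ih =>
    obtain ⟨h1, h2, h3, h4, h5⟩ := nodup_labels_cons hF
    have hv : v ≠ lab i := by rintro rfl; simp [rootLabels] at hi'
    have hr : i ∉ r.rootLabels := by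
      cases v <;> simp only [rootLabels, List.mem_cons, not_or] at hi' <;> tauto
    simp only [innerLabels, List.mem_append] at hi
    by_cases hc : i ∈ ch.labels
    · obtain ⟨l, hl⟩ := evR_linear ρ ch i h1 hc (h.comp (cbrace_mlin (ρ op v)) [] (evL ρ r))
      refine ⟨l, fun y => ?_⟩
      rw [evL, Env.set_ne _ _ _ _ _ _ hv, evL_set_of_not_mem _ _ _ _ r (h3 i hc), ← hl]
      rfl
    · obtain ⟨l, hl⟩ := ih h2 (by tauto) hr (h.cons (cbrace (ρ op v) (evR ρ ch)))
      refine ⟨l, fun y => ?_⟩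
      rw [evL, Env.set_ne _ _ _ _ _ _ hv, evR_set_of_not_mem _ _ _ _ ch hc, ← hl]

lemma evL_linear_root (ρ : Env O) (F : Forest) (i : ℕ) (hF : F.labels.Nodup)
    (hi : i ∈ F.rootLabels) (hi' : i ∉ F.innerLabels) {Ψ : List (O.M op) → A} (h : MLin Ψ) :
    ∃ l : O.M op →ₗ[k] A, ∀ y, Ψ (evL (ρ.set op (lab i) y) F) = l y := by
  induction F generalizing Ψ with
  | nil => simp [rootLabels] at hi
  | cons v ch r _ ih =>
    obtain ⟨h1, h2, h3, h4, h5⟩ := nodup_labels_cons hF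
    simp only [innerLabels, List.mem_append, not_or] at hi'
    by_cases hv : v = lab i
    · subst hv
      obtain ⟨l, hl⟩ := brace_linear_left (k := k) (x := op) (cls (evR ρ ch))
      obtain ⟨m, hm⟩ := h [] (evL ρ r)
      refine ⟨m.comp l, fun y => ?_⟩
      rw [evL, evR_set_of_not_mem _ _ _ _ ch hi'.1,
        evL_set_of_not_mem _ _ _ _ r (fun hc => h5 i hc rfl), Env.set_self]
      exact (hm _).trans (congrArg m (hl y))
    · have hr : i ∈ r.rootLabels := by
        cases v with
        | lab j =>
          rcases List.mem_cons.1 hi with rfl | hi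
          · exact absurd rfl hv
          · exact hi
        | neu e => exact hi
      obtain ⟨l, hl⟩ := ih h2 hr hi'.2 (h.cons (cbrace (ρ op v) (evR ρ ch)))
      refine ⟨l, fun y => ?_⟩
      rw [evL, Env.set_ne _ _ _ _ _ _ hv, evR_set_of_not_mem _ _ _ _ ch hi'.1, ← hl]

end

/-- The value of a word is linear in each label. -/
lemma ev_linear (ρ : Env O) {I : List Color} {F : Forest} (hS : F.Shape I x) (hF : F.labels.Nodup)
    {i : ℕ} (hi : i ∈ F.labels) {c : Color} (hc : I[i]? = some c) :
    ∃ l : O.M c →ₗ[k] O.M x, ∀ y, ev (ρ.set c (lab i) y) x F = l y := by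
  cases x
  · have := hS.2.label hi
    obtain rfl : c = cl := by simpa [hc] using this
    exact evR_linear ρ F i hF hi only_mlin
  · have hr := fun h => hS.2.rootLabel (i := i) h
    have hn := fun h => hS.2.innerLabel (i := i) h
    rcases (F.mem_labels_iff i).1 hi with h | h
    · obtain rfl : c = op := by simpa [hc] using hr h
      exact evL_linear_root ρ F i hF h (fun h' => by simpa [hc] using hn h') oprod_mlin
    · obtain rfl : c = cl := by simpa [hc] using hn h
      exact evL_linear_inner ρ F i hF h (fun h' => by simpa [hc] using hr h') oprod_mlin

lemma Shape_cl_iff {I : List Color} {X : Forest} (h : X.Shape I cl) :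
    ∃ w Y, X = .cons w Y .nil := by
  rcases X with _ | ⟨w, Y, _ | ⟨w', Y', Z⟩⟩
  · exact absurd h.1 (by simp [len])
  · exact ⟨w, Y, rfl⟩
  · exact absurd h.1 (by simp [len])

/-- Substitution of a word for a label. -/
lemma lsum_subst_ev (ρ : Env O) (hρ : ∀ c v, Supp (ρ c v)) {I J : List Color} {F X : Forest}
    (hS : F.Shape I x) (hF : F.labels.Nodup) {i : ℕ} (hi : i ∈ F.labels) {t : Color}
    (ht : I[i]? = some t) (hX : X.Shape J t) :
    lsum (F.subst i X) (fun T => ev ρ x T) = ev (ρ.set t (lab i) (ev ρ t X)) x F := by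
  cases x
  · obtain rfl : t = cl := by simpa [ht] using hS.2.label hi
    obtain ⟨w, Y, rfl⟩ := Shape_cl_iff hX
    exact lsum_subst_evR ρ F i w Y hF hi only_mlin
  · have hr := fun h => hS.2.rootLabel (i := i) h
    have hn := fun h => hS.2.innerLabel (i := i) h
    rcases (F.mem_labels_iff i).1 hi with h | h
    · obtain rfl : t = op := by simpa [ht] using hr h
      refine lsum_subst_evL_root ρ hρ F i X ?_ hF h (fun h' => by simpa [ht] using hn h')
        oprod_mlin oprod_isMul
      rintro rfl
      exact absurd hX.1 (by simp [len])
    · obtain rfl : t = cl := by simpa [ht] using hn h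
      obtain ⟨w, Y, rfl⟩ := Shape_cl_iff hX
      exact lsum_subst_evL_inner ρ F i w Y hF h (fun h' => by simpa [ht] using hr h') oprod_mlin

/-- The twisted differential of the value of a word. -/
lemma tw_ev {D : Deriv O} {S : O.M cl → Prop} {ρ : Env O} (h : IsTwisted D S ρ) {I : List Color}
    {F : Forest} (hS : F.Shape I x) (hs : F.Stable x) (hF : F.labels.Nodup) :
    D.tw (ρ cl (neu 0)) (ρ op (neu 0)) x (ev ρ x F) =
      lsum F.labels (fun i => ev (ρ.dlab D i) x F) +
        lsum (bd x F) (fun p => p.1 • ev ρ x p.2) := by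
  cases x
  · refine Eq.trans ?_ (leib_evR h F hs hF only_mlin)
    -- A word with closed output is a single tree, so the Leibniz sum over its trees has one term.
    obtain ⟨w, Y, rfl⟩ := Shape_cl_iff hS
    simp [ev, evR, leib, only, Deriv.tw]
  · exact (dop_oprod D (h.supp _ _) (h.supp _ _) (evL_supp h.supp F)).trans
      (leib_evL h F hs hF oprod_mlin oprod_isMul)

end PlainOp
end SwissCheese

namespace SwissCheese

open Color Vtx

namespace Forest

/-! ### Vertices of renamed, plugged, substituted and blown-up words -/

lemma verts_app (F G : Forest) : (F.app G).verts = F.verts ++ G.verts := by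
  induction F with
  | nil => rfl
  | cons v ch r _ ih => simp [app, verts, ih]

lemma verts_rename (f g : ℕ → ℕ) (F : Forest) :
    (F.rename f g).verts = F.verts.map (Vtx.rename f g) := by
  induction F with
  | nil => rfl
  | cons v ch r ih₁ ih₂ => rw [rename_cons, verts, verts, ih₁, ih₂]; simp

lemma labels_eq (F : Forest) : F.labels = F.verts.filterMap fun
    | lab i => some i
    | neu _ => none := by
  induction F with
  | nil => rfl
  | cons v ch r ih₁ ih₂ => cases v <;> simp [labels, verts, ih₁, ih₂]

lemma names_eq (F : Forest) : F.names = F.verts.filterMap fun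
    | lab _ => none
    | neu e => some e := by
  induction F with
  | nil => rfl
  | cons v ch r ih₁ ih₂ => cases v <;> simp [names, verts, ih₁, ih₂]

lemma labels_rename (f g : ℕ → ℕ) (F : Forest) : (F.rename f g).labels = F.labels.map f := by
  induction F with
  | nil => rfl
  | cons v ch r ih₁ ih₂ => cases v <;> simp [rename, labels, ih₁, ih₂]

lemma names_rename (f g : ℕ → ℕ) (F : Forest) : (F.rename f g).names = F.names.map g := by
  induction F with
  | nil => rfl
  | cons v ch r ih₁ ih₂ => cases v <;> simp [rename, names, ih₁, ih₂]

lemma len_rename (f g : ℕ → ℕ) (F : Forest) : (F.rename f g).len = F.len := by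
  induction F with
  | nil => rfl
  | cons v ch r _ ih => rw [rename_cons, len, len, ih]

lemma app_of_mem_splits {F : Forest} {p : Forest × Forest} (h : p ∈ F.splits) : p.1.app p.2 = F := by
  induction F generalizing p with
  | nil => simp [splits] at h; subst h; rfl
  | cons v ch r _ ih =>
    simp only [splits, List.mem_cons, List.mem_map] at h
    rcases h with rfl | ⟨q, hq, rfl⟩
    · rfl
    · simp [app, ih hq]

lemma app_of_mem_splits3 {F : Forest} {s : Forest × Forest × Forest} (h : s ∈ F.splits3) :
    s.1.app (s.2.1.app s.2.2) = F := by
  simp only [splits3, List.mem_flatMap, List.mem_map] at h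
  obtain ⟨p, hp, q, hq, rfl⟩ := h
  rw [app_of_mem_splits hq, app_of_mem_splits hp]

/-- Attaching trees neither creates nor removes vertices. Multiset identities of this kind determine
the labels and names in all terms of compositions and boundaries. -/
lemma verts_plug {F S T : Forest} (h : T ∈ F.plug S) :
    (T.verts : Multiset Vtx) = F.verts + S.verts := by
  induction F generalizing S T with
  | nil =>
    obtain rfl : T = S := by simpa [plug] using h
    simp [verts]
  | cons v ch r ih₁ ih₂ =>
    simp only [plug, List.mem_flatMap, List.mem_map] at h
    obtain ⟨s, hs, ch', hch, r', hr, rfl⟩ := h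
    have h1 := ih₁ hch
    have h2 := ih₂ hr
    rw [← app_of_mem_splits3 hs]
    simp only [verts_app, verts, ← Multiset.cons_coe, ← Multiset.coe_add] at h1 h2 ⊢
    rw [h1, h2]
    simp only [← Multiset.singleton_add]
    abel

lemma verts_plugWord {X S T : Forest} (h : T ∈ X.plugWord S) :
    (T.verts : Multiset Vtx) = X.verts + S.verts := by
  induction X generalizing S T with
  | nil =>
    cases S with
    | nil =>
      obtain rfl : T = nil := by simpa [plugWord] using h
      simp [verts]
    | cons v ch r => simp [plugWord] at h
  | cons v ch r _ ih =>
    simp only [plugWord, List.mem_flatMap, List.mem_map] at h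
    obtain ⟨s, hs, ch', hch, r', hr, rfl⟩ := h
    have h1 := verts_plug hch
    have h2 := ih hr
    rw [← app_of_mem_splits hs]
    simp only [verts_app, verts, ← Multiset.cons_coe, ← Multiset.coe_add] at h1 h2 ⊢
    rw [h1, h2]
    simp only [← Multiset.singleton_add]
    abel

/-- One vertex labelled `i` makes way for the vertices of `X`. The identity is written additively,
to avoid the subtraction of multisets. -/
lemma verts_subst {F X T : Forest} {i : ℕ} (h : T ∈ F.subst i X) :
    {lab i} + (T.verts : Multiset Vtx) = X.verts + F.verts := by
  induction F generalizing T with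
  | nil => simp [subst] at h
  | cons v ch r ih₁ ih₂ =>
    rw [subst] at h
    split_ifs at h with hv
    · subst hv
      obtain ⟨X', hX, rfl⟩ := List.mem_map.1 h
      have h1 := verts_plugWord hX
      simp only [verts_app, verts, ← Multiset.cons_coe, ← Multiset.coe_add] at h1 ⊢
      rw [h1]
      simp only [← Multiset.singleton_add]
      abel
    · rcases List.mem_append.1 h with h | h
      · obtain ⟨ch', hc, rfl⟩ := List.mem_map.1 h
        have h1 := ih₁ hc
        simp only [verts, ← Multiset.cons_coe, ← Multiset.coe_add, ← Multiset.singleton_add] at h1 ⊢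
        calc _ = {v} + ({lab i} + (ch'.verts : Multiset Vtx) + r.verts) := by abel
          _ = _ := by rw [h1]; abel
      · obtain ⟨r', hr, rfl⟩ := List.mem_map.1 h
        have h1 := ih₂ hr
        simp only [verts, ← Multiset.cons_coe, ← Multiset.coe_add, ← Multiset.singleton_add] at h1 ⊢
        calc _ = {v} + ch.verts + ({lab i} + (r'.verts : Multiset Vtx)) := by abel
          _ = _ := by rw [h1]; abel

section Boundary

lemma verts_blowR {v : Vtx} {ch : Forest} {p : ℤ × Forest} (h : p ∈ blowR v ch) :
    (p.2.verts : Multiset Vtx) = {neu 0} + ({v} + ch.verts) := by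
  have key : ∀ s ∈ ch.splits3, (ch.verts : Multiset Vtx) = s.1.verts + (s.2.1.verts + s.2.2.verts) :=
    fun s hs => by
      conv_lhs => rw [← app_of_mem_splits3 hs]
      simp [verts_app]
  cases v <;> simp only [blowR, List.mem_append, List.mem_flatMap] at h
  · rcases h with ⟨s, hs, h⟩ | ⟨s, hs, h⟩ <;> split_ifs at h with hc <;> simp at h <;> subst h <;>
      simp only [verts_app, verts, key s hs, ← Multiset.cons_coe, ← Multiset.coe_add,
        ← Multiset.singleton_add, Multiset.coe_nil] <;> abel
  · obtain ⟨s, hs, h⟩ := h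
    split_ifs at h with hc <;> simp at h
    subst h
    simp only [verts_app, verts, key s hs, ← Multiset.cons_coe, ← Multiset.coe_add,
      ← Multiset.singleton_add, Multiset.coe_nil]
    abel

lemma verts_blowS {v : Vtx} {ch : Forest} {p : ℤ × Forest} (h : p ∈ blowS v ch) :
    (p.2.verts : Multiset Vtx) = {neu 0} + ({v} + ch.verts) := by
  have key : ∀ s ∈ ch.splits3, (ch.verts : Multiset Vtx) = s.1.verts + (s.2.1.verts + s.2.2.verts) :=
    fun s hs => by
      conv_lhs => rw [← app_of_mem_splits3 hs]
      simp [verts_app]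
  have key' : ∀ s ∈ ch.splits, (ch.verts : Multiset Vtx) = s.1.verts + s.2.verts :=
    fun s hs => by
      conv_lhs => rw [← app_of_mem_splits hs]
      simp [verts_app]
  cases v <;> simp only [blowS, List.mem_append, List.mem_flatMap] at h
  · rcases h with (⟨s, hs, h⟩ | ⟨s, hs, h⟩) | ⟨s, hs, h⟩ <;> split_ifs at h with hc <;>
      simp at h <;> subst h <;> first | rw [key s hs] | rw [key' s hs]
    all_goals
      simp only [verts_app, verts, ← Multiset.cons_coe, ← Multiset.coe_add,
        ← Multiset.singleton_add, Multiset.coe_nil]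
      abel
  · rcases h with ⟨s, hs, h⟩ | ⟨s, hs, h⟩ <;> split_ifs at h with hc <;>
      simp at h <;> subst h <;> first | rw [key s hs] | rw [key' s hs]
    all_goals
      simp only [verts_app, verts, ← Multiset.cons_coe, ← Multiset.coe_add,
        ← Multiset.singleton_add, Multiset.coe_nil]
      abel

lemma verts_bdR {F : Forest} {p : ℤ × Forest} (h : p ∈ bdR F) :
    (p.2.verts : Multiset Vtx) = {neu 0} + F.verts := by
  induction F generalizing p with
  | nil => simp [bdR] at h
  | cons v ch r ih₁ ih₂ =>
    simp only [bdR, List.mem_append, List.mem_map] at h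
    rcases h with (⟨q, hq, rfl⟩ | ⟨q, hq, rfl⟩) | ⟨q, hq, rfl⟩
    · have := verts_blowR hq
      simp only [verts_app, verts, ← Multiset.cons_coe, ← Multiset.coe_add,
        ← Multiset.singleton_add] at this ⊢
      rw [this]; abel
    · have := ih₁ hq
      simp only [verts, ← Multiset.cons_coe, ← Multiset.coe_add, ← Multiset.singleton_add] at this ⊢
      rw [this]; abel
    · have := ih₂ hq
      simp only [verts, ← Multiset.cons_coe, ← Multiset.coe_add, ← Multiset.singleton_add] at this ⊢
      rw [this]; abel

lemma verts_bdS {F : Forest} {p : ℤ × Forest} (h : p ∈ bdS F) :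
    (p.2.verts : Multiset Vtx) = {neu 0} + F.verts := by
  induction F generalizing p with
  | nil => simp [bdS] at h
  | cons v ch r _ ih =>
    simp only [bdS, List.mem_append, List.mem_map] at h
    rcases h with (⟨q, hq, rfl⟩ | ⟨q, hq, rfl⟩) | ⟨q, hq, rfl⟩
    · have := verts_blowS hq
      simp only [verts_app, verts, ← Multiset.cons_coe, ← Multiset.coe_add,
        ← Multiset.singleton_add] at this ⊢
      rw [this]; abel
    · have := verts_bdR hq
      simp only [verts, ← Multiset.cons_coe, ← Multiset.coe_add, ← Multiset.singleton_add] at this ⊢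
      rw [this]; abel
    · have := ih hq
      simp only [verts, ← Multiset.cons_coe, ← Multiset.coe_add, ← Multiset.singleton_add] at this ⊢
      rw [this]; abel

lemma verts_bd {x : Color} {F : Forest} {p : ℤ × Forest} (h : p ∈ bd x F) :
    (p.2.verts : Multiset Vtx) = {neu 0} + F.verts := by
  cases x
  exacts [verts_bdR h, verts_bdS h]

end Boundary

/-! ### Shapes -/

/-- The version of `RoundOK` for a predicate on the labels. -/
def RoundP (p : ℕ → Prop) : Forest → Prop
  | nil => True
  | cons (lab i) ch r => p i ∧ ch.RoundP p ∧ r.RoundP p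
  | cons (neu _) ch r => 2 ≤ ch.len ∧ ch.RoundP p ∧ r.RoundP p

/-- The version of `SquareOK` for predicates on the labels. -/
def SquareP (p q : ℕ → Prop) : Forest → Prop
  | nil => True
  | cons (lab i) ch r => q i ∧ ch.RoundP p ∧ r.SquareP p q
  | cons (neu _) ch r => 1 ≤ ch.len ∧ ch.RoundP p ∧ r.SquareP p q

/-- The version of `Shape` for predicates on the labels. -/
def ShapeP (p q : ℕ → Prop) : Color → Forest → Prop
  | cl, F => F.len = 1 ∧ F.RoundP p
  | op, F => 1 ≤ F.len ∧ F.SquareP p q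

variable {p q p' q' : ℕ → Prop}

lemma roundOK_iff (I : List Color) (F : Forest) :
    F.RoundOK I ↔ F.RoundP fun i => I[i]? = some cl := by
  induction F with
  | nil => rfl
  | cons v ch r ih₁ ih₂ => cases v <;> simp [RoundOK, RoundP, ih₁, ih₂]

lemma squareOK_iff (I : List Color) (F : Forest) :
    F.SquareOK I ↔ F.SquareP (fun i => I[i]? = some cl) fun i => I[i]? = some op := by
  induction F with
  | nil => rfl
  | cons v ch r _ ih => cases v <;> simp [SquareOK, SquareP, roundOK_iff, ih]

lemma shape_iff (I : List Color) (x : Color) (F : Forest) :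
    F.Shape I x ↔ F.ShapeP (fun i => I[i]? = some cl) (fun i => I[i]? = some op) x := by
  cases x <;> simp [Shape, ShapeP, roundOK_iff, squareOK_iff]

lemma roundP_app {F G : Forest} : (F.app G).RoundP p ↔ F.RoundP p ∧ G.RoundP p := by
  induction F with
  | nil => simp [app, RoundP]
  | cons v ch r _ ih => cases v <;> simp [app, RoundP, ih, and_assoc]

lemma squareP_app {F G : Forest} : (F.app G).SquareP p q ↔ F.SquareP p q ∧ G.SquareP p q := by
  induction F with
  | nil => simp [app, SquareP]
  | cons v ch r _ ih => cases v <;> simp [app, SquareP, ih, and_assoc]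

lemma roundP_rename (f g : ℕ → ℕ) {F : Forest} :
    (F.rename f g).RoundP p ↔ F.RoundP fun i => p (f i) := by
  induction F with
  | nil => rfl
  | cons v ch r ih₁ ih₂ => cases v <;> simp [rename, RoundP, ih₁, ih₂, len_rename]

lemma squareP_rename (f g : ℕ → ℕ) {F : Forest} :
    (F.rename f g).SquareP p q ↔ F.SquareP (fun i => p (f i)) fun i => q (f i) := by
  induction F with
  | nil => rfl
  | cons v ch r _ ih => cases v <;> simp [rename, SquareP, roundP_rename, ih, len_rename]

lemma shapeP_rename (f g : ℕ → ℕ) {x : Color} {F : Forest} :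
    (F.rename f g).ShapeP p q x ↔ F.ShapeP (fun i => p (f i)) (fun i => q (f i)) x := by
  cases x <;> simp [ShapeP, roundP_rename, squareP_rename, len_rename]

lemma RoundP.mono {F : Forest} (h : F.RoundP p) (hp : ∀ i, p i → p' i) : F.RoundP p' := by
  induction F with
  | nil => trivial
  | cons v ch r ih₁ ih₂ =>
    cases v with
    | lab i => exact ⟨hp i h.1, ih₁ h.2.1, ih₂ h.2.2⟩
    | neu e => exact ⟨h.1, ih₁ h.2.1, ih₂ h.2.2⟩

lemma SquareP.mono {F : Forest} (h : F.SquareP p q) (hp : ∀ i, p i → p' i) (hq : ∀ i, q i → q' i) :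
    F.SquareP p' q' := by
  induction F with
  | nil => trivial
  | cons v ch r _ ih =>
    cases v with
    | lab i => exact ⟨hq i h.1, h.2.1.mono hp, ih h.2.2⟩
    | neu e => exact ⟨h.1, h.2.1.mono hp, ih h.2.2⟩

lemma ShapeP.mono {x : Color} {F : Forest} (h : F.ShapeP p q x) (hp : ∀ i, p i → p' i)
    (hq : ∀ i, q i → q' i) : F.ShapeP p' q' x := by
  cases x
  exacts [⟨h.1, h.2.mono hp⟩, ⟨h.1, h.2.mono hp hq⟩]

lemma RoundP.of_mem_splits3 {F : Forest} (h : F.RoundP p) {s : Forest × Forest × Forest}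
    (hs : s ∈ F.splits3) : s.1.RoundP p ∧ s.2.1.RoundP p ∧ s.2.2.RoundP p := by
  rwa [← app_of_mem_splits3 hs, roundP_app, roundP_app] at h

lemma RoundP.of_mem_splits {F : Forest} (h : F.RoundP p) {s : Forest × Forest}
    (hs : s ∈ F.splits) : s.1.RoundP p ∧ s.2.RoundP p := by
  rwa [← app_of_mem_splits hs, roundP_app] at h

/-- Monotonicity of the conditions at a vertex in the number of its subtrees. -/
lemma RoundP.cons_of_le {v : Vtx} {ch r ch' r' : Forest} (h : (cons v ch r).RoundP p)
    (hc : ch'.RoundP p') (hr : r'.RoundP p') (hl : ch.len ≤ ch'.len)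
    (hv : ∀ i, v = lab i → p i → p' i) : (cons v ch' r').RoundP p' := by
  cases v with
  | lab i => exact ⟨hv i rfl h.1, hc, hr⟩
  | neu e => exact ⟨h.1.trans hl, hc, hr⟩

lemma SquareP.cons_of_le {v : Vtx} {ch r ch' r' : Forest} (h : (cons v ch r).SquareP p q)
    (hc : ch'.RoundP p') (hr : r'.SquareP p' q') (hl : ch.len ≤ ch'.len)
    (hv : ∀ i, v = lab i → q i → q' i) : (cons v ch' r').SquareP p' q' := by
  cases v with
  | lab i => exact ⟨hv i rfl h.1, hc, hr⟩
  | neu e => exact ⟨h.1.trans hl, hc, hr⟩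

lemma RoundP.ch {v : Vtx} {ch r : Forest} (h : (cons v ch r).RoundP p) : ch.RoundP p := by
  cases v <;> exact h.2.1

lemma RoundP.rest {v : Vtx} {ch r : Forest} (h : (cons v ch r).RoundP p) : r.RoundP p := by
  cases v <;> exact h.2.2

lemma SquareP.ch {v : Vtx} {ch r : Forest} (h : (cons v ch r).SquareP p q) : ch.RoundP p := by
  cases v <;> exact h.2.1

lemma SquareP.rest {v : Vtx} {ch r : Forest} (h : (cons v ch r).SquareP p q) : r.SquareP p q := by
  cases v <;> exact h.2.2

/-- Attaching trees can only increase the number of children, so neutral vertices still have enough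
of them. -/
lemma RoundP.plug {F S T : Forest} (hF : F.RoundP p) (hS : S.RoundP p) (h : T ∈ F.plug S) :
    T.RoundP p ∧ F.len ≤ T.len := by
  induction F generalizing S T with
  | nil =>
    obtain rfl : T = S := by simpa [Forest.plug] using h
    exact ⟨hS, Nat.zero_le _⟩
  | cons v ch r ih₁ ih₂ =>
    simp only [Forest.plug, List.mem_flatMap, List.mem_map] at h
    obtain ⟨s, hs, ch', hch, r', hr, rfl⟩ := h
    obtain ⟨h1, h2, h3⟩ := hS.of_mem_splits3 hs
    obtain ⟨h4, h5⟩ := ih₁ hF.ch h2 hch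
    obtain ⟨h6, h7⟩ := ih₂ hF.rest h3 hr
    refine ⟨roundP_app.2 ⟨h1, hF.cons_of_le h4 h6 h5 fun _ _ h => h⟩, ?_⟩
    rw [len_app, len, len]
    omega

lemma RoundP.plugWord {X S T : Forest} (hX : X.RoundP p) (hS : S.RoundP p)
    (h : T ∈ X.plugWord S) : T.RoundP p ∧ T.len = X.len := by
  induction X generalizing S T with
  | nil =>
    cases S with
    | nil =>
      obtain rfl : T = nil := by simpa [Forest.plugWord] using h
      exact ⟨hX, rfl⟩
    | cons v ch r => simp [Forest.plugWord] at h
  | cons v ch r _ ih =>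
    simp only [Forest.plugWord, List.mem_flatMap, List.mem_map] at h
    obtain ⟨s, hs, ch', hch, r', hr, rfl⟩ := h
    obtain ⟨h2, h3⟩ := hS.of_mem_splits hs
    obtain ⟨h4, h5⟩ := hX.ch.plug h2 hch
    obtain ⟨h6, h7⟩ := ih hX.rest h3 hr
    exact ⟨hX.cons_of_le h4 h6 h5 fun _ _ h => h, by rw [len, len, h7]⟩

lemma SquareP.plugWord {X S T : Forest} (hX : X.SquareP p q) (hS : S.RoundP p)
    (h : T ∈ X.plugWord S) : T.SquareP p q ∧ T.len = X.len := by
  induction X generalizing S T with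
  | nil =>
    cases S with
    | nil =>
      obtain rfl : T = nil := by simpa [Forest.plugWord] using h
      exact ⟨hX, rfl⟩
    | cons v ch r => simp [Forest.plugWord] at h
  | cons v ch r _ ih =>
    simp only [Forest.plugWord, List.mem_flatMap, List.mem_map] at h
    obtain ⟨s, hs, ch', hch, r', hr, rfl⟩ := h
    obtain ⟨h2, h3⟩ := hS.of_mem_splits hs
    obtain ⟨h4, h5⟩ := hX.ch.plug h2 hch
    obtain ⟨h6, h7⟩ := ih hX.rest h3 hr
    exact ⟨hX.cons_of_le h4 h6 h5 fun _ _ h => h, by rw [len, len, h7]⟩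

lemma RoundP.of_ne {i : ℕ} (hp : ∀ j ≠ i, p j → p' j) {G : Forest} (hG : G.RoundP p)
    (hi : i ∉ G.labels) : G.RoundP p' := by
  induction G with
  | nil => trivial
  | cons v ch r ih₁ ih₂ =>
    rw [PlainOp.mem_labels_cons, not_or, not_or] at hi
    exact hG.cons_of_le (ih₁ hG.ch hi.2.1) (ih₂ hG.rest hi.2.2) le_rfl
      fun j hj => hp j (by rintro rfl; exact hi.1 hj)

/-- The predicates may disagree at `i`, since the vertex with this label is used up and labels do
not repeat. A round vertex is replaced by a single tree, hence the number of children of the vertex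
below it does not change. -/
lemma RoundP.subst {F X T : Forest} {i : ℕ} (hF : F.RoundP p) (hp : ∀ j ≠ i, p j → p' j)
    (hF' : F.labels.Nodup) (hX : p i → X.RoundP p' ∧ X.len = 1) (h : T ∈ F.subst i X) :
    T.RoundP p' ∧ T.len = F.len := by
  induction F generalizing T with
  | nil => simp [Forest.subst] at h
  | cons v ch r ih₁ ih₂ =>
    obtain ⟨h1, h2, h3, h4, h5⟩ := PlainOp.nodup_labels_cons hF'
    rw [Forest.subst] at h
    split_ifs at h with hv
    · subst hv
      obtain ⟨X', hX', rfl⟩ := List.mem_map.1 h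
      have hX1 := hX hF.1
      obtain ⟨h6, h7⟩ := hX1.1.plugWord (hF.ch.of_ne hp fun hc => h4 i hc rfl) hX'
      exact ⟨roundP_app.2 ⟨h6, hF.rest.of_ne hp fun hc => h5 i hc rfl⟩,
        by rw [len_app, h7, hX1.2, len]; omega⟩
    · have hv' : ∀ j, v = lab j → p j → p' j := fun j hj => hp j (by rintro rfl; exact hv hj)
      rcases List.mem_append.1 h with h | h
      · obtain ⟨ch', hc, rfl⟩ := List.mem_map.1 h
        obtain ⟨h6, h7⟩ := ih₁ hF.ch h1 hc
        have hi : i ∈ ch.labels := by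
          by_contra hi
          rw [subst_eq_nil _ _ _ hi] at hc
          simp at hc
        exact ⟨hF.cons_of_le h6 (hF.rest.of_ne hp (h3 i hi)) h7.ge hv', rfl⟩
      · obtain ⟨r', hr, rfl⟩ := List.mem_map.1 h
        obtain ⟨h6, h7⟩ := ih₂ hF.rest h2 hr
        have hi : i ∈ r.labels := by
          by_contra hi
          rw [subst_eq_nil _ _ _ hi] at hr
          simp at hr
        exact ⟨hF.cons_of_le (hF.ch.of_ne hp fun hc => h3 i hc hi) h6 le_rfl hv', by
          rw [len, len, h7]⟩

lemma SquareP.of_ne {i : ℕ} (hp : ∀ j ≠ i, p j → p' j) (hq : ∀ j ≠ i, q j → q' j) {G : Forest}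
    (hG : G.SquareP p q) (hi : i ∉ G.labels) : G.SquareP p' q' := by
  induction G with
  | nil => trivial
  | cons v ch r _ ih =>
    rw [PlainOp.mem_labels_cons, not_or, not_or] at hi
    exact hG.cons_of_le (hG.ch.of_ne hp hi.2.1) (ih hG.rest hi.2.2) le_rfl
      fun j hj => hq j (by rintro rfl; exact hi.1 hj)

lemma SquareP.subst {F X T : Forest} {i : ℕ} (hF : F.SquareP p q) (hp : ∀ j ≠ i, p j → p' j)
    (hq : ∀ j ≠ i, q j → q' j) (hF' : F.labels.Nodup) (hX : p i → X.RoundP p' ∧ X.len = 1)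
    (hX' : q i → X.SquareP p' q' ∧ 1 ≤ X.len) (h : T ∈ F.subst i X) :
    T.SquareP p' q' ∧ F.len ≤ T.len := by
  induction F generalizing T with
  | nil => simp [Forest.subst] at h
  | cons v ch r _ ih =>
    obtain ⟨h1, h2, h3, h4, h5⟩ := PlainOp.nodup_labels_cons hF'
    rw [Forest.subst] at h
    split_ifs at h with hv
    · subst hv
      obtain ⟨Y, hY, rfl⟩ := List.mem_map.1 h
      have hX1 := hX' hF.1
      obtain ⟨h6, h7⟩ := hX1.1.plugWord (hF.ch.of_ne hp fun hc => h4 i hc rfl) hY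
      exact ⟨squareP_app.2 ⟨h6, hF.rest.of_ne hp hq fun hc => h5 i hc rfl⟩,
        by rw [len_app, h7, len]; omega⟩
    · have hv' : ∀ j, v = lab j → q j → q' j := fun j hj => hq j (by rintro rfl; exact hv hj)
      rcases List.mem_append.1 h with h | h
      · obtain ⟨ch', hc, rfl⟩ := List.mem_map.1 h
        obtain ⟨h6, h7⟩ := hF.ch.subst hp h1 hX hc
        have hi : i ∈ ch.labels := by
          by_contra hi
          rw [subst_eq_nil _ _ _ hi] at hc
          simp at hc
        exact ⟨hF.cons_of_le h6 (hF.rest.of_ne hp hq (h3 i hi)) h7.ge hv', le_rfl⟩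
      · obtain ⟨r', hr, rfl⟩ := List.mem_map.1 h
        obtain ⟨h6, h7⟩ := ih hF.rest h2 hr
        have hi : i ∈ r.labels := by
          by_contra hi
          rw [subst_eq_nil _ _ _ hi] at hr
          simp at hr
        exact ⟨hF.cons_of_le (hF.ch.of_ne hp fun hc => h3 i hc hi) h6 le_rfl hv', by
          rw [len, len]; omega⟩

lemma ShapeP.subst {x : Color} {F X T : Forest} {i : ℕ} (hF : F.ShapeP p q x)
    (hp : ∀ j ≠ i, p j → p' j) (hq : ∀ j ≠ i, q j → q' j) (hF' : F.labels.Nodup)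
    (hX : p i → X.ShapeP p' q' cl) (hX' : q i → X.ShapeP p' q' op) (h : T ∈ F.subst i X) :
    T.ShapeP p' q' x := by
  cases x
  · obtain ⟨h1, h2⟩ := hF.2.subst hp hF' (fun hi => (hX hi).symm) h
    exact ⟨h2.trans hF.1, h1⟩
  · obtain ⟨h1, h2⟩ := hF.2.subst hp hq hF' (fun hi => (hX hi).symm) (fun hi => (hX' hi).symm) h
    exact ⟨hF.1.trans h2, h1⟩

end Forest

end SwissCheese

namespace SwissCheese

open Color Vtx

namespace Forest

variable {p q : ℕ → Prop}

/-! ### Shapes of blow-ups -/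

lemma RoundP.blowR {v : Vtx} {ch : Forest} (h : (cons v ch nil).RoundP p) {t : ℤ × Forest}
    (ht : t ∈ blowR v ch) : t.2.RoundP p ∧ t.2.len = 1 := by
  cases v with
  | lab i =>
    simp only [Forest.blowR, List.mem_append, List.mem_flatMap] at ht
    rcases ht with ⟨s, hs, ht⟩ | ⟨s, hs, ht⟩
    all_goals
      obtain ⟨h1, h2, h3⟩ := h.ch.of_mem_splits3 hs
      split_ifs at ht with hc
      · obtain rfl : t = _ := by simpa using ht
        refine ⟨?_, rfl⟩
        simp only [RoundP, roundP_app, len_app, len]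
        refine ⟨?_, ?_, trivial⟩
        · first | omega | exact h.1
        · first | exact ⟨h1, h.1, h2, h3⟩ | exact ⟨h1, hc, h2, h3⟩
      · simp at ht
  | neu e =>
    simp only [Forest.blowR, List.mem_flatMap] at ht
    obtain ⟨s, hs, ht⟩ := ht
    obtain ⟨h1, h2, h3⟩ := h.ch.of_mem_splits3 hs
    split_ifs at ht with hc
    · obtain rfl : t = _ := by simpa using ht
      refine ⟨?_, rfl⟩
      simp only [RoundP, roundP_app, len_app, len]
      exact ⟨by omega, ⟨h1, hc.1, h2, h3⟩, trivial⟩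
    · simp at ht

lemma SquareP.blowS {v : Vtx} {ch : Forest} (h : (cons v ch nil).SquareP p q) {t : ℤ × Forest}
    (ht : t ∈ blowS v ch) : t.2.SquareP p q ∧ 1 ≤ t.2.len := by
  cases v with
  | lab i =>
    simp only [Forest.blowS, List.mem_append, List.mem_flatMap] at ht
    rcases ht with (⟨s, hs, ht⟩ | ⟨s, hs, ht⟩) | ⟨s, hs, ht⟩
    · obtain ⟨h1, h2, h3⟩ := h.ch.of_mem_splits3 hs
      split_ifs at ht with hc
      · obtain rfl : t = _ := by simpa using ht
        simp only [SquareP, RoundP, roundP_app, len]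
        exact ⟨⟨h.1, ⟨h1, hc, h2, h3⟩, trivial⟩, by omega⟩
      · simp at ht
    all_goals
      obtain ⟨h1, h2⟩ := h.ch.of_mem_splits hs
      split_ifs at ht with hc
      · obtain rfl : t = _ := by simpa using ht
        simp only [SquareP, len]
        first
          | exact ⟨⟨h.1, h1, hc, h2, trivial⟩, by omega⟩
          | exact ⟨⟨hc, h1, h.1, h2, trivial⟩, by omega⟩
      · simp at ht
  | neu e =>
    simp only [Forest.blowS, List.mem_append, List.mem_flatMap] at ht
    rcases ht with ⟨s, hs, ht⟩ | ⟨s, hs, ht⟩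
    · obtain ⟨h1, h2, h3⟩ := h.ch.of_mem_splits3 hs
      split_ifs at ht with hc
      · obtain rfl : t = _ := by simpa using ht
        simp only [SquareP, RoundP, roundP_app, len, len_app]
        exact ⟨⟨by omega, ⟨h1, hc, h2, h3⟩, trivial⟩, by omega⟩
      · simp at ht
    · obtain ⟨h1, h2⟩ := h.ch.of_mem_splits hs
      split_ifs at ht with hc
      · obtain rfl : t = _ := by simpa using ht
        simp only [SquareP, len]
        exact ⟨⟨hc.1, h1, hc.2, h2, trivial⟩, by omega⟩
      · simp at ht

lemma RoundP.head {v : Vtx} {ch r : Forest} (h : (cons v ch r).RoundP p) :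
    (cons v ch nil).RoundP p :=
  h.cons_of_le h.ch trivial le_rfl fun _ _ h => h

lemma SquareP.head {v : Vtx} {ch r : Forest} (h : (cons v ch r).SquareP p q) :
    (cons v ch nil).SquareP p q :=
  h.cons_of_le h.ch trivial le_rfl fun _ _ h => h

lemma RoundP.bdR {F : Forest} (h : F.RoundP p) {t : ℤ × Forest} (ht : t ∈ bdR F) :
    t.2.RoundP p ∧ t.2.len = F.len := by
  induction F generalizing t with
  | nil => simp [Forest.bdR] at ht
  | cons v ch r ih₁ ih₂ =>
    simp only [Forest.bdR, List.mem_append, List.mem_map] at ht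
    rcases ht with (⟨s, hs, rfl⟩ | ⟨s, hs, rfl⟩) | ⟨s, hs, rfl⟩
    · obtain ⟨h1, h2⟩ := h.head.blowR hs
      exact ⟨roundP_app.2 ⟨h1, h.rest⟩, by rw [len_app, h2, len, add_comm]⟩
    · obtain ⟨h1, h2⟩ := ih₁ h.ch hs
      exact ⟨h.cons_of_le h1 h.rest h2.ge fun _ _ h => h, rfl⟩
    · obtain ⟨h1, h2⟩ := ih₂ h.rest hs
      exact ⟨h.cons_of_le h.ch h1 le_rfl fun _ _ h => h, by rw [len, len, h2]⟩

lemma SquareP.bdS {F : Forest} (h : F.SquareP p q) {t : ℤ × Forest} (ht : t ∈ bdS F) :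
    t.2.SquareP p q ∧ 1 ≤ t.2.len := by
  induction F generalizing t with
  | nil => simp [Forest.bdS] at ht
  | cons v ch r _ ih =>
    simp only [Forest.bdS, List.mem_append, List.mem_map] at ht
    rcases ht with (⟨s, hs, rfl⟩ | ⟨s, hs, rfl⟩) | ⟨s, hs, rfl⟩
    · obtain ⟨h1, h2⟩ := h.head.blowS hs
      exact ⟨squareP_app.2 ⟨h1, h.rest⟩, by rw [len_app]; omega⟩
    · obtain ⟨h1, h2⟩ := h.ch.bdR hs
      exact ⟨h.cons_of_le h1 h.rest h2.ge fun _ _ h => h, by rw [len]; omega⟩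
    · obtain ⟨h1, h2⟩ := ih h.rest hs
      exact ⟨h.cons_of_le h.ch h1 le_rfl fun _ _ h => h, by rw [len]; omega⟩

lemma ShapeP.bd {x : Color} {F : Forest} (h : F.ShapeP p q x) {t : ℤ × Forest} (ht : t ∈ bd x F) :
    t.2.ShapeP p q x := by
  cases x
  · obtain ⟨h1, h2⟩ := h.2.bdR ht
    exact ⟨h2.trans h.1, h1⟩
  · exact (h.2.bdS ht).symm

lemma RoundP.stable {F : Forest} (h : F.RoundP p) (h0 : 0 ∉ F.names) : F.StableR := by
  induction F with
  | nil => trivial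
  | cons v ch r ih₁ ih₂ =>
    cases v with
    | lab i =>
      simp only [names, List.mem_append, not_or] at h0
      exact ⟨ih₁ h.ch h0.1, ih₂ h.rest h0.2⟩
    | neu e =>
      simp only [names, List.mem_cons, List.mem_append, not_or] at h0
      exact ⟨fun he => h0.1 he.symm, h.1, ih₁ h.ch h0.2.1, ih₂ h.rest h0.2.2⟩

lemma SquareP.stable {F : Forest} (h : F.SquareP p q) (h0 : 0 ∉ F.names) : F.StableS := by
  induction F with
  | nil => trivial
  | cons v ch r _ ih =>
    cases v with
    | lab i =>
      simp only [names, List.mem_append, not_or] at h0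
      exact ⟨h.ch.stable h0.1, ih h.rest h0.2⟩
    | neu e =>
      simp only [names, List.mem_cons, List.mem_append, not_or] at h0
      exact ⟨fun he => h0.1 he.symm, h.1, h.ch.stable h0.2.1, ih h.rest h0.2.2⟩

lemma ShapeP.stable {x : Color} {F : Forest} (h : F.ShapeP p q x) (h0 : 0 ∉ F.names) :
    F.Stable x := by
  cases x
  exacts [h.2.stable h0, h.2.stable h0]

/-! ### Canonical names -/

lemma names_length_renum (s : ℕ) (F : Forest) : (F.renum s).names = List.range' s F.names.length := by
  induction F generalizing s with
  | nil => rfl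
  | cons v ch r ih₁ ih₂ =>
    cases v with
    | lab i =>
      simp only [renum, names, ih₁, ih₂, List.length_append]
      exact List.range'_append_1
    | neu e =>
      simp only [renum, names, ih₁, ih₂, List.length_append, List.length_cons]
      rw [List.range'_succ, List.range'_append_1]

lemma renum_rename (s : ℕ) (g : ℕ → ℕ) (F : Forest) : (F.rename id g).renum s = F.renum s := by
  induction F generalizing s with
  | nil => rfl
  | cons v ch r ih₁ ih₂ =>
    cases v <;> simp [rename, renum, ih₁, ih₂, names_rename]

lemma rename_renum (s : ℕ) (ν : ℕ → ℕ) (F : Forest)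
    (h : ∀ j < F.names.length, ν (s + j) = F.names.getD j 0) : (F.renum s).rename id ν = F := by
  induction F generalizing s with
  | nil => rfl
  | cons v ch r ih₁ ih₂ =>
    cases v with
    | lab i =>
      simp only [names, List.length_append] at h
      rw [renum, rename, ih₁ s, ih₂ (s + ch.names.length)]
      · rfl
      · intro j hj
        rw [add_assoc, h _ (by omega), List.getD_append_right _ _ _ _ (by omega)]
        congr 1; omega
      · intro j hj
        rw [h _ (by omega), List.getD_append _ _ _ _ hj]
    | neu e =>
      simp only [names, List.length_append, List.length_cons] at h
      have h0 := h 0 (by omega)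
      simp only [add_zero, List.getD_cons_zero] at h0
      rw [renum, rename, ih₁ (s + 1), ih₂ (s + 1 + ch.names.length), h0]
      · intro j hj
        rw [add_assoc, add_assoc, h _ (by omega),
          show 1 + (ch.names.length + j) = ch.names.length + j + 1 by omega, List.getD_cons_succ,
          List.getD_append_right _ _ _ _ (by omega)]
        congr 1; omega
      · intro j hj
        rw [add_assoc, h _ (by omega), add_comm 1 j, List.getD_cons_succ,
          List.getD_append _ _ _ _ hj]

/-- A word is the renaming of its version with canonical names. -/
lemma rename_renum_zero (F : Forest) : (F.renum 0).rename id (fun j => F.names.getD j 0) = F :=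
  F.rename_renum 0 _ fun j _ => by rw [zero_add]

lemma renum_renum (F : Forest) : (F.renum 0).renum 0 = F.renum 0 := by
  conv_rhs => rw [← F.rename_renum_zero, renum_rename]

lemma names_renum_zero (F : Forest) : (F.renum 0).names = List.range F.names.length := by
  rw [names_length_renum, List.range_eq_range']

lemma labels_renum (F : Forest) : (F.renum 0).labels = F.labels := by
  conv_rhs => rw [← F.rename_renum_zero, labels_rename, List.map_id]

lemma shape_renum {I : List Color} {x : Color} (F : Forest) :
    (F.renum 0).Shape I x ↔ F.Shape I x := by
  conv_rhs => rw [← F.rename_renum_zero, shape_iff, shapeP_rename]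
  rw [shape_iff]
  rfl

lemma Valid.names {I : List Color} {x : Color} {e : ℤ} {F : Forest} (h : F.Valid I x e) :
    F.names = List.range F.names.length := by
  conv_lhs => rw [← h.2.1, names_renum_zero]

lemma valid_renum {I : List Color} {x : Color} {F : Forest}
    (hl : F.labels.Perm (List.range I.length)) (hS : F.Shape I x) :
    (F.renum 0).Valid I x (-(F.names.length : ℤ)) :=
  ⟨by rwa [labels_renum], F.renum_renum, by rw [names_renum_zero, List.length_range],
    F.shape_renum.2 hS⟩

lemma verts_canon {F : Forest} {r n : ℕ} (hn : F.names.Perm (List.range r))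
    (hl : F.labels.Perm (List.range n)) : F.verts.Perm (canonVerts r n) :=
  F.verts_perm.trans ((hn.map _).append (hl.map _))

lemma names_perm_of_verts {F : Forest} {M : List ℕ} {l : List ℕ}
    (h : (F.verts : Multiset Vtx) = (M.map neu : List Vtx) + (l.map lab : List Vtx)) :
    F.names.Perm M ∧ F.labels.Perm l := by
  rw [Multiset.coe_add, Multiset.coe_eq_coe] at h
  rw [names_eq, labels_eq]
  have h1 := h.filterMap fun
    | lab _ => none
    | neu e => some e
  have h2 := h.filterMap fun
    | lab i => some i
    | neu _ => none
  rw [List.filterMap_append, List.filterMap_map, List.filterMap_map] at h1 h2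
  constructor
  · refine h1.trans (List.Perm.of_eq ?_)
    have : ((fun | lab _ => none | neu e => some e : Vtx → Option ℕ) ∘ neu) = some := rfl
    rw [this, List.filterMap_some]
    simp
  · refine h2.trans (List.Perm.of_eq ?_)
    have : ((fun | lab i => some i | neu _ => none : Vtx → Option ℕ) ∘ lab) = some := rfl
    rw [this, List.filterMap_some]
    simp

end Forest

/-! ### Sorting signs -/

/-- Both signs collect a factor `-1` for each smaller letter further to the right. Distinctness is
essential: on a repeated letter `wordSign` vanishes, while `sortSign` does not. -/
lemma sortSign_eq {l : List ℕ} (h : l.Nodup) : sortSign l = wordSign l := by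
  induction l with
  | nil => rfl
  | cons a l ih =>
    rw [List.nodup_cons] at h
    rw [sortSign, wordSign, ih h.2]
    congr 1
    have key : ∀ m : List ℕ, a ∉ m → (-1 : ℤ) ^ m.countP (· < a) = biSign {a} m := by
      intro m hm
      rw [biSign, Multiset.map_singleton, Multiset.prod_singleton]
      induction m with
      | nil => simp
      | cons b m ihm =>
        rw [List.mem_cons, not_or] at hm
        rw [List.countP_cons, pow_add, ihm hm.2, ← Multiset.cons_coe, Multiset.map_cons,
          Multiset.prod_cons, mul_comm]
        congr 1
        by_cases hb : b < a <;> simp [letSign, hm.1, hb]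
    exact key l h.1

/-- The case of blocks consisting of one odd letter each: the sign of a permutation does not depend
on the names of the letters. -/
lemma wordSign_map_perm {l l' : List ℕ} (h : l.Perm l') :
    ∃ ε : ℤ, ε * ε = 1 ∧ ∀ ν : ℕ → ℕ, wordSign (l.map ν) = ε * wordSign (l'.map ν) := by
  obtain ⟨ε, h1, h2⟩ := wordSign_flatMap_perm h fun _ => 1
  refine ⟨ε, h1, fun ν => ?_⟩
  have := h2 (fun i => [ν i]) fun _ => by simp
  simpa only [List.map_eq_flatMap] using this

end SwissCheese

namespace SwissCheese

open Color Vtx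

namespace Forest

/-! ### Comparison of the two conventions for the names in a blow-up -/

lemma rename_rename (f g f' g' : ℕ → ℕ) (F : Forest) :
    (F.rename f g).rename f' g' = F.rename (fun i => f' (f i)) fun e => g' (g e) := by
  induction F with
  | nil => rfl
  | cons v ch r ih₁ ih₂ => cases v <;> simp [rename, ih₁, ih₂]

lemma rename_congr {f f' g g' : ℕ → ℕ} (F : Forest) (h : ∀ i ∈ F.labels, f i = f' i)
    (h' : ∀ e ∈ F.names, g e = g' e) : F.rename f g = F.rename f' g' := by
  induction F with
  | nil => rfl
  | cons v ch r ih₁ ih₂ =>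
    cases v with
    | lab i =>
      simp only [labels, names, List.mem_cons, List.mem_append] at h h'
      rw [rename, rename, h i (by simp), ih₁ (fun i hi => h i (by tauto)) fun e he => h' e (by tauto),
        ih₂ (fun i hi => h i (by tauto)) fun e he => h' e (by tauto)]
    | neu e =>
      simp only [labels, names, List.mem_cons, List.mem_append] at h h'
      rw [rename, rename, h' e (by simp), ih₁ (fun i hi => h i (by tauto)) fun e he => h' e (by tauto),
        ih₂ (fun i hi => h i (by tauto)) fun e he => h' e (by tauto)]

lemma app_rename (f g : ℕ → ℕ) (F G : Forest) :
    (F.app G).rename f g = (F.rename f g).app (G.rename f g) := by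
  induction F with
  | nil => rfl
  | cons v ch r _ ih => rw [app, rename_cons, rename_cons, app, ih]

lemma splits_rename (f g : ℕ → ℕ) (F : Forest) :
    (F.rename f g).splits = F.splits.map fun p => (p.1.rename f g, p.2.rename f g) := by
  induction F with
  | nil => rfl
  | cons v ch r _ ih =>
    rw [rename_cons, splits, splits, ih, List.map_cons, List.map_map, List.map_map]
    refine congrArg₂ List.cons (by rw [rename_cons]; rfl) (List.map_congr_left fun p _ => ?_)
    simp [rename_cons]

lemma splits3_rename (f g : ℕ → ℕ) (F : Forest) : (F.rename f g).splits3 =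
    F.splits3.map fun s => (s.1.rename f g, s.2.1.rename f g, s.2.2.rename f g) := by
  rw [splits3, splits3, splits_rename, List.flatMap_map, List.map_flatMap]
  refine List.flatMap_congr fun p _ => ?_
  rw [splits_rename, List.map_map, List.map_map]
  rfl

/-- Make room for the name `1`, which the vertex `e` receives if there is one. -/
def bump (e : Option ℕ) : ℕ → ℕ
  | 0 => 0
  | j + 1 => if some j = e then 1 else j + 2

/-- The coefficients and the words of the two conventions, the vertex that is blown up being `e` if
it is neutral. -/
def BumpRel (N : List ℕ) (p' p : ℤ × Forest) : Prop :=
  ∃ e : Option ℕ, (∀ j ∈ e, j ∈ N) ∧ p'.1 = (e.elim 1 fun j => sgn j) * p.1 ∧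
    p'.2 = p.2.rename id (bump e)

lemma rename_bump {N : List ℕ} {e : Option ℕ} (he : ∀ j ∈ e, j ∈ N) {G : Forest}
    (hG : ∀ j ∈ N, j ∉ G.names) :
    (G.rename id (· + 1)).rename id (bump e) = G.rename id (· + 2) := by
  rw [rename_rename]
  refine rename_congr G (fun _ _ => rfl) fun j hj => ?_
  rw [bump, if_neg]
  rintro rfl
  exact hG j (he j rfl) hj

lemma BumpRel.mono {N N' : List ℕ} {p' p : ℤ × Forest} (h : BumpRel N p' p) (hN : ∀ j ∈ N, j ∈ N') :
    BumpRel N' p' p := by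
  obtain ⟨e, h1, h2⟩ := h
  exact ⟨e, fun j hj => hN j (h1 j hj), h2⟩

lemma BumpRel.app {N : List ℕ} {p' p : ℤ × Forest} (h : BumpRel N p' p) {r : Forest}
    (hr : ∀ j ∈ N, j ∉ r.names) : BumpRel N (p'.1, p'.2.app (r.rename id (· + 2)))
      (p.1, p.2.app (r.rename id (· + 1))) := by
  obtain ⟨e, h1, h2, h3⟩ := h
  exact ⟨e, h1, h2, by rw [app_rename, rename_bump h1 hr, h3]⟩

lemma vtx_rename_bump {N : List ℕ} {e : Option ℕ} (he : ∀ j ∈ e, j ∈ N) {v : Vtx}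
    (hv : ∀ j ∈ N, v ≠ neu j) : (v.rename id (· + 1)).rename id (bump e) = v.rename id (· + 2) := by
  cases v with
  | lab i => rfl
  | neu m =>
    simp only [Vtx.rename, bump]
    rw [if_neg]
    rintro rfl
    exact hv m (he m rfl) rfl

lemma BumpRel.ch {N : List ℕ} {p' p : ℤ × Forest} (h : BumpRel N p' p) {v : Vtx} {r : Forest}
    (hv : ∀ j ∈ N, v ≠ neu j) (hr : ∀ j ∈ N, j ∉ r.names) :
    BumpRel N (p'.1, cons (v.rename id (· + 2)) p'.2 (r.rename id (· + 2)))
      (p.1, cons (v.rename id (· + 1)) p.2 (r.rename id (· + 1))) := by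
  obtain ⟨e, h1, h2, h3⟩ := h
  exact ⟨e, h1, h2, by rw [rename_cons, rename_bump h1 hr, vtx_rename_bump h1 hv, h3]⟩

lemma BumpRel.rest {N : List ℕ} {p' p : ℤ × Forest} (h : BumpRel N p' p) {v : Vtx} {ch : Forest}
    (hv : ∀ j ∈ N, v ≠ neu j) (hr : ∀ j ∈ N, j ∉ ch.names) :
    BumpRel N (p'.1, cons (v.rename id (· + 2)) (ch.rename id (· + 2)) p'.2)
      (p.1, cons (v.rename id (· + 1)) (ch.rename id (· + 1)) p.2) := by
  obtain ⟨e, h1, h2, h3⟩ := h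
  exact ⟨e, h1, h2, by rw [rename_cons, rename_bump h1 hr, vtx_rename_bump h1 hv, h3]⟩

section

variable {α β γ : Type*} {R : β → γ → Prop}

lemma forall₂_flatMap {l : List α} {f : α → List β} {g : α → List γ}
    (h : ∀ s ∈ l, List.Forall₂ R (f s) (g s)) : List.Forall₂ R (l.flatMap f) (l.flatMap g) := by
  induction l with
  | nil => exact .nil
  | cons a l ih =>
    rw [List.flatMap_cons, List.flatMap_cons]
    exact List.rel_append (h a (by simp)) (ih fun s hs => h s (by simp [hs]))

lemma forall₂_ite {P P' : Prop} [Decidable P] [Decidable P'] (hP : P' ↔ P) {b : β} {c : γ}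
    (h : R b c) : List.Forall₂ R (if P' then [b] else []) (if P then [c] else []) := by
  by_cases hp : P
  · rw [if_pos hp, if_pos (hP.2 hp)]; exact .cons h .nil
  · rw [if_neg hp, if_neg fun h => hp (hP.1 h)]; exact .nil

end

lemma names_of_mem_splits3 {F : Forest} {s : Forest × Forest × Forest} (h : s ∈ F.splits3) :
    F.names = s.1.names ++ (s.2.1.names ++ s.2.2.names) := by
  conv_lhs => rw [← app_of_mem_splits3 h]
  rw [names_app, names_app]

lemma names_of_mem_splits {F : Forest} {s : Forest × Forest} (h : s ∈ F.splits) :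
    F.names = s.1.names ++ s.2.names := by
  conv_lhs => rw [← app_of_mem_splits h]
  rw [names_app]

lemma sgn_add_two (n : ℤ) : sgn (n + 2) = sgn n := by
  rw [sgn_add]
  simp [sgn]

/-- When a neutral vertex is blown up, `blowR` lets the upper vertex keep its name, whereas
`blowRound` calls the two vertices `0` and `1` and has an additional factor `sgn e`. Renaming by
`bump` passes from one convention to the other. -/
lemma bumpRel_blowRound (v : Vtx) (ch : Forest) (hv : ∀ e, v = neu e → e ∉ ch.names) :
    List.Forall₂ (BumpRel (cons v nil nil).names)
      (blowRound (v.rename id (· + 2)) (ch.rename id (· + 2)))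
      (blowR (v.rename id (· + 1)) (ch.rename id (· + 1))) := by
  cases v with
  | lab i =>
    simp only [Vtx.rename, blowRound, blowR, splits3_rename, List.flatMap_map, len_rename]
    refine List.rel_append ?_ ?_
    all_goals
      refine forall₂_flatMap fun s _ => forall₂_ite Iff.rfl ⟨none, by simp, by simp, ?_⟩
      simp only [app_rename, rename_cons, rename_rename]
      rfl
  | neu e =>
    simp only [Vtx.rename, blowRound, blowR, splits3_rename, List.flatMap_map, len_rename]
    refine forall₂_flatMap fun s hs => forall₂_ite Iff.rfl
      ⟨some e, by simp [names], by simp [sgn_add_two], ?_⟩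
    have he := hv e rfl
    rw [names_of_mem_splits3 hs] at he
    simp only [List.mem_append, not_or] at he
    simp only [app_rename, rename_cons]
    rw [rename_bump (N := [e]) (by simp) (by simpa using he.1),
      rename_bump (N := [e]) (by simp) (by simpa using he.2.1),
      rename_bump (N := [e]) (by simp) (by simpa using he.2.2)]
    simp only [Vtx.rename, bump]
    rfl

lemma bumpRel_blowSquare (v : Vtx) (ch : Forest) (hv : ∀ e, v = neu e → e ∉ ch.names) :
    List.Forall₂ (BumpRel (cons v nil nil).names)
      (blowSquare (v.rename id (· + 2)) (ch.rename id (· + 2)))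
      (blowS (v.rename id (· + 1)) (ch.rename id (· + 1))) := by
  cases v with
  | lab i =>
    simp only [Vtx.rename, blowSquare, blowS, splits3_rename, splits_rename, List.flatMap_map,
      len_rename]
    refine List.rel_append (List.rel_append ?_ ?_) ?_
    all_goals
      refine forall₂_flatMap fun s _ => forall₂_ite Iff.rfl ⟨none, by simp, by simp, ?_⟩
      simp only [app_rename, rename_cons, rename_rename]
      rfl
  | neu e =>
    have he := hv e rfl
    simp only [Vtx.rename, blowSquare, blowS, splits3_rename, splits_rename, List.flatMap_map,
      len_rename]
    refine List.rel_append ?_ ?_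
    · refine forall₂_flatMap fun s hs => forall₂_ite Iff.rfl
        ⟨some e, by simp [names], by simp [sgn_add_two], ?_⟩
      rw [names_of_mem_splits3 hs] at he
      simp only [List.mem_append, not_or] at he
      simp only [app_rename, rename_cons]
      rw [rename_bump (N := [e]) (by simp) (by simpa using he.1),
        rename_bump (N := [e]) (by simp) (by simpa using he.2.1),
        rename_bump (N := [e]) (by simp) (by simpa using he.2.2)]
      simp only [Vtx.rename, bump]
      rfl
    · refine forall₂_flatMap fun s hs => forall₂_ite Iff.rfl
        ⟨some e, by simp [names], by simp [sgn_add_two], ?_⟩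
      rw [names_of_mem_splits hs] at he
      simp only [List.mem_append, not_or] at he
      simp only [rename_cons]
      rw [rename_bump (N := [e]) (by simp) (by simpa using he.1),
        rename_bump (N := [e]) (by simp) (by simpa using he.2)]
      simp only [Vtx.rename, bump]
      rfl

lemma names_cons (v : Vtx) (ch r : Forest) :
    (cons v ch r).names = (cons v nil nil).names ++ (ch.names ++ r.names) := by
  cases v <;> simp [names]

lemma mem_names_single {v : Vtx} {e : ℕ} : e ∈ (cons v nil nil).names ↔ v = neu e := by
  cases v <;> simp [names, eq_comm]

lemma bumpRel_bdRound (F : Forest) (hF : F.names.Nodup) :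
    List.Forall₂ (BumpRel F.names) (F.rename id (· + 2)).bdRound (bdR (F.rename id (· + 1))) := by
  induction F with
  | nil => exact .nil
  | cons v ch r ih₁ ih₂ =>
    rw [names_cons, List.nodup_append', List.nodup_append'] at hF
    obtain ⟨-, ⟨h1, h2, h3⟩, h4⟩ := hF
    rw [List.disjoint_append_right] at h4
    simp only [rename_cons, bdRound, bdR]
    refine List.rel_append (List.rel_append ?_ ?_) ?_
    · rw [List.forall₂_map_left_iff, List.forall₂_map_right_iff]
      refine (bumpRel_blowRound v ch fun e he => h4.1 (mem_names_single.2 he)).imp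
        fun p' p h => (h.app fun j hj => h4.2 hj).mono fun j hj => ?_
      rw [names_cons]; simp [hj]
    · rw [List.forall₂_map_left_iff, List.forall₂_map_right_iff]
      refine (ih₁ h1).imp fun p' p h => (h.ch (fun j hj hv => h4.1 (mem_names_single.2 hv) hj)
        fun j hj => h3 hj).mono fun j hj => ?_
      rw [names_cons]; simp [hj]
    · rw [List.forall₂_map_left_iff, List.forall₂_map_right_iff]
      refine (ih₂ h2).imp fun p' p h => (h.rest (fun j hj hv => h4.2 (mem_names_single.2 hv) hj)
        fun j hj hj' => h3 hj' hj).mono fun j hj => ?_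
      rw [names_cons]; simp [hj]

lemma bumpRel_bdSquare (F : Forest) (hF : F.names.Nodup) :
    List.Forall₂ (BumpRel F.names) (F.rename id (· + 2)).bdSquare (bdS (F.rename id (· + 1))) := by
  induction F with
  | nil => exact .nil
  | cons v ch r _ ih =>
    rw [names_cons, List.nodup_append', List.nodup_append'] at hF
    obtain ⟨-, ⟨h1, h2, h3⟩, h4⟩ := hF
    rw [List.disjoint_append_right] at h4
    simp only [rename_cons, bdSquare, bdS]
    refine List.rel_append (List.rel_append ?_ ?_) ?_
    · rw [List.forall₂_map_left_iff, List.forall₂_map_right_iff]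
      refine (bumpRel_blowSquare v ch fun e he => h4.1 (mem_names_single.2 he)).imp
        fun p' p h => (h.app fun j hj => h4.2 hj).mono fun j hj => ?_
      rw [names_cons]; simp [hj]
    · rw [List.forall₂_map_left_iff, List.forall₂_map_right_iff]
      refine (bumpRel_bdRound ch h1).imp fun p' p h =>
        (h.ch (fun j hj hv => h4.1 (mem_names_single.2 hv) hj) fun j hj => h3 hj).mono
          fun j hj => ?_
      rw [names_cons]; simp [hj]
    · rw [List.forall₂_map_left_iff, List.forall₂_map_right_iff]
      refine (ih h2).imp fun p' p h => (h.rest (fun j hj hv => h4.2 (mem_names_single.2 hv) hj)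
        fun j hj hj' => h3 hj' hj).mono fun j hj => ?_
      rw [names_cons]; simp [hj]

lemma bumpRel_rbdTerms (x : Color) (F : Forest) (hF : F.names.Nodup) :
    List.Forall₂ (BumpRel F.names) (rbdTerms x F) (bd x (F.rename id (· + 1))) := by
  cases x
  exacts [bumpRel_bdRound F hF, bumpRel_bdSquare F hF]

end Forest

/-- Up to an increasing renaming, `bump` only moves the vertex `e` to the place right behind the new
vertex `0`. It passes the `e` old names below it, whence the sign. -/
lemma wordSign_map_bump (r : ℕ) (e : Option ℕ) (he : ∀ j ∈ e, j < r) {l : List ℕ}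
    (hl : l.Perm (List.range (r + 1))) :
    wordSign (l.map (Forest.bump e)) = (e.elim 1 fun j => sgn j) * wordSign l := by
  obtain ⟨ε, -, h⟩ := wordSign_map_perm hl
  have h0 := h id
  rw [List.map_id, List.map_id, wordSign_eq_one List.pairwise_lt_range, mul_one] at h0
  rw [h, h0, mul_comm]
  congr 1
  have hb : (List.range (r + 1)).map (Forest.bump e) =
      0 :: (List.range r).map fun j => if some j = e then 1 else j + 2 := by
    rw [List.range_succ_eq_map, List.map_cons, List.map_map]
    rfl
  rw [hb]
  cases e with
  | none =>
    refine wordSign_eq_one (List.pairwise_cons.2 ⟨by simp, ?_⟩)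
    rw [List.pairwise_map]
    exact List.pairwise_lt_range.imp fun h => by simpa using h
  | some e =>
    obtain ⟨m, rfl⟩ := Nat.exists_eq_add_of_lt (he e rfl)
    have h1 : (List.range (e + m + 1)).map (fun j => if some j = some e then 1 else j + 2) =
        (List.range e).map (· + 2) ++ 1 :: (List.range m).map (e + 1 + · + 2) := by
      rw [show e + m + 1 = e + (1 + m) by omega, List.range_add, List.range_add, List.map_append,
        List.map_append, List.map_append, List.map_map, List.map_map]
      congr 1
      · refine List.map_congr_left fun j hj => ?_
        have : j < e := by simpa using hj
        simp [this.ne]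
      · simp only [List.range_one, List.map_cons, List.map_nil, List.map_map, List.cons_append,
          List.nil_append]
        refine congrArg₂ List.cons (by simp) (List.map_congr_left fun j _ => ?_)
        simp [Function.comp_def]; omega
    rw [h1]
    have h2 := wordSign_swap [0] ((List.range e).map (· + 2)) [1]
      ((List.range m).map (e + 1 + · + 2))
    have h3 : wordSign (0 :: 1 :: ((List.range e).map (· + 2) ++
        (List.range m).map (e + 1 + · + 2))) = 1 := by
      refine wordSign_eq_one (List.pairwise_cons.2 ⟨?_, List.pairwise_cons.2 ⟨?_, ?_⟩⟩)
      · intro j hj; simp at hj; omega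
      · intro j hj; simp at hj; omega
      · rw [List.pairwise_append]
        refine ⟨?_, ?_, ?_⟩
        · rw [List.pairwise_map]
          exact List.pairwise_lt_range.imp fun h => by simpa using h
        · rw [List.pairwise_map]
          exact List.pairwise_lt_range.imp fun h => by simpa using h
        · intro a ha b hb
          simp at ha hb; omega
    simp only [List.append_assoc, List.cons_append, List.nil_append, List.length_map,
      List.length_range, List.length_cons, List.length_nil] at h2
    rw [h2, h3]
    simp

/-- The terms of the differential in the convention of `Forest.bd`. -/
lemma rori_bumpRel {I : List Color} {x : Color} {e : ℤ} {r : ℕ} {p' p : ℤ × Forest}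
    (h : Forest.BumpRel (List.range r) p' p) (hp : p.2.names.Perm (List.range (r + 1))) :
    p'.1 • rori I x e p'.2 = p.1 • rori I x e p.2 := by
  obtain ⟨c', T'⟩ := p'
  obtain ⟨c, T⟩ := p
  obtain ⟨j, hj, h1, h2⟩ := h
  simp only at h1 h2 hp
  subst h1 h2
  have hr : ∀ i ∈ j, i < r := fun i hi => by simpa using hj i hi
  have hs := wordSign_map_bump r j hr hp
  have hd : T.names.Nodup := hp.nodup_iff.2 List.nodup_range
  have hd' : (T.names.map (Forest.bump j)).Nodup := by
    refine hd.map_on fun a _ b _ hab => ?_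
    rcases a with _ | a <;> rcases b with _ | b <;> simp only [Forest.bump] at hab
    · rfl
    · split_ifs at hab
    · split_ifs at hab
    · split_ifs at hab with h1 h2
      · exact congrArg (· + 1) (Option.some.inj (h1.trans h2.symm))
      all_goals omega
  have hε : (j.elim 1 fun j => sgn j : ℤ) * (j.elim 1 fun j => sgn j : ℤ) = 1 := by
    cases j with
    | none => rfl
    | some i => exact sgn_mul_self _
  simp only [rori, Forest.names_rename, Forest.renum_rename]
  rw [sortSign_eq hd', sortSign_eq hd, hs, smul_smul, smul_smul]
  congr 1
  linear_combination c * wordSign T.names * hε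

/-- The differential in the convention of `Forest.bd`. -/
lemma sum_rbdTerms {I : List Color} {x : Color} {e e' : ℤ} {F : Forest} (hF : F.Valid I x e') :
    ((rbdTerms x F).map fun p => p.1 • rori I x e p.2).sum =
      lsum (Forest.bd x (F.rename id (· + 1))) fun p => p.1 • rori I x e p.2 := by
  have hn := hF.names
  have h := Forest.bumpRel_rbdTerms x F (by rw [hn]; exact List.nodup_range)
  have hm : ∀ p ∈ Forest.bd x (F.rename id (· + 1)),
      p.2.names.Perm (List.range (F.names.length + 1)) := fun p hp => by
    have h1 := Forest.verts_bd hp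
    have h2 := Multiset.coe_eq_coe.2 (F.rename id (· + 1)).verts_perm
    refine (Forest.names_perm_of_verts (M := 0 :: (F.rename id (· + 1)).names)
      (l := (F.rename id (· + 1)).labels) ?_).1.trans ?_
    · rw [h1, h2, List.map_cons, ← Multiset.cons_coe, ← Multiset.singleton_add,
        ← Multiset.coe_add, add_assoc]
    · rw [Forest.names_rename]
      conv_lhs => rw [hn]
      rw [List.range_succ_eq_map]
  rw [← lsum]
  rw [hn, List.length_range] at *
  generalize rbdTerms x F = l' at h
  generalize Forest.bd x (F.rename id (· + 1)) = l at h hm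
  induction h with
  | nil => rfl
  | cons h _ ih =>
    rw [lsum_cons, lsum_cons, ih fun p hp => hm p (by simp [hp]),
      rori_bumpRel h (hm _ (by simp))]

end SwissCheese

namespace SwissCheese

open Color Vtx

universe u v

variable {k : Type u} [CommRing k]

/-! ### The action on the total module -/

/-- Homogeneous elements. -/
abbrev Hel (L : OpData.{u, v} k) := Σ p : Color × ℤ, Fam L p.1 p.2

/-- The component of the colour `c` of a homogeneous element. -/
noncomputable def pick (L : OpData.{u, v} k) (p : Color × ℤ) (c : Color) :
    Fam L p.1 p.2 →ₗ[k] Fam L c p.2 :=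
  if h : p.1 = c then h ▸ LinearMap.id else 0

lemma pick_self (L : OpData.{u, v} k) (c : Color) (d : ℤ) (a : Fam L c d) :
    pick L (c, d) c a = a := by
  simp [pick]

lemma pick_ne (L : OpData.{u, v} k) {p : Color × ℤ} {c : Color} (h : p.1 ≠ c) : pick L p c = 0 := by
  simp [pick, h]

namespace Args

/-- The arguments given by a sequence of homogeneous elements. -/
noncomputable def of {L : OpData.{u, v} k} (f : ℕ → Hel L) : Args L where
  deg i := (f i).1.2
  val c i := pick L (f i).1 c (f i).2

/-- Change one argument. -/
def upd {L : OpData.{u, v} k} (a : Args L) (i : ℕ) (y : ∀ c, Fam L c (a.deg i)) : Args L where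
  deg := a.deg
  val c := Function.update (a.val c) i (y c)

lemma upd_self {L : OpData.{u, v} k} (a : Args L) (i : ℕ) (y : ∀ c, Fam L c (a.deg i)) (c : Color) :
    (a.upd i y).val c i = y c := Function.update_self i _ _

lemma upd_ne {L : OpData.{u, v} k} (a : Args L) (i : ℕ) (y : ∀ c, Fam L c (a.deg i)) (c : Color)
    {j : ℕ} (h : j ≠ i) : (a.upd i y).val c j = a.val c j := Function.update_of_ne h _ _

variable {P : OpData.{u, v} k} (η : OpHom (hscInf k) P) (a : Args (lam P))
  (hL : IsNSOperad (lam P))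

lemma act_linear {I : List Color} {x : Color} {F : Forest} (hS : F.Shape I x)
    (hF : F.labels.Nodup) (r n : ℕ) {i : ℕ} (hi : i ∈ F.labels) {c : Color} (hc : I[i]? = some c) :
    ∃ l : Fam (lam P) c (a.deg i) →ₗ[k] Fam (lam P) x (a.tdeg r n),
      ∀ y, (a.upd i y).act η hL r n x F = l (y c) := by
  obtain ⟨l, hl⟩ := PlainOp.ev_linear (a.env η hL (a.isKey_std r)) hS hF hi hc
  refine ⟨(Keyed.part hL ⟨((canonVerts r n).flatMap (a.std r) : List ℕ), a.tdeg r n,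
    a.even_canon (a.isKey_std r) r n⟩).comp (l.comp (Keyed.lin hL (a.std r (lab i)) (a.deg i)
      (a.isKey_std r (lab i)))), fun y => ?_⟩
  change Keyed.part hL _ (PlainOp.ev ((a.upd i y).env η hL (a.isKey_std r)) x F) =
    Keyed.part hL _ (l (Keyed.lin hL (a.std r (lab i)) (a.deg i) (a.isKey_std r (lab i)) (y c)))
  congr 1
  rw [← hl]
  refine PlainOp.ev_congr hS (fun j c' hj => ?_) fun c' e _ => ?_
  by_cases hji : j = i
  · subst hji
    obtain rfl : c' = c := by simpa [hc] using hj.symm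
    rw [PlainOp.Env.set_self]
    change Keyed.toM hL ⟨_, _, _, Function.update (a.val c') j (y c') j⟩ = _
    rw [Function.update_self]
    rfl
  · rw [PlainOp.Env.set_ne _ _ _ _ _ _ (by simpa using hji)]
    change Keyed.toM hL ⟨_, _, _, Function.update (a.val c') i (y c') j⟩ = Keyed.toM hL ⟨_, _, _, a.val c' j⟩
    rw [Function.update_of_ne hji]
  · rw [PlainOp.Env.set_ne _ _ _ _ _ _ (by simp)]
    rfl

end Args

section

variable {P : OpData.{u, v} k} (η : OpHom (hscInf k) P)

/-- The inclusion of a homogeneous component of the deformation complex. -/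
noncomputable def inc (c : Color) (d : ℤ) : Fam (lam P) c d →ₗ[k] (defPair η).Tot :=
  (defPair η).ι c d

/-- A homogeneous element in the total module. -/
noncomputable def hel (h : Hel (lam P)) : (defPair η).Tot := inc η h.1.1 h.1.2 h.2

/-- The degrees and colours of a family indexed by `Fin n`. -/
def pext {n : ℕ} (p : Fin n → Color × ℤ) (i : ℕ) : Color × ℤ :=
  if h : i < n then p ⟨i, h⟩ else (cl, 0)

lemma pext_val {n : ℕ} (p : Fin n → Color × ℤ) (j : Fin n) : p j = pext p j := by
  simp [pext]

/-- Transport along an equality of degrees and colours. -/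
noncomputable def castLin (L : OpData.{u, v} k) {p q : Color × ℤ} (h : p = q) :
    Fam L p.1 p.2 →ₗ[k] Fam L q.1 q.2 := h ▸ LinearMap.id

/-- Extension of a family indexed by `Fin n`. -/
noncomputable def hext {L : OpData.{u, v} k} {n : ℕ} (p : Fin n → Color × ℤ)
    (a : ∀ j, Fam L (p j).1 (p j).2) (i : ℕ) : Hel L :=
  ⟨pext p i, if h : i < n then castLin L (pext_val p ⟨i, h⟩) (a ⟨i, h⟩) else 0⟩

variable (hL : IsNSOperad (lam P))

lemma homAct_linear {I : List Color} {x : Color} {F : Forest} (hS : F.Shape I x)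
    (hF : F.labels.Perm (List.range I.length)) (r : ℕ) (p : Fin I.length → Color × ℤ)
    (a : ∀ j, Fam (lam P) (p j).1 (p j).2) (j : Fin I.length) :
    ∃ l : Fam (lam P) (p j).1 (p j).2 →ₗ[k] (defPair η).Tot, ∀ y,
      inc η x _ ((Args.of (hext p (Function.update a j y))).act η hL r I.length x F) = l y := by
  obtain ⟨l, hl⟩ := (Args.of (hext p a)).act_linear η hL hS (hF.nodup_iff.2 List.nodup_range) r
    I.length (hF.mem_iff.2 (List.mem_range.2 j.2)) (List.getElem?_eq_getElem j.2)
  refine ⟨(inc η x _).comp (l.comp ((pick (lam P) (pext p j) (I[j])).comp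
    (castLin (lam P) (pext_val p j)))), fun y => ?_⟩
  let Y : ∀ c, Fam (lam P) c ((Args.of (hext p a)).deg j) := fun c =>
    pick (lam P) (pext p j) c (castLin (lam P) (pext_val p j) y)
  have key : Args.of (hext p (Function.update a j y)) = (Args.of (hext p a)).upd j Y := by
    refine congrArg (Args.mk _) ?_
    funext c i
    by_cases hi : i = j
    · subst hi
      refine Eq.trans ?_ ((Args.of (hext p a)).upd_self j Y c).symm
      change pick (lam P) (pext p j) c (if h : (j : ℕ) < I.length then
        castLin (lam P) (pext_val p ⟨j, h⟩) (Function.update a j y ⟨j, h⟩) else 0) = _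
      rw [dif_pos j.2]
      exact congrArg (fun z => pick (lam P) (pext p j) c (castLin (lam P) (pext_val p j) z))
        (Function.update_self j y a)
    · refine Eq.trans ?_ ((Args.of (hext p a)).upd_ne j Y c hi).symm
      change pick (lam P) (pext p i) c (if h : i < I.length then
        castLin (lam P) (pext_val p ⟨i, h⟩) (Function.update a j y ⟨i, h⟩) else 0) =
        pick (lam P) (pext p i) c (if h : i < I.length then
        castLin (lam P) (pext_val p ⟨i, h⟩) (a ⟨i, h⟩) else 0)
      by_cases hn : i < I.length
      · have : (⟨i, hn⟩ : Fin I.length) ≠ j := fun h => hi (congrArg Fin.val h)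
        rw [dif_pos hn, dif_pos hn, Function.update_of_ne this]
      · rw [dif_neg hn, dif_neg hn]
  rw [key]
  exact congrArg (inc η x _) (hl _)

/-- The action of a word on homogeneous elements. -/
noncomputable def homAct {I : List Color} {x : Color} {F : Forest} (hS : F.Shape I x)
    (hF : F.labels.Perm (List.range I.length)) (r : ℕ) (p : Fin I.length → Color × ℤ) :
    MultilinearMap k (fun j => (defPair η).V (p j).1 (p j).2) (defPair η).Tot where
  toFun a := inc η x _ ((Args.of (hext p a)).act η hL r I.length x F)
  map_update_add' {dec} a j y y' := by
    obtain rfl : dec = instDecidableEqFin _ := Subsingleton.elim _ _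
    obtain ⟨l, hl⟩ := homAct_linear η hL hS hF r p a j
    exact (hl _).trans ((map_add l y y').trans (congrArg₂ _ (hl y).symm (hl y').symm))
  map_update_smul' {dec} a j c y := by
    obtain rfl : dec = instDecidableEqFin _ := Subsingleton.elim _ _
    obtain ⟨l, hl⟩ := homAct_linear η hL hS hF r p a j
    exact (hl _).trans ((map_smul l c y).trans (congrArg _ (hl y).symm))

/-- The action of a word. -/
noncomputable def wordAct {I : List Color} {x : Color} {F : Forest} (hS : F.Shape I x)
    (hF : F.labels.Perm (List.range I.length)) (r : ℕ) :
    MultilinearMap k (fun _ : Fin I.length => (defPair η).Tot) (defPair η).Tot :=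
  MultilinearMap.fromDirectSumEquiv fun p => homAct η hL hS hF r p

lemma wordAct_lof {I : List Color} {x : Color} {F : Forest} (hS : F.Shape I x)
    (hF : F.labels.Perm (List.range I.length)) (r : ℕ) (p : Fin I.length → Color × ℤ)
    (a : ∀ j, (defPair η).V (p j).1 (p j).2) :
    wordAct η hL hS hF r (fun j => (defPair η).ι (p j).1 (p j).2 (a j)) =
      homAct η hL hS hF r p a := by
  have h := MultilinearMap.fromDirectSumEquiv_lof (R := k) (ι := Fin I.length)
    (M' := (defPair η).Tot) (κ := fun _ => Color × ℤ) (M := fun _ i => (defPair η).V i.1 i.2)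
    (homAct η hL hS hF r) p a
  exact h

/-- The sequence of homogeneous elements given by a list. -/
def seq {L : OpData.{u, v} k} (l : List (Hel L)) (i : ℕ) : Hel L := l.getD i ⟨(cl, 0), 0⟩

lemma feed_wordAct {I : List Color} {x : Color} {F : Forest} (hS : F.Shape I x)
    (hF : F.labels.Perm (List.range I.length)) (r : ℕ) (l : List (Hel (lam P)))
    (h : l.length = I.length) : feed (wordAct η hL hS hF r) (l.map (hel η)) =
      inc η x _ ((Args.of (seq l)).act η hL r I.length x F) := by
  have h1 : (fun j : Fin I.length => (l.map (hel η)).getD j 0) = fun j : Fin I.length =>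
      (defPair η).ι (seq l j).1.1 (seq l j).1.2 (seq l j).2 := by
    funext j
    have hj : (j : ℕ) < l.length := by rw [h]; exact j.2
    rw [List.getD_eq_getElem _ _ (by simpa using hj), List.getElem_map, seq,
      List.getD_eq_getElem _ _ hj]
    rfl
  -- Beyond the list both sequences have the same default, the zero element of closed colour and
  -- degree `0`.
  have h2 : seq l = hext (fun j : Fin I.length => (seq l j).1) fun j => (seq l j).2 := by
    funext i
    by_cases hi : i < I.length
    · have : ∀ (p : Color × ℤ) (hp : (seq l i).1 = p), seq l i = ⟨p, castLin (lam P) hp (seq l i).2⟩ := by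
        rintro p rfl
        rfl
      rw [hext, dif_pos hi]
      exact this _ _
    · rw [hext, dif_neg hi]
      have hp : pext (fun j : Fin I.length => (seq l j).1) i = (cl, 0) := by simp [pext, hi]
      rw [hp, seq, List.getD_eq_default _ _ (by omega)]
  rw [feed, h1]
  refine (wordAct_lof η hL hS hF r (fun j : Fin I.length => (seq l j).1)
    fun j => (seq l j).2).trans ?_
  change inc η x _ ((Args.of (hext _ _)).act η hL r I.length x F) = _
  rw [← h2]

end

end SwissCheese

/-! ### Orientations and the action of basis elements. -/

namespace SwissCheese

open Color Vtx

universe u v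

variable {k : Type u} [CommRing k]

lemma feed_ext_hom {M : Type v} [AddCommGroup M] [Module k M] {n : ℕ} (l : List M) :
    ∃ φ : MultilinearMap k (fun _ : Fin n => M) M →+ M, ∀ f, φ f = feed f l :=
  ⟨{ toFun := fun f => feed f l, map_zero' := rfl, map_add' := fun _ _ => rfl }, fun _ => rfl⟩

variable {P : OpData.{u, v} k} (η : OpHom (hscInf k) P) (hL : IsNSOperad (lam P))

/-- The part of an operation of the envelope with coefficient the letters of `w`. -/
noncomputable def extract {x : Color} (w : List ℕ) (d : ℤ) (p : Even (d + w.length)) :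
    (envelope hL).M x →ₗ[k] (defPair η).Tot :=
  (inc η x d).comp (Keyed.part hL ⟨(w : Multiset ℕ), d, p⟩)

lemma extract_toM {x : Color} {w : List ℕ} {d : ℤ} (p : Even (d + w.length))
    (A : Keyed (lam P) x) (hw : w.Perm A.word) (hd : d = A.deg) :
    extract η hL w d p (A.toM hL) = wordSign A.word • inc η x A.deg A.val := by
  subst hd
  have key : ∀ (m : Multiset ℕ) (hm : m = A.word) (p : Even (A.deg + m.card)),
      Keyed.part hL ⟨m, A.deg, p⟩ (A.toM hL) = wordSign A.word • A.val := by
    rintro m rfl p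
    exact Keyed.part_toM hL A
  refine (congrArg (inc η x A.deg) (key w (Multiset.coe_eq_coe.2 hw) p)).trans ?_
  exact map_zsmul _ _ _

namespace Args

variable (a : Args (lam P))

/-- Extraction ignores the order of `w`, so the sign comes from the canonical word of `κ` alone. The
signs of orientations, permutations, compositions and differentials are computed with this lemma. -/
lemma extract_ev {r n : ℕ} {x : Color} {F : Forest} (hF : F.verts.Perm (canonVerts r n))
    (hx : x = cl → F.len = 1) {κ : Vtx → List ℕ} (hκ : a.IsKey κ) {w : List ℕ} {d : ℤ}
    (p : Even (d + w.length)) (hw : w.Perm ((canonVerts r n).flatMap κ)) (hd : d = a.tdeg r n) :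
    extract η hL w d p (PlainOp.ev (a.env η hL hκ) x F) =
      wordSign ((canonVerts r n).flatMap κ) • inc η x _ (a.act η hL r n x F) := by
  rw [a.ev_eq_act η hL r n x F hF hx hκ]
  exact extract_toM η hL p _ hw hd

lemma flatMap_canonVerts (κ : Vtx → List ℕ) (r n : ℕ) : (canonVerts r n).flatMap κ =
    (List.range r).flatMap (fun e => κ (neu e)) ++ (List.range n).flatMap fun i => κ (lab i) := by
  rw [canonVerts, List.flatMap_append, List.flatMap_map, List.flatMap_map]

/-- The names of the neutral vertices are the letters of the copies of the twisting element. Putting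
the names into canonical order permutes these letters, which explains why orientations are orderings
of the neutral vertices up to sign. -/
lemma act_renum {r n : ℕ} {x : Color} {T : Forest} (hn : T.names.Perm (List.range r))
    (hl : T.labels.Perm (List.range n)) (hx : x = cl → T.len = 1) :
    inc η x _ (a.act η hL r n x T) =
      sortSign T.names • inc η x _ (a.act η hL r n x (T.renum 0)) := by
  have hr : T.names.length = r := by simpa using hn.length_eq
  set ν : ℕ → ℕ := fun j => T.names.getD j 0
  set κ : Vtx → List ℕ := fun v => a.std r (v.rename id ν)
  have hκ : a.IsKey κ := fun v => by
    have := a.isKey_std r (v.rename id ν)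
    cases v <;> exact this
  have h1 : PlainOp.ev (a.env η hL (a.isKey_std r)) x T =
      PlainOp.ev (a.env η hL hκ) x (T.renum 0) := by
    conv_lhs => rw [← T.rename_renum_zero, PlainOp.ev_rename]
    congr 1
    funext c v
    cases v <;> rfl
  have hνl : (List.range r).map ν = T.names := by
    rw [← hr]
    refine List.ext_getElem (by simp) fun i h h' => ?_
    simp [ν, h']
  have hword : (canonVerts r n).flatMap κ =
      T.names ++ (List.range n).flatMap fun i => a.std r (lab i) := by
    rw [flatMap_canonVerts]
    congr 1
    conv_rhs => rw [← hνl]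
    rw [List.map_eq_flatMap]
    rfl
  have hstd : (canonVerts r n).flatMap (a.std r) =
      List.range r ++ (List.range n).flatMap fun i => a.std r (lab i) := by
    rw [flatMap_canonVerts]
    congr 1
    simp [std]
  have hp : ((canonVerts r n).flatMap (a.std r)).Perm ((canonVerts r n).flatMap κ) := by
    rw [hstd, hword]
    exact hn.symm.append_right _
  have hs : wordSign ((canonVerts r n).flatMap κ) = sortSign T.names := by
    have h2 := a.wordSign_canon_std r n
    rw [hstd, wordSign_append, wordSign_eq_one List.pairwise_lt_range] at h2
    rw [hword, wordSign_append, sortSign_eq (hn.nodup_iff.2 List.nodup_range),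
      Multiset.coe_eq_coe.2 hn]
    linear_combination wordSign T.names * h2
  have h2 := a.extract_ev η hL (Forest.verts_canon hn hl) hx (a.isKey_std r)
    (a.even_canon (a.isKey_std r) r n) (List.Perm.refl _) rfl
  have hn' : (T.renum 0).names.Perm (List.range r) := by rw [T.names_renum_zero, hr]
  have hl' : (T.renum 0).labels.Perm (List.range n) := by rwa [T.labels_renum]
  have hx' : x = cl → (T.renum 0).len = 1 := fun h => by
    rw [← hx h]
    conv_rhs => rw [← T.rename_renum_zero, Forest.len_rename]
  rw [h1, a.extract_ev η hL (Forest.verts_canon hn' hl') hx' hκ _ hp rfl, hs,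
    a.wordSign_canon_std, one_smul] at h2
  exact h2.symm

end Args

/-- The action of the operad of relative braces on the deformation complex. -/
noncomputable def opAct {I : List Color} {x : Color} {e : ℤ} : RB I x e →ₗ[ℤ]
    MultilinearMap k (fun _ : Fin I.length => (defPair η).Tot) (defPair η).Tot :=
  Finsupp.linearCombination ℤ fun F => wordAct η hL F.2.2.2.2 F.2.1 F.1.names.length

lemma opAct_single {I : List Color} {x : Color} {e : ℤ} {F : Forest} (hF : F.Valid I x e) :
    opAct η hL (Finsupp.single ⟨F, hF⟩ 1) = wordAct η hL hF.2.2.2 hF.1 F.names.length := by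
  simp [opAct]

lemma Shape_len {I : List Color} {x : Color} {F : Forest} (h : F.Shape I x) :
    x = cl → F.len = 1 := by
  rintro rfl
  exact h.1

lemma feed_single {I : List Color} {x : Color} {e : ℤ} {F : Forest} (hF : F.Valid I x e)
    (l : List (Hel (lam P))) (h : l.length = I.length) :
    feed (opAct η hL (Finsupp.single ⟨F, hF⟩ 1)) (l.map (hel η)) =
      inc η x _ ((Args.of (seq l)).act η hL F.names.length I.length x F) := by
  rw [opAct_single, feed_wordAct η hL _ _ _ l h]

lemma feed_rori {I : List Color} {x : Color} {e : ℤ} {r : ℕ} {T : Forest}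
    (hn : T.names.Perm (List.range r)) (hl : T.labels.Perm (List.range I.length))
    (hS : T.Shape I x) (he : e = -(r : ℤ)) (l : List (Hel (lam P))) (h : l.length = I.length) :
    feed (opAct η hL (rori I x e T)) (l.map (hel η)) =
      inc η x _ ((Args.of (seq l)).act η hL r I.length x T) := by
  have hr : T.names.length = r := by simpa using hn.length_eq
  subst hr
  subst he
  rw [(Args.of (seq l)).act_renum η hL hn hl (Shape_len hS), rori, rbas,
    dif_pos (Forest.valid_renum hl hS), map_zsmul]
  refine congrArg (sortSign T.names • ·) ((feed_single η hL _ l h).trans ?_)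
  rw [T.names_renum_zero, List.length_range]

/-- Evaluation of a basis element through the envelope. -/
lemma feed_rbas_of_ev {I : List Color} {x : Color} {e : ℤ} {r : ℕ} {F : Forest}
    (hn : F.names.length = r) (hF : F.Valid I x e)
    (l : List (Hel (lam P))) (h : l.length = I.length) (A : Keyed (lam P) x)
    (hA : PlainOp.ev ((Args.of (seq l)).env η hL ((Args.of (seq l)).isKey_std r)) x F = A.toM hL)
    (hw : A.word = (canonVerts r I.length).flatMap ((Args.of (seq l)).std r))
    (hd : (Args.of (seq l)).tdeg r I.length = A.deg) :
    feed (opAct η hL (rbas I x e F)) (l.map (hel η)) = inc η x A.deg A.val := by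
  subst hn
  rw [rbas, dif_pos hF, feed_single η hL hF l h]
  have hn : F.names.Perm (List.range F.names.length) := List.Perm.of_eq hF.names
  have h1 := (Args.of (seq l)).extract_ev η hL (Forest.verts_canon hn hF.1) (Shape_len hF.2.2.2)
    ((Args.of (seq l)).isKey_std F.names.length)
    ((Args.of (seq l)).even_canon ((Args.of (seq l)).isKey_std _) _ _) (List.Perm.refl _) rfl
  rw [hA, extract_toM η hL _ A (List.Perm.of_eq hw.symm) hd, hw, Args.wordSign_canon_std, one_smul,
    one_smul] at h1
  exact h1.symm

/-! ### Colours and degrees -/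

/-- An argument enters through its component at the colour of the input, given by `pick`. This
component is zero for the wrong colour, and the action is linear in it. -/
lemma homAct_eq_zero {I : List Color} {x : Color} {F : Forest} (hS : F.Shape I x)
    (hF : F.labels.Perm (List.range I.length)) (r : ℕ) (p : Fin I.length → Color × ℤ)
    (a : ∀ j, Fam (lam P) (p j).1 (p j).2) (j : Fin I.length) (hj : (p j).1 ≠ I.get j) :
    homAct η hL hS hF r p a = 0 := by
  obtain ⟨l, hl⟩ := (Args.of (hext p a)).act_linear η hL hS (hF.nodup_iff.2 List.nodup_range) r
    I.length (hF.mem_iff.2 (List.mem_range.2 j.2)) (List.getElem?_eq_getElem j.2)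
  have h1 : (Args.of (hext p a)).upd j (fun c => (Args.of (hext p a)).val c j) =
      Args.of (hext p a) := by
    refine congrArg (Args.mk _) ?_
    funext c
    exact Function.update_eq_self _ _
  have h2 := hl fun c => (Args.of (hext p a)).val c j
  have h4 := congrArg (fun A : Args (lam P) => inc η x _ (A.act η hL r I.length x F)) h1
  have h3 : (Args.of (hext p a)).val I[j] j = 0 := by
    change pick (lam P) (pext p j) I[j] _ = 0
    rw [pick_ne]
    · rfl
    · rw [← pext_val]; exact hj
  change inc η x _ ((Args.of (hext p a)).act η hL r I.length x F) = 0
  refine h4.symm.trans ((congrArg (inc η x _) h2).trans ?_)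
  exact (congrArg (fun z => inc η x _ (l z)) h3).trans (by rw [map_zero, map_zero])

lemma opAct_color {I : List Color} {x : Color} {e : ℤ} (p : RB I x e)
    (f : Fin I.length → (defPair η).Tot) (j : Fin I.length) (c : Color) (m : ℤ)
    (a : (defPair η).V c m) (hc : c ≠ I.get j) (hf : f j = (defPair η).ι c m a) :
    opAct η hL p f = 0 := by
  induction p using Finsupp.induction_linear with
  | zero => rw [map_zero]; rfl
  | add p q hp hq => rw [map_add]; exact (congrArg₂ (· + ·) hp hq).trans (add_zero _)
  | single F z =>
    rw [← mul_one z, ← smul_eq_mul, ← Finsupp.smul_single, map_zsmul, opAct_single]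
    -- The other arguments need not be homogeneous. Projection to the component `(c, m)` in the slot
    -- `j` gives a multilinear map that vanishes on homogeneous elements, hence everywhere, and the
    -- projection fixes `f j`.
    let g : Fin I.length → (defPair η).Tot →ₗ[k] (defPair η).Tot := fun i =>
      if i = j then ((defPair η).ι c m).comp (DirectSum.component k _ _ (c, m)) else LinearMap.id
    have hg : (wordAct η hL F.2.2.2.2 F.2.1 F.1.names.length).compLinearMap g = 0 := by
      refine MultilinearMap.directSum_ext fun q => ?_
      refine MultilinearMap.ext fun b => ?_
      change wordAct η hL F.2.2.2.2 F.2.1 F.1.names.length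
        (fun i => g i ((defPair η).ι (q i).1 (q i).2 (b i))) = 0
      by_cases hq : q j = (c, m)
      · have : (fun i => g i ((defPair η).ι (q i).1 (q i).2 (b i))) =
            fun i => (defPair η).ι (q i).1 (q i).2 (b i) := by
          funext i
          by_cases hi : i = j
          · subst hi
            simp only [g, if_true]
            have : ∀ (s : Color × ℤ) (_ : s = (c, m)) (y : (defPair η).V s.1 s.2),
                ((defPair η).ι c m) (DirectSum.component k (Color × ℤ)
                  (fun i => (defPair η).V i.1 i.2) (c, m) ((defPair η).ι s.1 s.2 y)) =
                  (defPair η).ι s.1 s.2 y := by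
              rintro s rfl y
              exact congrArg _ (DirectSum.component.lof_self _ _ _)
            exact this _ hq _
          · simp only [g, if_neg hi]
            rfl
        rw [this, wordAct_lof]
        exact homAct_eq_zero η hL _ _ _ q b j (by rw [hq]; exact hc)
      · refine MultilinearMap.map_coord_zero _ j ?_
        simp only [g, if_true]
        refine (congrArg ((defPair η).ι c m) ?_).trans (map_zero _)
        exact (DirectSum.component.of _ _ _ _).trans (dif_neg fun h => hq h)
    have hf' : (fun i => g i (f i)) = f := by
      funext i
      by_cases hi : i = j
      · subst hi
        simp only [g, if_true]
        rw [hf]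
        exact congrArg ((defPair η).ι c m) (DirectSum.component.lof_self _ _ _)
      · simp only [g, if_neg hi]
        rfl
    have h2 := congrArg (fun φ => φ f) hg
    change wordAct η hL F.2.2.2.2 F.2.1 F.1.names.length (fun i => g i (f i)) = 0 at h2
    rw [hf'] at h2
    exact (congrArg (z • ·) h2).trans (smul_zero z)

lemma opAct_deg {I : List Color} {x : Color} {e : ℤ} (p : RB I x e) (g : Fin I.length → ℤ)
    (a : ∀ j, (defPair η).V (I.get j) (g j)) :
    opAct η hL p (fun j => (defPair η).ι (I.get j) (g j) (a j)) ∈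
      LinearMap.range ((defPair η).ι x (e + ∑ j, g j)) := by
  induction p using Finsupp.induction_linear with
  | zero => rw [map_zero]; exact Submodule.zero_mem _
  | add p q hp hq => rw [map_add]; exact Submodule.add_mem _ hp hq
  | single F z =>
    rw [← mul_one z, ← smul_eq_mul, ← Finsupp.smul_single, map_zsmul, opAct_single]
    refine zsmul_mem ?_ z
    have h := wordAct_lof η hL F.2.2.2.2 F.2.1 F.1.names.length (fun j => (I.get j, g j)) a
    refine (congrArg (· ∈ _) h).mpr ?_
    have hd : (Args.of (hext (L := lam P) (fun j => (I.get j, g j)) a)).tdeg F.1.names.length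
        I.length = e + ∑ j, g j := by
      refine Eq.trans ?_ (congrArg (· + ∑ j, g j) F.2.2.2.1.symm)
      rw [Args.tdeg, Finset.sum_range]
      refine congrArg _ ?_
      refine Finset.sum_congr rfl fun j _ => ?_
      exact congrArg Prod.snd (pext_val (fun j => (I.get j, g j)) j).symm
    rw [← hd]
    exact ⟨_, rfl⟩

end SwissCheese

namespace SwissCheese

open Color Vtx

universe u v

/-! ### Corollas -/

namespace Forest

lemma labels_dots (i n : ℕ) : (dots i n).labels = List.range' i n := by
  induction n generalizing i with
  | zero => rfl
  | succ n ih => simp [dots, labels, ih, List.range'_succ]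

lemma names_dots (i n : ℕ) : (dots i n).names = [] := by
  induction n generalizing i with
  | zero => rfl
  | succ n ih => simp [dots, names, ih]

lemma renum_dots (s i n : ℕ) : (dots i n).renum s = dots i n := by
  induction n generalizing i s with
  | zero => rfl
  | succ n ih => simp [dots, renum, ih]

lemma len_dots (i n : ℕ) : (dots i n).len = n := by
  induction n generalizing i with
  | zero => rfl
  | succ n ih => simp [dots, len, ih]

lemma roundP_dots {p : ℕ → Prop} {i n : ℕ} (h : ∀ j < n, p (i + j)) : (dots i n).RoundP p := by
  induction n generalizing i with
  | zero => trivial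
  | succ n ih =>
    refine ⟨h 0 (by omega), trivial, ih fun j hj => ?_⟩
    rw [add_assoc, add_comm 1 j]
    exact h (j + 1) (by omega)

lemma shape_single {p q : ℕ → Prop} {c : Color} {v : Vtx} {ch : Forest} (hch : ch.RoundP p)
    (hv : (∃ i, v = lab i ∧ (c = cl → p i) ∧ (c = op → q i)) ∨
      (∃ e, v = neu e) ∧ 1 ≤ ch.len ∧ (c = cl → 2 ≤ ch.len)) : (cons v ch nil).ShapeP p q c := by
  rcases hv with ⟨i, rfl, h1, h2⟩ | ⟨⟨e, rfl⟩, h1, h2⟩ <;> cases c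
  · exact ⟨rfl, h1 rfl, hch, trivial⟩
  · exact ⟨le_rfl, h2 rfl, hch, trivial⟩
  · exact ⟨rfl, h2 rfl, hch, trivial⟩
  · exact ⟨le_rfl, h1, hch, trivial⟩

lemma valid_corolla_lab (c : Color) (n : ℕ) :
    (cons (lab 0) (dots 1 n) nil).Valid (c :: List.replicate n cl) c 0 := by
  refine ⟨?_, ?_, ?_, ?_⟩
  · simp [labels, labels_dots, List.range_eq_range', List.range'_succ]
  · simp [renum, renum_dots]
  · simp [names, names_dots]
  · rw [shape_iff]
    refine shape_single (roundP_dots fun j hj => ?_) (Or.inl ⟨0, rfl, ?_, ?_⟩)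
    · rw [add_comm, List.getElem?_cons_succ]
      simp [hj]
    · rintro rfl; rfl
    · rintro rfl; rfl

lemma valid_corolla_neu (c : Color) {n : ℕ} (h1 : 1 ≤ n) (h2 : c = cl → 2 ≤ n) :
    (cons (neu 0) (dots 0 n) nil).Valid (List.replicate n cl) c (-1) := by
  refine ⟨?_, ?_, ?_, ?_⟩
  · simp [labels, labels_dots, List.range_eq_range']
  · simp [renum, renum_dots]
  · simp [names, names_dots]
  · rw [shape_iff]
    refine shape_single (roundP_dots fun j hj => ?_) (Or.inr ⟨⟨0, rfl⟩, ?_, ?_⟩)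
    · simp [hj]
    · rwa [len_dots]
    · rwa [len_dots]

end Forest

variable {k : Type u} [CommRing k]

namespace PlainOp

variable {O : PlainOp.{u, v} k}

lemma evR_dots (ρ : Env O) (i n : ℕ) :
    evR ρ (dots i n) = (List.range' i n).map fun j => ρ cl (lab j) := by
  induction n generalizing i with
  | zero => rfl
  | succ n ih => rw [dots, evR, ih, List.range'_succ, List.map_cons]; rfl

lemma ev_single (ρ : Env O) (c : Color) (v : Vtx) (ch : Forest) :
    ev ρ c (.cons v ch .nil) = cbrace (ρ c v) (evR ρ ch) := by
  cases c <;> rfl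

end PlainOp

variable {P : OpData.{u, v} k} (η : OpHom (hscInf k) P) (hL : IsNSOperad (lam P))

lemma sig_keyed (f : ℕ → Hel (lam P)) {κ : Vtx → List ℕ} (hκ : (Args.of f).IsKey κ) {i : ℕ}
    {c : Color} {d : ℤ} {y : Fam (lam P) c d} (h : f i = ⟨(c, d), y⟩) :
    ((Args.of f).keyed η hκ c (lab i)).sig = ⟨d, y⟩ := by
  have : ∀ g : Hel (lam P), g = ⟨(c, d), y⟩ →
      (⟨g.1.2, pick (lam P) g.1 c g.2⟩ : Σ e : ℤ, Fam (lam P) c e) = ⟨d, y⟩ := by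
    rintro _ rfl
    rw [pick_self]
  exact this _ h

/-- A homogeneous family in the total module. -/
noncomputable def incS (c : Color) (s : Σ d : ℤ, Fam (lam P) c d) : (defPair η).Tot :=
  inc η c s.1 s.2

/-- The brace of homogeneous families. -/
noncomputable def braceS {L : OpData.{u, v} k} {c : Color} (s : Σ d : ℤ, Fam L c d)
    (ys : List (Σ e : ℤ, Fam L cl e)) : Σ d : ℤ, Fam L c d :=
  ⟨braceDeg L s.1 ys.reverse, brace s.2 ys⟩

/-- By `hv` the planar order of the vertices is the canonical one. The word of letters is then
already sorted and the value is the brace without any sign. -/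
lemma feed_corolla {I : List Color} {c : Color} {e : ℤ} {v : Vtx} {i n r : ℕ}
    (hn : (Forest.cons v (dots i n) .nil).names.length = r)
    (hF : (Forest.cons v (dots i n) .nil).Valid I c e) (l : List (Hel (lam P)))
    (h : l.length = I.length) (ys : List (Σ e : ℤ, Fam (lam P) cl e))
    (hn : ys.length = n) (hs : ∀ j (hj : j < ys.length), seq l (i + j) = ⟨(cl, ys[j].1), ys[j].2⟩)
    (hv : v :: (List.range' i n).map lab = canonVerts r I.length) :
    feed (opAct η hL (rbas I c e (.cons v (dots i n) .nil))) (l.map (hel η)) =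
      incS η c (braceS ((Args.of (seq l)).keyed η ((Args.of (seq l)).isKey_std r) c v).sig ys) := by
  set a := Args.of (seq l)
  have hκ := a.isKey_std r
  set Y := (List.range' i n).map fun j => a.keyed η hκ cl (lab j)
  have hY : Y.map Keyed.sig = ys := by
    refine List.ext_getElem (by simp [Y, hn]) fun j h1 h2 => ?_
    simp only [Y, List.getElem_map, List.getElem_range', one_mul]
    exact sig_keyed η _ hκ (hs j h2)
  have hw : ((a.keyed η hκ c v).brace Y).word = (canonVerts r I.length).flatMap (a.std r) := by
    rw [← hv, List.flatMap_cons, List.flatMap_map]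
    simp only [Keyed.brace, Y, List.flatMap_map]
    rfl
  refine (feed_rbas_of_ev η hL (by assumption) hF l h ((a.keyed η hκ c v).brace Y) ?_ hw ?_).trans ?_
  · rw [PlainOp.ev_single, PlainOp.evR_dots, ← Keyed.toM_brace, List.map_map]
    rfl
  · rw [← a.sum_vdeg, ← hv, List.map_cons, List.sum_cons]
    simp only [Keyed.brace]
    rw [Keyed.braceDeg_eq]
    simp only [Y, List.map_map]
    rfl
  · exact congrArg (fun ys => incS η c (braceS (a.keyed η hκ c v).sig ys)) hY

lemma feed_corolla_lab (c : Color) (m : ℤ) (a : Fam (lam P) c m)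
    (ys : List (Σ e : ℤ, Fam (lam P) cl e)) :
    feed (opAct η hL (rbas (c :: List.replicate ys.length cl) c 0
        (.cons (lab 0) (dots 1 ys.length) .nil)))
      ((defPair η).ι c m a :: ys.map fun y => (defPair η).ι cl y.1 y.2) =
        (defPair η).ι c _ (brace a ys) := by
  have hs : ∀ j (hj : j < ys.length), seq (⟨(c, m), a⟩ ::
      ys.map fun y => (⟨(cl, y.1), y.2⟩ : Hel (lam P))) (1 + j) = ⟨(cl, ys[j].1), ys[j].2⟩ := by
    intro j hj
    rw [seq, add_comm, List.getD_cons_succ, List.getD_eq_getElem _ _ (by simpa using hj),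
      List.getElem_map]
  have h := feed_corolla η hL (r := 0) (by simp [Forest.names, Forest.names_dots])
    (Forest.valid_corolla_lab c ys.length)
    (⟨(c, m), a⟩ :: ys.map fun y => (⟨(cl, y.1), y.2⟩ : Hel (lam P))) (by simp) ys rfl hs
    (by simp [canonVerts, List.range_eq_range', List.range'_succ])
  rw [List.map_cons, List.map_map] at h
  refine h.trans ?_
  rw [sig_keyed η _ _ (i := 0) (c := c) (d := m) (y := a) rfl]
  rfl

lemma feed_corolla_neu (c : Color) (ys : List (Σ e : ℤ, Fam (lam P) cl e)) (h1 : 1 ≤ ys.length)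
    (h2 : c = cl → 2 ≤ ys.length) :
    feed (opAct η hL (rbas (List.replicate ys.length cl) c (-1)
        (.cons (neu 0) (dots 0 ys.length) .nil)))
      (ys.map fun y => (defPair η).ι cl y.1 y.2) =
        (defPair η).ι c _ (brace (twist η c) ys) := by
  have hs : ∀ j (hj : j < ys.length), seq (
      ys.map fun y => (⟨(cl, y.1), y.2⟩ : Hel (lam P))) (0 + j) = ⟨(cl, ys[j].1), ys[j].2⟩ := by
    intro j hj
    rw [seq, zero_add, List.getD_eq_getElem _ _ (by simpa using hj), List.getElem_map]
  have h := feed_corolla η hL (r := 1) (by simp [Forest.names, Forest.names_dots])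
    (Forest.valid_corolla_neu c h1 h2)
    (ys.map fun y => (⟨(cl, y.1), y.2⟩ : Hel (lam P))) (by simp) ys rfl hs
    (by simp [canonVerts, List.range_eq_range'])
  rw [List.map_map] at h
  exact h

/-- The unit is the labelled corolla without children, and the brace without arguments is the
element itself. -/
lemma feed_opAct_one (c : Color) {I : List Color} {z : ℤ} (hI : I = [c]) (hz : z = 0) (m : ℤ)
    (a : (defPair η).V c m) :
    feed (opAct η hL (rbas I c z (.cons (lab 0) .nil .nil))) [(defPair η).ι c m a] =
      (defPair η).ι c m a := by
  subst hI hz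
  exact feed_corolla_lab η hL c m a []

lemma valid_mu :
    (Forest.cons (lab 0) .nil (.cons (lab 1) .nil .nil)).Valid [op, op] op 0 :=
  ⟨List.Perm.refl _, rfl, rfl, by simp [Forest.len], rfl, trivial, rfl, trivial, trivial⟩

lemma feed_mu (m n : ℤ) (a : Fam (lam P) op m) (b : Fam (lam P) op n) :
    feed (opAct η hL (rbas [op, op] op 0 (.cons (lab 0) .nil (.cons (lab 1) .nil .nil))))
      [(defPair η).ι op m a, (defPair η).ι op n b] =
        (defPair η).ι op (m + n) (openMul (lam P) rfl a b) := by
  set l : List (Hel (lam P)) := [⟨(op, m), a⟩, ⟨(op, n), b⟩]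
  set g := Args.of (seq l)
  have hκ := g.isKey_std 0
  have hc : canonVerts 0 2 = [lab 0, lab 1] := rfl
  have hw : ((g.keyed η hκ op (lab 0)).mul (g.keyed η hκ op (lab 1)) rfl).word =
      (canonVerts 0 2).flatMap (g.std 0) := by
    rw [hc, List.flatMap_cons, List.flatMap_cons, List.flatMap_nil, List.append_nil]
    rfl
  have hd : g.tdeg 0 2 = (g.keyed η hκ op (lab 0)).deg + (g.keyed η hκ op (lab 1)).deg := by
    rw [← g.sum_vdeg, hc, List.map_cons, List.map_cons, List.sum_cons, List.sum_cons, List.map_nil,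
      List.sum_nil, add_zero]
    rfl
  have h := feed_rbas_of_ev η hL (r := 0) rfl valid_mu l rfl
    ((g.keyed η hκ op (lab 0)).mul (g.keyed η hκ op (lab 1)) rfl)
    (by rw [← Keyed.toM_mul]; rfl) hw hd
  refine h.trans ?_
  have h0 := sig_keyed η (seq l) hκ (i := 0) (c := op) (d := m) (y := a) rfl
  have h1 := sig_keyed η (seq l) hκ (i := 1) (c := op) (d := n) (y := b) rfl
  exact congrArg₂ (fun s t : Σ d : ℤ, Fam (lam P) op d =>
    inc η op (s.1 + t.1) (openMul (lam P) rfl s.2 t.2)) h0 h1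

end SwissCheese

namespace SwissCheese

open Color Vtx

universe u v

/-! ### Permutations -/

lemma biSign_flatten (S : Multiset ℕ) {n : ℕ} (K : Fin n → List ℕ) :
    biSign S ((List.ofFn K).flatten : List ℕ) = ∏ j, biSign S (K j) := by
  induction n with
  | zero => simp
  | succ n ih =>
    rw [List.ofFn_succ, List.flatten_cons, ← Multiset.coe_add, biSign_add_right, ih,
      Fin.prod_univ_succ]

/-- Signs of concatenations are multiplicative over pairs of blocks; as a double product the sign
can be compared with `koszulSign`. -/
lemma wordSign_flatten {n : ℕ} (K : Fin n → List ℕ) :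
    wordSign (List.ofFn K).flatten =
      (∏ i, wordSign (K i)) * ∏ i, ∏ j, if i < j then biSign (K i) (K j) else 1 := by
  induction n with
  | zero => simp [wordSign]
  | succ n ih =>
    rw [List.ofFn_succ, List.flatten_cons, wordSign_append, ih, biSign_flatten]
    simp only [Fin.prod_univ_succ, Fin.succ_lt_succ_iff, Fin.succ_pos, if_true,
      if_false, one_mul, Fin.not_lt_zero]
    ring

variable {k : Type u} [CommRing k] {P : OpData.{u, v} k} (η : OpHom (hscInf k) P)
  (hL : IsNSOperad (lam P))

lemma biSign_std {L : OpData.{u, v} k} (a : Args L) (r i j : ℕ) :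
    biSign (a.std r (lab i)) (a.std r (lab j)) =
      if i = j then (if Even (a.deg i) then 1 else 0) else if j < i then sgn (a.deg i * a.deg j)
        else 1 := by
  by_cases hi : Even (a.deg i) <;> by_cases hj : Even (a.deg j)
  · simp [Args.std, hi, hj, sgn]
  · simp [Args.std, hi, hj, sgn]
  · have : i ≠ j := by rintro rfl; exact hi hj
    simp [Args.std, hi, hj, sgn, this]
  · simp [Args.std, hi, hj, sgn, Int.even_mul, biSign, letSign]

/-- The letters of the rearranged arguments are out of order exactly at the inversions of `σ`, and
only pairs of odd arguments have letters to exchange. -/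
lemma wordSign_std_perm {L : OpData.{u, v} k} (a : Args L) (r : ℕ) {n : ℕ}
    (σ : Equiv.Perm (Fin n)) :
    wordSign (List.ofFn fun i : Fin n => a.std r (lab (σ.symm i : Fin n))).flatten =
      koszulSign σ fun j => a.deg j := by
  have h1 : ∀ i, wordSign (a.std r (lab i)) = 1 := fun i => by
    by_cases hi : Even (a.deg i) <;> simp [Args.std, hi, wordSign]
  rw [wordSign_flatten]
  simp only [h1, Finset.prod_const_one, one_mul]
  rw [koszulSign, Finset.prod_comm, ← Equiv.prod_comp σ]
  refine Finset.prod_congr rfl fun j _ => ?_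
  rw [← Equiv.prod_comp σ]
  refine Finset.prod_congr rfl fun i _ => ?_
  simp only [Equiv.symm_apply_apply, biSign_std]
  by_cases h : σ i < σ j
  · have hij : (i : ℕ) ≠ j := fun h' => by
      rw [Fin.ext h'] at h
      exact lt_irrefl _ h
    rw [if_pos h, if_neg hij]
    by_cases h' : j < i
    · rw [if_pos (Fin.lt_def.1 h'), if_pos ⟨h', h⟩, mul_comm]
    · rw [if_neg (fun h2 => h' (Fin.lt_def.2 h2)), if_neg fun h2 => h' h2.1]
  · rw [if_neg h, if_neg fun h2 => h h2.2]

/-- The permutation of the labels. -/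
def relabel {n : ℕ} (σ : Equiv.Perm (Fin n)) (i : ℕ) : ℕ :=
  if h : i < n then ((σ.symm ⟨i, h⟩ : Fin n) : ℕ) else i

lemma relabel_val {n : ℕ} (σ : Equiv.Perm (Fin n)) (i : Fin n) : relabel σ i = σ.symm i := by
  simp [relabel]

lemma map_relabel_perm {n : ℕ} (σ : Equiv.Perm (Fin n)) :
    ((List.range n).map (relabel σ)).Perm (List.range n) := by
  have h1 : List.range n = (List.finRange n).map Fin.val := by simp
  have h2 : ((List.range n).map (relabel σ)) =
      ((List.finRange n).map σ.symm).map Fin.val := by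
    rw [h1, List.map_map, List.map_map]
    exact List.map_congr_left fun i _ => relabel_val σ i
  rw [h2]
  conv_rhs => rw [h1]
  exact (Equiv.Perm.map_finRange_perm σ.symm).map _

/-- The relabelled word has the value of `F` at the permuted arguments, except that each argument
keeps the letter of its old place. The two canonical words differ by the permutation of the letters
of the odd arguments. -/
lemma inc_act_rename (f : ℕ → Hel (lam P)) {I : List Color} {x : Color} {e : ℤ} {F : Forest}
    (hF : F.Valid I x e) {n : ℕ} (hn : I.length = n) (σ : Equiv.Perm (Fin n)) :
    inc η x _ ((Args.of f).act η hL F.names.length n x (F.rename (relabel σ) id)) =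
      koszulSign σ (fun j => (f j).1.2) •
        inc η x _ ((Args.of fun i => f (relabel σ i)).act η hL F.names.length n x F) := by
  have hF1 : F.labels.Perm (List.range n) := hn ▸ hF.1
  set r := F.names.length
  set a := Args.of f
  set a' := Args.of fun i => f (relabel σ i)
  set κ : Vtx → List ℕ := fun v => a.std r (v.rename (relabel σ) id)
  have hκ : a'.IsKey κ := fun v => by
    have := a.isKey_std r (v.rename (relabel σ) id)
    cases v <;> exact this
  have hnames : F.names.Perm (List.range r) := List.Perm.of_eq hF.names
  have hn' : (F.rename (relabel σ) id).names.Perm (List.range r) := by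
    rw [Forest.names_rename, List.map_id]
    exact hnames
  have hl' : (F.rename (relabel σ) id).labels.Perm (List.range n) := by
    rw [Forest.labels_rename]
    exact (hF1.map _).trans (map_relabel_perm σ)
  have hW : (canonVerts r n).flatMap κ = List.range r ++
      ((List.range n).map (relabel σ)).flatMap fun i => a.std r (lab i) := by
    rw [Args.flatMap_canonVerts, List.flatMap_map]
    congr 1
    simp [κ, Vtx.rename, Args.std]
  have hstd : (canonVerts r n).flatMap (a.std r) =
      List.range r ++ (List.range n).flatMap fun i => a.std r (lab i) := by
    rw [Args.flatMap_canonVerts]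
    congr 1
    simp [Args.std]
  have hp : (((List.range n).map (relabel σ)).flatMap fun i => a.std r (lab i)).Perm
      ((List.range n).flatMap fun i => a.std r (lab i)) := (map_relabel_perm σ).flatMap_right _
  have hflat : (((List.range n).map (relabel σ)).flatMap fun i => a.std r (lab i)) =
      (List.ofFn fun i : Fin n => a.std r (lab (σ.symm i : Fin n))).flatten := by
    rw [← List.flatMap_id, List.flatMap_map]
    have h1 : List.range n = (List.finRange n).map Fin.val := by simp
    rw [h1, List.flatMap_map, List.ofFn_eq_map, List.flatMap_map]
    refine List.flatMap_congr fun i _ => ?_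
    rw [relabel_val]
    rfl
  have hs : wordSign ((canonVerts r n).flatMap κ) = koszulSign σ (fun j => (f j).1.2) := by
    have h2 := a.wordSign_canon_std r n
    rw [hstd, wordSign_append] at h2
    have h3 : wordSign ((List.range n).flatMap fun i => a.std r (lab i)) = 1 := by
      refine wordSign_eq_one ((a.pairwise_canon_std r n).sublist ?_)
      rw [hstd]
      exact List.sublist_append_right _ _
    rw [hW, wordSign_append, Multiset.coe_eq_coe.2 hp, hflat, wordSign_std_perm]
    rw [h3, mul_one] at h2
    rw [h2, one_mul]
    rfl
  have hd : a'.tdeg r n = a.tdeg r n := by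
    have h := ((map_relabel_perm σ).map a.deg).sum_eq
    rw [List.map_map] at h
    rw [Args.tdeg, Args.tdeg]
    exact congrArg _ h
  have h1 : PlainOp.ev (a.env η hL (a.isKey_std r)) x (F.rename (relabel σ) id) =
      PlainOp.ev (a'.env η hL hκ) x F := by
    rw [PlainOp.ev_rename]
    congr 1
    funext c v
    cases v <;> rfl
  have h2 := a.extract_ev η hL (Forest.verts_canon hn' hl')
    (fun h => by rw [Forest.len_rename]; exact Shape_len hF.2.2.2 h) (a.isKey_std r)
    (a.even_canon (a.isKey_std r) r n) (List.Perm.refl _) rfl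
  rw [h1, a'.extract_ev η hL (Forest.verts_canon hnames hF1) (Shape_len hF.2.2.2) hκ _
    (by rw [hW, hstd]; exact (hp.symm).append_left _) hd.symm, hs, a.wordSign_canon_std, one_smul] at h2
  exact h2.symm

lemma rb_ext {I : List Color} {x : Color} {e : ℤ} {M : Type*} [AddCommGroup M]
    (Φ Ψ : RB I x e →+ M)
    (h : ∀ F (hF : F.Valid I x e), Φ (Finsupp.single ⟨F, hF⟩ 1) = Ψ (Finsupp.single ⟨F, hF⟩ 1))
    (p : RB I x e) : Φ p = Ψ p := by
  induction p using Finsupp.induction_linear with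
  | zero => rw [map_zero, map_zero]
  | add p q hp hq => rw [map_add, map_add, hp, hq]
  | single F z =>
    rw [← mul_one z, ← smul_eq_mul, ← Finsupp.smul_single, map_zsmul, map_zsmul, h F.1 F.2]

lemma opAct_perm {I I' : List Color} {x : Color} {e : ℤ} (σ : Equiv.Perm (Fin I.length))
    (hI : I' = List.ofFn (fun j => I.get (σ j))) (p : RB I x e) (g : Fin I.length → ℤ)
    (b : ∀ j, (defPair η).V (I.get (σ j)) (g j)) (f : Fin I.length → (defPair η).Tot)
    (hf : ∀ j, f j = (defPair η).ι _ (g j) (b j)) :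
    feed (opAct η hL (relBrace.perm σ hI p : RB I' x e)) (List.ofFn f) =
      koszulSign σ g • feed (opAct η hL p) (List.ofFn fun i => f (σ.symm i)) := by
  obtain ⟨φ, hφ⟩ := feed_ext_hom (k := k) (n := I'.length) (List.ofFn f)
  obtain ⟨ψ, hψ⟩ := feed_ext_hom (k := k) (n := I.length) (List.ofFn fun i => f (σ.symm i))
  let π : RB I x e →ₗ[ℤ] RB I' x e :=
    Finsupp.linearCombination ℤ fun F => rori I' x e (F.1.rename (relabel σ) id)
  change feed (opAct η hL (π p)) _ = _
  rw [← hφ, ← hψ]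
  refine rb_ext (φ.comp ((opAct η hL).comp π).toAddMonoidHom)
    (koszulSign σ g • ψ.comp (opAct η hL).toAddMonoidHom) (fun F hF => ?_) p
  change φ (opAct η hL (π (Finsupp.single ⟨F, hF⟩ 1))) =
    koszulSign σ g • ψ (opAct η hL (Finsupp.single ⟨F, hF⟩ 1))
  rw [hφ, hψ]
  have h0 : π (Finsupp.single ⟨F, hF⟩ 1) = rori I' x e (F.rename (relabel σ) id) := by
    simp [π]
  have hlen : I'.length = I.length := by rw [hI, List.length_ofFn]
  set l' : List (Hel (lam P)) := List.ofFn fun j => ⟨(I.get (σ j), g j), b j⟩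
  set l : List (Hel (lam P)) := List.ofFn fun i => ⟨(I.get (σ (σ.symm i)), g (σ.symm i)), b (σ.symm i)⟩
  have hl' : List.ofFn f = l'.map (hel η) := by
    rw [List.map_ofFn]
    congr 1
    funext j
    exact hf j
  have hl : (List.ofFn fun i => f (σ.symm i)) = l.map (hel η) := by
    rw [List.map_ofFn]
    congr 1
    funext j
    exact hf _
  have hseq : seq l = fun i => seq l' (relabel σ i) := by
    funext i
    by_cases hi : i < I.length
    · rw [seq, List.getD_eq_getElem _ _ (by simpa [l] using hi), relabel, dif_pos hi, seq,
        List.getD_eq_getElem _ _ (by simp [l'])]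
      simp [l, l']
    · rw [seq, List.getD_eq_default _ _ (by simpa [l] using hi), relabel, dif_neg hi, seq,
        List.getD_eq_default _ _ (by simpa [l'] using hi)]
  have hg : (fun j : Fin I.length => (seq l' j).1.2) = g := by
    funext j
    rw [seq, List.getD_eq_getElem _ _ (by simp [l'])]
    simp [l']
  have hS : (F.rename (relabel σ) id).Shape I' x := by
    rw [Forest.shape_iff, Forest.shapeP_rename]
    have key : ∀ c i, I[i]? = some c → I'[relabel σ i]? = some c := by
      intro c i hi
      obtain ⟨hi', hc⟩ := List.getElem?_eq_some_iff.1 hi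
      rw [relabel, dif_pos hi', hI, List.getElem?_eq_getElem (by simp)]
      simpa using hc
    exact ((Forest.shape_iff I x F).1 hF.2.2.2).mono (key cl) (key op)
  have hnm : (F.rename (relabel σ) id).names.Perm (List.range F.names.length) := by
    rw [Forest.names_rename, List.map_id]
    exact List.Perm.of_eq hF.names
  have hlb : (F.rename (relabel σ) id).labels.Perm (List.range I'.length) := by
    rw [Forest.labels_rename, hlen]
    exact (hF.1.map _).trans (map_relabel_perm σ)
  rw [h0, hl', hl, feed_single η hL hF l (by simp [l]), feed_rori η hL hnm hlb hS hF.2.2.1 l'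
    (by simp [l', hlen])]
  have h := inc_act_rename η hL (seq l') hF rfl σ
  rw [hg, ← hseq] at h
  rw [← h, hlen]

end SwissCheese

namespace SwissCheese

open Color Vtx

universe u v

variable {k : Type u} [CommRing k]

/-! ### Maps of lists that are linear in each entry -/

/-- Maps that are linear in each entry of a list of length `n`. -/
def ListLin (k : Type u) [CommRing k] {M N : Type v} [AddCommGroup M] [Module k M] [AddCommGroup N]
    [Module k N] (n : ℕ) (Φ : List M → N) : Prop :=
  ∀ u w : List M, u.length + w.length + 1 = n → ∃ l : M →ₗ[k] N, ∀ y, Φ (u ++ y :: w) = l y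

section ListLin

variable {M N : Type v} [AddCommGroup M] [Module k M] [AddCommGroup N] [Module k N]

lemma feed_slot {n : ℕ} (f : MultilinearMap k (fun _ : Fin n => M) M) (u w : List M)
    (h : u.length < n) : ∃ l : M →ₗ[k] M, ∀ y, feed f (u ++ y :: w) = l y := by
  refine ⟨f.toLinearMap (fun j => (u ++ 0 :: w).getD j 0) ⟨u.length, h⟩, fun y => ?_⟩
  rw [feed, MultilinearMap.toLinearMap_apply]
  congr 1
  funext j
  by_cases hj : j = ⟨u.length, h⟩
  · subst hj
    rw [Function.update_self]
    simp
  · rw [Function.update_of_ne hj]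
    have hj' : (j : ℕ) ≠ u.length := fun h' => hj (Fin.ext h')
    rw [List.getD_eq_getElem?_getD, List.getD_eq_getElem?_getD]
    rcases lt_or_gt_of_ne hj' with h' | h'
    · rw [List.getElem?_append_left h', List.getElem?_append_left h']
    · rw [List.getElem?_append_right h'.le, List.getElem?_append_right h'.le]
      obtain ⟨m, hm⟩ : ∃ m, (j : ℕ) - u.length = m + 1 := ⟨j - u.length - 1, by omega⟩
      rw [hm, List.getElem?_cons_succ, List.getElem?_cons_succ]

lemma ListLin.of_feed {m n : ℕ} (f : MultilinearMap k (fun _ : Fin m => M) M) {Φ : List M → List M}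
    (h : ∀ u w : List M, u.length + w.length + 1 = n → ∃ (u' w' : List M) (l : M →ₗ[k] M),
      u'.length < m ∧ ∀ y, Φ (u ++ y :: w) = u' ++ l y :: w') :
    ListLin k n fun l => feed f (Φ l) := fun u w hn => by
  obtain ⟨u', w', l, h1, h2⟩ := h u w hn
  obtain ⟨l', hl⟩ := feed_slot f u' w' h1
  exact ⟨l'.comp l, fun y =>
    (congrArg (feed f) (h2 y)).trans (hl _)⟩

lemma ListLin.comp {n : ℕ} {Φ : List M → N} (h : ListLin k n Φ) (g : N →ₗ[k] N) :
    ListLin k n fun l => g (Φ l) := fun u w hn => by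
  obtain ⟨l, hl⟩ := h u w hn
  exact ⟨g.comp l, fun y => congrArg g (hl y)⟩

lemma ListLin.sub {n : ℕ} {Φ Ψ : List M → N} (h : ListLin k n Φ) (h' : ListLin k n Ψ) :
    ListLin k n fun l => Φ l - Ψ l := fun u w hn => by
  obtain ⟨l, hl⟩ := h u w hn
  obtain ⟨l', hl'⟩ := h' u w hn
  exact ⟨l - l', fun y => congrArg₂ (· - ·) (hl y) (hl' y)⟩

lemma ListLin.zsmul {n : ℕ} {Φ : List M → N} (h : ListLin k n Φ) (z : ℤ) :
    ListLin k n fun l => z • Φ l := fun u w hn => by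
  obtain ⟨l, hl⟩ := h u w hn
  exact ⟨z • l, fun y => congrArg (z • ·) (hl y)⟩

lemma ListLin.sum {n m : ℕ} {Φ : ℕ → List M → N} (h : ∀ j < m, ListLin k n (Φ j)) :
    ListLin k n fun l => ∑ j ∈ Finset.range m, Φ j l := fun u w hn => by
  choose! l hl using fun j (hj : j < m) => h j hj u w hn
  refine ⟨∑ j ∈ Finset.range m, l j, fun y => ?_⟩
  rw [LinearMap.sum_apply]
  exact Finset.sum_congr rfl fun j hj => hl j (Finset.mem_range.1 hj) y

end ListLin

section

variable {P : OpData.{u, v} k} (η : OpHom (hscInf k) P)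

/-- Two maps that are linear in each entry agree if they agree on homogeneous elements. -/
lemma ListLin.ext {n : ℕ} {Φ Ψ : List (defPair η).Tot → (defPair η).Tot} (hΦ : ListLin k n Φ)
    (hΨ : ListLin k n Ψ)
    (h : ∀ l : List (Hel (lam P)), l.length = n → Φ (l.map (hel η)) = Ψ (l.map (hel η)))
    (L : List (defPair η).Tot) (hL : L.length = n) : Φ L = Ψ L := by
  -- The entries are reduced to homogeneous ones from left to right; `l` is the part already
  -- treated.
  have key : ∀ (L : List (defPair η).Tot) (l : List (Hel (lam P))), l.length + L.length = n →
      Φ (l.map (hel η) ++ L) = Ψ (l.map (hel η) ++ L) := by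
    intro L
    induction L with
    | nil =>
      intro l hl
      rw [List.append_nil]
      exact h l hl
    | cons y L ih =>
      intro l hl
      have hn : (l.map (hel η)).length + L.length + 1 = n := by
        rw [List.length_map, ← hl, List.length_cons]
        omega
      obtain ⟨m, hm⟩ := hΦ _ L hn
      obtain ⟨m', hm'⟩ := hΨ _ L hn
      rw [List.length_cons] at hl
      rw [hm, hm']
      induction y using DirectSum.induction_on with
      | zero => rw [map_zero, map_zero]
      | of i x =>
        have h1 := ih (l ++ [⟨i, x⟩]) (by rw [List.length_append, List.length_singleton]; omega)
        rw [List.map_append, List.append_assoc] at h1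
        exact (hm _).symm.trans (h1.trans (hm' _))
      | add a b ha hb => rw [map_add, map_add, ha, hb]
  exact key L [] (by simpa using hL)

lemma kos_hel (n : ℤ) (h : Hel (lam P)) :
    (defPair η).kos n (hel η h) = sgn (n * h.1.2) • hel η h := by
  exact DirectSum.toModule_lof k (φ := fun i : Color × ℤ =>
    sgn (n * i.2) • (defPair η).ι i.1 i.2) h.1 h.2

lemma dTot_hel (h : Hel (lam P)) :
    (defPair η).dTot (hel η h) = hel η ⟨(h.1.1, h.1.2 - 1), (defPair η).d h.1.1 rfl h.2⟩ := by
  exact DirectSum.toModule_lof k (φ := fun i : Color × ℤ =>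
    ((defPair η).ι i.1 (i.2 - 1)).comp ((defPair η).d i.1 rfl)) h.1 h.2

/-- The total degree of a list of homogeneous elements. -/
def hdeg {L : OpData.{u, v} k} (l : List (Hel L)) : ℤ := (l.map fun h => h.1.2).sum

lemma feed_kos {m : ℕ} (f : MultilinearMap k (fun _ : Fin m => (defPair η).Tot) (defPair η).Tot)
    (n : ℤ) (l : List (Hel (lam P))) (u w : List (defPair η).Tot) (h : u.length + l.length ≤ m) :
    feed f (u ++ ((l.map (hel η)).map ((defPair η).kos n) ++ w)) =
      sgn (n * hdeg l) • feed f (u ++ (l.map (hel η) ++ w)) := by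
  induction l generalizing u with
  | nil => simp [hdeg, sgn_zero]
  | cons a l ih =>
    rw [List.length_cons] at h
    obtain ⟨φ, hφ⟩ := feed_slot f u ((l.map (hel η)).map ((defPair η).kos n) ++ w) (by omega)
    have h1 := ih (u ++ [hel η a]) (by simp; omega)
    rw [List.append_assoc, List.append_assoc, List.singleton_append, List.singleton_append] at h1
    rw [List.map_cons, List.map_cons, List.cons_append, List.cons_append, kos_hel, hφ, map_zsmul,
      ← hφ, h1, smul_smul, ← sgn_add]
    congr 2
    simp only [hdeg, List.map_cons, List.sum_cons]
    ring

end

/-! ### Letters of lists of homogeneous elements -/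

section

variable {L : OpData.{u, v} k}

/-- The letters of the odd elements of a list, numbered from `o` on. -/
def letters : ℕ → List (Hel L) → List ℕ
  | _, [] => []
  | o, h :: l => (if Even h.1.2 then [] else [o]) ++ letters (o + 1) l

lemma letters_append (o : ℕ) (l l' : List (Hel L)) :
    letters o (l ++ l') = letters o l ++ letters (o + l.length) l' := by
  induction l generalizing o with
  | nil => simp [letters]
  | cons h l ih =>
    rw [List.cons_append, letters, letters, ih, List.length_cons, List.append_assoc]
    congr 3
    omega

lemma seq_cons_succ (h : Hel L) (l : List (Hel L)) (i : ℕ) : seq (h :: l) (i + 1) = seq l i := rfl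

lemma seq_append_left {l l' : List (Hel L)} {i : ℕ} (h : i < l.length) :
    seq (l ++ l') i = seq l i := by
  rw [seq, seq, List.getD_append _ _ _ _ h]

lemma seq_append_right (l l' : List (Hel L)) (i : ℕ) : seq (l ++ l') (l.length + i) = seq l' i := by
  rw [seq, seq, List.getD_append_right _ _ _ _ (by omega)]
  congr 1
  omega

lemma flatMap_seq (o : ℕ) (l : List (Hel L)) (φ : ℕ → List ℕ)
    (h : ∀ i < l.length, φ i = if Even (seq l i).1.2 then [] else [o + i]) :
    (List.range l.length).flatMap φ = letters o l := by
  induction l generalizing o φ with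
  | nil => rfl
  | cons a l ih =>
    rw [List.length_cons, List.range_succ_eq_map, List.flatMap_cons, List.flatMap_map, letters,
      h 0 (by simp)]
    congr 1
    refine ih (o + 1) _ fun i hi => ?_
    rw [h (i + 1) (by simpa using hi), seq_cons_succ, add_right_comm, add_assoc]

lemma sum_seq (l : List (Hel L)) : ∑ i ∈ Finset.range l.length, (seq l i).1.2 = hdeg l := by
  induction l with
  | nil => rfl
  | cons a l ih =>
    rw [List.length_cons, Finset.sum_range_succ', hdeg, List.map_cons, List.sum_cons, ← hdeg, ← ih,
      add_comm]
    rfl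

lemma hdeg_append (l l' : List (Hel L)) : hdeg (l ++ l') = hdeg l + hdeg l' := by
  simp [hdeg]

lemma hdeg_cons (a : Hel L) (l : List (Hel L)) : hdeg (a :: l) = a.1.2 + hdeg l := by
  simp [hdeg]

lemma even_hdeg (o : ℕ) (l : List (Hel L)) : Even (hdeg l + (letters o l).length) := by
  induction l generalizing o with
  | nil => simp [hdeg, letters]
  | cons a l ih =>
    have h := ih (o + 1)
    rw [hdeg_cons, letters, List.length_append, Nat.cast_add, add_add_add_comm]
    refine Even.add ?_ h
    by_cases h : Even a.1.2
    · simp [h]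
    · simp only [h, if_false]
      exact (Int.not_even_iff_odd.1 h).add_one

/-- The standard word of a list of homogeneous elements. -/
lemma canon_std_seq (r : ℕ) (l : List (Hel L)) :
    (canonVerts r l.length).flatMap ((Args.of (seq l)).std r) = List.range r ++ letters r l := by
  rw [Args.flatMap_canonVerts]
  congr 1
  · simp [Args.std]
  · exact flatMap_seq r l _ fun i _ => rfl

lemma tdeg_seq (r : ℕ) (l : List (Hel L)) : (Args.of (seq l)).tdeg r l.length = -r + hdeg l := by
  rw [Args.tdeg, ← sum_seq]
  rfl

end

section

variable {P : OpData.{u, v} k} (η : OpHom (hscInf k) P) (hL : IsNSOperad (lam P))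

lemma env_lab_congr {f f' : ℕ → Hel (lam P)} {κ κ' : Vtx → List ℕ} (hκ : (Args.of f).IsKey κ)
    (hκ' : (Args.of f').IsKey κ') {i j : ℕ} (h : f i = f' j) (hw : κ (lab i) = κ' (lab j))
    (c : Color) :
    (Args.of f).env η hL hκ c (lab i) = (Args.of f').env η hL hκ' c (lab j) := by
  have key : ∀ (a b : Hel (lam P)) (w w' : List ℕ) (p : Even (a.1.2 + w.length))
      (p' : Even (b.1.2 + w'.length)), a = b → w = w' →
      (⟨w, a.1.2, p, pick _ a.1 c a.2⟩ : Keyed (lam P) c).toM hL =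
        (⟨w', b.1.2, p', pick _ b.1 c b.2⟩ : Keyed (lam P) c).toM hL := by
    rintro a b w w' p p' rfl rfl
    rfl
  exact key (f i) (f' j) _ _ (hκ (lab i)) (hκ' (lab j)) h hw

lemma env_neu_congr {a a' : Args (lam P)} {κ κ' : Vtx → List ℕ} (hκ : a.IsKey κ)
    (hκ' : a'.IsKey κ') {i j : ℕ} (hw : κ (neu i) = κ' (neu j)) (c : Color) :
    a.env η hL hκ c (neu i) = a'.env η hL hκ' c (neu j) := by
  have key : ∀ (w w' : List ℕ) (p : Even ((-1 : ℤ) + w.length)) (p' : Even ((-1 : ℤ) + w'.length)),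
      w = w' → (⟨w, -1, p, twist η c⟩ : Keyed (lam P) c).toM hL =
        (⟨w', -1, p', twist η c⟩ : Keyed (lam P) c).toM hL := by
    rintro w w' p p' rfl
    rfl
  exact key _ _ (hκ (neu i)) (hκ' (neu j)) hw

lemma env_lab_eq (a : Args (lam P)) {κ : Vtx → List ℕ} (hκ : a.IsKey κ) (i : ℕ) (c : Color)
    {w : List ℕ} {d : ℤ} (p : Even (d + w.length)) (y : Fam (lam P) c d) (hw : κ (lab i) = w)
    (hd : a.deg i = d) (hy : HEq (a.val c i) y) :
    a.env η hL hκ c (lab i) = (⟨w, d, p, y⟩ : Keyed (lam P) c).toM hL :=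
  Keyed.toM_congr hL _ _ hw hd hy

end

end SwissCheese

namespace SwissCheese

open Color Vtx

universe u v

/-! ### Compositions -/

/-- Make room for `m` inputs at the input `i`. -/
def makeRoom (i m j : ℕ) : ℕ := if j ≤ i then j else j + m - 1

lemma map_makeRoom (i m q : ℕ) : (List.range (i + 1 + q)).map (makeRoom i m) =
    List.range i ++ i :: (List.range q).map (i + m + ·) := by
  rw [List.range_add, List.range_succ, List.map_append, List.map_append, List.map_map,
    List.append_assoc, List.map_singleton]
  congr 1
  · conv_rhs => rw [← List.map_id (List.range i)]
    refine List.map_congr_left fun j hj => ?_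
    simp [makeRoom, (List.mem_range.1 hj).le]
  · rw [List.singleton_append]
    congr 1
    · simp [makeRoom]
    · refine List.map_congr_left fun j _ => ?_
      rw [Function.comp_apply, makeRoom, if_neg (by omega)]
      omega

lemma getElem?_makeRoom {α : Type*} (u v w : List α) (z : α) {j : ℕ} (hj : j ≠ u.length) :
    (u ++ v ++ w)[makeRoom u.length v.length j]? = (u ++ z :: w)[j]? := by
  rw [makeRoom, List.append_assoc]
  rcases lt_or_gt_of_ne hj with h | h
  · rw [if_pos h.le, List.getElem?_append_left h, List.getElem?_append_left h]
  · obtain ⟨q, rfl⟩ : ∃ q, j = u.length + (q + 1) := ⟨j - u.length - 1, by omega⟩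
    rw [if_neg (by omega), List.getElem?_append_right (by omega),
      List.getElem?_append_right (by omega), List.getElem?_append_right (by omega),
      show u.length + (q + 1) - u.length = q + 1 by omega, List.getElem?_cons_succ]
    congr 1
    omega

/-- The assumption `1 ≤ m` matters: for `m = 0` the label `i + 1` would be sent to `i`. -/
lemma makeRoom_of_ne {i m j : ℕ} (hm : 1 ≤ m) (hj : j ≠ i) :
    makeRoom i m j < i ∨ i + m ≤ makeRoom i m j := by
  rw [makeRoom]
  split_ifs <;> omega

lemma makeRoom_self (i m : ℕ) : makeRoom i m i = i := by simp [makeRoom]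

namespace Forest

/-- Neutral vertices have children, so a vertex without children is labelled. It follows that no
word has an empty profile, as `makeRoom` requires. -/
lemma RoundOK.labels_ne_nil {I : List Color} {F : Forest} (h : F.RoundOK I) (hF : 1 ≤ F.len) :
    F.labels ≠ [] := by
  induction F with
  | nil => simp [len] at hF
  | cons v ch r ih _ =>
    cases v with
    | lab i => simp [labels]
    | neu e =>
      rw [labels, Ne, List.append_eq_nil_iff]
      exact fun h' => ih h.2.1 (one_le_two.trans h.1) h'.1

lemma Shape.labels_ne_nil {I : List Color} {x : Color} {F : Forest} (h : F.Shape I x) :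
    F.labels ≠ [] := by
  cases x with
  | cl => exact h.2.labels_ne_nil h.1.ge
  | op =>
    rcases F with _ | ⟨_ | _, ch, r⟩
    · exact absurd h.1 (by simp [len])
    · simp [labels]
    · rw [labels, Ne, List.append_eq_nil_iff]
      exact fun h' => h.2.2.1.labels_ne_nil h.2.1 h'.1

lemma Valid.one_le {I : List Color} {x : Color} {e : ℤ} {F : Forest} (h : F.Valid I x e) :
    1 ≤ I.length := by
  by_contra h'
  have := h.1
  rw [Nat.lt_one_iff.1 (not_le.1 h')] at this
  exact h.2.2.2.labels_ne_nil this.eq_nil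

end Forest

section

variable {a c I J K : List Color} {t x : Color} {m n : ℤ} {F X T : Forest}

lemma labels_makeRoom (hF : F.Valid I x m) (hI : I = a ++ t :: c) (r : ℕ) :
    (F.rename (makeRoom a.length r) id).labels.Perm
      (List.range a.length ++ a.length :: (List.range c.length).map (a.length + r + ·)) := by
  rw [Forest.labels_rename, ← map_makeRoom]
  refine hF.1.map _ |>.trans (List.Perm.of_eq ?_)
  rw [hI, List.length_append, List.length_cons, ← add_assoc, add_right_comm]

lemma nodup_makeRoom (hF : F.Valid I x m) (hI : I = a ++ t :: c) {r : ℕ} (hr : 1 ≤ r) :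
    (F.rename (makeRoom a.length r) id).labels.Nodup := by
  rw [(labels_makeRoom hF hI r).nodup_iff, List.nodup_append, List.nodup_cons]
  refine ⟨List.nodup_range, ⟨?_, List.nodup_range.map fun p q h => by simpa using h⟩, ?_⟩
  · simp only [List.mem_map, not_exists, not_and]
    omega
  · intro p hp q hq
    rw [List.mem_range] at hp
    simp only [List.mem_cons, List.mem_map] at hq
    rcases hq with rfl | ⟨q, _, rfl⟩ <;> omega

lemma shape_makeRoom (hF : F.Valid I x m) (hI : I = a ++ t :: c) (J : List Color) :
    (F.rename (makeRoom a.length (t :: J).length) id).Shape (a ++ (t :: J) ++ c) x := by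
  rw [Forest.shape_iff, Forest.shapeP_rename]
  have key : ∀ s j, I[j]? = some s →
      (a ++ (t :: J) ++ c)[makeRoom a.length (t :: J).length j]? = some s := by
    intro s j h
    by_cases hj : j = a.length
    · subst hj
      rw [makeRoom_self]
      rw [hI] at h
      simpa using h
    · rwa [getElem?_makeRoom a (t :: J) c t hj, ← hI]
  exact ((Forest.shape_iff I x F).1 hF.2.2.2).mono (key cl) (key op)

lemma shape_shift (hX : X.Valid J t n) (a : List Color) (g : ℕ → ℕ) :
    (X.rename (fun j => j + a.length) g).Shape (a ++ J) t := by
  rw [Forest.shape_iff, Forest.shapeP_rename]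
  have key : ∀ s j, J[j]? = some s → (a ++ J)[j + a.length]? = some s := fun s j h => by
    rwa [List.getElem?_append_right (by omega), Nat.add_sub_cancel]
  exact ((Forest.shape_iff J t X).1 hX.2.2.2).mono (key cl) (key op)

lemma rcompTerms_spec (hF : F.Valid I x m) (hX : X.Valid J t n) (hI : I = a ++ t :: c)
    (hK : K = a ++ J ++ c) (hT : T ∈ rcompTerms a.length J.length F X) :
    T.names.Perm (List.range (F.names.length + X.names.length)) ∧
      T.labels.Perm (List.range K.length) ∧ T.Shape K x := by
  have hIi : I[a.length]? = some t := by simp [hI]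
  have hFl := labels_makeRoom hF hI J.length
  have hJ1 := hX.one_le
  have hnd := nodup_makeRoom hF hI hJ1
  have hXv : (X.rename (fun j => j + a.length) (fun e => e + F.names.length)).verts.Perm
      (((List.range X.names.length).map (F.names.length + ·)).map neu ++
        ((List.range J.length).map (a.length + ·)).map lab) := by
    rw [Forest.verts_rename]
    refine ((Forest.verts_canon (List.Perm.of_eq hX.names) hX.1).map _).trans ?_
    rw [canonVerts, List.map_append, List.map_map, List.map_map, List.map_map, List.map_map]
    refine List.Perm.of_eq ?_
    congr 1
    · refine List.map_congr_left fun j _ => ?_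
      simp [Vtx.rename, add_comm]
    · refine List.map_congr_left fun j _ => ?_
      simp [Vtx.rename, add_comm]
  have hFv : (F.rename (makeRoom a.length J.length) id).verts.Perm
      ((List.range F.names.length).map neu ++ (List.range a.length ++
        a.length :: (List.range c.length).map (a.length + J.length + ·)).map lab) := by
    refine (Forest.verts_perm _).trans (List.Perm.append ?_ (hFl.map _))
    rw [Forest.names_rename, List.map_id]
    exact (List.Perm.of_eq hF.names).map _
  have hv := Forest.verts_subst (F := F.rename (makeRoom a.length J.length) id) hT
  rw [Multiset.coe_eq_coe.2 hXv, Multiset.coe_eq_coe.2 hFv] at hv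
  have hv' : (T.verts : Multiset Vtx) =
      ((List.range (F.names.length + X.names.length)).map neu : List Vtx) +
        ((List.range K.length).map lab : List Vtx) := by
    refine add_left_cancel (hv.trans ?_)
    rw [hK, List.length_append, List.length_append, List.range_add, List.range_add, List.range_add]
    simp only [List.map_append, List.map_cons, ← Multiset.coe_add, ← Multiset.cons_coe,
      ← Multiset.singleton_add]
    abel
  obtain ⟨h1, h2⟩ := Forest.names_perm_of_verts hv'
  refine ⟨h1, h2, ?_⟩
  · rw [Forest.shape_iff]
    have hJ : ∀ j s, J[j]? = some s → K[j + a.length]? = some s := fun j s h => by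
      have hj : j < J.length := (List.getElem?_eq_some_iff.1 h).1
      rw [hK, List.append_assoc, List.getElem?_append_right (by omega), Nat.add_sub_cancel,
        List.getElem?_append_left hj, h]
    have hIK : ∀ s j, I[j]? = some s →
        (makeRoom a.length J.length j ≠ a.length → K[makeRoom a.length J.length j]? = some s) ∧
        (makeRoom a.length J.length j = a.length → t = s) := by
      intro s j h
      by_cases hj : j = a.length
      · subst hj
        rw [makeRoom_self]
        exact ⟨fun h' => absurd rfl h', fun _ => by simpa [hIi] using h⟩
      · rw [hK, getElem?_makeRoom a J c t hj, ← hI]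
        refine ⟨fun _ => h, fun h' => ?_⟩
        have := makeRoom_of_ne hJ1 hj
        omega
    -- At the label `a.length` the condition on `F` compares the shape of the vertex with `t` only.
    -- After the substitution this label belongs to `X` and has to fit the profile `K`.
    refine Forest.ShapeP.subst (i := a.length) (F := F.rename (makeRoom a.length J.length) id)
      (p := fun j => (j ≠ a.length → K[j]? = some cl) ∧ (j = a.length → t = cl))
      (q := fun j => (j ≠ a.length → K[j]? = some op) ∧ (j = a.length → t = op))
      ?_ (fun j hj h => h.1 hj) (fun j hj h => h.1 hj) hnd (fun h => ?_) (fun h => ?_) hT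
    · rw [Forest.shapeP_rename]
      exact ((Forest.shape_iff I x F).1 hF.2.2.2).mono (hIK cl) (hIK op)
    · obtain rfl := h.2 rfl
      rw [Forest.shapeP_rename]
      exact ((Forest.shape_iff J _ X).1 hX.2.2.2).mono (fun j => hJ j cl) fun j => hJ j op
    · obtain rfl := h.2 rfl
      rw [Forest.shapeP_rename]
      exact ((Forest.shape_iff J _ X).1 hX.2.2.2).mono (fun j => hJ j cl) fun j => hJ j op

end

end SwissCheese

namespace SwissCheese

open Color Vtx

universe u v

variable {k : Type u} [CommRing k] {P : OpData.{u, v} k} (η : OpHom (hscInf k) P)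
  (hL : IsNSOperad (lam P))

lemma Args.extract_act (a : Args (lam P)) {r n : ℕ} {x : Color} {T : Forest}
    (hn : T.names.Perm (List.range r)) (hl : T.labels.Perm (List.range n))
    (hx : x = cl → T.len = 1) :
    extract η hL ((canonVerts r n).flatMap (a.std r)) (a.tdeg r n)
      (a.even_canon (a.isKey_std r) r n) (PlainOp.ev (a.env η hL (a.isKey_std r)) x T) =
      inc η x _ (a.act η hL r n x T) := by
  rw [a.extract_ev η hL (Forest.verts_canon hn hl) hx (a.isKey_std r) _ (List.Perm.refl _) rfl,
    a.wordSign_canon_std, one_smul]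

lemma seq_makeRoom {L : OpData.{u, v} k} (u v w : List (Hel L)) (z : Hel L) {j : ℕ}
    (hj : j ≠ u.length) :
    seq (u ++ z :: w) j = seq (u ++ v ++ w) (makeRoom u.length v.length j) := by
  rw [seq, seq, List.getD_eq_getElem?_getD, List.getD_eq_getElem?_getD, getElem?_makeRoom u v w z hj]

/-- The value of a word on a list of homogeneous elements. -/
noncomputable def hact (r : ℕ) (x : Color) (F : Forest) (l : List (Hel (lam P))) : Hel (lam P) :=
  ⟨(x, _), (Args.of (seq l)).act η hL r l.length x F⟩

lemma hel_hact (r : ℕ) (x : Color) (F : Forest) (l : List (Hel (lam P))) :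
    hel η (hact η hL r x F l) = inc η x _ ((Args.of (seq l)).act η hL r l.length x F) := rfl

lemma feed_single_hel {I : List Color} {x : Color} {e : ℤ} {F : Forest} (hF : F.Valid I x e)
    (l : List (Hel (lam P))) (h : l.length = I.length) :
    feed (opAct η hL (Finsupp.single ⟨F, hF⟩ 1)) (l.map (hel η)) =
      hel η (hact η hL F.names.length x F l) := by
  rw [hel_hact, feed_single η hL hF l h, h]

lemma feed_rori_hel {I : List Color} {x : Color} {e : ℤ} {r : ℕ} {T : Forest}
    (hn : T.names.Perm (List.range r)) (hl : T.labels.Perm (List.range I.length))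
    (hS : T.Shape I x) (he : e = -(r : ℤ)) (l : List (Hel (lam P))) (h : l.length = I.length) :
    feed (opAct η hL (rori I x e T)) (l.map (hel η)) = hel η (hact η hL r x T l) := by
  rw [hel_hact, feed_rori η hL hn hl hS he l h, h]

variable {a c I J K : List Color} {t x : Color} {m n : ℤ} {F X : Forest}

/-- By `lsum_subst_ev`, evaluating the substituted words amounts to evaluating `X` and using its
value as an argument of `F`. The canonical word of the composite lists the names of `F`, the names
of `X` and then the arguments, whereas in the iterated evaluation the names of `X` come after the
arguments `u`. The exchange is the Koszul sign of an operation of degree `-X.names.length` that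
passes `u`. -/
lemma lsum_rcompTerms (hF : F.Valid I x m) (hX : X.Valid J t n) (hI : I = a ++ t :: c)
    (hK : K = a ++ J ++ c) (u v w : List (Hel (lam P))) (hu : u.length = a.length)
    (hv : v.length = J.length) (hw : w.length = c.length) :
    lsum (rcompTerms a.length J.length F X) (fun T =>
      hel η (hact η hL (F.names.length + X.names.length) x T (u ++ v ++ w))) =
    sgn (-X.names.length * hdeg u) • hel η (hact η hL F.names.length x F
      (u ++ hact η hL X.names.length t X v :: w)) := by
  set rF := F.names.length
  set rX := X.names.length
  set b := Args.of (seq (u ++ v ++ w))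
  set z := hact η hL rX t X v
  set d := Args.of (seq (u ++ z :: w))
  have hn : (u ++ v ++ w).length = K.length := by simp [hK, hu, hv, hw]
  have hnI : (u ++ z :: w).length = I.length := by simp [hI, hu, hw]
  have hIi : I[a.length]? = some t := by simp [hI]
  have hXn : X.names.Perm (List.range rX) := List.Perm.of_eq hX.names
  have hFn : F.names.Perm (List.range rF) := List.Perm.of_eq hF.names
  -- the value of `X` at the letters of `v`
  let κX : Vtx → List ℕ := fun y => match y with
    | neu e => [e + rF]
    | lab j => if Even (seq v j).1.2 then [] else [rF + rX + a.length + j]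
  have hκX : (Args.of (seq v)).IsKey κX := by
    intro y
    cases y with
    | neu e => simp [Args.vdeg, κX]
    | lab j =>
      change Even ((seq v j).1.2 + (κX (lab j)).length)
      by_cases h : Even (seq v j).1.2
      · simp [κX, h]
      · simp only [κX, h, if_false]
        exact (Int.not_even_iff_odd.1 h).add_one
  have hX1 : PlainOp.ev (b.env η hL (b.isKey_std (rF + rX))) t
      (X.rename (fun j => j + a.length) (fun e => e + rF)) =
      PlainOp.ev ((Args.of (seq v)).env η hL hκX) t X := by
    rw [PlainOp.ev_rename]
    refine PlainOp.ev_congr hX.2.2.2 (fun j s hj => ?_) fun s e _ => ?_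
    · have hj' : j < v.length := hv ▸ (List.getElem?_eq_some_iff.1 hj).1
      have h1 : seq (u ++ v ++ w) (j + a.length) = seq v j := by
        rw [List.append_assoc, ← hu, add_comm, seq_append_right, seq_append_left hj']
      refine env_lab_congr η hL (b.isKey_std (rF + rX)) hκX h1 ?_ s
      change (if Even (seq (u ++ v ++ w) (j + a.length)).1.2 then [] else _) = _
      rw [h1, add_comm j, ← add_assoc]
    · exact env_neu_congr η hL (b.isKey_std (rF + rX)) hκX rfl s
  set WX : List ℕ := (canonVerts rX v.length).flatMap κX
  have hWX : WX = (List.range rX).map (rF + ·) ++ letters (rF + rX + a.length) v := by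
    refine (Args.flatMap_canonVerts κX rX v.length).trans ?_
    congr 1
    · rw [List.map_eq_flatMap]
      exact List.flatMap_congr fun e _ => by simp [κX, add_comm]
    · exact flatMap_seq _ v _ fun i _ => rfl
  have hX2 := (Args.of (seq v)).ev_eq_act η hL rX v.length t X
    (Forest.verts_canon hXn (hv ▸ hX.1)) (Shape_len hX.2.2.2) hκX
  -- the value of `F`
  let κF : Vtx → List ℕ := fun y => match y with
    | neu e => [e]
    -- The input filled by `X` carries the whole word of `X`; every other label has the letter of
    -- its place in the composite.
    | lab j => if j = a.length then WX else
        if Even (seq (u ++ z :: w) j).1.2 then [] else [rF + rX + makeRoom a.length J.length j]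
  have hz : seq (u ++ z :: w) a.length = z := by
    rw [← hu, ← add_zero u.length, seq_append_right]
    rfl
  have hκF : d.IsKey κF := by
    intro y
    cases y with
    | neu e => simp [Args.vdeg, κF]
    | lab j =>
      change Even ((seq (u ++ z :: w) j).1.2 + (κF (lab j)).length)
      by_cases hj : j = a.length
      · subst hj
        rw [hz]
        simp only [κF, if_true]
        exact (Args.of (seq v)).even_canon hκX rX v.length
      by_cases h : Even (seq (u ++ z :: w) j).1.2
      · simp [κF, h, hj]
      · simp only [κF, h, hj, if_false]
        exact (Int.not_even_iff_odd.1 h).add_one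
  have hne : ∀ j, j ≠ a.length → makeRoom a.length J.length j ≠ a.length := fun j hj h => by
    have := makeRoom_of_ne hX.one_le hj
    have := hX.one_le
    omega
  have hF1 : PlainOp.ev ((b.env η hL (b.isKey_std (rF + rX))).set t (lab a.length)
      (PlainOp.ev (b.env η hL (b.isKey_std (rF + rX))) t
        (X.rename (fun j => j + a.length) (fun e => e + rF)))) x
      (F.rename (makeRoom a.length J.length) id) = PlainOp.ev (d.env η hL hκF) x F := by
    rw [PlainOp.ev_rename]
    refine PlainOp.ev_congr hF.2.2.2 (fun j s hj => ?_) fun s e _ => ?_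
    · by_cases hj' : j = a.length
      · subst hj'
        obtain rfl : t = s := by simpa [hIi] using hj
        change ((b.env η hL (b.isKey_std (rF + rX))).set t (lab a.length) _) t
          (lab (makeRoom a.length J.length a.length)) = _
        rw [makeRoom_self, PlainOp.Env.set_self, hX1, hX2]
        refine (env_lab_eq η hL d hκF a.length t _ _ (by simp [κF, WX]) (congrArg (·.1.2) hz) ?_).symm
        have : ∀ y : Hel (lam P), y = z → HEq (pick (lam P) y.1 t y.2) z.2 := by
          rintro y rfl
          exact heq_of_eq (pick_self (lam P) t _ _)
        exact this _ hz
      · change ((b.env η hL (b.isKey_std (rF + rX))).set t (lab a.length) _) s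
          (lab (makeRoom a.length J.length j)) = _
        rw [PlainOp.Env.set_ne _ _ _ _ _ _ (by simpa using hne j hj')]
        have h1 : seq (u ++ v ++ w) (makeRoom a.length J.length j) = seq (u ++ z :: w) j := by
          rw [seq_makeRoom u v w z (hu.symm ▸ hj'), hu, hv]
        refine env_lab_congr η hL (b.isKey_std (rF + rX)) hκF h1 ?_ s
        change (if Even (seq (u ++ v ++ w) (makeRoom a.length J.length j)).1.2 then [] else _) =
          if _ then _ else _
        rw [h1, if_neg hj']
    · change ((b.env η hL (b.isKey_std (rF + rX))).set t (lab a.length) _) s (neu e) = _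
      rw [PlainOp.Env.set_ne _ _ _ _ _ _ (by simp)]
      exact env_neu_congr η hL (b.isKey_std (rF + rX)) hκF rfl s
  set WF : List ℕ := (canonVerts rF (u ++ z :: w).length).flatMap κF
  have hWF : WF = List.range rF ++ letters (rF + rX) u ++ (List.range rX).map (rF + ·) ++
      (letters (rF + rX + u.length) v ++ letters (rF + rX + u.length + v.length) w) := by
    refine (Args.flatMap_canonVerts κF rF _).trans ?_
    have h1 : (List.range rF).flatMap (fun e => κF (neu e)) = List.range rF := by simp [κF]
    have h2 : (List.range u.length).flatMap (fun j => κF (lab j)) = letters (rF + rX) u := by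
      refine flatMap_seq _ u _ fun j hj => ?_
      simp only [κF]
      rw [if_neg (show ¬ j = a.length by omega), seq_append_left hj, makeRoom,
        if_pos (show j ≤ a.length by omega)]
    have h3 : (List.range w.length).flatMap (fun j => κF (lab (u.length + 1 + j))) =
        letters (rF + rX + u.length + v.length) w := by
      refine flatMap_seq _ w _ fun j hj => ?_
      simp only [κF]
      rw [if_neg (show ¬ u.length + 1 + j = a.length by omega), add_assoc u.length, seq_append_right, add_comm 1 j, seq_cons_succ,
        makeRoom, if_neg (show ¬ u.length + (j + 1) ≤ a.length by omega)]
      congr 2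
      omega
    have h4 : κF (lab u.length) = WX := by simp [κF, hu]
    rw [h1, List.length_append, List.length_cons, ← add_assoc, add_right_comm, List.range_add,
      List.range_succ, List.flatMap_append, List.flatMap_append, h2, List.flatMap_singleton, h4,
      List.flatMap_map, h3, hWX, ← hu]
    simp only [List.append_assoc]
  have hW : (canonVerts (rF + rX) (u ++ v ++ w).length).flatMap (b.std (rF + rX)) =
      List.range rF ++ (List.range rX).map (rF + ·) ++ letters (rF + rX) u ++
      (letters (rF + rX + u.length) v ++ letters (rF + rX + u.length + v.length) w) := by
    refine (canon_std_seq (rF + rX) (u ++ v ++ w)).trans ?_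
    rw [List.range_add, letters_append, letters_append, List.length_append]
    simp only [List.append_assoc, add_assoc]
  -- The `rX` names of `X` are exchanged with the letters of `u`, whose number has the parity of
  -- `hdeg u`.
  have hs : wordSign WF = sgn (-rX * hdeg u) := by
    have h1 := b.wordSign_canon_std (rF + rX) (u ++ v ++ w).length
    rw [hW] at h1
    rw [hWF, wordSign_swap, h1, mul_one, List.length_map, List.length_range]
    refine sgn_congr ?_
    have := (ZMod.intCast_eq_zero_iff_even.2 (even_hdeg (rF + rX) u))
    push_cast at this ⊢
    have h2 : (hdeg u : ZMod 2) = (letters (rF + rX) u).length :=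
      (eq_neg_of_add_eq_zero_left this).trans (ZMod.neg_eq_self_mod_two _)
    rw [h2, neg_mul, ZMod.neg_eq_self_mod_two, mul_comm]
  have hd : b.tdeg (rF + rX) (u ++ v ++ w).length = d.tdeg rF (u ++ z :: w).length := by
    rw [tdeg_seq, tdeg_seq, hdeg_append, hdeg_append, hdeg_append, hdeg_cons]
    have : z.1.2 = -rX + hdeg v := tdeg_seq rX v
    rw [this]
    push_cast
    ring
  -- Only the length of the middle block and the colour `t` at the place `a.length` matter here, so
  -- `J` is replaced by a constant block of the same length. It is nonempty by `Valid.one_le`.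
  have hs1 : (F.rename (makeRoom a.length J.length) id).Shape
      (a ++ (t :: List.replicate (J.length - 1) t) ++ c) x := by
    have h := shape_makeRoom hF hI (List.replicate (J.length - 1) t)
    rwa [List.length_cons, List.length_replicate, Nat.sub_add_cancel hX.one_le] at h
  have hsub := PlainOp.lsum_subst_ev (b.env η hL (b.isKey_std (rF + rX)))
    (fun s y => Keyed.toM_supp hL _) hs1 (nodup_makeRoom hF hI hX.one_le) (i := a.length)
    ((labels_makeRoom hF hI J.length).mem_iff.2 (by simp)) (t := t) (by simp)
    (shape_shift hX a (fun e => e + rF))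
  have hfin := congrArg (extract η hL ((canonVerts (rF + rX) (u ++ v ++ w).length).flatMap
    (b.std (rF + rX))) (b.tdeg (rF + rX) (u ++ v ++ w).length)
    (b.even_canon (b.isKey_std (rF + rX)) (rF + rX) _)) (hsub.trans hF1)
  rw [map_lsum, d.extract_ev η hL (Forest.verts_canon hFn (hnI ▸ hF.1)) (Shape_len hF.2.2.2) hκF _ ?_ hd]
    at hfin
  · rw [hel_hact, ← hs]
    refine Eq.trans (lsum_congr fun T hT => ?_) hfin
    obtain ⟨h1, h2, h3⟩ := rcompTerms_spec hF hX hI hK hT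
    exact (b.extract_act η hL h1 (hn ▸ h2) (Shape_len h3)).symm
  · rw [hW]
    refine List.Perm.trans ?_ (List.Perm.of_eq hWF.symm)
    refine List.Perm.append_right _ ?_
    rw [List.append_assoc, List.append_assoc]
    exact List.perm_append_comm.append_left _

lemma feed_opAct_comp_single (hF : F.Valid I x m) (hX : X.Valid J t n) (hI : I = a ++ t :: c)
    (hK : K = a ++ J ++ c) {l : ℤ} (hl : l = m + n) (u v w : List (defPair η).Tot)
    (hu : u.length = a.length) (hv : v.length = J.length) (hw : w.length = c.length) :
    feed (opAct η hL ((rcompTerms a.length J.length F X).map (rori K x l)).sum) (u ++ v ++ w) =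
      feed (opAct η hL (Finsupp.single ⟨F, hF⟩ 1)) (u.map ((defPair η).kos n) ++
        feed (opAct η hL (Finsupp.single ⟨X, hX⟩ 1)) v :: w) := by
  set f := opAct η hL ((rcompTerms a.length J.length F X).map (rori K x l)).sum
  set g := opAct η hL (Finsupp.single ⟨F, hF⟩ 1)
  set h := opAct η hL (Finsupp.single ⟨X, hX⟩ 1)
  have hIl : I.length = a.length + c.length + 1 := by simp [hI]; omega
  have hKl : K.length = a.length + J.length + c.length := by simp [hK]; omega
  -- reduction to homogeneous elements
  refine ListLin.ext η (n := a.length) (Φ := fun u => feed f (u ++ v ++ w))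
    (Ψ := fun u => feed g (u.map ((defPair η).kos n) ++ feed h v :: w))
    (ListLin.of_feed f fun p q hpq => ⟨p, q ++ v ++ w, LinearMap.id, by omega, fun y => by simp⟩)
    (ListLin.of_feed g fun p q hpq => ⟨p.map ((defPair η).kos n),
      q.map ((defPair η).kos n) ++ feed h v :: w, (defPair η).kos n,
      by rw [List.length_map]; omega, fun y => by simp⟩) (fun u' hu' => ?_) u hu
  refine ListLin.ext η (n := J.length) (Φ := fun v => feed f (u'.map (hel η) ++ v ++ w))
    (Ψ := fun v => feed g ((u'.map (hel η)).map ((defPair η).kos n) ++ feed h v :: w))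
    (ListLin.of_feed f fun p q hpq => ⟨u'.map (hel η) ++ p, q ++ w, LinearMap.id,
      by rw [List.length_append, List.length_map]; omega, fun y => by simp⟩)
    (ListLin.of_feed g fun p q hpq => ?_) (fun v' hv' => ?_) v hv
  · obtain ⟨φ, hφ⟩ := feed_slot h p q (by omega)
    exact ⟨(u'.map (hel η)).map ((defPair η).kos n), w, φ,
      by rw [List.length_map, List.length_map]; omega, fun y => by rw [hφ]⟩
  refine ListLin.ext η (n := c.length)
    (Φ := fun w => feed f (u'.map (hel η) ++ v'.map (hel η) ++ w))
    (Ψ := fun w => feed g ((u'.map (hel η)).map ((defPair η).kos n) ++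
      feed h (v'.map (hel η)) :: w))
    (ListLin.of_feed f fun p q hpq => ⟨u'.map (hel η) ++ v'.map (hel η) ++ p, q, LinearMap.id,
      by rw [List.length_append, List.length_append, List.length_map, List.length_map]; omega,
      fun y => by simp⟩)
    (ListLin.of_feed g fun p q hpq => ⟨(u'.map (hel η)).map ((defPair η).kos n) ++
      feed h (v'.map (hel η)) :: p, q, LinearMap.id,
      by rw [List.length_append, List.length_map, List.length_map, List.length_cons]; omega,
      fun y => by simp⟩) (fun w' hw' => ?_) w hw
  -- homogeneous elements
  have h1 : feed h (v'.map (hel η)) = hel η (hact η hL X.names.length t X v') :=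
    feed_single_hel η hL hX v' hv'
  have h2 := feed_kos η g n u' [] (hel η (hact η hL X.names.length t X v') :: w'.map (hel η))
    (by rw [List.length_nil]; omega)
  have h3 : feed g (u'.map (hel η) ++ hel η (hact η hL X.names.length t X v') :: w'.map (hel η)) =
      hel η (hact η hL F.names.length x F (u' ++ hact η hL X.names.length t X v' :: w')) := by
    have hlen : (u' ++ hact η hL X.names.length t X v' :: w').length = I.length := by
      rw [List.length_append, List.length_cons]; omega
    have h5 := feed_single_hel η hL hF _ hlen
    rw [List.map_append, List.map_cons] at h5
    exact h5
  have h4 : feed f (u'.map (hel η) ++ v'.map (hel η) ++ w'.map (hel η)) =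
      lsum (rcompTerms a.length J.length F X) fun T =>
        hel η (hact η hL (F.names.length + X.names.length) x T (u' ++ v' ++ w')) := by
    obtain ⟨φ, hφ⟩ := feed_ext_hom (k := k) (n := K.length)
      (u'.map (hel η) ++ v'.map (hel η) ++ w'.map (hel η))
    have hlen : (u' ++ v' ++ w').length = K.length := by
      rw [List.length_append, List.length_append]; omega
    rw [← hφ]
    change φ (opAct η hL (lsum (rcompTerms a.length J.length F X) (rori K x l))) = _
    rw [map_lsum, map_lsum]
    refine lsum_congr fun T hT => ?_
    obtain ⟨e1, e2, e3⟩ := rcompTerms_spec hF hX hI hK hT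
    rw [hφ, ← List.map_append, ← List.map_append, feed_rori_hel η hL e1 e2 e3 ?_ _ hlen]
    rw [hl, hF.2.2.1, hX.2.2.1]
    push_cast
    ring
  rw [List.nil_append, List.nil_append] at h2
  change feed f _ = feed g _
  rw [h1, h2, h3, h4, lsum_rcompTerms η hL hF hX hI hK u' v' w' hu' hv' hw', hX.2.2.1]

lemma opAct_comp {l : ℤ} (hI : I = a ++ t :: c) (hK : K = a ++ J ++ c) (hl : l = m + n)
    (p : RB I x m) (q : RB J t n) (u v w : List (defPair η).Tot)
    (hu : u.length = a.length) (hv : v.length = J.length) (hw : w.length = c.length) :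
    feed (opAct η hL (relBrace.comp a c hI hK hl p q : RB K x l)) (u ++ v ++ w) =
      feed (opAct η hL p) (u.map ((defPair η).kos n) ++ feed (opAct η hL q) v :: w) := by
  obtain ⟨φ, hφ⟩ := feed_ext_hom (k := k) (n := K.length) (u ++ v ++ w)
  obtain ⟨χ, hχ⟩ := feed_ext_hom (k := k) (n := J.length) v
  let π : RB I x m →ₗ[ℤ] RB J t n →ₗ[ℤ] RB K x l :=
    Finsupp.linearCombination ℤ fun F => Finsupp.linearCombination ℤ fun X =>
      ((rcompTerms a.length J.length F.1 X.1).map (rori K x l)).sum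
  change feed (opAct η hL (π p q)) _ = _
  obtain ⟨ψ, hψ⟩ := feed_ext_hom (k := k) (n := I.length)
    (u.map ((defPair η).kos n) ++ feed (opAct η hL q) v :: w)
  rw [← hφ, ← hψ]
  refine rb_ext (φ.comp ((opAct η hL).comp (π.flip q)).toAddMonoidHom)
    (ψ.comp (opAct η hL).toAddMonoidHom) (fun F hF => ?_) p
  change φ (opAct η hL (π (Finsupp.single ⟨F, hF⟩ 1) q)) =
    ψ (opAct η hL (Finsupp.single ⟨F, hF⟩ 1))
  rw [hψ]
  obtain ⟨θ, hθ⟩ := feed_slot (opAct η hL (Finsupp.single ⟨F, hF⟩ 1))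
    (u.map ((defPair η).kos n)) w (by rw [List.length_map, hI, List.length_append, hu]; simp)
  rw [hθ, ← hχ]
  refine rb_ext (φ.comp ((opAct η hL).comp (π (Finsupp.single ⟨F, hF⟩ 1))).toAddMonoidHom)
    (θ.toAddMonoidHom.comp (χ.comp (opAct η hL).toAddMonoidHom)) (fun X hX => ?_) q
  change φ (opAct η hL (π (Finsupp.single ⟨F, hF⟩ 1) (Finsupp.single ⟨X, hX⟩ 1))) =
    θ (χ (opAct η hL (Finsupp.single ⟨X, hX⟩ 1)))
  have h0 : π (Finsupp.single ⟨F, hF⟩ 1) (Finsupp.single ⟨X, hX⟩ 1) =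
      ((rcompTerms a.length J.length F X).map (rori K x l)).sum := by
    simp [π]
  rw [hφ, hχ, ← hθ, h0]
  exact feed_opAct_comp_single η hL hF hX hI hK hl u v w hu hv hw

end SwissCheese

namespace SwissCheese

open Color Vtx

universe u v

variable {k : Type u} [CommRing k] {P : OpData.{u, v} k} (η : OpHom (hscInf k) P)
  (hL : IsNSOperad (lam P))

/-! ### The differential -/

/-- The differential of a homogeneous element. -/
noncomputable def hd (h : Hel (lam P)) : Hel (lam P) :=
  ⟨(h.1.1, h.1.2 - 1), (defPair η).d h.1.1 rfl h.2⟩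

lemma d_pick (p : Color × ℤ) (c : Color) (y : Fam (lam P) p.1 p.2) :
    (defPair η).d c rfl (pick (lam P) p c y) =
      pick (lam P) (p.1, p.2 - 1) c ((defPair η).d p.1 rfl y) := by
  obtain ⟨c', d⟩ := p
  by_cases h : c' = c
  · subst h
    rw [pick_self]
    exact (pick_self (lam P) c' (d - 1) _).symm
  · rw [pick_ne (lam P) (p := (c', d)) h, pick_ne (lam P) (p := (c', d - 1)) h]
    exact map_zero _

variable {I : List Color} {x : Color} {e : ℤ} {F : Forest}

/-- By `tw_toM`, the twisted differential of one label replaces its value by the differential and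
puts the letter `0` in front of its letters. To reach the front of the whole word, this letter
passes the names of the neutral vertices and the letters of `u`. -/
lemma extract_dlab (hF : F.Valid I x e) (u w : List (Hel (lam P))) (h : Hel (lam P))
    (hn : (u ++ h :: w).length = I.length) :
    extract η hL ((canonVerts (F.names.length + 1) (u ++ h :: w).length).flatMap
        ((Args.of (seq (u ++ h :: w))).std (F.names.length + 1)))
      ((Args.of (seq (u ++ h :: w))).tdeg (F.names.length + 1) (u ++ h :: w).length)
      ((Args.of (seq (u ++ h :: w))).even_canon (Args.isKey_std _ _) _ _)
      (PlainOp.ev (PlainOp.Env.dlab (envD hL 0)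
        ((Args.of (seq (u ++ h :: w))).env η hL (Args.isKey_std _ (F.names.length + 1))) u.length)
        x (F.rename id (· + 1))) =
      sgn (F.names.length + hdeg u) •
        hel η (hact η hL F.names.length x F (u ++ hd η h :: w)) := by
  set r := F.names.length
  set a := Args.of (seq (u ++ h :: w))
  set b := Args.of (seq (u ++ hd η h :: w))
  have hnb : (u ++ hd η h :: w).length = I.length := by simpa using hn
  have hsu : seq (u ++ h :: w) u.length = h := by
    rw [← add_zero u.length, seq_append_right]
    rfl
  have hsb : seq (u ++ hd η h :: w) u.length = hd η h := by
    rw [← add_zero u.length, seq_append_right]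
    rfl
  have hsj : ∀ j, j ≠ u.length → seq (u ++ h :: w) j = seq (u ++ hd η h :: w) j := fun j hj => by
    rcases lt_or_gt_of_ne hj with h' | h'
    · rw [seq_append_left h', seq_append_left h']
    · obtain ⟨q, rfl⟩ : ∃ q, j = u.length + (q + 1) := ⟨j - u.length - 1, by omega⟩
      rw [seq_append_right, seq_append_right]
      rfl
  let κ : Vtx → List ℕ := fun y => match y with
    | neu e => [e + 1]
    | lab j => if j = u.length then 0 :: a.std (r + 1) (lab j) else a.std (r + 1) (lab j)
  have hκ : b.IsKey κ := by
    intro y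
    cases y with
    | neu e => simp [Args.vdeg, κ]
    | lab j =>
      have h1 := a.isKey_std (r + 1) (lab j)
      change Even ((seq (u ++ hd η h :: w) j).1.2 + (κ (lab j)).length)
      change Even ((seq (u ++ h :: w) j).1.2 + (a.std (r + 1) (lab j)).length) at h1
      by_cases hj : j = u.length
      · subst hj
        rw [hsu] at h1
        rw [hsb]
        simp only [κ, if_true, List.length_cons]
        have : (hd η h).1.2 = h.1.2 - 1 := rfl
        rw [this]
        push_cast
        rwa [sub_add_add_cancel h.1.2 _ 1] at *
      · simp only [κ, hj, if_false]
        rwa [← hsj j hj]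
  have hev : PlainOp.ev (PlainOp.Env.dlab (envD hL 0) (a.env η hL (a.isKey_std (r + 1))) u.length)
      x (F.rename id (· + 1)) = PlainOp.ev (b.env η hL hκ) x F := by
    rw [PlainOp.ev_rename]
    refine PlainOp.ev_congr hF.2.2.2 (fun j s hj => ?_) fun s e _ => ?_
    · change PlainOp.Env.dlab (envD hL 0) (a.env η hL (a.isKey_std (r + 1))) u.length s (lab j) = _
      by_cases hj' : j = u.length
      · subst hj'
        rw [PlainOp.Env.dlab_self]
        refine (tw_toM hL η 0 s (a.keyed η (a.isKey_std (r + 1)) s (lab u.length)) rfl).trans ?_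
        refine (env_lab_eq η hL b hκ u.length s _ _ (by simp [κ, Args.keyed]) ?_ ?_).symm
        · change (seq (u ++ hd η h :: w) u.length).1.2 = (seq (u ++ h :: w) u.length).1.2 - 1
          rw [hsu, hsb]
          rfl
        · have key : ∀ y z : Hel (lam P), y = hd η h → z = h →
              HEq (pick (lam P) y.1 s y.2) ((defPair η).d s rfl (pick (lam P) z.1 s z.2)) := by
            rintro y z rfl rfl
            exact heq_of_eq (d_pick η z.1 s z.2).symm
          exact key _ _ hsb hsu
      · rw [PlainOp.Env.dlab_ne _ _ _ _ _ (by simpa using hj')]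
        refine env_lab_congr η hL (a.isKey_std (r + 1)) hκ (hsj j hj') ?_ s
        simp only [κ, hj', if_false]
    · change PlainOp.Env.dlab (envD hL 0) (a.env η hL (a.isKey_std (r + 1))) u.length s
        (neu (e + 1)) = _
      rw [PlainOp.Env.dlab_ne _ _ _ _ _ (by simp)]
      exact env_neu_congr η hL (a.isKey_std (r + 1)) hκ rfl s
  set V : List ℕ := a.std (r + 1) (lab u.length)
  have hV : letters (r + 1 + u.length) (h :: w) = V ++ letters (r + 1 + u.length + 1) w := by
    rw [letters]
    congr 1
    change _ = if Even (seq (u ++ h :: w) u.length).1.2 then [] else _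
    rw [hsu]
  have hW : (canonVerts (r + 1) (u ++ h :: w).length).flatMap (a.std (r + 1)) =
      [] ++ [0] ++ ((List.range r).map (· + 1) ++ letters (r + 1) u) ++
        (V ++ letters (r + 1 + u.length + 1) w) := by
    refine (canon_std_seq (r + 1) (u ++ h :: w)).trans ?_
    rw [letters_append, hV, List.range_succ_eq_map]
    simp
  have hWκ : (canonVerts r (u ++ hd η h :: w).length).flatMap κ =
      [] ++ ((List.range r).map (· + 1) ++ letters (r + 1) u) ++ [0] ++
        (V ++ letters (r + 1 + u.length + 1) w) := by
    refine (Args.flatMap_canonVerts κ r _).trans ?_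
    have h1 : (List.range r).flatMap (fun e => κ (neu e)) = (List.range r).map (· + 1) := by
      rw [List.map_eq_flatMap]
    have h2 : (List.range u.length).flatMap (fun j => κ (lab j)) = letters (r + 1) u := by
      refine flatMap_seq _ u _ fun j hj => ?_
      simp only [κ]
      rw [if_neg (show ¬ j = u.length by omega)]
      change (if Even (seq (u ++ h :: w) j).1.2 then [] else _) = _
      rw [seq_append_left hj]
    have h3 : (List.range w.length).flatMap (fun j => κ (lab (u.length + 1 + j))) =
        letters (r + 1 + u.length + 1) w := by
      refine flatMap_seq _ w _ fun j hj => ?_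
      simp only [κ]
      rw [if_neg (show ¬ u.length + 1 + j = u.length by omega)]
      change (if Even (seq (u ++ h :: w) (u.length + 1 + j)).1.2 then [] else _) = _
      rw [add_assoc u.length, seq_append_right, add_comm 1 j, seq_cons_succ, add_comm j 1]
      simp only [add_assoc]
    have h4 : κ (lab u.length) = 0 :: V := by simp [κ, V]
    rw [h1, List.length_append, List.length_cons, ← add_assoc, add_right_comm, List.range_add,
      List.range_succ, List.flatMap_append, List.flatMap_append, h2, List.flatMap_singleton, h4,
      List.flatMap_map, h3]
    simp
  have hs : wordSign ((canonVerts r (u ++ hd η h :: w).length).flatMap κ) = sgn (r + hdeg u) := by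
    have h1 := a.wordSign_canon_std (r + 1) (u ++ h :: w).length
    rw [hW] at h1
    rw [hWκ, wordSign_swap, h1, mul_one, List.length_append, List.length_map, List.length_range]
    refine sgn_congr ?_
    have := ZMod.intCast_eq_zero_iff_even.2 (even_hdeg (r + 1) u)
    push_cast at this ⊢
    have h2 : (hdeg u : ZMod 2) = (letters (r + 1) u).length :=
      (eq_neg_of_add_eq_zero_left this).trans (ZMod.neg_eq_self_mod_two _)
    rw [h2]
    simp
  have hdd : a.tdeg (r + 1) (u ++ h :: w).length = b.tdeg r (u ++ hd η h :: w).length := by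
    rw [tdeg_seq, tdeg_seq, hdeg_append, hdeg_append, hdeg_cons, hdeg_cons]
    have : (hd η h).1.2 = h.1.2 - 1 := rfl
    rw [this]
    push_cast
    ring
  rw [hev, b.extract_ev η hL (Forest.verts_canon (List.Perm.of_eq hF.names) (hnb ▸ hF.1))
    (Shape_len hF.2.2.2) hκ _ ?_ hdd, hs, hel_hact]
  rw [hW, hWκ]
  refine List.Perm.append_right _ ?_
  rw [List.append_assoc, List.append_assoc]
  exact List.perm_append_comm.append_left _

/-- This is `tw_ev` with the coefficient of the canonical word extracted. The letter `0` of that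
word belongs to the differential or, in a blow-up, to the new neutral vertex; the names of `F` are
shifted by one to make room for it. -/
lemma d_single_hel (hF : F.Valid I x e) {e' : ℤ} (he : e' = e - 1) (l : List (Hel (lam P)))
    (hn : l.length = I.length) :
    feed (opAct η hL ((rbdTerms x F).map fun p => p.1 • rori I x e' p.2).sum) (l.map (hel η)) =
      hel η (hd η (hact η hL F.names.length x F l)) -
        ∑ j ∈ Finset.range I.length, sgn (F.names.length + hdeg (l.take j)) •
          hel η (hact η hL F.names.length x F (l.take j ++ hd η (seq l j) :: l.drop (j + 1))) := by
  set r := F.names.length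
  set a := Args.of (seq l)
  set F1 := F.rename id (· + 1)
  have hnm : F1.names = (List.range r).map (· + 1) := by
    rw [Forest.names_rename]
    conv_lhs => rw [hF.names]
  have hlb : F1.labels = F.labels := by rw [Forest.labels_rename, List.map_id]
  have hS : F1.Shape I x := by
    rw [Forest.shape_iff, Forest.shapeP_rename]
    exact (Forest.shape_iff I x F).1 hF.2.2.2
  have h0 : 0 ∉ F1.names := by simp [hnm]
  have hnd : F1.labels.Nodup := by
    rw [hlb, hF.1.nodup_iff]
    exact List.nodup_range
  have htw := PlainOp.tw_ev (a.isTwisted η hL (a.isKey_std (r + 1)) fun _ => rfl) hS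
    (((Forest.shape_iff I x F1).1 hS).stable h0) hnd
  -- the left-hand side
  let κ : Vtx → List ℕ := fun y => a.std (r + 1) (y.rename id (· + 1))
  have hκ : a.IsKey κ := fun y => by
    have := a.isKey_std (r + 1) (y.rename id (· + 1))
    cases y <;> exact this
  have hev : PlainOp.ev (a.env η hL (a.isKey_std (r + 1))) x F1 =
      PlainOp.ev (a.env η hL hκ) x F := by
    rw [PlainOp.ev_rename]
    congr 1
    funext c y
    cases y <;> rfl
  have hw : (canonVerts (r + 1) l.length).flatMap (a.std (r + 1)) =
      0 :: (canonVerts r l.length).flatMap κ := by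
    rw [Args.flatMap_canonVerts, Args.flatMap_canonVerts, List.range_succ_eq_map, List.flatMap_cons,
      List.flatMap_map]
    rfl
  have hdeg1 : a.tdeg (r + 1) l.length = a.tdeg r l.length - 1 := by
    rw [tdeg_seq, tdeg_seq]
    push_cast
    ring
  rw [hev, a.ev_eq_act η hL r l.length x F (Forest.verts_canon (List.Perm.of_eq hF.names)
    (hn ▸ hF.1)) (Shape_len hF.2.2.2) hκ] at htw
  have htw2 := (tw_toM hL η 0 x (⟨(canonVerts r l.length).flatMap κ, a.tdeg r l.length,
    a.even_canon hκ r l.length, a.act η hL r l.length x F⟩ : Keyed (lam P) x) rfl).symm.trans htw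
  have hfin := congrArg (extract η hL ((canonVerts (r + 1) l.length).flatMap (a.std (r + 1)))
    (a.tdeg (r + 1) l.length) (a.even_canon (a.isKey_std (r + 1)) (r + 1) l.length)) htw2
  rw [extract_toM η hL _ _ (List.Perm.of_eq hw) hdeg1, map_add, map_lsum, map_lsum] at hfin
  have hone : wordSign (0 :: (canonVerts r l.length).flatMap κ) = 1 := by
    rw [← hw, a.wordSign_canon_std]
  -- the blow-ups
  have hbd : feed (opAct η hL ((rbdTerms x F).map fun p => p.1 • rori I x e' p.2).sum)
      (l.map (hel η)) = lsum (Forest.bd x F1) fun p =>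
        extract η hL ((canonVerts (r + 1) l.length).flatMap (a.std (r + 1)))
          (a.tdeg (r + 1) l.length) (a.even_canon (a.isKey_std (r + 1)) (r + 1) l.length)
          (p.1 • PlainOp.ev (a.env η hL (a.isKey_std (r + 1))) x p.2) := by
    obtain ⟨φ, hφ⟩ := feed_ext_hom (k := k) (n := I.length) (l.map (hel η))
    rw [sum_rbdTerms hF, ← hφ, map_lsum, map_lsum]
    refine lsum_congr fun p hp => ?_
    have hv : (p.2.verts : Multiset Vtx) =
        ((0 :: F1.names).map neu : List Vtx) + (F1.labels.map lab : List Vtx) := by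
      rw [Forest.verts_bd hp, Multiset.coe_eq_coe.2 F1.verts_perm, List.map_cons,
        ← Multiset.cons_coe, ← Multiset.singleton_add, ← Multiset.coe_add, add_assoc]
    obtain ⟨h1, h2⟩ := Forest.names_perm_of_verts hv
    have h1' : p.2.names.Perm (List.range (r + 1)) := by
      rwa [hnm, ← List.range_succ_eq_map] at h1
    have h2' : p.2.labels.Perm (List.range I.length) := by
      rw [hlb] at h2
      exact h2.trans hF.1
    have h3 : p.2.Shape I x :=
      (Forest.shape_iff I x _).2 (((Forest.shape_iff I x F1).1 hS).bd hp)
    rw [map_zsmul, map_zsmul, map_zsmul, hφ, feed_rori_hel η hL h1' h2' h3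
      (by rw [he, hF.2.2.1]; push_cast; ring) l hn, hel_hact,
      a.extract_act η hL h1' (hn ▸ h2') (Shape_len h3)]
  -- the differentials of the labels
  have hlab : lsum F1.labels (fun j =>
      extract η hL ((canonVerts (r + 1) l.length).flatMap (a.std (r + 1)))
        (a.tdeg (r + 1) l.length) (a.even_canon (a.isKey_std (r + 1)) (r + 1) l.length)
        (PlainOp.ev (PlainOp.Env.dlab (envD hL 0) (a.env η hL (a.isKey_std (r + 1))) j) x F1)) =
      ∑ j ∈ Finset.range I.length, sgn (r + hdeg (l.take j)) •
          hel η (hact η hL r x F (l.take j ++ hd η (seq l j) :: l.drop (j + 1))) := by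
    rw [lsum, hlb, (hF.1.map _).sum_eq, ← List.sum_toFinset _ List.nodup_range,
      List.toFinset_range]
    refine Finset.sum_congr rfl fun j hj => ?_
    have hj' : j < l.length := hn ▸ Finset.mem_range.1 hj
    -- Since `extract_dlab` concerns a list of the form `u ++ h :: w` and types depend on the list,
    -- it is transported to `l` along the equality of the two lists.
    have key : ∀ (l' : List (Hel (lam P))) (i : ℕ), l' = l → i = j →
        l'.length = I.length →
        extract η hL ((canonVerts (r + 1) l'.length).flatMap ((Args.of (seq l')).std (r + 1)))
          ((Args.of (seq l')).tdeg (r + 1) l'.length)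
          ((Args.of (seq l')).even_canon (Args.isKey_std _ (r + 1)) (r + 1) l'.length)
          (PlainOp.ev (PlainOp.Env.dlab (envD hL 0)
            ((Args.of (seq l')).env η hL (Args.isKey_std _ (r + 1))) i) x F1) =
          sgn (r + hdeg (l.take j)) •
            hel η (hact η hL r x F (l.take j ++ hd η (seq l j) :: l.drop (j + 1))) →
        extract η hL ((canonVerts (r + 1) l.length).flatMap (a.std (r + 1)))
          (a.tdeg (r + 1) l.length) (a.even_canon (a.isKey_std (r + 1)) (r + 1) l.length)
          (PlainOp.ev (PlainOp.Env.dlab (envD hL 0) (a.env η hL (a.isKey_std (r + 1))) j) x F1) =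
          sgn (r + hdeg (l.take j)) •
            hel η (hact η hL r x F (l.take j ++ hd η (seq l j) :: l.drop (j + 1))) := by
      rintro l' i rfl rfl _ h
      exact h
    have hsplit : l.take j ++ seq l j :: l.drop (j + 1) = l := by
      rw [seq, List.getD_eq_getElem _ _ hj', ← List.drop_eq_getElem_cons hj', List.take_append_drop]
    have hlen : (l.take j ++ seq l j :: l.drop (j + 1)).length = I.length := by rw [hsplit, hn]
    exact key _ _ hsplit (by rw [List.length_take, min_eq_left hj'.le]) hlen
      (extract_dlab η hL hF (l.take j) (l.drop (j + 1)) (seq l j) hlen)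
  rw [hbd, ← hlab]
  refine eq_sub_of_add_eq' (hfin.symm.trans ?_)
  exact (congrArg (· • _) hone).trans (one_smul ℤ _)

lemma feed_opAct_d_single (hF : F.Valid I x e) {e' : ℤ} (he : e' = e - 1)
    (l : List (defPair η).Tot) (hl : l.length = I.length) :
    feed (opAct η hL ((rbdTerms x F).map fun p => p.1 • rori I x e' p.2).sum) l =
      (defPair η).dTot (feed (opAct η hL (Finsupp.single ⟨F, hF⟩ 1)) l) -
        sgn e • ∑ j ∈ Finset.range I.length, feed (opAct η hL (Finsupp.single ⟨F, hF⟩ 1))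
          ((l.take j).map ((defPair η).kos 1) ++ (defPair η).dTot (l.getD j 0) ::
            l.drop (j + 1)) := by
  set f := opAct η hL ((rbdTerms x F).map fun p => p.1 • rori I x e' p.2).sum
  set g := opAct η hL (Finsupp.single ⟨F, hF⟩ 1)
  refine ListLin.ext η (n := I.length) (Φ := fun l => feed f l)
    (Ψ := fun l => (defPair η).dTot (feed g l) - sgn e • ∑ j ∈ Finset.range I.length, feed g
      ((l.take j).map ((defPair η).kos 1) ++ (defPair η).dTot (l.getD j 0) :: l.drop (j + 1)))
    (ListLin.of_feed (Φ := id) f fun p q hpq => ⟨p, q, LinearMap.id, by omega, fun y => rfl⟩)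
    (ListLin.sub (ListLin.comp (ListLin.of_feed (Φ := id) g fun p q hpq =>
      ⟨p, q, LinearMap.id, by omega, fun y => rfl⟩) _) (ListLin.zsmul (ListLin.sum fun j hj =>
        ListLin.of_feed g fun p q hpq => ?_) _)) (fun l' hl' => ?_) l hl
  -- The entry that varies lies to the right of the slot `j` to which the differential is applied,
  -- at this slot, or to the left of it, where it meets the operator `kos 1`.
  · rcases lt_trichotomy j p.length with h | rfl | h
    · refine ⟨(p.take j).map ((defPair η).kos 1) ++ (defPair η).dTot (p.getD j 0) :: p.drop (j + 1),
        q, LinearMap.id, ?_, fun y => ?_⟩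
      · rw [List.length_append, List.length_cons, List.length_map, List.length_take,
          List.length_drop]
        omega
      · rw [List.take_append_of_le_length h.le, List.getD_append _ _ _ _ h,
          List.drop_append_of_le_length h, List.append_assoc, List.cons_append]
        rfl
    · refine ⟨p.map ((defPair η).kos 1), q, (defPair η).dTot, by rw [List.length_map]; omega,
        fun y => ?_⟩
      simp
    · obtain ⟨i, rfl⟩ : ∃ i, j = p.length + (i + 1) := ⟨j - p.length - 1, by omega⟩
      refine ⟨p.map ((defPair η).kos 1), (q.take i).map ((defPair η).kos 1) ++
        (defPair η).dTot (q.getD i 0) :: q.drop (i + 1), (defPair η).kos 1,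
        by rw [List.length_map]; omega, fun y => ?_⟩
      rw [List.take_length_add_append, List.getD_append_right _ _ _ _ (by omega),
        Nat.add_sub_cancel_left, add_assoc, List.drop_length_add_append]
      simp
  · have h1 : ∀ j ∈ Finset.range I.length, feed g (((l'.map (hel η)).take j).map ((defPair η).kos 1) ++
        (defPair η).dTot ((l'.map (hel η)).getD j 0) :: (l'.map (hel η)).drop (j + 1)) =
        sgn (hdeg (l'.take j)) •
          hel η (hact η hL F.names.length x F (l'.take j ++ hd η (seq l' j) :: l'.drop (j + 1))) := by
      intro j hj
      have hj' : j < l'.length := hl' ▸ Finset.mem_range.1 hj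
      have h2 := feed_kos η g 1 (l'.take j) [] ((defPair η).dTot ((l'.map (hel η)).getD j 0) ::
        (l'.map (hel η)).drop (j + 1)) (by rw [List.length_nil, List.length_take]; omega)
      rw [List.nil_append, List.nil_append, one_mul] at h2
      have hlen : (l'.take j ++ hd η (seq l' j) :: l'.drop (j + 1)).length = I.length := by
        rw [List.length_append, List.length_cons, List.length_take, List.length_drop]
        omega
      rw [← feed_single_hel η hL hF _ hlen, ← List.map_take, h2, List.map_append, List.map_cons,
        List.map_drop, List.getD_eq_getElem _ _ (by simpa using hj'), List.getElem_map, dTot_hel,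
        seq, List.getD_eq_getElem _ _ hj']
      rfl
    change feed f _ = (defPair η).dTot (feed g _) - sgn e • _
    rw [Finset.sum_congr rfl h1, feed_single_hel η hL hF l' hl', dTot_hel,
      d_single_hel η hL hF he l' hl', Finset.smul_sum]
    refine congrArg (_ - ·) (Finset.sum_congr rfl fun j _ => ?_)
    rw [smul_smul, sgn_add]
    congr 2
    rw [hF.2.2.1]
    exact sgn_congr (by push_cast; rw [ZMod.neg_eq_self_mod_two])

lemma opAct_d {e' : ℤ} (he : e' = e - 1) (p : RB I x e) (l : List (defPair η).Tot)
    (hl : l.length = I.length) :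
    feed (opAct η hL (relBrace.d he p : RB I x e')) l =
      (defPair η).dTot (feed (opAct η hL p) l) -
        sgn e • ∑ j ∈ Finset.range I.length, feed (opAct η hL p)
          ((l.take j).map ((defPair η).kos 1) ++ (defPair η).dTot (l.getD j 0) ::
            l.drop (j + 1)) := by
  obtain ⟨φ, hφ⟩ := feed_ext_hom (k := k) (n := I.length) l
  choose χ hχ using fun j => feed_ext_hom (k := k) (n := I.length)
    ((l.take j).map ((defPair η).kos 1) ++ (defPair η).dTot (l.getD j 0) :: l.drop (j + 1))
  let π : RB I x e →ₗ[ℤ] RB I x e' := Finsupp.linearCombination ℤ fun F =>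
    ((rbdTerms x F.1).map fun p => p.1 • rori I x e' p.2).sum
  change feed (opAct η hL (π p)) l = _
  simp only [← hφ, ← hχ]
  have h := rb_ext (φ.comp ((opAct η hL).comp π).toAddMonoidHom)
    ((defPair η).dTot.toAddMonoidHom.comp (φ.comp (opAct η hL).toAddMonoidHom) -
      sgn e • ∑ j ∈ Finset.range I.length, (χ j).comp (opAct η hL).toAddMonoidHom)
    (fun F hF => ?_) p
  · rw [AddMonoidHom.sub_apply, AddMonoidHom.smul_apply, AddMonoidHom.finsetSum_apply] at h
    exact h
  · rw [AddMonoidHom.sub_apply, AddMonoidHom.smul_apply, AddMonoidHom.finsetSum_apply]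
    change φ (opAct η hL (π (Finsupp.single ⟨F, hF⟩ 1))) =
      (defPair η).dTot (φ (opAct η hL (Finsupp.single ⟨F, hF⟩ 1))) -
        sgn e • ∑ j ∈ Finset.range I.length, χ j (opAct η hL (Finsupp.single ⟨F, hF⟩ 1))
    have h0 : π (Finsupp.single ⟨F, hF⟩ 1) =
        ((rbdTerms x F).map fun p => p.1 • rori I x e' p.2).sum := by
      simp [π]
    simp only [hφ, hχ]
    rw [h0]
    exact feed_opAct_d_single η hL hF he l hl

end SwissCheese

/-! ### The algebra structure on the deformation complex. -/

namespace SwissCheese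

open Color Vtx

universe u v

variable {k : Type u} [CommRing k] {P : OpData.{u, v} k}

lemma dTot_dTot (hL : IsNSOperad (lam P)) (η : OpHom (hscInf k) P) (y : (defPair η).Tot) :
    (defPair η).dTot ((defPair η).dTot y) = 0 := by
  induction y using DirectSum.induction_on with
  | zero => rw [map_zero, map_zero]
  | of i x =>
    refine (congrArg (defPair η).dTot (dTot_hel η ⟨i, x⟩)).trans ((dTot_hel η _).trans ?_)
    refine (congrArg (inc η i.1 (i.2 - 1 - 1)) ?_).trans (map_zero _)
    exact defPair_d_d hL η i.1 rfl rfl x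
  | add a b ha hb => rw [map_add, map_add, ha, hb, add_zero]

/-- The action of the operad of relative braces on the deformation complex. -/
noncomputable def relBraceAlgebra (hL : IsNSOperad (lam P)) (η : OpHom (hscInf k) P) :
    OpAlgebra relBrace (defPair η) where
  d_d := dTot_dTot hL η
  act := opAct η hL
  act_color := opAct_color η hL
  act_deg := opAct_deg η hL
  act_one := feed_opAct_one η hL
  act_comp _ _ {_ _ _ _ _ _ _ _} hI hK hl p q u v w hu hv hw :=
    opAct_comp η hL hI hK hl p q u v w hu hv hw
  act_perm σ hI p g b f hf := opAct_perm η hL σ hI p g b f hf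
  act_d h p l hl := opAct_d η hL h p l hl

end SwissCheese

open SwissCheese Color in
theorem theoremT {k : Type*} [CommRing k] (P : OpData k) (hP : IsNSOperad P)
    (η : OpHom (hscInf k) P) :
    ∃ A : OpAlgebra relBrace (defPair η),
      (∀ (m : ℤ) (a : Fam (lam P) cl m) (ys : List (Σ e : ℤ, Fam (lam P) cl e)),
        feed (A.act (genM ys.length))
            ((defPair η).ι cl m a :: ys.map (fun y => (defPair η).ι cl y.1 y.2)) =
          (defPair η).ι cl _ (brace a ys)) ∧
      (∀ ys : List (Σ e : ℤ, Fam (lam P) cl e), 2 ≤ ys.length →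
        feed (A.act (genDelta ys.length)) (ys.map (fun y => (defPair η).ι cl y.1 y.2)) =
          (defPair η).ι cl _ (brace (twist η cl) ys)) ∧
      (∀ (m n : ℤ) (a : Fam (lam P) op m) (b : Fam (lam P) op n),
        feed (A.act genMu) [(defPair η).ι op m a, (defPair η).ι op n b] =
          (defPair η).ι op (m + n) (openMul (lam P) rfl a b)) ∧
      (∀ (m : ℤ) (a : Fam (lam P) op m) (ys : List (Σ e : ℤ, Fam (lam P) cl e)),
        feed (A.act (genGamma ys.length))
            ((defPair η).ι op m a :: ys.map (fun y => (defPair η).ι cl y.1 y.2)) =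
          (defPair η).ι op _ (brace a ys)) ∧
      (∀ ys : List (Σ e : ℤ, Fam (lam P) cl e), 1 ≤ ys.length →
        feed (A.act (genG ys.length)) (ys.map (fun y => (defPair η).ι cl y.1 y.2)) =
          (defPair η).ι op _ (brace (twist η op) ys)) := by
  exact ⟨relBraceAlgebra hP.lam η, feed_corolla_lab η hP.lam cl,
    fun ys h => feed_corolla_neu η hP.lam cl ys (one_le_two.trans h) fun _ => h,
    feed_mu η hP.lam, feed_corolla_lab η hP.lam op,
    fun ys h => feed_corolla_neu η hP.lam op ys h nofun⟩
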